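/- Let $W$ be a compact connected complex manifold of dimension $n$, and let $(L,h)$ be a Hermitian holomorphic line bundle over $W$. Assume that (1) there is a Kähler–Einstein form $\omega_0$ on $W$ with $\mathrm{Ric}(\omega_0)=\omega_0$, where $\mathrm{Ric}(\omega_0)$ is the Ricci form; and (2) the form $2\pi c_1(L;h):=\sqrt{-1}\,\bar\partial\partial\log h$ has constant eigenvalues $\mu_1\le\dots\le\mu_n$ with respect to $\omega_0$, with $-1<\mu_k<1$ for all $k$. Let $M=\mathbb P(L\oplus\mathcal O_W)$, let $K_M^\times$ be the complement of the zero section in the canonical bundle $K_M$ of $M$, and let $S=K_M^\times/\mathbb R_{>0}$ be the associated $S^1$-bundle over $M$. For local holomorphic coordinates $w$ on $W$ and a local holomorphic frame of $L$, let $\zeta^+$ be the fibre coordinate of $L\subset M$, $\zeta^-=1/\zeta^+$ the fibre coordinate of $L^{-1}\subset M$, and $\tau^\pm$ the fibre coordinates of $K_M$ with respect to the frames $\pm dw^1\wedge\dots\wedge dw^n\wedge d\zeta^\pm$. For a real number $a>-\tfrac12$ let $\xi_a$ be the holomorphic vector field on $K_M$ equal to $a\sqrt{-1}\,\zeta^+\partial_{\zeta^+}+\sqrt{-1}\,\tau^+\partial_{\tau^+}$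 over the domain of $\zeta^+$ and to $-a\sqrt{-1}\,\zeta^-\partial_{\zeta^-}+(1+2a)\sqrt{-1}\,\tau^-\partial_{\tau^-}$ over the domain of $\zeta^-$. Put $\mu_{k,a}=\mu_k+a(1+\mu_k)$ and suppose that $$A_a(1)=-\int_{-\frac1{1+2a}}^{1}x\prod_{k=1}^n(1+\mu_{k,a}x)\,dx=0 .$$ Then $S$ admits a Sasaki–Einstein metric whose Reeb field is $\xi_a$ up to a positive constant factor. More precisely, there are a Riemannian metric $g$ on $S$ with $\mathrm{Ric}_g=2(n+1)g$ and a diffeomorphism $\Phi:S\times\mathbb R_{>0}\to K_M^\times$, whose restriction to $S\times\{1\}$ is a section of the projection $K_M^\times\to S$, such that the cone metric $dr^2+r^2g$ is Kähler with respect to the complex structure $J$ on $S\times\mathbb R_{>0}$ pulled back from $K_M^\times$ by $\Phi$, and such that the Reeb field $J(r\partial_r)$ corresponds under $\Phi$ to $\frac{n+2}{1+a}(\xi_a+\bar\xi_a)$. -/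

import Mathlib

open scoped Manifold ContDiff LinearAlgebra.Projectivization Topology
open Set Bundle

set_option linter.unusedSectionVars false

namespace SasakiEinstein
noncomputable section

section Charts
variable {𝕜 : Type*} [NontriviallyNormedField 𝕜] {E : Type*} [NormedAddCommGroup E]
  [NormedSpace 𝕜 E] {M ι : Type*}

/-- Coordinate systems on a bare set whose changes of coordinates are `C^n` on open sets. -/
structure CoordFamily (𝕜 : Type*) [NontriviallyNormedField 𝕜] (E : Type*) [NormedAddCommGroup E]
    [NormedSpace 𝕜 E] (M ι : Type*) (n : ℕ∞ω) where
  chart : ι → PartialEquiv M E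
  idx : M → ι
  mem_source : ∀ x, x ∈ (chart (idx x)).source
  open_source : ∀ i j, IsOpen ((chart i).symm.trans (chart j)).source
  smooth : ∀ i j, ContDiffOn 𝕜 n ((chart i).symm.trans (chart j))
    ((chart i).symm.trans (chart j)).source

namespace CoordFamily
variable {n : ℕ∞ω}

/-- The associated charted space core. -/
def core (c : CoordFamily 𝕜 E M ι n) : ChartedSpaceCore E M where
  atlas := range c.chart
  chartAt x := c.chart (c.idx x)
  mem_chart_source := c.mem_source
  chart_mem_atlas x := mem_range_self _
  open_source := by rintro _ _ ⟨i, rfl⟩ ⟨j, rfl⟩; exact c.open_source i j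
  continuousOn_toFun := by rintro _ _ ⟨i, rfl⟩ ⟨j, rfl⟩; exact (c.smooth i j).continuousOn

theorem isManifold (c : CoordFamily 𝕜 E M ι n) :
    @IsManifold 𝕜 _ E _ _ E _ 𝓘(𝕜, E) n M c.core.toTopologicalSpace c.core.toChartedSpace := by
  let _ := c.core.toTopologicalSpace
  let _ := c.core.toChartedSpace
  refine isManifold_of_contDiffOn _ _ _ ?_
  rintro e e' he he'
  obtain ⟨f, ⟨i, rfl⟩, rfl⟩ : ∃ f, ∃ h : f ∈ c.core.atlas, e = c.core.openPartialHomeomorph f h := by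
    have := he
    change e ∈ (⋃ (f : PartialEquiv M E) (h : f ∈ c.core.atlas),
      {c.core.openPartialHomeomorph f h}) at this
    simpa using this
  obtain ⟨f', ⟨j, rfl⟩, rfl⟩ :
      ∃ f, ∃ h : f ∈ c.core.atlas, e' = c.core.openPartialHomeomorph f h := by
    have := he'
    change e' ∈ (⋃ (f : PartialEquiv M E) (h : f ∈ c.core.atlas),
      {c.core.openPartialHomeomorph f h}) at this
    simpa using this
  have h := c.smooth i j
  refine (h.mono ?_).congr ?_
  · rintro y hy; exact hy.1
  · rintro y hy; rfl

end CoordFamily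
end Charts

section RealStructure
variable {E : Type*} [NormedAddCommGroup E] [NormedSpace ℂ E] {M : Type*} [TopologicalSpace M]
  [ChartedSpace E M]

/-- A complex manifold is a real smooth manifold, with the same charts. -/
instance realManifold [IsManifold 𝓘(ℂ, E) ω M] : IsManifold 𝓘(ℝ, E) ∞ M := by
  refine isManifold_of_contDiffOn _ _ _ fun e e' he he' => ?_
  have h := (contDiffGroupoid ω 𝓘(ℂ, E)).compatible he he'
  rw [contDiffGroupoid, mem_groupoid_of_pregroupoid] at h
  exact (ContDiffOn.restrict_scalars ℝ h.1).of_le (by exact_mod_cast le_top)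

end RealStructure

section ProjectiveBundle
variable {E : Type*} [NormedAddCommGroup E] [NormedSpace ℂ E] {W : Type*} [TopologicalSpace W]
  [ChartedSpace E W]

/-- The projective bundle `ℙ(L ⊕ 𝒪)` over `W`: a point is a line `[l : t]` in `L w ⊕ ℂ`. -/
structure ProjBundle {W : Type*} (L : W → Type*) [∀ w, AddCommGroup (L w)]
    [∀ w, Module ℂ (L w)] where
  base : W
  line : ℙ ℂ (L base × ℂ)

variable {L : W → Type*} [∀ w, AddCommGroup (L w)] [∀ w, Module ℂ (L w)]

/-- The point `[l : t]` over `w` (and `[0 : 1]` if `(l, t) = 0`). -/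
def projPoint (w : W) (v : L w × ℂ) : ProjBundle L :=
  haveI := Classical.dec (v = 0)
  ⟨w, if h : v = 0 then Projectivization.mk ℂ ((0 : L w), (1 : ℂ)) (by simp)
    else Projectivization.mk ℂ v h⟩

theorem rep_projPoint (w : W) (v : L w × ℂ) (hv : v ≠ 0) :
    ∃ a : ℂ, a ≠ 0 ∧ (projPoint w v).line.rep = a • v := by
  obtain ⟨a, ha⟩ := Projectivization.exists_smul_eq_mk_rep ℂ v hv
  refine ⟨a, a.ne_zero, ?_⟩
  simp only [projPoint, hv, dif_neg, not_false_iff]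
  exact ha.symm

theorem projPoint_smul_rep (p : ProjBundle L) (a : ℂ) (ha : a ≠ 0) :
    projPoint p.base (a • p.line.rep) = p := by
  obtain ⟨w, P⟩ := p
  have h : a • P.rep ≠ 0 := smul_ne_zero ha P.rep_nonzero
  simp only [projPoint, h, dif_neg, not_false_iff]
  congr 1
  conv_rhs => rw [← P.mk_rep]
  rw [Projectivization.mk_eq_mk_iff']
  exact ⟨a, rfl⟩

variable [TopologicalSpace (TotalSpace ℂ L)] [∀ w, TopologicalSpace (L w)] [FiberBundle ℂ L]

variable (E L) in
/-- The open set of `W` on which both the preferred holomorphic coordinates `w_α` at `α` and the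
preferred frame `e_α` of `L` at `α` are defined. -/
def baseDomain (α : W) : Set W :=
  (chartAt E α).source ∩ (trivializationAt ℂ L α).baseSet

theorem isOpen_baseDomain (α : W) : IsOpen (baseDomain E L α) :=
  (chartAt E α).open_source.inter (trivializationAt ℂ L α).open_baseSet

variable [VectorBundle ℂ ℂ L]

variable (L) in
/-- The fibre coordinate on `L` with respect to the preferred holomorphic frame `e_α`. -/
def lineCoord (α w : W) : L w →ₗ[ℂ] ℂ := (trivializationAt ℂ L α).linearMapAt ℂ w

variable (L) in
/-- The map `z ↦ z • e_α(w)` for the preferred holomorphic frame `e_α` of `L`. -/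
def lineFrame (α w : W) : ℂ →ₗ[ℂ] L w := (trivializationAt ℂ L α).symmₗ ℂ w

theorem lineFrame_lineCoord {α w : W} (h : w ∈ baseDomain E L α) (l : L w) :
    lineFrame L α w (lineCoord L α w l) = l :=
  Trivialization.symmₗ_linearMapAt _ h.2 l

theorem lineCoord_lineFrame {α w : W} (h : w ∈ baseDomain E L α) (z : ℂ) :
    lineCoord L α w (lineFrame L α w z) = z :=
  Trivialization.linearMapAt_symmₗ _ h.2 z

/-- Exchange of homogeneous coordinates if `s = false`. -/
def swapIf (s : Bool) (v : ℂ × ℂ) : ℂ × ℂ := bif s then v else v.swap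

theorem swapIf_smul (s : Bool) (a : ℂ) (v : ℂ × ℂ) : swapIf s (a • v) = a • swapIf s v := by
  cases s <;> rfl

theorem swapIf_swapIf (s : Bool) (v : ℂ × ℂ) : swapIf s (swapIf s v) = v := by
  cases s <;> rfl

/-- Homogeneous fibre coordinates `(l, t)` of a point, with respect to the frame `e_α`. -/
def homCoord (α : W) (p : ProjBundle L) : ℂ × ℂ :=
  (lineCoord L α p.base p.line.rep.1, p.line.rep.2)

/-- The affine fibre coordinate of a point over `baseDomain E L α`: for `s = true` it is
`ζ_α⁺ = l / t` (the fibre coordinate of `L`), for `s = false` it is `ζ_α⁻ = t / l`. -/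
def affCoord (α : W) (s : Bool) (p : ProjBundle L) : ℂ :=
  (swapIf s (homCoord α p)).1 / (swapIf s (homCoord α p)).2

variable (E L) in
/-- The set `U_α^±` where the coordinates `(w_α, ζ_α^±)` are defined. -/
def affDomain (α : W) (s : Bool) : Set (ProjBundle L) :=
  {p | p.base ∈ baseDomain E L α ∧ (swapIf s (homCoord α p)).2 ≠ 0}

/-- The point over `w` with affine fibre coordinate `ζ_α^± = z`. -/
def affPoint (α : W) (s : Bool) (w : W) (z : ℂ) : ProjBundle L :=
  projPoint w (lineFrame L α w (swapIf s (z, 1)).1, (swapIf s (z, 1)).2)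

variable (L) in
/-- Transition function of `L` between the frames `e_α` and `e_β`. -/
def lineTrans (α β w : W) : ℂ := lineCoord L β w (lineFrame L α w 1)

/-- Homogeneous coordinates of the point `affPoint α s w z` in the frame of `β`. -/
theorem homCoord_affPoint {α : W} (β : W) {w : W} (hα : w ∈ baseDomain E L α) (s : Bool) (z : ℂ) :
    ∃ a : ℂ, a ≠ 0 ∧ homCoord β (affPoint α s w z : ProjBundle L) =
      a • ((swapIf s (z, 1)).1 * lineTrans L α β w, (swapIf s (z, 1)).2) := by
  have hne : ((lineFrame L α w (swapIf s (z, 1)).1, (swapIf s (z, 1)).2) : L w × ℂ) ≠ 0 := by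
    intro h0
    have h1 := congrArg Prod.fst h0
    have h2 := congrArg Prod.snd h0
    cases s
    · have := congrArg (lineCoord L α w) h1
      simp [lineCoord_lineFrame hα, swapIf] at this
    · simp [swapIf] at h2
  obtain ⟨a, ha, h⟩ := rep_projPoint w _ hne
  refine ⟨a, ha, ?_⟩
  have h1 : lineFrame L α w (swapIf s (z, 1)).1 = (swapIf s (z, 1)).1 • lineFrame L α w 1 := by
    rw [← map_smul]; simp
  have h2 : homCoord β (affPoint α s w z : ProjBundle L) =
      (lineCoord L β w (projPoint w (lineFrame L α w (swapIf s (z, 1)).1, (swapIf s (z, 1)).2)).line.rep.1,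
        (projPoint w (lineFrame L α w (swapIf s (z, 1)).1, (swapIf s (z, 1)).2)).line.rep.2) := rfl
  rw [h2, h]
  ext
  · simp [h1, lineTrans]
  · simp

theorem lineTrans_self {α w : W} (hα : w ∈ baseDomain E L α) : lineTrans L α α w = 1 :=
  lineCoord_lineFrame hα 1

variable (E L) in
/-- The holomorphic coordinates `(w_α, ζ_α^±)` on `ℙ(L ⊕ 𝒪)`, with sign `+` for `true`. -/
def projChart (i : W × Bool) : PartialEquiv (ProjBundle L) (E × ℂ) where
  toFun p := (chartAt E i.1 p.base, affCoord i.1 i.2 p)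
  invFun y := affPoint i.1 i.2 ((chartAt E i.1).symm y.1) y.2
  source := affDomain E L i.1 i.2
  target := {y | y.1 ∈ (chartAt E i.1).target ∧
    (chartAt E i.1).symm y.1 ∈ (trivializationAt ℂ L i.1).baseSet}
  map_source' := by
    rintro p ⟨hp, -⟩
    exact ⟨(chartAt E i.1).map_source hp.1, by simpa [(chartAt E i.1).left_inv hp.1] using hp.2⟩
  map_target' := by
    rintro y ⟨h1, h2⟩
    have hb : (chartAt E i.1).symm y.1 ∈ baseDomain E L i.1 := ⟨(chartAt E i.1).map_target h1, h2⟩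
    refine ⟨hb, ?_⟩
    obtain ⟨a, ha, h3⟩ := homCoord_affPoint i.1 hb i.2 y.2
    rw [h3, lineTrans_self hb, mul_one, swapIf_smul, swapIf_swapIf]
    simpa using ha
  left_inv' := by
    rintro p ⟨hp, hp2⟩
    dsimp only
    rw [(chartAt E i.1).left_inv hp.1]
    obtain ⟨α, s⟩ := i
    dsimp only at *
    have key : ((lineFrame L α p.base (swapIf s (affCoord α s p, 1)).1,
        (swapIf s (affCoord α s p, 1)).2) : L p.base × ℂ) =
        ((swapIf s (homCoord α p)).2)⁻¹ • p.line.rep := by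
      have h0 : swapIf s (affCoord α s p, 1) = ((swapIf s (homCoord α p)).2)⁻¹ • homCoord α p := by
        rw [← swapIf_swapIf s (((swapIf s (homCoord α p)).2)⁻¹ • homCoord α p), swapIf_smul]
        congr 1
        ext
        · simp [affCoord, div_eq_inv_mul]
        · simp [hp2]
      rw [h0]
      ext
      · simp only [Prod.smul_fst, homCoord, map_smul, lineFrame_lineCoord hp]
      · simp [homCoord]
    rw [affPoint, key]
    exact projPoint_smul_rep p _ (inv_ne_zero hp2)
  right_inv' := by
    rintro y ⟨h1, h2⟩
    have hb : (chartAt E i.1).symm y.1 ∈ baseDomain E L i.1 := ⟨(chartAt E i.1).map_target h1, h2⟩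
    ext1
    · exact (chartAt E i.1).right_inv h1
    · obtain ⟨a, ha, h3⟩ := homCoord_affPoint i.1 hb i.2 y.2
      dsimp only [affCoord]
      rw [h3, lineTrans_self hb, mul_one, swapIf_smul, swapIf_swapIf]
      simp [ha]

variable (L) in
/-- The homogeneous coordinates in the chart `j` in terms of the coordinates in the chart `i`. -/
def homTrans (i j : W × Bool) (y : E × ℂ) : ℂ × ℂ :=
  swapIf j.2 ((swapIf i.2 (y.2, 1)).1 * lineTrans L i.1 j.1 ((chartAt E i.1).symm y.1),
    (swapIf i.2 (y.2, 1)).2)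

variable (E L) in
/-- The domain over which `homTrans` is holomorphic. -/
def transDomain (i j : W × Bool) : Set (E × ℂ) :=
  {y | y.1 ∈ (chartAt E i.1).target ∩ (chartAt E i.1).symm ⁻¹'
        (baseDomain E L i.1 ∩ baseDomain E L j.1)}

theorem projChart_source (i j : W × Bool) :
    ((projChart E L i).symm.trans (projChart E L j)).source =
    transDomain E L i j ∩ {y | (homTrans L i j y).2 ≠ 0} := by
  ext y
  rw [PartialEquiv.trans_source]
  constructor
  · rintro ⟨⟨h1, h2⟩, h3, h4⟩
    have hb : (chartAt E i.1).symm y.1 ∈ baseDomain E L i.1 := ⟨(chartAt E i.1).map_target h1, h2⟩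
    refine ⟨⟨h1, hb, h3⟩, ?_⟩
    obtain ⟨a, ha, h5⟩ := homCoord_affPoint j.1 hb i.2 y.2
    change (swapIf j.2 (homCoord j.1
      (affPoint i.1 i.2 ((chartAt E i.1).symm y.1) y.2 : ProjBundle L))).2 ≠ 0 at h4
    rw [h5, swapIf_smul] at h4
    exact right_ne_zero_of_mul h4
  · rintro ⟨⟨h1, hb, h3⟩, h4⟩
    refine ⟨⟨h1, hb.2⟩, h3, ?_⟩
    obtain ⟨a, ha, h5⟩ := homCoord_affPoint j.1 hb i.2 y.2
    change (swapIf j.2 (homCoord j.1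
      (affPoint i.1 i.2 ((chartAt E i.1).symm y.1) y.2 : ProjBundle L))).2 ≠ 0
    rw [h5, swapIf_smul]
    exact mul_ne_zero ha h4

theorem projChart_trans (i j : W × Bool) (y : E × ℂ)
    (hy : y ∈ ((projChart E L i).symm.trans (projChart E L j)).source) :
    (projChart E L i).symm.trans (projChart E L j) y =
      (chartAt E j.1 ((chartAt E i.1).symm y.1), (homTrans L i j y).1 / (homTrans L i j y).2) := by
  rw [projChart_source] at hy
  obtain ⟨⟨h1, hb, h3⟩, h4⟩ := hy
  obtain ⟨a, ha, h5⟩ := homCoord_affPoint j.1 hb i.2 y.2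
  ext1
  · rfl
  · change (swapIf j.2 (homCoord j.1
      (affPoint i.1 i.2 ((chartAt E i.1).symm y.1) y.2 : ProjBundle L))).1 / (swapIf j.2
      (homCoord j.1 (affPoint i.1 i.2 ((chartAt E i.1).symm y.1) y.2 : ProjBundle L))).2 = _
    rw [h5, swapIf_smul]
    exact mul_div_mul_left _ _ ha

variable [IsManifold 𝓘(ℂ, E) ω W] [ContMDiffVectorBundle ω ℂ L 𝓘(ℂ, E)]

theorem contDiffOn_lineTrans (α β : W) :
    ContDiffOn ℂ ω (fun y : E => lineTrans L α β ((chartAt E α).symm y))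
      ((chartAt E α).target ∩ (chartAt E α).symm ⁻¹' (baseDomain E L α ∩ baseDomain E L β)) := by
  have h := contMDiffOn_coordChangeL (n := ω) (IB := 𝓘(ℂ, E)) (trivializationAt ℂ L α)
    (trivializationAt ℂ L β)
  have h1 : ContMDiffOn 𝓘(ℂ, E) 𝓘(ℂ, ℂ) ω (fun w => (((trivializationAt ℂ L α).coordChangeL ℂ
    (trivializationAt ℂ L β) w : ℂ →L[ℂ] ℂ)) 1)
    ((trivializationAt ℂ L α).baseSet ∩ (trivializationAt ℂ L β).baseSet) :=
    h.clm_apply contMDiffOn_const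
  have h2 := contMDiffOn_chart_symm (I := 𝓘(ℂ, E)) (n := ω) (x := α)
  rw [← contMDiffOn_iff_contDiffOn]
  refine ((h1.comp (h2.mono inter_subset_left) ?_)).congr ?_
  · rintro y ⟨-, hy⟩; exact ⟨hy.1.2, hy.2.2⟩
  · rintro y ⟨-, hy⟩
    dsimp
    rw [lineTrans, lineCoord, lineFrame]
    rw [Trivialization.coordChangeL_apply _ _ ⟨hy.1.2, hy.2.2⟩]
    rw [Trivialization.coe_linearMapAt_of_mem _ hy.2.2, Trivialization.symmₗ_apply _ hy.1.2]

theorem contDiffOn_homTrans (i j : W × Bool) :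
    ContDiffOn ℂ ω (homTrans L i j) (transDomain E L i j) := by
  have h : ContDiffOn ℂ ω (fun y : E × ℂ => lineTrans L i.1 j.1 ((chartAt E i.1).symm y.1))
      (transDomain E L i j) :=
    (contDiffOn_lineTrans (E := E) (L := L) i.1 j.1).comp
      (contDiff_fst (𝕜 := ℂ) (n := ω) (E := E) (F := ℂ)).contDiffOn (fun y hy => hy)
  have h2 : ContDiffOn ℂ ω (fun y : E × ℂ => y.2) (transDomain E L i j) :=
    contDiff_snd.contDiffOn
  unfold homTrans
  cases i.2 <;> cases j.2 <;>
    simp only [swapIf, cond_true, cond_false, one_mul, Prod.swap]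
  · exact h2.prodMk h
  · exact h.prodMk h2
  · exact contDiffOn_const.prodMk (h2.mul h)
  · exact (h2.mul h).prodMk contDiffOn_const

theorem isOpen_transDomain (i j : W × Bool) : IsOpen (transDomain E L i j) :=
  ((chartAt E i.1).isOpen_inter_preimage_symm
    ((isOpen_baseDomain i.1).inter (isOpen_baseDomain j.1))).preimage continuous_fst

variable (E L) in
/-- The holomorphic coordinates `(w_α, ζ_α^±)` on `ℙ(L ⊕ 𝒪)`. The preferred ones at a point over
`w` are `(w_w, ζ_w^+)`, except on the section at infinity `t = 0`, where they are
`(w_w, ζ_w^-)`. -/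
def projFamily : CoordFamily ℂ (E × ℂ) (ProjBundle L) (W × Bool) ω where
  chart := projChart E L
  idx p := haveI := Classical.dec (p.line.rep.2 = 0)
    (p.base, if p.line.rep.2 = 0 then false else true)
  mem_source := by
    rintro ⟨w, P⟩
    have hb : w ∈ baseDomain E L w := ⟨mem_chart_source E w, mem_baseSet_trivializationAt ℂ L w⟩
    refine ⟨hb, ?_⟩
    dsimp only
    split_ifs with h
    · simp only [swapIf, cond_false, homCoord, Prod.swap]
      intro h0
      apply P.rep_nonzero
      ext1
      · rw [← lineFrame_lineCoord hb P.rep.1, h0]; simp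
      · exact h
    · simpa [swapIf, homCoord] using h
  open_source := by
    intro i j
    rw [projChart_source]
    exact ((contDiffOn_homTrans i j).continuousOn.snd).isOpen_inter_preimage
      (isOpen_transDomain i j) isOpen_ne
  smooth := by
    intro i j
    refine ContDiffOn.congr ?_ (projChart_trans i j)
    rw [projChart_source]
    have h := (contDiffOn_homTrans (E := E) (L := L) i j).mono
      (inter_subset_left (t := {y | (homTrans L i j y).2 ≠ 0}))
    refine ContDiffOn.prodMk ?_ (h.fst.div h.snd fun y hy => hy.2)
    have h2 := (contDiffGroupoid ω 𝓘(ℂ, E)).compatible (chart_mem_atlas E i.1)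
      (chart_mem_atlas E j.1)
    rw [contDiffGroupoid, mem_groupoid_of_pregroupoid] at h2
    refine ContDiffOn.comp (t := ((chartAt E i.1).symm ≫ₕ chartAt E j.1).source)
      (g := fun y => chartAt E j.1 ((chartAt E i.1).symm y)) ?_ contDiff_fst.contDiffOn ?_
    · exact ContDiffOn.mono h2.1 (by simp)
    · rintro y ⟨⟨h1, h2, h3⟩, -⟩
      simp only [OpenPartialHomeomorph.trans_source]
      exact ⟨h1, h3.1⟩

/-- The complex manifold `ℙ(L ⊕ 𝒪)`. The type records the model space `E` of the base, because the
complex structure depends on the one of the base. -/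
def ProjManifold (_E : Type*) {W : Type*} (L : W → Type*) [∀ w, AddCommGroup (L w)]
    [∀ w, Module ℂ (L w)] : Type _ := ProjBundle L

instance : TopologicalSpace (ProjManifold E L) := (projFamily E L).core.toTopologicalSpace
instance : ChartedSpace (E × ℂ) (ProjManifold E L) := (projFamily E L).core.toChartedSpace
instance : IsManifold 𝓘(ℂ, E × ℂ) ω (ProjManifold E L) := (projFamily E L).isManifold

end ProjectiveBundle

section Canonical
variable {V : Type*} [NormedAddCommGroup V] [NormedSpace ℂ V] [FiniteDimensional ℂ V]
  {M : Type*} [TopologicalSpace M] [ChartedSpace V M]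

/-- The fibre at `x` of the canonical bundle: complex top degree forms on the tangent space. -/
abbrev CanonicalFiber (V : Type*) [NormedAddCommGroup V] [NormedSpace ℂ V]
    {M : Type*} [TopologicalSpace M] [ChartedSpace V M] (x : M) : Type _ :=
  TangentSpace 𝓘(ℂ, V) x [⋀^Fin (Module.finrank ℂ V)]→ₗ[ℂ] ℂ

/-- The total space of the canonical bundle. -/
structure CanonicalBundle (V : Type*) [NormedAddCommGroup V] [NormedSpace ℂ V]
    (M : Type*) [TopologicalSpace M] [ChartedSpace V M] where
  base : M
  form : CanonicalFiber V base

/-- The circle bundle associated with the canonical bundle: the quotient of the complement of the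
zero section by the positive real numbers. -/
structure CircleBundle (V : Type*) [NormedAddCommGroup V] [NormedSpace ℂ V]
    (M : Type*) [TopologicalSpace M] [ChartedSpace V M] where
  base : M
  ray : Module.Ray ℝ (CanonicalFiber V base)

/-- The differential at `i x` of the change of coordinates from the chart `i` to the preferred chart
at `x`. Since the tangent space at `x` is identified with `V` through the preferred chart, it sends
`b_k` to the coordinate vector field `∂ / ∂ y^k` of the chart `i` at `x`. -/
def frameMap (i : OpenPartialHomeomorph M V) (x : M) : V →L[ℂ] V :=
  fderiv ℂ (fun y => chartAt V x (i.symm y)) (i x)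

/-- The fibre coordinate `τ` of a top form at `x` with respect to the frame `dy^1 ∧ ⋯ ∧ dy^N` given
by the coordinates `y` of the chart `i`. -/
def formCoord (i : OpenPartialHomeomorph M V) (x : M) (σ : CanonicalFiber V x) : ℂ :=
  σ (fun k => frameMap i x (Module.finBasis ℂ V k))

/-- The top form `dy^1 ∧ ⋯ ∧ dy^N` at `x` of the preferred chart. -/
def stdForm (x : M) : CanonicalFiber V x := (Module.finBasis ℂ V).det

theorem stdForm_ne_zero (x : M) : (stdForm x : CanonicalFiber V x) ≠ 0 :=
  (Module.finBasis ℂ V).det_ne_zero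

/-- The jacobian determinant of `frameMap`. -/
def jac (i : OpenPartialHomeomorph M V) (x : M) : ℂ :=
  LinearMap.det (M := V) (frameMap i x : V →ₗ[ℂ] V)

theorem formCoord_smul_stdForm (i : OpenPartialHomeomorph M V) (x : M) (c : ℂ) :
    formCoord i x (c • stdForm x) = c * jac i x := by
  have h := Module.Basis.det_comp (Module.finBasis ℂ V) (frameMap i x : V →ₗ[ℂ] V)
    (Module.finBasis ℂ V)
  rw [Module.Basis.det_self, mul_one] at h
  have h2 : formCoord i x (stdForm x) = jac i x := h
  rw [← h2]; rfl

theorem exists_smul_stdForm (x : M) (σ : CanonicalFiber V x) :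
    ∃ c : ℂ, σ = c • stdForm x :=
  ⟨_, AlternatingMap.eq_smul_basis_det (Module.finBasis ℂ V) σ⟩

/-- The quotient of the jacobians for two charts, as a function of the coordinates in `i`. -/
def jacQuot (i j : OpenPartialHomeomorph M V) (y : V) : ℂ :=
  jac j (i.symm y) / jac i (i.symm y)

variable [IsManifold 𝓘(ℂ, V) ω M]

theorem contDiffOn_trans {i j : OpenPartialHomeomorph M V} (hi : i ∈ atlas V M)
    (hj : j ∈ atlas V M) :
    ContDiffOn ℂ ω (fun y => j (i.symm y)) (i.symm ≫ₕ j).source := by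
  have h2 := (contDiffGroupoid ω 𝓘(ℂ, V)).compatible hi hj
  rw [contDiffGroupoid, mem_groupoid_of_pregroupoid] at h2
  exact ContDiffOn.mono h2.1 (by simp)

/-- The chain rule for `frameMap`. -/
theorem frameMap_comp {i j : OpenPartialHomeomorph M V} (hi : i ∈ atlas V M)
    (hj : j ∈ atlas V M) {x : M} (hxi : x ∈ i.source) (hxj : x ∈ j.source) :
    frameMap i x = (frameMap j x).comp (fderiv ℂ (fun y => j (i.symm y)) (i x)) := by
  have h1 : DifferentiableAt ℂ (fun y => j (i.symm y)) (i x) := by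
    refine ((contDiffOn_trans hi hj).contDiffAt ?_).differentiableAt (by simp)
    exact (i.symm ≫ₕ j).open_source.mem_nhds (by simp [hxi, hxj])
  have h2 : DifferentiableAt ℂ (fun y => chartAt V x (j.symm y)) (j (i.symm (i x))) := by
    rw [i.left_inv hxi]
    refine ((contDiffOn_trans hj (chart_mem_atlas V x)).contDiffAt ?_).differentiableAt (by simp)
    exact (j.symm ≫ₕ chartAt V x).open_source.mem_nhds (by simp [hxj])
  have h3 := fderiv_comp (i x) h2 h1
  have h4 : frameMap j x = fderiv ℂ (fun y => chartAt V x (j.symm y)) (j (i.symm (i x))) := by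
    rw [i.left_inv hxi]; rfl
  rw [h4]
  refine Eq.trans ?_ h3
  apply Filter.EventuallyEq.fderiv_eq
  have hn : (i.symm ≫ₕ j).source ∈ 𝓝 (i x) :=
    (i.symm ≫ₕ j).open_source.mem_nhds (by simp [hxi, hxj])
  filter_upwards [hn] with y hy
  simp only [OpenPartialHomeomorph.trans_source, mem_inter_iff, mem_preimage] at hy
  simp only [Function.comp_apply, j.left_inv hy.2]

theorem jac_comp {i j : OpenPartialHomeomorph M V} (hi : i ∈ atlas V M)
    (hj : j ∈ atlas V M) {x : M} (hxi : x ∈ i.source) (hxj : x ∈ j.source) :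
    jac i x = jac j x * LinearMap.det (fderiv ℂ (fun y => j (i.symm y)) (i x) : V →ₗ[ℂ] V) := by
  rw [jac, jac, frameMap_comp hi hj hxi hxj]
  exact LinearMap.det_comp _ _

theorem jac_ne_zero {i : OpenPartialHomeomorph M V} (hi : i ∈ atlas V M) {x : M}
    (hx : x ∈ i.source) : jac i x ≠ 0 := by
  have h := jac_comp (chart_mem_atlas V x) hi (mem_chart_source V x) hx
  have h1 : jac (chartAt V x) x = 1 := by
    have h2 : frameMap (chartAt V x) x = ContinuousLinearMap.id ℂ V := by
      rw [← fderiv_id (x := chartAt V x x)]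
      apply Filter.EventuallyEq.fderiv_eq
      filter_upwards [(chartAt V x).open_target.mem_nhds (mem_chart_target V x)] with y hy
      exact (chartAt V x).right_inv hy
    rw [jac, h2]
    exact LinearMap.det_id
  rw [h1] at h
  exact left_ne_zero_of_mul (h ▸ one_ne_zero)

theorem contDiff_det : ContDiff ℂ ω (fun A : V →L[ℂ] V => LinearMap.det (A : V →ₗ[ℂ] V)) := by
  have h : (fun A : V →L[ℂ] V => LinearMap.det (A : V →ₗ[ℂ] V)) = fun A =>
      ∑ σ : Equiv.Perm (Fin (Module.finrank ℂ V)), ((Equiv.Perm.sign σ : ℤ) : ℂ) *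
        ∏ k, (Module.finBasis ℂ V).equivFunL (A (Module.finBasis ℂ V k)) (σ k) := by
    ext A
    rw [← LinearMap.det_toMatrix (Module.finBasis ℂ V), Matrix.det_apply']
    simp [LinearMap.toMatrix_apply]
  rw [h]
  refine ContDiff.sum fun σ _ => contDiff_const.mul (contDiff_prod fun k _ => ?_)
  have h1 : ContDiff ℂ ω (fun A : V →L[ℂ] V => A (Module.finBasis ℂ V k)) :=
    contDiff_id.clm_apply contDiff_const
  exact contDiff_pi.1 ((Module.finBasis ℂ V).equivFunL.contDiff.comp h1) (σ k)

theorem jacQuot_spec {i j : OpenPartialHomeomorph M V} (hi : i ∈ atlas V M) (hj : j ∈ atlas V M) :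
    ContDiffOn ℂ ω (jacQuot i j) (i.symm ≫ₕ j).source ∧
      ∀ y ∈ (i.symm ≫ₕ j).source, jacQuot i j y ≠ 0 := by
  have h0 : ∀ y ∈ (i.symm ≫ₕ j).source,
      jac i (i.symm y) ≠ 0 ∧ jac j (i.symm y) ≠ 0 ∧ jac i (i.symm y) = jac j (i.symm y) *
        LinearMap.det (fderiv ℂ (fun y => j (i.symm y)) y : V →ₗ[ℂ] V) := by
    intro y hy
    simp only [OpenPartialHomeomorph.trans_source, mem_inter_iff, mem_preimage] at hy
    have h := jac_comp hi hj (i.map_target hy.1) hy.2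
    rw [i.right_inv hy.1] at h
    exact ⟨jac_ne_zero hi (i.map_target hy.1), jac_ne_zero hj hy.2, h⟩
  refine ⟨?_, fun y hy => div_ne_zero (h0 y hy).2.1 (h0 y hy).1⟩
  have h1 : ContDiffOn ℂ ω (fun y => LinearMap.det (fderiv ℂ (fun y => j (i.symm y)) y : V →ₗ[ℂ] V))
      (i.symm ≫ₕ j).source :=
    contDiff_det.comp_contDiffOn
      ((contDiffOn_trans hi hj).fderiv_of_isOpen (i.symm ≫ₕ j).open_source (by simp))
  refine (h1.inv fun y hy => ?_).congr fun y hy => ?_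
  · exact right_ne_zero_of_mul ((h0 y hy).2.2 ▸ (h0 y hy).1)
  · obtain ⟨h2, h3, h4⟩ := h0 y hy
    rw [Pi.inv_apply, jacQuot, h4, div_mul_cancel_left₀ h3]

/-- The holomorphic coordinates `(y, τ)` on the canonical bundle given by a chart with
coordinates `y`. -/
def canChart (i : atlas V M) : PartialEquiv (CanonicalBundle V M) (V × ℂ) where
  toFun p := (i.1 p.base, formCoord i.1 p.base p.form)
  invFun y := ⟨i.1.symm y.1, (y.2 / jac i.1 (i.1.symm y.1)) • stdForm _⟩
  source := {p | p.base ∈ i.1.source}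
  target := {y | y.1 ∈ i.1.target}
  map_source' p hp := i.1.map_source hp
  map_target' y hy := i.1.map_target hy
  left_inv' := by
    rintro ⟨x, σ⟩ (hp : x ∈ i.1.source)
    dsimp only
    rw [i.1.left_inv hp]
    obtain ⟨c, rfl⟩ := exists_smul_stdForm x σ
    rw [formCoord_smul_stdForm, mul_div_cancel_right₀ _ (jac_ne_zero i.2 hp)]
  right_inv' := by
    rintro y hy
    ext1
    · exact i.1.right_inv hy
    · dsimp only
      rw [formCoord_smul_stdForm, div_mul_cancel₀ _ (jac_ne_zero i.2 (i.1.map_target hy))]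

theorem canChart_source (i j : atlas V M) : ((canChart i).symm.trans (canChart j)).source =
    {y | y.1 ∈ (i.1.symm ≫ₕ j.1).source} := by
  ext y; simp [canChart, PartialEquiv.trans_source]

/-- The holomorphic coordinates on the canonical bundle. -/
def canFamily (V : Type*) [NormedAddCommGroup V] [NormedSpace ℂ V] [FiniteDimensional ℂ V]
    (M : Type*) [TopologicalSpace M] [ChartedSpace V M] [IsManifold 𝓘(ℂ, V) ω M] :
    CoordFamily ℂ (V × ℂ) (CanonicalBundle V M) (atlas V M) ω where
  chart := canChart
  idx p := ⟨chartAt V p.base, chart_mem_atlas V p.base⟩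
  mem_source p := mem_chart_source V p.base
  open_source i j := by
    rw [canChart_source]
    exact (i.1.symm ≫ₕ j.1).open_source.preimage continuous_fst
  smooth i j := by
    rw [canChart_source]
    have h1 := (contDiffOn_trans i.2 j.2).comp (t := (i.1.symm ≫ₕ j.1).source)
      (contDiff_fst (𝕜 := ℂ) (n := ω) (E := V) (F := ℂ)).contDiffOn
      (s := {y : V × ℂ | y.1 ∈ (i.1.symm ≫ₕ j.1).source}) (fun y hy => hy)
    have h2 := (jacQuot_spec i.2 j.2).1.comp
      (contDiff_fst (𝕜 := ℂ) (n := ω) (E := V) (F := ℂ)).contDiffOn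
      (s := {y : V × ℂ | y.1 ∈ (i.1.symm ≫ₕ j.1).source}) (fun y hy => hy)
    refine (h1.prodMk (contDiff_snd.contDiffOn.mul h2)).congr fun y hy => ?_
    change (j.1 (i.1.symm y.1), formCoord j.1 (i.1.symm y.1)
      ((y.2 / jac i.1 (i.1.symm y.1)) • stdForm _)) = _
    rw [formCoord_smul_stdForm]
    ext1
    · rfl
    · simp [jacQuot]; ring

instance : TopologicalSpace (CanonicalBundle V M) := (canFamily V M).core.toTopologicalSpace
instance : ChartedSpace (V × ℂ) (CanonicalBundle V M) := (canFamily V M).core.toChartedSpace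
instance : IsManifold 𝓘(ℂ, V × ℂ) ω (CanonicalBundle V M) := (canFamily V M).isManifold

/-- The complement of the zero section of the canonical bundle. -/
def puncturedCanonical (V : Type*) [NormedAddCommGroup V] [NormedSpace ℂ V]
    [FiniteDimensional ℂ V] (M : Type*) [TopologicalSpace M] [ChartedSpace V M]
    [IsManifold 𝓘(ℂ, V) ω M] : TopologicalSpace.Opens (CanonicalBundle V M) where
  carrier := {p | p.form ≠ 0}
  is_open' := by
    have h : {p : CanonicalBundle V M | p.form ≠ 0} =
        ⋃ p : CanonicalBundle V M, (chartAt (V × ℂ) p).source ∩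
          chartAt (V × ℂ) p ⁻¹' {y | y.2 ≠ 0} := by
      have key : ∀ (p q : CanonicalBundle V M), q ∈ (chartAt (V × ℂ) p).source →
          (q.form ≠ 0 ↔ (chartAt (V × ℂ) p q).2 ≠ 0) := by
        rintro p ⟨x, σ⟩ (hq : x ∈ (chartAt V p.base).source)
        change σ ≠ 0 ↔ formCoord (chartAt V p.base) x σ ≠ 0
        obtain ⟨c, rfl⟩ := exists_smul_stdForm x σ
        rw [formCoord_smul_stdForm]
        simp [jac_ne_zero (chart_mem_atlas V p.base) hq, stdForm_ne_zero]
      ext q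
      simp only [mem_ofPred_eq, mem_iUnion, mem_inter_iff, mem_preimage]
      constructor
      · intro hq
        exact ⟨q, mem_chart_source _ q, (key q q (mem_chart_source _ q)).1 hq⟩
      · rintro ⟨p, h1, h2⟩
        exact (key p q h1).2 h2
    rw [h]
    refine isOpen_iUnion fun p => ?_
    exact (chartAt (V × ℂ) p).isOpen_inter_preimage (isOpen_ne.preimage continuous_snd)

/-- The projection of the punctured canonical bundle onto the circle bundle. -/
def toCircleBundle (p : puncturedCanonical V M) : CircleBundle V M :=
  ⟨p.1.base, rayOfNeZero ℝ p.1.form p.2⟩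

/-- The complex number `e^{-iβ} τ`, where `τ` is the fibre coordinate of some form on the given
ray, with respect to the chart `i`. -/
def rayCoord (i : OpenPartialHomeomorph M V) (β : ℝ) (p : CircleBundle V M) : ℂ :=
  formCoord i p.base p.ray.someVector * Complex.exp (-(β * Complex.I))

/-- The ray through `c • stdForm x` (through `stdForm x` if `c = 0`). -/
def rayPoint (x : M) (c : ℂ) : CircleBundle V M :=
  haveI := Classical.dec (c = 0)
  ⟨x, rayOfNeZero ℝ ((if c = 0 then 1 else c) • stdForm x) (smul_ne_zero (by split_ifs <;> simp [*])
    (stdForm_ne_zero x))⟩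

theorem formCoord_real_smul (i : OpenPartialHomeomorph M V) (x : M) (a : ℝ)
    (σ : CanonicalFiber V x) : formCoord i x (a • σ) = a * formCoord i x σ := by
  obtain ⟨c, rfl⟩ := exists_smul_stdForm x σ
  have h : (a • c • stdForm x : CanonicalFiber V x) = ((a : ℂ) * c) • stdForm x := by
    rw [mul_smul]; rfl
  rw [h, formCoord_smul_stdForm, formCoord_smul_stdForm]; ring

theorem rayPoint_of_ne (x : M) (c : ℂ) (hc : c ≠ 0) : rayPoint (V := V) x c =
    ⟨x, rayOfNeZero ℝ (c • stdForm x) (smul_ne_zero hc (stdForm_ne_zero x))⟩ := by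
  simp only [rayPoint, hc, if_false]

theorem formCoord_rayPoint (i : OpenPartialHomeomorph M V) (x : M) (c : ℂ) (hc : c ≠ 0) :
    ∃ a : ℝ, 0 < a ∧ formCoord i (rayPoint (V := V) x c).base
      (rayPoint (V := V) x c).ray.someVector = a * (c * jac i x) := by
  rw [rayPoint_of_ne x c hc]
  have hne : (c • stdForm x : CanonicalFiber V x) ≠ 0 := smul_ne_zero hc (stdForm_ne_zero x)
  have h := (rayOfNeZero ℝ (c • stdForm x : CanonicalFiber V x) hne).someVector_ray
  rw [ray_eq_iff] at h
  obtain ⟨a, ha, h1⟩ := h.symm.exists_pos_left hne (Module.Ray.someVector_ne_zero _)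
  refine ⟨a, ha, ?_⟩
  rw [← formCoord_smul_stdForm, ← formCoord_real_smul, h1]

theorem rayPoint_eq (p : CircleBundle V M) (c : ℂ) (a : ℝ) (ha : 0 < a)
    (h : (c • stdForm p.base : CanonicalFiber V p.base) = a • p.ray.someVector) :
    rayPoint p.base c = p := by
  have hc : c ≠ 0 := by
    rintro rfl
    rw [zero_smul] at h
    exact smul_ne_zero ha.ne' p.ray.someVector_ne_zero h.symm
  obtain ⟨x, R⟩ := p
  rw [rayPoint_of_ne x c hc]
  congr 1
  rw [← R.someVector_ray, ray_eq_iff]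
  dsimp only at h
  rw [h]
  exact SameRay.sameRay_pos_smul_left _ ha

theorem rayCoord_rayPoint {i : OpenPartialHomeomorph M V} (hi : i ∈ atlas V M)
    (j : OpenPartialHomeomorph M V) (β β' : ℝ) (θ : ℝ) {x : M} (hx : x ∈ i.source) :
    ∃ a : ℝ, 0 < a ∧
      rayCoord j β' (rayPoint (V := V) x (Complex.exp ((θ + β : ℝ) * Complex.I) / jac i x)) =
        a * (Complex.exp ((θ + (β - β') : ℝ) * Complex.I) * (jac j x / jac i x)) := by
  obtain ⟨a, ha, h⟩ := formCoord_rayPoint j x (Complex.exp ((θ + β : ℝ) * Complex.I) / jac i x)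
    (div_ne_zero (Complex.exp_ne_zero _) (jac_ne_zero hi hx))
  refine ⟨a, ha, ?_⟩
  rw [rayCoord, h]
  have h1 : Complex.exp ((θ + (β - β') : ℝ) * Complex.I) =
      Complex.exp ((θ + β : ℝ) * Complex.I) * Complex.exp (-(β' * Complex.I)) := by
    rw [← Complex.exp_add]; congr 1; push_cast; ring
  rw [h1]; ring

theorem pos_mul_mem_slitPlane {a : ℝ} (ha : 0 < a) (z : ℂ) :
    (a : ℂ) * z ∈ Complex.slitPlane ↔ z ∈ Complex.slitPlane := by
  simp [Complex.mem_slitPlane_iff, ha, ha.ne']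

theorem arg_exp {θ : ℝ} (h : θ ∈ Ioo (-Real.pi) Real.pi) :
    (Complex.exp ((θ : ℝ) * Complex.I)).arg = θ ∧
      Complex.exp ((θ : ℝ) * Complex.I) ∈ Complex.slitPlane := by
  have h1 : (Complex.exp ((θ : ℝ) * Complex.I)).arg = θ := by
    have := Complex.arg_mul_cos_add_sin_mul_I one_pos (Ioo_subset_Ioc_self h)
    rwa [← Complex.exp_mul_I, Complex.ofReal_one, one_mul] at this
  refine ⟨h1, ?_⟩
  rw [Complex.mem_slitPlane_iff_arg, h1]
  exact ⟨h.2.ne, Complex.exp_ne_zero _⟩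

/-- The coordinates `(y, θ)` on the circle bundle, for a chart of the base with coordinates `y`
and fibre coordinate `τ` of the canonical bundle, where `θ = arg (e^{-iβ} τ) ∈ (-π, π)`. -/
def circChart (i : atlas V M × ℝ) : PartialEquiv (CircleBundle V M) (V × ℝ) where
  toFun p := (i.1.1 p.base, (rayCoord i.1.1 i.2 p).arg)
  invFun y := rayPoint (i.1.1.symm y.1)
    (Complex.exp ((y.2 + i.2 : ℝ) * Complex.I) / jac i.1.1 (i.1.1.symm y.1))
  source := {p | p.base ∈ i.1.1.source ∧ rayCoord i.1.1 i.2 p ∈ Complex.slitPlane}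
  target := {y | y.1 ∈ i.1.1.target ∧ y.2 ∈ Ioo (-Real.pi) Real.pi}
  map_source' := by
    rintro p ⟨h1, h2⟩
    refine ⟨i.1.1.map_source h1, ?_, ?_⟩
    · exact Complex.neg_pi_lt_arg _
    · exact lt_of_le_of_ne (Complex.arg_le_pi _) (Complex.mem_slitPlane_iff_arg.1 h2).1
  map_target' := by
    rintro y ⟨h1, h2⟩
    have hx := i.1.1.map_target h1
    refine ⟨hx, ?_⟩
    obtain ⟨a, ha, h⟩ := rayCoord_rayPoint i.1.2 i.1.1 i.2 i.2 y.2 hx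
    rw [h, pos_mul_mem_slitPlane ha, div_self (jac_ne_zero i.1.2 hx), sub_self, add_zero, mul_one]
    exact (arg_exp h2).2
  left_inv' := by
    rintro p ⟨h1, h2⟩
    dsimp only
    rw [i.1.1.left_inv h1]
    have hne : ‖rayCoord i.1.1 i.2 p‖ ≠ 0 := norm_ne_zero_iff.2 (Complex.slitPlane_ne_zero h2)
    refine rayPoint_eq p _ (‖rayCoord i.1.1 i.2 p‖)⁻¹ (by positivity) ?_
    obtain ⟨d, hd⟩ := exists_smul_stdForm p.base p.ray.someVector
    have h3 := Complex.norm_mul_exp_arg_mul_I (rayCoord i.1.1 i.2 p)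
    have h4 : rayCoord i.1.1 i.2 p = d * jac i.1.1 p.base * Complex.exp (-(i.2 * Complex.I)) := by
      rw [rayCoord, hd, formCoord_smul_stdForm]
    have h5 : Complex.exp (((rayCoord i.1.1 i.2 p).arg + i.2 : ℝ) * Complex.I) =
        Complex.exp ((rayCoord i.1.1 i.2 p).arg * Complex.I) * Complex.exp (i.2 * Complex.I) := by
      rw [← Complex.exp_add]; congr 1; push_cast; ring
    have h6 : Complex.exp ((rayCoord i.1.1 i.2 p).arg * Complex.I) =
        (‖rayCoord i.1.1 i.2 p‖ : ℂ)⁻¹ *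
          (d * jac i.1.1 p.base * Complex.exp (-(i.2 * Complex.I))) := by
      rw [← h4, eq_inv_mul_iff_mul_eq₀ (by exact_mod_cast hne), h3]
    have h7 : Complex.exp (-(i.2 * Complex.I)) * Complex.exp (i.2 * Complex.I) = 1 := by
      rw [← Complex.exp_add]; simp
    have hj := jac_ne_zero i.1.2 h1
    have h8 : Complex.exp (((rayCoord i.1.1 i.2 p).arg + i.2 : ℝ) * Complex.I) /
        jac i.1.1 p.base = ((‖rayCoord i.1.1 i.2 p‖⁻¹ : ℝ) : ℂ) * d := by
      rw [h5, h6, div_eq_iff hj, mul_assoc, mul_assoc, h7]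
      push_cast; ring
    rw [h8, hd, mul_smul]
    rfl
  right_inv' := by
    rintro y ⟨h1, h2⟩
    have hx := i.1.1.map_target h1
    obtain ⟨a, ha, h⟩ := rayCoord_rayPoint i.1.2 i.1.1 i.2 i.2 y.2 hx
    ext1
    · exact i.1.1.right_inv h1
    · dsimp only
      rw [h, Complex.arg_real_mul _ ha, div_self (jac_ne_zero i.1.2 hx), sub_self, add_zero,
        mul_one]
      exact (arg_exp h2).1

/-- The fibre coordinate on the punctured canonical bundle in the chart `j`, up to a positive
factor, in terms of the coordinates on the circle bundle given by the chart `i`. -/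
def circTrans (i j : atlas V M × ℝ) (y : V × ℝ) : ℂ :=
  Complex.exp ((y.2 + (i.2 - j.2) : ℝ) * Complex.I) * jacQuot i.1.1 j.1.1 y.1

theorem circChart_source (i j : atlas V M × ℝ) : ((circChart i).symm.trans (circChart j)).source =
    {y | y.1 ∈ (i.1.1.symm ≫ₕ j.1.1).source ∧ y.2 ∈ Ioo (-Real.pi) Real.pi} ∩
      {y | circTrans i j y ∈ Complex.slitPlane} := by
  ext y
  rw [PartialEquiv.trans_source]
  constructor
  · rintro ⟨⟨h1, h2⟩, h3, h4⟩
    obtain ⟨a, ha, h⟩ := rayCoord_rayPoint i.1.2 j.1.1 i.2 j.2 y.2 (i.1.1.map_target h1)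
    have h5 : y.1 ∈ (i.1.1.symm ≫ₕ j.1.1).source := by
      rw [OpenPartialHomeomorph.trans_source]; exact ⟨h1, h3⟩
    refine ⟨⟨h5, h2⟩, ?_⟩
    change rayCoord _ _ (rayPoint _ _) ∈ _ at h4
    rw [h, pos_mul_mem_slitPlane ha] at h4
    exact h4
  · rintro ⟨⟨h5, h2⟩, h4⟩
    rw [OpenPartialHomeomorph.trans_source] at h5
    obtain ⟨a, ha, h⟩ := rayCoord_rayPoint i.1.2 j.1.1 i.2 j.2 y.2 (i.1.1.map_target h5.1)
    refine ⟨⟨h5.1, h2⟩, h5.2, ?_⟩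
    change rayCoord _ _ (rayPoint _ _) ∈ _
    rw [h, pos_mul_mem_slitPlane ha]
    exact h4

theorem contDiffOn_circTrans (i j : atlas V M × ℝ) :
    ContDiffOn ℝ ∞ (circTrans i j)
      {y | y.1 ∈ (i.1.1.symm ≫ₕ j.1.1).source ∧ y.2 ∈ Ioo (-Real.pi) Real.pi} := by
  have h1 : ContDiffOn ℝ ∞ (jacQuot i.1.1 j.1.1) (i.1.1.symm ≫ₕ j.1.1).source :=
    ((jacQuot_spec i.1.2 j.1.2).1.restrict_scalars ℝ).of_le (by exact_mod_cast le_top)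
  have h2 : ContDiff ℝ ∞ (fun y : V × ℝ =>
      Complex.exp ((y.2 + (i.2 - j.2) : ℝ) * Complex.I)) := by
    refine ContDiff.cexp (ContDiff.mul ?_ contDiff_const)
    exact Complex.ofRealCLM.contDiff.comp (contDiff_snd.add contDiff_const)
  exact h2.contDiffOn.mul (h1.comp contDiff_fst.contDiffOn fun y hy => hy.1)

/-- The coordinates on the circle bundle. The preferred ones at a point are given by the preferred
chart of the base and by an angle centred at the point. -/
def circFamily (V : Type*) [NormedAddCommGroup V] [NormedSpace ℂ V] [FiniteDimensional ℂ V]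
    (M : Type*) [TopologicalSpace M] [ChartedSpace V M] [IsManifold 𝓘(ℂ, V) ω M] :
    CoordFamily ℝ (V × ℝ) (CircleBundle V M) (atlas V M × ℝ) ∞ where
  chart := circChart
  idx p := (⟨chartAt V p.base, chart_mem_atlas V p.base⟩,
    (formCoord (chartAt V p.base) p.base p.ray.someVector).arg)
  mem_source p := by
    refine ⟨mem_chart_source V p.base, ?_⟩
    set τ := formCoord (chartAt V p.base) p.base p.ray.someVector with hτ
    have hne : τ ≠ 0 := by
      obtain ⟨d, hd⟩ := exists_smul_stdForm p.base p.ray.someVector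
      rw [hτ, hd, formCoord_smul_stdForm]
      refine mul_ne_zero ?_ (jac_ne_zero (chart_mem_atlas V p.base) (mem_chart_source V p.base))
      rintro rfl
      exact p.ray.someVector_ne_zero (by rw [hd, zero_smul])
    have h : rayCoord (chartAt V p.base) τ.arg p = (‖τ‖ : ℂ) := by
      rw [rayCoord, ← hτ]
      nth_rewrite 1 [← Complex.norm_mul_exp_arg_mul_I τ]
      rw [mul_assoc, ← Complex.exp_add]; simp
    change rayCoord (chartAt V p.base) τ.arg p ∈ _
    rw [h, Complex.ofReal_mem_slitPlane]
    exact norm_pos_iff.2 hne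
  open_source i j := by
    rw [circChart_source]
    refine (contDiffOn_circTrans i j).continuousOn.isOpen_inter_preimage ?_ Complex.isOpen_slitPlane
    exact ((i.1.1.symm ≫ₕ j.1.1).open_source.preimage continuous_fst).inter
      (isOpen_Ioo.preimage continuous_snd)
  smooth i j := by
    have h1 : ContDiffOn ℝ ∞ (fun y => j.1.1 (i.1.1.symm y)) (i.1.1.symm ≫ₕ j.1.1).source :=
      ((contDiffOn_trans i.1.2 j.1.2).restrict_scalars ℝ).of_le (by exact_mod_cast le_top)
    have h2 := (contDiffOn_circTrans i j).mono
      (inter_subset_left (t := {y | circTrans i j y ∈ Complex.slitPlane}))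
    have h3 : ContDiffOn ℝ ∞ (fun y => (Complex.log (circTrans i j y)).im)
        ((circChart i).symm.trans (circChart j)).source := by
      rw [circChart_source]
      intro y hy
      exact Complex.imCLM.contDiff.contDiffAt.comp_contDiffWithinAt y
        (((Complex.contDiffAt_log hy.2).restrict_scalars ℝ).comp_contDiffWithinAt y (h2 y hy))
    have h4 : ContDiffOn ℝ ∞ (fun y : V × ℝ => j.1.1 (i.1.1.symm y.1))
        ((circChart i).symm.trans (circChart j)).source := by
      rw [circChart_source]
      exact h1.comp contDiff_fst.contDiffOn fun y hy => hy.1.1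
    refine (h4.prodMk h3).congr fun y hy => ?_
    rw [circChart_source] at hy
    obtain ⟨⟨h5, h6⟩, h7⟩ := hy
    rw [OpenPartialHomeomorph.trans_source] at h5
    obtain ⟨a, ha, h⟩ := rayCoord_rayPoint i.1.2 j.1.1 i.2 j.2 y.2 (i.1.1.map_target h5.1)
    ext1
    · rfl
    · change (rayCoord _ _ (rayPoint _ _)).arg = _
      rw [h, Complex.arg_real_mul _ ha, Complex.log_im]
      rfl

instance : TopologicalSpace (CircleBundle V M) := (circFamily V M).core.toTopologicalSpace
instance : ChartedSpace (V × ℝ) (CircleBundle V M) := (circFamily V M).core.toChartedSpace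
instance : IsManifold 𝓘(ℝ, V × ℝ) ∞ (CircleBundle V M) := (circFamily V M).isManifold

end Canonical

section Riemannian
variable {F : Type*} [NormedAddCommGroup F] [NormedSpace ℝ F] {Y : Type*} [TopologicalSpace Y]
  [ChartedSpace F Y] [IsManifold 𝓘(ℝ, F) ∞ Y]

/-- Smooth Riemannian metrics on a manifold `Y` modelled on `F`. -/
abbrev Metric (F : Type*) [NormedAddCommGroup F] [NormedSpace ℝ F] (Y : Type*)
    [TopologicalSpace Y] [ChartedSpace F Y] [IsManifold 𝓘(ℝ, F) ∞ Y] : Type _ :=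
  ContMDiffRiemannianMetric 𝓘(ℝ, F) ∞ F (fun y : Y => TangentSpace 𝓘(ℝ, F) y)

/-- The expression of a metric in the coordinates of a chart. -/
def Metric.inChart (g : Metric F Y) (φ : OpenPartialHomeomorph Y F) (y u v : F) : ℝ :=
  g.inner (φ.symm y) (mfderiv 𝓘(ℝ, F) 𝓘(ℝ, F) φ.symm y u) (mfderiv 𝓘(ℝ, F) 𝓘(ℝ, F) φ.symm y v)

/-- The coefficients `g_ij` of a field `G` of bilinear forms, in the linear coordinates of `b`. -/
def gram {ι : Type*} (b : Module.Basis ι ℝ F) (G : F → F → F → ℝ) (y : F) : Matrix ι ι ℝ :=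
  Matrix.of fun i j => G y (b i) (b j)

/-- The partial derivative `∂_k f` in the linear coordinates of `b`. -/
def pd {ι : Type*} (b : Module.Basis ι ℝ F) (k : ι) (f : F → ℝ) (y : F) : ℝ := fderiv ℝ f y (b k)

/-- The Christoffel symbols `Γ^k_ij = ½ ∑_l g^kl (∂_i g_jl + ∂_j g_il - ∂_l g_ij)`. -/
def christoffel {ι : Type*} [Fintype ι] [DecidableEq ι] (b : Module.Basis ι ℝ F)
    (G : F → F → F → ℝ) (k i j : ι) (y : F) : ℝ :=
  (1 / 2) * ∑ l, (gram b G y)⁻¹ k l *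
    (pd b i (fun z => gram b G z j l) y + pd b j (fun z => gram b G z i l) y -
      pd b l (fun z => gram b G z i j) y)

/-- The Ricci tensor
`R_ij = ∑_k (∂_k Γ^k_ij - ∂_j Γ^k_ik) + ∑_{k,l} (Γ^k_kl Γ^l_ij - Γ^k_jl Γ^l_ik)`. -/
def ricci {ι : Type*} [Fintype ι] [DecidableEq ι] (b : Module.Basis ι ℝ F)
    (G : F → F → F → ℝ) (i j : ι) (y : F) : ℝ :=
  (∑ k, (pd b k (christoffel b G k i j) y - pd b j (christoffel b G k i k) y)) +
    ∑ k, ∑ l, (christoffel b G k k l y * christoffel b G l i j y -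
      christoffel b G k j l y * christoffel b G l i k y)

/-- `g` is an Einstein metric with `Ric = c g`. The Ricci curvature is a tensor, so that the equation
at a point can be tested in any smooth local coordinates around that point. -/
def IsEinstein (g : Metric F Y) (c : ℝ) : Prop :=
  ∀ x : Y, ∃ φ ∈ IsManifold.maximalAtlas 𝓘(ℝ, F) ∞ Y, x ∈ φ.source ∧
    ∃ b : Module.Basis (Fin (Module.finrank ℝ F)) ℝ F, ∀ i j,
      ricci b (g.inChart φ) i j (φ x) = c * gram b (g.inChart φ) (φ x) i j

end Riemannian

section Kahler
variable {E : Type*} [NormedAddCommGroup E] [NormedSpace ℂ E] {X : Type*} [TopologicalSpace X]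
  [ChartedSpace E X] [IsManifold 𝓘(ℂ, E) ω X]

/-- The complex structure on a tangent space of a complex manifold. -/
def cplx (x : X) (v : TangentSpace 𝓘(ℝ, E) x) : TangentSpace 𝓘(ℝ, E) x :=
  let w : E := v
  (Complex.I • w : E)

/-- `g` is a Kähler metric: it is invariant under the complex structure `J`, and the form
`(u, v) ↦ g (J u) v` is closed. -/
def IsKahler (g : Metric E X) : Prop :=
  (∀ (x : X) (u v : TangentSpace 𝓘(ℝ, E) x), g.inner x (cplx x u) (cplx x v) = g.inner x u v) ∧
  ∀ φ ∈ atlas E X, ∀ y ∈ φ.target, ∀ u v w : E,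
    fderiv ℝ (fun z => g.inChart φ z (Complex.I • u) v) y w +
    fderiv ℝ (fun z => g.inChart φ z (Complex.I • v) w) y u +
    fderiv ℝ (fun z => g.inChart φ z (Complex.I • w) u) y v = 0

/-- The symmetric form `(u, v) ↦ (i ∂ ∂̄ f) (u, J v)` of a real function `f`. -/
def leviForm (f : E → ℝ) (y u v : E) : ℝ :=
  (1 / 2) * (fderiv ℝ (fun z => fderiv ℝ f z u) y v +
    fderiv ℝ (fun z => fderiv ℝ f z (Complex.I • u)) y (Complex.I • v))

/-- The matrix of the hermitian form `B(u, v) + i B(u, J v)` with real part `B`, for a `J`-invariant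
symmetric form `B`, in the standard basis of `ℂⁿ`. -/
def hermMatrix {n : ℕ} (B : EuclideanSpace ℂ (Fin n) → EuclideanSpace ℂ (Fin n) → ℝ) :
    Matrix (Fin n) (Fin n) ℂ :=
  Matrix.of fun j k =>
    (B (EuclideanSpace.single j 1) (EuclideanSpace.single k 1) : ℂ) +
      Complex.I * B (EuclideanSpace.single j 1) (Complex.I • EuclideanSpace.single k 1)

variable {n : ℕ} {W : Type*} [TopologicalSpace W] [ChartedSpace (EuclideanSpace ℂ (Fin n)) W]
  [IsManifold 𝓘(ℂ, EuclideanSpace ℂ (Fin n)) ω W]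

/-- The Kähler form `ω₀(u, v) = g (J u) v` of a Kähler metric `g` is equal to its Ricci form, which
is given by `-i ∂ ∂̄ log det (g_{j k̄})` in holomorphic coordinates. Both are written as symmetric forms
`(u, v) ↦ ω₀(u, J v)`. -/
def IsKahlerEinsteinForm (g : Metric (EuclideanSpace ℂ (Fin n)) W) : Prop :=
  IsKahler g ∧
  ∀ φ ∈ IsManifold.maximalAtlas 𝓘(ℂ, EuclideanSpace ℂ (Fin n)) ω W, ∀ y ∈ φ.target,
    ∀ u v : EuclideanSpace ℂ (Fin n),
      -leviForm (fun z => Real.log (hermMatrix (g.inChart φ z)).det.re) y u v = g.inChart φ y u v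

/-- A hermitian metric `h` on a line bundle, given by `sqNorm w l = h(l, l)`. -/
structure HermitianMetric (E : Type*) [NormedAddCommGroup E] [NormedSpace ℂ E] {W : Type*}
    [TopologicalSpace W] [ChartedSpace E W] (L : W → Type*) [∀ w, AddCommGroup (L w)]
    [∀ w, Module ℂ (L w)] [TopologicalSpace (TotalSpace ℂ L)] [∀ w, TopologicalSpace (L w)]
    [FiberBundle ℂ L] [VectorBundle ℂ ℂ L] where
  sqNorm : ∀ w, L w → ℝ
  sqNorm_smul : ∀ w (c : ℂ) (l : L w), sqNorm w (c • l) = ‖c‖ ^ 2 * sqNorm w l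
  pos : ∀ w (l : L w), l ≠ 0 → 0 < sqNorm w l
  smooth : ∀ (e : Trivialization ℂ (TotalSpace.proj : TotalSpace ℂ L → W))
    [MemTrivializationAtlas e],
    ContMDiffOn 𝓘(ℝ, E) 𝓘(ℝ, ℝ) ∞ (fun w => sqNorm w (e.symm w 1)) e.baseSet

/-- The form `2π c₁(L; h) = -i ∂ ∂̄ log h(e, e)`, written as a symmetric form
`(u, v) ↦ 2π c₁(L; h) (u, J v)`, in a chart `φ` of the base and for the local frame given by a local
trivialization `e`. -/
def chernForm {W : Type*} [TopologicalSpace W] [ChartedSpace E W] {L : W → Type*}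
    [∀ w, AddCommGroup (L w)]
    [∀ w, Module ℂ (L w)] [TopologicalSpace (TotalSpace ℂ L)] [∀ w, TopologicalSpace (L w)]
    [FiberBundle ℂ L] [VectorBundle ℂ ℂ L] (h : HermitianMetric E L)
    (φ : OpenPartialHomeomorph W E) (e : Trivialization ℂ (TotalSpace.proj : TotalSpace ℂ L → W))
    (y u v : E) : ℝ :=
  -leviForm (fun z => Real.log (h.sqNorm (φ.symm z) (e.symm (φ.symm z) 1))) y u v

/-- The eigenvalues of `2π c₁(L; h)` with respect to the Kähler form of `g` are, at every point and
with multiplicities, the constants `μ k`. -/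
def HasConstantEigenvalues {L : W → Type*} [∀ w, AddCommGroup (L w)] [∀ w, Module ℂ (L w)]
    [TopologicalSpace (TotalSpace ℂ L)] [∀ w, TopologicalSpace (L w)] [FiberBundle ℂ L]
    [VectorBundle ℂ ℂ L] (h : HermitianMetric (EuclideanSpace ℂ (Fin n)) L)
    (g : Metric (EuclideanSpace ℂ (Fin n)) W) (μ : Fin n → ℝ) : Prop :=
  ∀ φ ∈ IsManifold.maximalAtlas 𝓘(ℂ, EuclideanSpace ℂ (Fin n)) ω W,
    ∀ (e : Trivialization ℂ (TotalSpace.proj : TotalSpace ℂ L → W)) [MemTrivializationAtlas e],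
    ∀ y ∈ φ.target, φ.symm y ∈ e.baseSet →
      ((hermMatrix (g.inChart φ y))⁻¹ * hermMatrix (chernForm h φ e y)).charpoly =
        ∏ k, (Polynomial.X - Polynomial.C (μ k : ℂ))

end Kahler

section Cone

/-- The positive real numbers as an open submanifold of the line. -/
def posReal : TopologicalSpace.Opens ℝ := ⟨Ioi 0, isOpen_Ioi⟩

theorem one_mem_posReal : (1 : ℝ) ∈ posReal := one_pos (α := ℝ)

variable {F : Type*} [NormedAddCommGroup F] [NormedSpace ℝ F] {S : Type*} [TopologicalSpace S]
  [ChartedSpace F S] [IsManifold 𝓘(ℝ, F) ∞ S]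
  {E : Type*} [NormedAddCommGroup E] [NormedSpace ℂ E] {X : Type*} [TopologicalSpace X]
  [ChartedSpace E X] [IsManifold 𝓘(ℂ, E) ω X]

/-- Diffeomorphisms of the cone manifold `C(S) = S × ℝ_{>0}` onto a complex manifold `X`. Each of
them is the same thing as an (integrable) complex structure on `C(S)` isomorphic to `X`. -/
abbrev ConeDiffeo (F : Type*) [NormedAddCommGroup F] [NormedSpace ℝ F] (S : Type*)
    [TopologicalSpace S] [ChartedSpace F S] (E : Type*) [NormedAddCommGroup E] [NormedSpace ℂ E]
    (X : Type*) [TopologicalSpace X] [ChartedSpace E X] : Type _ :=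
  Diffeomorph (𝓘(ℝ, F).prod 𝓘(ℝ, ℝ)) 𝓘(ℝ, E) (S × posReal) X ∞

/-- The differential of `Φ` at `(s, r)`, on the tangent space `T_s S × ℝ`. -/
def ConeDiffeo.d (Φ : ConeDiffeo F S E X) (s : S) (r : posReal) (u : TangentSpace 𝓘(ℝ, F) s)
    (α : ℝ) : TangentSpace 𝓘(ℝ, E) (Φ (s, r)) :=
  mfderiv (𝓘(ℝ, F).prod 𝓘(ℝ, ℝ)) 𝓘(ℝ, E) Φ (s, r) ((u, α) : F × ℝ)

/-- `(S, g)` is a Sasaki manifold: the cone metric `dr² + r² g` on `C(S)` is Kähler for the complex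
structure given by `Φ`. -/
def IsSasaki (g : Metric F S) (Φ : ConeDiffeo F S E X) : Prop :=
  ∃ gbar : Metric E X, IsKahler gbar ∧
    ∀ (s : S) (r : posReal) (u v : TangentSpace 𝓘(ℝ, F) s) (α β : ℝ),
      gbar.inner (Φ (s, r)) (Φ.d s r u α) (Φ.d s r v β) =
        α * β + (r : ℝ) ^ 2 * g.inner s u v

/-- The vector field `ξ` on `X ≅ C(S)` is the Reeb field `J (r ∂_r)`. -/
def IsReebField (Φ : ConeDiffeo F S E X) (ξ : ∀ x : X, TangentSpace 𝓘(ℝ, E) x) : Prop :=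
  ∀ (s : S) (r : posReal), ξ (Φ (s, r)) = cplx (Φ (s, r)) (Φ.d s r 0 r)

end Cone

section Main
variable {E : Type*} [NormedAddCommGroup E] [NormedSpace ℂ E] [FiniteDimensional ℂ E]
  {W : Type*} [TopologicalSpace W] [ChartedSpace E W] [IsManifold 𝓘(ℂ, E) ω W]
  {L : W → Type*} [∀ w, AddCommGroup (L w)] [∀ w, Module ℂ (L w)]
  [TopologicalSpace (TotalSpace ℂ L)] [∀ w, TopologicalSpace (L w)] [FiberBundle ℂ L]
  [VectorBundle ℂ ℂ L] [ContMDiffVectorBundle ω ℂ L 𝓘(ℂ, E)]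

variable (E L) in
/-- The complement of the zero section in the canonical bundle of `ℙ(L ⊕ 𝒪)`. -/
abbrev PuncturedK : Type _ := puncturedCanonical (E × ℂ) (ProjManifold E L)

variable (E L) in
/-- The circle bundle `S_W^L` associated with the canonical bundle of `ℙ(L ⊕ 𝒪)`. -/
abbrev CircleK : Type _ := CircleBundle (E × ℂ) (ProjManifold E L)

/-- The holomorphic vector field `ξ_a`, written in the preferred holomorphic coordinates around
each point, which are `(w, ζ⁺, τ⁺)` away from the section at infinity and `(w, ζ⁻, τ⁻)` on it:
it is equal to `a i ζ⁺ ∂/∂ζ⁺ + i τ⁺ ∂/∂τ⁺` in the former and to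
`-a i ζ⁻ ∂/∂ζ⁻ + (1 + 2a) i τ⁻ ∂/∂τ⁻` in the latter. As an element of the real tangent space, the
vector with these holomorphic components is `ξ_a + ξ̄_a`. -/
def xi (a : ℝ) (p : PuncturedK E L) : TangentSpace 𝓘(ℝ, (E × ℂ) × ℂ) p :=
  haveI := Classical.dec (p.1.base.line.rep.2 = 0)
  let y : (E × ℂ) × ℂ := chartAt ((E × ℂ) × ℂ) p p
  if p.1.base.line.rep.2 = 0 then
    (((0, -(a * Complex.I * y.1.2)), (1 + 2 * a) * Complex.I * y.2) : (E × ℂ) × ℂ)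
  else
    (((0, a * Complex.I * y.1.2), Complex.I * y.2) : (E × ℂ) × ℂ)

/-- `A_a(x) = -∫_{-1/(1+2a)}^x s ∏_k (1 + μ_{k,a} s) ds` with `μ_{k,a} = μ_k + a (1 + μ_k)`. -/
def profile {n : ℕ} (μ : Fin n → ℝ) (a x : ℝ) : ℝ :=
  -∫ s in (-(1 / (1 + 2 * a)))..x, s * ∏ k, (1 + (μ k + a * (1 + μ k)) * s)

end Main
end
end SasakiEinstein

open SasakiEinstein

/-!
The metric is given by the Calabi ansatz. Over a chart of `W` with a frame of `L`, let `|ζ|²_h` be the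
square norm of a point of `L` (`lineNorm`), and `|τ|²` the square norm of a point of the canonical
bundle of `M`, for the metric induced by `ω₀` and `h` (`canNorm`). The potential of the cone metric is
`f = (|τ|^{2 (1 + a)} Q(t))^{1 / (n + 2)}` with `t = |ζ|²_h |τ|^{-2a}` (`potential`), and the Kähler form
is `i ∂∂̄ f`. The exponents are chosen so that the flow of `-i ξ_a`, rescaled by `(n + 2) / (1 + a)`,
fixes `t` and multiplies `f` by `e^{2s}` at the time `s`: this flow (`scaleMap`) is homothetic, and with
`r² = 2 f` the metric is a cone.

Let `A` be the profile, `P(x) = ∏ (1 + μ_{k,a} x)`, and `x = X(t)` the moment coordinate, defined by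
`t X' = -A(X) / P(X)` and `Q(t) A(X(t)) = c t`. Since the curvature of `h` has constant eigenvalues
with respect to `ω₀`, and `Ric ω₀ = ω₀`, the Levi form of `f` splits into a form on the base with the
eigenvalues `f (1 + μ_{k,a} x) / (n + 2)` and a form of rank two in the differentials of `log |ζ|²_h`
and `log |τ|²` (`isSplitForm_potential`). All factors are positive, and the equation for `X` makes the
determinant constant (`leviMap_potential_of_ne`). Hence the metric is Ricci flat
(`IsKahlerOn.trace_connMap`, `IsKahlerOn.ricciForm_eq_zero`).

The condition `A(1) = 0` says that `A` has simple zeros at both ends of the interval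
`[-1 / (1 + 2a), 1]`. At the end `1` this makes `X` and `Q` smooth at `t = 0`, that is, along the zero
section (`exists_isProfile`); there the Levi form stays definite because its determinant does not
vanish (`leviMap_potential`). The section at infinity is a zero section again when `L` is replaced by
its dual, `μ` by `-μ`, and `a` by `-a / (1 + 2a)`. The two solutions agree by uniqueness for the
differential equation (`profile_unique`), so that the potentials glue to one function on the punctured
canonical bundle (`potential_swap`, `isConeAtlas`).

Each ray in a fibre of the canonical bundle meets the level set `f = 1/2` exactly once
(`exists_radius`). This identifies the circle bundle with the level set, and the flow extends the
identification to the cone over the circle bundle (`coneDiffeo`). The pull-back of the Kähler metric is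
the cone metric over the induced metric (`leviMap_coneCoord`), because the radial field is the gradient
of `f` (`leviMap_euler`). The Ricci form of a cone restricts to `Ric - (2n + 2) g` on the link
(`ricciForm_cone`), so that `g` is Einstein. Finally, `J` applied to the generator of the flow is the
prescribed multiple of `ξ_a` (`smul_xi`).
-/

set_option maxSynthPendingDepth 3

namespace SasakiEinstein

noncomputable section

/-! ### Ricci curvature in linear coordinates, free of indices -/

section LeviCivita
variable {F : Type*} [NormedAddCommGroup F] [NormedSpace ℝ F]

/-- A smooth Riemannian metric on an open subset `U` of a vector space. -/
structure IsCoordMetric (G : F → F →L[ℝ] F →L[ℝ] ℝ) (U : Set F) : Prop where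
  isOpen : IsOpen U
  smooth : ContDiffOn ℝ ∞ G U
  symm : ∀ z ∈ U, ∀ u v, G z u v = G z v u
  pos : ∀ z ∈ U, ∀ u, u ≠ 0 → 0 < G z u u

/-- The right-hand side of the Koszul formula for coordinate vector fields,
`½ (∂_u G(v, w) + ∂_v G(u, w) - ∂_w G(u, v))`. -/
def koszul (G : F → F →L[ℝ] F →L[ℝ] ℝ) (z : F) : F →L[ℝ] F →L[ℝ] F →L[ℝ] ℝ :=
  (1 / 2 : ℝ) • (fderiv ℝ G z + (fderiv ℝ G z).flip -
    ((ContinuousLinearMap.flipₗᵢ ℝ F F ℝ : (F →L[ℝ] F →L[ℝ] ℝ) →L[ℝ] F →L[ℝ] F →L[ℝ] ℝ)).comp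
      (fderiv ℝ G z).flip)

theorem koszul_apply (G : F → F →L[ℝ] F →L[ℝ] ℝ) (z u v w : F) :
    koszul G z u v w =
      (1 / 2) * (fderiv ℝ G z u v w + fderiv ℝ G z v u w - fderiv ℝ G z w u v) := rfl

/-- The Levi-Civita connection of `G` on constant vector fields: `∇_u v = Γ(u, v)`.
It solves the Koszul formula; `inverse` is zero where `G z` is degenerate, which is excluded on the
domain of an `IsCoordMetric`. -/
def connMap (G : F → F →L[ℝ] F →L[ℝ] ℝ) (z : F) : F →L[ℝ] F →L[ℝ] F :=
  (ContinuousLinearMap.compL ℝ F (F →L[ℝ] ℝ) F (G z).inverse).comp (koszul G z)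

/-- The endomorphism `u ↦ R(u, v) w` of the Riemann curvature tensor. -/
def riem (G : F → F →L[ℝ] F →L[ℝ] ℝ) (z v w : F) : F →L[ℝ] F :=
  ((fderiv ℝ (connMap G) z).flip v).flip w - (fderiv ℝ (connMap G) z v).flip w +
    (connMap G z).flip (connMap G z v w) - (connMap G z v).comp ((connMap G z).flip w)

theorem riem_apply (G : F → F →L[ℝ] F →L[ℝ] ℝ) (z u v w : F) :
    riem G z v w u = fderiv ℝ (connMap G) z u v w - fderiv ℝ (connMap G) z v u w +
      connMap G z u (connMap G z v w) - connMap G z v (connMap G z u w) := rfl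

/-- The Ricci form, as the trace of `u ↦ R(u, v) w`. -/
def ricciForm (G : F → F →L[ℝ] F →L[ℝ] ℝ) (z v w : F) : ℝ :=
  LinearMap.trace ℝ F (riem G z v w : F →ₗ[ℝ] F)

namespace IsCoordMetric
variable {G : F → F →L[ℝ] F →L[ℝ] ℝ} {U : Set F} {z : F}

theorem contDiffAt (h : IsCoordMetric G U) (hz : z ∈ U) : ContDiffAt ℝ ∞ G z :=
  h.smooth.contDiffAt (h.isOpen.mem_nhds hz)

theorem injective (h : IsCoordMetric G U) (hz : z ∈ U) : Function.Injective (G z) := by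
  rw [injective_iff_map_eq_zero]
  intro u hu
  by_contra hne
  have := h.pos z hz u hne
  simp [hu] at this

variable [FiniteDimensional ℝ F]

theorem isInvertible (h : IsCoordMetric G U) (hz : z ∈ U) : (G z).IsInvertible := by
  have hfin : Module.finrank ℝ F = Module.finrank ℝ (F →L[ℝ] ℝ) := by
    rw [← (LinearMap.toContinuousLinearMap (𝕜 := ℝ) (E := F) (F' := ℝ)).finrank_eq]
    exact (Subspace.dual_finrank_eq (K := ℝ) (V := F)).symm
  have hinj : Function.Injective (G z : F →ₗ[ℝ] F →L[ℝ] ℝ) := h.injective hz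
  refine ⟨(LinearEquiv.ofInjectiveOfFinrankEq _ hinj hfin).toContinuousLinearEquiv, ?_⟩
  ext u v
  rfl

theorem ext (h : IsCoordMetric G U) (hz : z ∈ U) {u v : F} (huv : ∀ w, G z u w = G z v w) :
    u = v := h.injective hz (ContinuousLinearMap.ext huv)

theorem connMap_spec (h : IsCoordMetric G U) (hz : z ∈ U) (u v w : F) :
    G z (connMap G z u v) w = koszul G z u v w := by
  obtain ⟨e, he⟩ := h.isInvertible hz
  have : G z (connMap G z u v) = koszul G z u v := by
    change G z ((G z).inverse (koszul G z u v)) = _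
    rw [← he, ContinuousLinearMap.inverse_equiv]
    simp
  rw [this]

theorem contDiffOn_koszul (h : IsCoordMetric G U) : ContDiffOn ℝ ∞ (koszul G) U := by
  have h1 : ContDiffOn ℝ ∞ (fderiv ℝ G) U := h.smooth.fderiv_of_isOpen h.isOpen (by simp)
  have h2 : ContDiffOn ℝ ∞ (fun z => (fderiv ℝ G z).flip) U :=
    (ContinuousLinearMap.flipₗᵢ ℝ F F (F →L[ℝ] ℝ)).contDiff.comp_contDiffOn h1
  exact ((h1.add h2).sub (contDiffOn_const.clm_comp h2)).const_smul (1 / 2 : ℝ)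

theorem contDiffOn_connMap (h : IsCoordMetric G U) : ContDiffOn ℝ ∞ (connMap G) U := by
  have h1 : ContDiffOn ℝ ∞ (fun z => (G z).inverse) U := fun z hz =>
    ((h.isInvertible hz).contDiffAt_map_inverse.comp z (h.contDiffAt hz)).contDiffWithinAt
  exact ((ContinuousLinearMap.compL ℝ F (F →L[ℝ] ℝ) F).contDiff.comp_contDiffOn h1).clm_comp
    h.contDiffOn_koszul

theorem differentiableAt_connMap (h : IsCoordMetric G U) (hz : z ∈ U) :
    DifferentiableAt ℝ (connMap G) z :=
  (h.contDiffOn_connMap.contDiffAt (h.isOpen.mem_nhds hz)).differentiableAt (by simp)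

theorem fderiv_apply (h : IsCoordMetric G U) (hz : z ∈ U) (u v w : F) :
    fderiv ℝ (fun y => G y v w) z u = fderiv ℝ G z u v w := by
  have h1 := (h.contDiffAt hz).differentiableAt (by simp)
  rw [((h1.hasFDerivAt.clm_apply (hasFDerivAt_const v z)).clm_apply
    (hasFDerivAt_const w z)).fderiv]
  simp

theorem fderiv_symm (h : IsCoordMetric G U) (hz : z ∈ U) (u v w : F) :
    fderiv ℝ G z u v w = fderiv ℝ G z u w v := by
  rw [← h.fderiv_apply hz, ← h.fderiv_apply hz]
  congr 1
  apply Filter.EventuallyEq.fderiv_eq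
  filter_upwards [h.isOpen.mem_nhds hz] with y hy using h.symm y hy v w

theorem connMap_symm (h : IsCoordMetric G U) (hz : z ∈ U) (u v : F) :
    connMap G z u v = connMap G z v u := by
  refine h.ext hz fun w => ?_
  rw [h.connMap_spec hz, h.connMap_spec hz, koszul_apply, koszul_apply, h.fderiv_symm hz w u v]
  ring

theorem eq_connMap (h : IsCoordMetric G U) (hz : z ∈ U) {u v x : F}
    (hx : ∀ w, G z x w = koszul G z u v w) : x = connMap G z u v :=
  h.ext hz fun w => (hx w).trans (h.connMap_spec hz u v w).symm

/-- The connection is metric. -/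
theorem fderiv_eq (h : IsCoordMetric G U) (hz : z ∈ U) (u v w : F) :
    fderiv ℝ G z u v w = G z (connMap G z u v) w + G z v (connMap G z u w) := by
  rw [h.symm z hz v, h.connMap_spec hz, h.connMap_spec hz, koszul_apply, koszul_apply,
    h.fderiv_symm hz u w v, h.fderiv_symm hz w u v, h.fderiv_symm hz v u w]
  ring

theorem fderiv_connMap_apply (h : IsCoordMetric G U) (hz : z ∈ U) (u v w : F) :
    fderiv ℝ (fun y => connMap G y v w) z u = fderiv ℝ (connMap G) z u v w := by
  rw [(((h.differentiableAt_connMap hz).hasFDerivAt.clm_apply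
    (hasFDerivAt_const v z)).clm_apply (hasFDerivAt_const w z)).fderiv]
  simp

theorem fderiv_connMap_symm (h : IsCoordMetric G U) (hz : z ∈ U) (u v w : F) :
    fderiv ℝ (connMap G) z u v w = fderiv ℝ (connMap G) z u w v := by
  rw [← h.fderiv_connMap_apply hz, ← h.fderiv_connMap_apply hz]
  congr 1
  apply Filter.EventuallyEq.fderiv_eq
  filter_upwards [h.isOpen.mem_nhds hz] with y hy using h.connMap_symm hy v w

theorem riem_antisymm (_h : IsCoordMetric G U) (u v w : F) :
    riem G z v w u = -riem G z u w v := by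
  rw [riem_apply, riem_apply]; abel

/-- The first Bianchi identity. -/
theorem riem_bianchi (h : IsCoordMetric G U) (hz : z ∈ U) (u v w : F) :
    riem G z v w u + riem G z w u v + riem G z u v w = 0 := by
  simp only [riem_apply]
  rw [h.fderiv_connMap_symm hz u v w, h.fderiv_connMap_symm hz v u w,
    h.fderiv_connMap_symm hz w u v, h.connMap_symm hz v w, h.connMap_symm hz u w,
    h.connMap_symm hz v u]
  abel

/-- The curvature endomorphisms are skew: differentiate the metric property of the connection and
use the symmetry of second derivatives. -/
theorem riem_skew (h : IsCoordMetric G U) (hz : z ∈ U) (u v w x : F) :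
    G z (riem G z v w u) x = -G z w (riem G z v x u) := by
  have key : ∀ u v : F, fderiv ℝ (fderiv ℝ G) z u v w x =
      G z (connMap G z u (connMap G z v w)) x + G z (connMap G z v w) (connMap G z u x) +
      G z (fderiv ℝ (connMap G) z u v w) x +
      (G z (connMap G z u w) (connMap G z v x) + G z w (connMap G z u (connMap G z v x)) +
      G z w (fderiv ℝ (connMap G) z u v x)) := by
    intro u v
    have hG := ((h.contDiffAt hz).differentiableAt (by simp)).hasFDerivAt
    have hC := (h.differentiableAt_connMap hz).hasFDerivAt
    have hC1 : ∀ y, HasFDerivAt (fun y' => connMap G y' v y) _ z := fun y =>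
      (hC.clm_apply (hasFDerivAt_const v z)).clm_apply (hasFDerivAt_const y z)
    have hD : HasFDerivAt (fderiv ℝ G) _ z :=
      (((h.contDiffAt hz).fderiv_right (m := 1)
        (by rw [one_add_one_eq_two]; exact ENat.LEInfty.out)).differentiableAt (by simp)).hasFDerivAt
    have h1 := (((hD.clm_apply (hasFDerivAt_const v z)).clm_apply
      (hasFDerivAt_const w z)).clm_apply (hasFDerivAt_const x z))
    have h2 := ((hG.clm_apply (hC1 w)).clm_apply (hasFDerivAt_const x z)).add
      ((hG.clm_apply (hasFDerivAt_const w z)).clm_apply (hC1 x))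
    have h3 := h1.unique (h2.congr_of_eventuallyEq (by
      filter_upwards [h.isOpen.mem_nhds hz] with y hy using h.fderiv_eq hy v w x))
    have h4 := congrArg (fun A : F →L[ℝ] ℝ => A u) h3
    simp at h4
    rw [h4, h.fderiv_eq hz, h.fderiv_eq hz]
    ring
  have hs : fderiv ℝ (fderiv ℝ G) z u v = fderiv ℝ (fderiv ℝ G) z v u :=
    ((h.contDiffAt hz).isSymmSndFDerivAt (by simpa using ENat.LEInfty.out)).eq u v
  have h1 := key u v
  rw [hs, key v u] at h1
  simp only [riem_apply, map_add, map_sub, add_apply,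
    sub_apply]
  linarith

/-- The pair symmetry of the curvature tensor. -/
theorem riem_pair (h : IsCoordMetric G U) (hz : z ∈ U) (u v w x : F) :
    G z (riem G z v w u) x = G z (riem G z x u w) v := by
  have B : ∀ u v w x : F, G z (riem G z v w u) x + G z (riem G z w u v) x +
      G z (riem G z u v w) x = 0 := by
    intro u v w x
    have := congrArg (fun y => G z y x) (h.riem_bianchi hz u v w)
    simpa using this
  have S : ∀ u v w x : F, G z (riem G z v w u) x = -G z (riem G z v x u) w := by
    intro u v w x
    rw [h.riem_skew hz, h.symm z hz]
  have A : ∀ u v w x : F, G z (riem G z v w u) x = -G z (riem G z u w v) x := by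
    intro u v w x
    rw [h.riem_antisymm u v w]; simp
  have b1 := B u v w x
  have b2 := B v w x u
  have b3 := B w x u v
  have b4 := B x u v w
  have s1 := S v w u x
  have s2 := S w u v x
  have s3 := S w x v u
  have s4 := S x v w u
  have s5 := S x u w v
  have s6 := S u w x v
  have s7 := S u v x w
  have s8 := S v x u w
  have a1 := A u v w x
  have a2 := A w x u v
  have s9 := S v w x u
  have s10 := S w x u v
  have s11 := S x u v w
  have s12 := S u v w x
  have a3 := A u w v x
  have a4 := A v x w u
  have a5 := A x u w v
  have a6 := A u w x v
  linarith

end IsCoordMetric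
end LeviCivita

/-! ### Comparison with Christoffel symbols, and naturality of the Ricci form -/

section Indices
variable {F : Type*} [NormedAddCommGroup F] [NormedSpace ℝ F] [FiniteDimensional ℝ F]
  {ι : Type*} [Fintype ι] [DecidableEq ι] {G : F → F →L[ℝ] F →L[ℝ] ℝ} {U : Set F}
  {G₀ : F → F → F → ℝ} {z : F}

theorem gram_inv (h : IsCoordMetric G U) (b : Module.Basis ι ℝ F)
    (hG : ∀ z ∈ U, ∀ u v, G₀ z u v = G z u v) (hz : z ∈ U) :
    gram b G₀ z * (gram b G₀ z)⁻¹ = 1 := by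
  have hinj : Function.Injective (gram b G₀ z).mulVec := by
    rw [← Matrix.coe_mulVecLin, injective_iff_map_eq_zero]
    intro x hx
    have h0 : ∑ j, x j • b j = 0 := by
      refine h.injective hz ?_
      rw [map_zero]
      refine ContinuousLinearMap.coe_injective (b.ext fun i => ?_)
      have := congrFun hx i
      simp only [Matrix.mulVecLin_apply, Matrix.mulVec, dotProduct, gram, Matrix.of_apply,
        Pi.zero_apply, hG z hz] at this
      simp only [map_sum, map_smul, ContinuousLinearMap.coe_coe,
        ContinuousLinearMap.toLinearMap_zero, LinearMap.zero_apply, ← this]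
      simp [h.symm z hz (b i), mul_comm]
    have := b.linearIndependent
    rw [Fintype.linearIndependent_iff] at this
    exact funext (this x h0)
  exact Matrix.mul_nonsing_inv _
    ((Matrix.isUnit_iff_isUnit_det _).1 (Matrix.mulVec_injective_iff_isUnit.1 hinj))

theorem christoffel_eq (h : IsCoordMetric G U) (b : Module.Basis ι ℝ F)
    (hG : ∀ z ∈ U, ∀ u v, G₀ z u v = G z u v) (hz : z ∈ U) (k i j : ι) :
    christoffel b G₀ k i j z = b.repr (connMap G z (b i) (b j)) k := by
  have hpd : ∀ i j k, pd b i (fun y => gram b G₀ y j k) z = fderiv ℝ G z (b i) (b j) (b k) := by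
    intro i j k
    rw [pd, ← h.fderiv_apply hz]
    congr 1
    apply Filter.EventuallyEq.fderiv_eq
    filter_upwards [h.isOpen.mem_nhds hz] with y hy using hG y hy _ _
  have hx : ∑ k, christoffel b G₀ k i j z • b k = connMap G z (b i) (b j) := by
    refine h.eq_connMap hz fun w => ?_
    suffices hs : (G z (∑ k, christoffel b G₀ k i j z • b k) : F →ₗ[ℝ] ℝ) =
        (koszul G z (b i) (b j) : F →ₗ[ℝ] ℝ) from congrArg (fun A : F →ₗ[ℝ] ℝ => A w) hs
    refine b.ext fun m => ?_
    have hm := gram_inv h b hG hz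
    have h1 : ∀ k, G z (b k) (b m) = gram b G₀ z m k := fun k => by
      rw [gram, Matrix.of_apply, hG z hz, h.symm z hz]
    simp only [ContinuousLinearMap.coe_coe, map_sum, map_smul, sum_apply,
      smul_apply, h1, smul_eq_mul, koszul_apply, christoffel, hpd]
    have h2 : ∀ m l, ∑ k, gram b G₀ z m k * (gram b G₀ z)⁻¹ k l = if m = l then 1 else 0 := by
      intro m l
      have := congrFun (congrFun hm m) l
      rwa [Matrix.mul_apply, Matrix.one_apply] at this
    set X : ι → ℝ := fun l => fderiv ℝ G z (b i) (b j) (b l) + fderiv ℝ G z (b j) (b i) (b l) -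
      fderiv ℝ G z (b l) (b i) (b j) with hX
    calc ∑ k, (1 / 2) * (∑ l, (gram b G₀ z)⁻¹ k l * X l) * gram b G₀ z m k
        = (1 / 2) * ∑ l, (∑ k, gram b G₀ z m k * (gram b G₀ z)⁻¹ k l) * X l := by
          simp only [Finset.mul_sum, Finset.sum_mul]
          rw [Finset.sum_comm]
          refine Finset.sum_congr rfl fun l _ => Finset.sum_congr rfl fun k _ => by ring
      _ = (1 / 2) * X m := by simp [h2]
  rw [← hx, map_sum, Finset.sum_apply']
  simp [Finsupp.single_apply]

/-- The Ricci tensor in linear coordinates is the trace form of the curvature endomorphisms. -/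
theorem ricci_eq (h : IsCoordMetric G U) (b : Module.Basis ι ℝ F)
    (hG : ∀ z ∈ U, ∀ u v, G₀ z u v = G z u v) (hz : z ∈ U) (i j : ι) :
    ricci b G₀ i j z = ricciForm G z (b j) (b i) := by
  have hpd : ∀ m k i j, pd b m (christoffel b G₀ k i j) z =
      b.repr (fderiv ℝ (connMap G) z (b m) (b i) (b j)) k := by
    intro m k i j
    have hC := ((h.differentiableAt_connMap hz).hasFDerivAt.clm_apply
      (hasFDerivAt_const (b i) z)).clm_apply (hasFDerivAt_const (b j) z)
    obtain ⟨A, hA⟩ : ∃ A : F →L[ℝ] ℝ, ∀ y, A y = b.repr y k :=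
      ⟨LinearMap.toContinuousLinearMap (b.coord k), fun y => rfl⟩
    have h2 : HasFDerivAt (christoffel b G₀ k i j) _ z :=
      (A.hasFDerivAt.comp z hC).congr_of_eventuallyEq (by
        filter_upwards [h.isOpen.mem_nhds hz] with y hy
        rw [christoffel_eq h b hG hy k i j, ← hA]; rfl)
    rw [pd, h2.fderiv, ← hA]
    simp
  have hsum : ∀ (y : F) (A : F →L[ℝ] F) (k : ι),
      b.repr (A y) k = ∑ l, b.repr y l * b.repr (A (b l)) k := by
    intro y A k
    conv_lhs => rw [← b.sum_repr y]
    rw [map_sum, map_sum, Finset.sum_apply']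
    simp
  rw [ricciForm, LinearMap.trace_eq_matrix_trace ℝ b, Matrix.trace, ricci, ← Finset.sum_add_distrib]
  refine Finset.sum_congr rfl fun k _ => ?_
  rw [Matrix.diag_apply, LinearMap.toMatrix_apply, ContinuousLinearMap.coe_coe, riem_apply, hpd,
    hpd]
  simp only [christoffel_eq h b hG hz, map_add, map_sub, Finsupp.add_apply, Finsupp.sub_apply,
    Finset.sum_sub_distrib]
  rw [hsum (connMap G z (b j) (b i)), hsum (connMap G z (b k) (b i)),
    h.fderiv_connMap_symm hz (b j) (b i) (b k)]
  rw [h.connMap_symm hz (b i) (b j), h.connMap_symm hz (b i) (b k),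
    h.fderiv_connMap_symm hz (b k) (b i) (b j)]
  simp only [mul_comm]
  ring

end Indices

section Naturality
variable {F₁ F₂ : Type*} [NormedAddCommGroup F₁] [NormedSpace ℝ F₁] [FiniteDimensional ℝ F₁]
  [NormedAddCommGroup F₂] [NormedSpace ℝ F₂] [FiniteDimensional ℝ F₂]
  {G₁ : F₁ → F₁ →L[ℝ] F₁ →L[ℝ] ℝ} {G₂ : F₂ → F₂ →L[ℝ] F₂ →L[ℝ] ℝ} {U₁ : Set F₁} {U₂ : Set F₂}
  {Ψ : F₁ → F₂} {z : F₁}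

/-- The transformation law of the connection under a local isometry `Ψ`. -/
theorem connMap_comp (h₁ : IsCoordMetric G₁ U₁) (h₂ : IsCoordMetric G₂ U₂)
    (hΨ : ContDiffOn ℝ ∞ Ψ U₁) (hmaps : MapsTo Ψ U₁ U₂)
    (hsurj : ∀ z ∈ U₁, Function.Surjective (fderiv ℝ Ψ z))
    (hG : ∀ z ∈ U₁, ∀ u v, G₁ z u v = G₂ (Ψ z) (fderiv ℝ Ψ z u) (fderiv ℝ Ψ z v))
    (hz : z ∈ U₁) (v w : F₁) :
    fderiv ℝ Ψ z (connMap G₁ z v w) =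
      connMap G₂ (Ψ z) (fderiv ℝ Ψ z v) (fderiv ℝ Ψ z w) + fderiv ℝ (fderiv ℝ Ψ) z v w := by
  have hc : ContDiffAt ℝ ∞ Ψ z := hΨ.contDiffAt (h₁.isOpen.mem_nhds hz)
  have hd : HasFDerivAt Ψ (fderiv ℝ Ψ z) z := (hc.differentiableAt (by simp)).hasFDerivAt
  have hdd : HasFDerivAt (fderiv ℝ Ψ) (fderiv ℝ (fderiv ℝ Ψ) z) z :=
    ((hc.fderiv_right (m := 1)
      (by rw [one_add_one_eq_two]; exact ENat.LEInfty.out)).differentiableAt (by simp)).hasFDerivAt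
  have hs : ∀ u v, fderiv ℝ (fderiv ℝ Ψ) z u v = fderiv ℝ (fderiv ℝ Ψ) z v u :=
    (hc.isSymmSndFDerivAt (by simpa using ENat.LEInfty.out)).eq
  have hG2 := ((h₂.contDiffAt (hmaps hz)).differentiableAt (by simp)).hasFDerivAt
  have key : ∀ u v w, fderiv ℝ G₁ z u v w =
      fderiv ℝ G₂ (Ψ z) (fderiv ℝ Ψ z u) (fderiv ℝ Ψ z v) (fderiv ℝ Ψ z w) +
      G₂ (Ψ z) (fderiv ℝ (fderiv ℝ Ψ) z u v) (fderiv ℝ Ψ z w) +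
      G₂ (Ψ z) (fderiv ℝ Ψ z v) (fderiv ℝ (fderiv ℝ Ψ) z u w) := by
    intro u v w
    rw [← h₁.fderiv_apply hz]
    have h3 := ((hG2.comp z hd).clm_apply (hdd.clm_apply (hasFDerivAt_const v z))).clm_apply
      (hdd.clm_apply (hasFDerivAt_const w z))
    rw [(h3.congr_of_eventuallyEq (f₁ := fun y => G₁ y v w) (by
      filter_upwards [h₁.isOpen.mem_nhds hz] with y hy using hG y hy v w)).fderiv]
    simp
    ring
  refine h₂.ext (hmaps hz) fun y => ?_
  obtain ⟨x, rfl⟩ := hsurj z hz y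
  rw [← hG z hz, h₁.connMap_spec hz, map_add, add_apply, h₂.connMap_spec (hmaps hz),
    koszul_apply, koszul_apply, key, key, key, hs x v, hs x w, hs w v,
    h₂.symm _ (hmaps hz) (fderiv ℝ Ψ z v) (fderiv ℝ (fderiv ℝ Ψ) z w x),
    h₂.symm _ (hmaps hz) (fderiv ℝ Ψ z w) (fderiv ℝ (fderiv ℝ Ψ) z v x)]
  ring

theorem riem_comp (h₁ : IsCoordMetric G₁ U₁) (h₂ : IsCoordMetric G₂ U₂)
    (hΨ : ContDiffOn ℝ ∞ Ψ U₁) (hmaps : MapsTo Ψ U₁ U₂)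
    (hsurj : ∀ z ∈ U₁, Function.Surjective (fderiv ℝ Ψ z))
    (hG : ∀ z ∈ U₁, ∀ u v, G₁ z u v = G₂ (Ψ z) (fderiv ℝ Ψ z u) (fderiv ℝ Ψ z v))
    (hz : z ∈ U₁) (u v w : F₁) :
    fderiv ℝ Ψ z (riem G₁ z v w u) =
      riem G₂ (Ψ z) (fderiv ℝ Ψ z v) (fderiv ℝ Ψ z w) (fderiv ℝ Ψ z u) := by
  have hc : ContDiffAt ℝ ∞ Ψ z := hΨ.contDiffAt (h₁.isOpen.mem_nhds hz)
  have hd : HasFDerivAt Ψ (fderiv ℝ Ψ z) z := (hc.differentiableAt (by simp)).hasFDerivAt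
  have hc1 : ContDiffAt ℝ ∞ (fderiv ℝ Ψ) z := hc.fderiv_right (by simp)
  have hc2 : ContDiffAt ℝ ∞ (fderiv ℝ (fderiv ℝ Ψ)) z := hc1.fderiv_right (by simp)
  have hdd : HasFDerivAt (fderiv ℝ Ψ) (fderiv ℝ (fderiv ℝ Ψ) z) z :=
    (hc1.differentiableAt (by simp)).hasFDerivAt
  have hddd : HasFDerivAt (fderiv ℝ (fderiv ℝ Ψ)) (fderiv ℝ (fderiv ℝ (fderiv ℝ Ψ)) z) z :=
    (hc2.differentiableAt (by simp)).hasFDerivAt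
  have hs : ∀ u v, fderiv ℝ (fderiv ℝ Ψ) z u v = fderiv ℝ (fderiv ℝ Ψ) z v u :=
    (hc.isSymmSndFDerivAt (by simpa using ENat.LEInfty.out)).eq
  have hs3 : ∀ u v, fderiv ℝ (fderiv ℝ (fderiv ℝ Ψ)) z u v =
      fderiv ℝ (fderiv ℝ (fderiv ℝ Ψ)) z v u :=
    (hc1.isSymmSndFDerivAt (by simpa using ENat.LEInfty.out)).eq
  have hΓ1 := (h₁.differentiableAt_connMap hz).hasFDerivAt
  have hΓ2 := (h₂.differentiableAt_connMap (hmaps hz)).hasFDerivAt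
  have law := fun v w => connMap_comp h₁ h₂ hΨ hmaps hsurj hG hz v w
  have key : ∀ u v w, fderiv ℝ (fderiv ℝ Ψ) z u (connMap G₁ z v w) +
      fderiv ℝ Ψ z (fderiv ℝ (connMap G₁) z u v w) =
      fderiv ℝ (connMap G₂) (Ψ z) (fderiv ℝ Ψ z u) (fderiv ℝ Ψ z v) (fderiv ℝ Ψ z w) +
      connMap G₂ (Ψ z) (fderiv ℝ (fderiv ℝ Ψ) z u v) (fderiv ℝ Ψ z w) +
      connMap G₂ (Ψ z) (fderiv ℝ Ψ z v) (fderiv ℝ (fderiv ℝ Ψ) z u w) +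
      fderiv ℝ (fderiv ℝ (fderiv ℝ Ψ)) z u v w := by
    intro u v w
    have h3 := hdd.clm_apply ((hΓ1.clm_apply (hasFDerivAt_const v z)).clm_apply
      (hasFDerivAt_const w z))
    have h4 := (((hΓ2.comp z hd).clm_apply (hdd.clm_apply (hasFDerivAt_const v z))).clm_apply
      (hdd.clm_apply (hasFDerivAt_const w z))).add
      ((hddd.clm_apply (hasFDerivAt_const v z)).clm_apply (hasFDerivAt_const w z))
    have h5 := h3.unique (h4.congr_of_eventuallyEq (by
      filter_upwards [h₁.isOpen.mem_nhds hz] with y hy using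
        connMap_comp h₁ h₂ hΨ hmaps hsurj hG hy v w))
    have h6 := congrArg (fun A : F₁ →L[ℝ] F₂ => A u) h5
    simp at h6
    rw [add_comm, h6]
    abel
  have k1 := eq_sub_of_add_eq' (key u v w)
  have k2 := eq_sub_of_add_eq' (key v u w)
  rw [riem_apply, riem_apply, map_sub, map_add, map_sub, k1, k2, law u (connMap G₁ z v w), law v (connMap G₁ z u w),
    law u w, law v w,
    hs3 v u, hs v u, map_add, map_add]
  abel

theorem ricciForm_comp (h₁ : IsCoordMetric G₁ U₁) (h₂ : IsCoordMetric G₂ U₂)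
    (hΨ : ContDiffOn ℝ ∞ Ψ U₁) (hmaps : MapsTo Ψ U₁ U₂)
    (hsurj : ∀ z ∈ U₁, Function.Surjective (fderiv ℝ Ψ z))
    (hG : ∀ z ∈ U₁, ∀ u v, G₁ z u v = G₂ (Ψ z) (fderiv ℝ Ψ z u) (fderiv ℝ Ψ z v))
    (hz : z ∈ U₁) (v w : F₁) :
    ricciForm G₁ z v w = ricciForm G₂ (Ψ z) (fderiv ℝ Ψ z v) (fderiv ℝ Ψ z w) := by
  have hinj : Function.Injective (fderiv ℝ Ψ z) := by
    rw [injective_iff_map_eq_zero]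
    intro u hu
    by_contra hne
    have := h₁.pos z hz u hne
    rw [hG z hz, hu] at this
    simp at this
  let e : F₁ ≃ₗ[ℝ] F₂ := LinearEquiv.ofBijective (fderiv ℝ Ψ z : F₁ →ₗ[ℝ] F₂) ⟨hinj, hsurj z hz⟩
  rw [ricciForm, ricciForm, ← LinearMap.trace_conj' _ e]
  congr 1
  ext y
  obtain ⟨x, rfl⟩ := e.surjective y
  rw [LinearEquiv.conj_apply_apply, e.symm_apply_apply]
  exact riem_comp h₁ h₂ hΨ hmaps hsurj hG hz x v w

end Naturality

/-! ### Metric cones -/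

section MetricCone
variable {F : Type*} [NormedAddCommGroup F] [NormedSpace ℝ F] [FiniteDimensional ℝ F]
  {G : F → F →L[ℝ] F →L[ℝ] ℝ} {U : Set F} {z : F}

/-- The cone metric `dr² + r² G` in the coordinates `(z, r)`. -/
def coneMetric (G : F → F →L[ℝ] F →L[ℝ] ℝ) (p : F × ℝ) : F × ℝ →L[ℝ] F × ℝ →L[ℝ] ℝ :=
  p.2 ^ 2 • (G p.1).bilinearComp (ContinuousLinearMap.fst ℝ F ℝ) (ContinuousLinearMap.fst ℝ F ℝ) +
    (ContinuousLinearMap.mul ℝ ℝ).bilinearComp (ContinuousLinearMap.snd ℝ F ℝ)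
      (ContinuousLinearMap.snd ℝ F ℝ)

theorem coneMetric_apply (p u v : F × ℝ) :
    coneMetric G p u v = p.2 ^ 2 * G p.1 u.1 v.1 + u.2 * v.2 := rfl

theorem IsCoordMetric.cone (h : IsCoordMetric G U) :
    IsCoordMetric (coneMetric G) (U ×ˢ Ioi (0 : ℝ)) where
  isOpen := h.isOpen.prod isOpen_Ioi
  smooth := by
    refine contDiffOn_clm_apply.2 fun u => contDiffOn_clm_apply.2 fun v => ?_
    have h1 : ContDiffOn ℝ ∞ (fun p : F × ℝ => G p.1) (U ×ˢ Ioi (0 : ℝ)) :=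
      h.smooth.comp contDiffOn_fst fun p hp => hp.1
    exact ((contDiffOn_snd.pow 2).mul ((h1.clm_apply contDiffOn_const).clm_apply
      contDiffOn_const)).add contDiffOn_const
  symm p hp u v := by
    rw [coneMetric_apply, coneMetric_apply, h.symm _ hp.1, mul_comm u.2]
  pos p hp u hu := by
    rw [coneMetric_apply]
    have hr : 0 < p.2 := hp.2
    by_cases h1 : u.1 = 0
    · have h2 : u.2 ≠ 0 := fun h2 => hu (Prod.ext h1 h2)
      rw [h1]
      have := mul_self_pos.2 h2
      simpa using h2
    · have := mul_pos (pow_pos hr 2) (h.pos _ hp.1 _ h1)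
      nlinarith [mul_self_nonneg u.2]

theorem fderiv_coneMetric (h : IsCoordMetric G U) (hz : z ∈ U) {r : ℝ} (hr : 0 < r)
    (w u v : F × ℝ) : fderiv ℝ (coneMetric G) (z, r) w u v =
      2 * r * w.2 * G z u.1 v.1 + r ^ 2 * fderiv ℝ G z w.1 u.1 v.1 := by
  rw [← h.cone.fderiv_apply (z := (z, r)) ⟨hz, hr⟩]
  have h1 : HasFDerivAt (fun p : F × ℝ => G p.1 u.1 v.1) _ (z, r) :=
    (((((h.contDiffAt hz).differentiableAt (by simp)).hasFDerivAt.comp (z, r)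
      hasFDerivAt_fst)).clm_apply (hasFDerivAt_const u.1 _)).clm_apply (hasFDerivAt_const v.1 _)
  have h2 : HasFDerivAt (fun p : F × ℝ => coneMetric G p u v) _ (z, r) :=
    (((hasFDerivAt_snd (𝕜 := ℝ) (E := F) (F := ℝ) (p := (z, r))).pow 2).mul h1).add
      (hasFDerivAt_const (u.2 * v.2) _)
  rw [h2.fderiv]
  simp
  ring

/-- The Levi-Civita connection of the cone metric. -/
theorem connMap_cone (h : IsCoordMetric G U) (hz : z ∈ U) {r : ℝ} (hr : 0 < r) (u v : F × ℝ) :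
    connMap (coneMetric G) (z, r) u v =
      (connMap G z u.1 v.1 + r⁻¹ • (u.2 • v.1 + v.2 • u.1), -(r * G z u.1 v.1)) := by
  symm
  refine h.cone.eq_connMap (z := (z, r)) ⟨hz, hr⟩ fun w => ?_
  rw [koszul_apply]
  simp only [fderiv_coneMetric h hz hr, coneMetric_apply, map_add, map_smul, add_apply,
    smul_apply, smul_eq_mul, h.connMap_spec hz, koszul_apply]
  rw [h.symm z hz u.1 v.1]
  field_simp
  ring

/-- On vectors tangent to the link, the Ricci form of the cone metric is `Ric - (d - 1) G`, where `d` is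
the dimension of the link; thus a Ricci flat cone has an Einstein link. The endomorphism
`u ↦ R(u, v) w` of the cone kills the radial direction and maps into the link, where it is the map
`A` below. -/
theorem ricciForm_cone (h : IsCoordMetric G U) (hz : z ∈ U) {r : ℝ} (hr : 0 < r) (v w : F) :
    ricciForm (coneMetric G) (z, r) (v, 0) (w, 0) =
      ricciForm G z v w - (Module.finrank ℝ F - 1 : ℝ) * G z v w := by
  set A : F →ₗ[ℝ] F := (riem G z v w : F →ₗ[ℝ] F) - G z v w • LinearMap.id +
    ((G z w : F →ₗ[ℝ] ℝ)).smulRight v with hA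
  have hd : ∀ (v₁ w₁ x : F × ℝ), fderiv ℝ (connMap (coneMetric G)) (z, r) x v₁ w₁ =
      (fderiv ℝ (connMap G) z x.1 v₁.1 w₁.1 - (r ^ 2)⁻¹ • x.2 • (v₁.2 • w₁.1 + w₁.2 • v₁.1),
        -(x.2 * G z v₁.1 w₁.1 + r * fderiv ℝ G z x.1 v₁.1 w₁.1)) := by
    intro v₁ w₁ x
    rw [← h.cone.fderiv_connMap_apply (z := (z, r)) ⟨hz, hr⟩]
    have h0 : HasFDerivAt (fun p : F × ℝ => connMap G p.1) _ (z, r) :=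
      HasFDerivAt.comp (g := connMap G) (f := Prod.fst) (z, r)
        (h.differentiableAt_connMap hz).hasFDerivAt hasFDerivAt_fst
    have h1 : HasFDerivAt (fun p : F × ℝ => connMap G p.1 v₁.1 w₁.1) _ (z, r) :=
      (h0.clm_apply (hasFDerivAt_const v₁.1 _)).clm_apply (hasFDerivAt_const w₁.1 _)
    have h2 : HasFDerivAt (fun p : F × ℝ => G p.1 v₁.1 w₁.1) _ (z, r) :=
      (((((h.contDiffAt hz).differentiableAt (by simp)).hasFDerivAt.comp (z, r)
        hasFDerivAt_fst)).clm_apply (hasFDerivAt_const v₁.1 _)).clm_apply (hasFDerivAt_const w₁.1 _)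
    have h3 : HasFDerivAt (fun p : F × ℝ => p.2⁻¹) _ (z, r) :=
      (hasDerivAt_inv hr.ne').hasFDerivAt.comp (z, r)
        (hasFDerivAt_snd (𝕜 := ℝ) (E := F) (F := ℝ) (p := (z, r)))
    have h4 := (h1.add (h3.smul (hasFDerivAt_const (v₁.2 • w₁.1 + w₁.2 • v₁.1) _))).prodMk
      ((hasFDerivAt_snd (𝕜 := ℝ) (E := F) (F := ℝ) (p := (z, r))).mul h2).neg
    have h5 := h4.congr_of_eventuallyEq (f₁ := fun p => connMap (coneMetric G) p v₁ w₁) (by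
      filter_upwards [h.cone.isOpen.mem_nhds (show (z, r) ∈ U ×ˢ Ioi (0 : ℝ) from ⟨hz, hr⟩)]
        with p hp using connMap_cone h hp.1 hp.2 v₁ w₁)
    rw [h5.fderiv]
    ext1
    · simp
      module
    · simp
      ring
  have hT : (riem (coneMetric G) (z, r) (v, 0) (w, 0) : F × ℝ →ₗ[ℝ] F × ℝ) =
      LinearMap.inl ℝ F ℝ ∘ₗ (A ∘ₗ LinearMap.fst ℝ F ℝ) := by
    ext1
    · ext u
      · change (riem (coneMetric G) (z, r) (v, 0) (w, 0) (u, 0)).1 = A u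
        rw [riem_apply]
        simp only [connMap_cone h hz hr, hd]
        simp [hA, riem_apply, h.symm z hz w u]
        match_scalars <;> field_simp
      · change (riem (coneMetric G) (z, r) (v, 0) (w, 0) (u, 0)).2 = 0
        rw [riem_apply]
        simp only [connMap_cone h hz hr, hd]
        simp [h.fderiv_eq hz, h.symm z hz (connMap G z u v) w]
        rw [h.connMap_symm hz v u, h.symm z hz w (connMap G z u v)]
        ring
    · ext
      · change (riem (coneMetric G) (z, r) (v, 0) (w, 0) (0, 1)).1 = A 0
        rw [riem_apply]
        simp only [connMap_cone h hz hr, hd]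
        simp
      · change (riem (coneMetric G) (z, r) (v, 0) (w, 0) (0, 1)).2 = 0
        rw [riem_apply]
        simp only [connMap_cone h hz hr, hd]
        simp [hr.ne']
  rw [ricciForm, hT, LinearMap.trace_comp_comm', LinearMap.comp_assoc, LinearMap.fst_comp_inl,
    LinearMap.comp_id, hA, map_add, map_sub, map_smul, LinearMap.trace_id, LinearMap.trace_smulRight,
    ricciForm]
  simp [h.symm z hz w v]
  ring

end MetricCone

/-! ### Kähler metrics and Ricci flatness -/

theorem I_smul_I_smul {V : Type*} [AddCommGroup V] [Module ℂ V] (u : V) :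
    Complex.I • Complex.I • u = -u := by
  rw [smul_smul, Complex.I_mul_I, neg_one_smul]

section KahlerRicci
variable {V : Type*} [NormedAddCommGroup V] [NormedSpace ℂ V] [FiniteDimensional ℂ V]
  {G : V → V →L[ℝ] V →L[ℝ] ℝ} {U : Set V} {z : V}

/-- A Kähler metric on an open subset of a complex vector space: it is invariant under the complex
structure, and its fundamental form is closed. -/
structure IsKahlerOn (G : V → V →L[ℝ] V →L[ℝ] ℝ) (U : Set V) : Prop extends
    IsCoordMetric G U where
  inv : ∀ z ∈ U, ∀ u v, G z (Complex.I • u) (Complex.I • v) = G z u v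
  closed : ∀ z ∈ U, ∀ u v w, fderiv ℝ G z w (Complex.I • u) v +
    fderiv ℝ G z u (Complex.I • v) w + fderiv ℝ G z v (Complex.I • w) u = 0

namespace IsKahlerOn

theorem inv_left (h : IsKahlerOn G U) (hz : z ∈ U) (u v : V) :
    G z (Complex.I • u) v = -G z u (Complex.I • v) := by
  rw [← h.inv z hz u, I_smul_I_smul, map_neg, neg_neg]

theorem fderiv_inv (h : IsKahlerOn G U) (hz : z ∈ U) (u v w : V) :
    fderiv ℝ G z u (Complex.I • v) (Complex.I • w) = fderiv ℝ G z u v w := by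
  rw [← h.fderiv_apply hz, ← h.fderiv_apply hz]
  congr 1
  apply Filter.EventuallyEq.fderiv_eq
  filter_upwards [h.isOpen.mem_nhds hz] with y hy using h.inv y hy v w

theorem fderiv_inv_left (h : IsKahlerOn G U) (hz : z ∈ U) (u v w : V) :
    fderiv ℝ G z u (Complex.I • v) w = -fderiv ℝ G z u v (Complex.I • w) := by
  rw [← h.fderiv_inv hz u v, I_smul_I_smul, map_neg, neg_neg]

/-- The complex structure of a Kähler metric is parallel. -/
theorem connMap_I (h : IsKahlerOn G U) (hz : z ∈ U) (u v : V) :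
    connMap G z u (Complex.I • v) = Complex.I • connMap G z u v := by
  refine h.ext hz fun w => ?_
  rw [h.inv_left hz, h.connMap_spec hz, h.connMap_spec hz, koszul_apply, koszul_apply]
  have h1 := h.closed z hz u v w
  have h4 := h.closed z hz u (Complex.I • v) (Complex.I • w)
  have s1 : fderiv ℝ G z v w (Complex.I • u) = -fderiv ℝ G z v u (Complex.I • w) := by
    rw [h.fderiv_symm hz, h.fderiv_inv_left hz]
  have s2 := h.fderiv_symm hz (Complex.I • v) w u
  simp only [I_smul_I_smul, map_neg, neg_apply, h.fderiv_inv_left hz] at h1 h4 ⊢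
  linarith

theorem connMap_I_left (h : IsKahlerOn G U) (hz : z ∈ U) (u v : V) :
    connMap G z (Complex.I • u) v = Complex.I • connMap G z u v := by
  rw [h.connMap_symm hz, h.connMap_I hz, h.connMap_symm hz]

theorem fderiv_connMap_I (h : IsKahlerOn G U) (hz : z ∈ U) (u v w : V) :
    fderiv ℝ (connMap G) z u v (Complex.I • w) = Complex.I • fderiv ℝ (connMap G) z u v w := by
  rw [← h.fderiv_connMap_apply hz, ← h.fderiv_connMap_apply hz]
  have hd : DifferentiableAt ℝ (fun y => connMap G y v w) z :=
    ((h.differentiableAt_connMap hz).clm_apply (differentiableAt_const v)).clm_apply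
      (differentiableAt_const w)
  have h1 : fderiv ℝ (fun y => connMap G y v (Complex.I • w)) z =
      fderiv ℝ (fun y => Complex.I • connMap G y v w) z := by
    apply Filter.EventuallyEq.fderiv_eq
    filter_upwards [h.isOpen.mem_nhds hz] with y hy using h.connMap_I hy v w
  rw [h1, fderiv_fun_const_smul hd]
  rfl

theorem riem_I (h : IsKahlerOn G U) (hz : z ∈ U) (u v w : V) :
    riem G z v (Complex.I • w) u = Complex.I • riem G z v w u := by
  simp only [riem_apply, h.fderiv_connMap_I hz, h.connMap_I hz, smul_sub, smul_add]

theorem riem_I_I (h : IsKahlerOn G U) (hz : z ∈ U) (u v w : V) :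
    riem G z (Complex.I • v) w (Complex.I • u) = riem G z v w u := by
  refine h.ext hz fun x => ?_
  rw [h.riem_pair hz, h.riem_I hz, h.inv z hz, ← h.riem_pair hz]

/-- The Ricci form of a Kähler metric is invariant under the complex structure. -/
theorem ricciForm_I (h : IsKahlerOn G U) (hz : z ∈ U) (v w : V) :
    ricciForm G z (Complex.I • v) (Complex.I • w) = ricciForm G z v w := by
  let J : V →ₗ[ℝ] V := (Complex.I • (LinearMap.id : V →ₗ[ℂ] V)).restrictScalars ℝ
  have h1 : (riem G z (Complex.I • v) (Complex.I • w) : V →ₗ[ℝ] V) =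
      J ∘ₗ (riem G z (Complex.I • v) w : V →ₗ[ℝ] V) := by
    ext u; exact h.riem_I hz u _ w
  have h2 : (riem G z (Complex.I • v) w : V →ₗ[ℝ] V) ∘ₗ J = (riem G z v w : V →ₗ[ℝ] V) := by
    ext u; exact h.riem_I_I hz u v w
  rw [ricciForm, h1, LinearMap.trace_comp_comm', h2, ricciForm]

/-- A Kähler metric is Ricci flat if its connection form has trace zero: the remaining terms of the
Ricci form change sign under `(v, w) ↦ (i v, i w)`. -/
theorem ricciForm_eq_zero (h : IsKahlerOn G U)
    (htr : ∀ z ∈ U, ∀ v, LinearMap.trace ℝ V (connMap G z v : V →ₗ[ℝ] V) = 0)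
    (hz : z ∈ U) (v w : V) : ricciForm G z v w = 0 := by
  have key : ∀ v w, ricciForm G z v w =
      LinearMap.trace ℝ V (((fderiv ℝ (connMap G) z).flip v).flip w : V →ₗ[ℝ] V) -
      LinearMap.trace ℝ V ((connMap G z v).comp (connMap G z w) : V →ₗ[ℝ] V) := by
    intro v w
    have h1 : ∀ v, (connMap G z).flip v = connMap G z v := fun v => by
      ext u; exact h.connMap_symm hz u v
    have h2 : (fderiv ℝ (connMap G) z v).flip w = fderiv ℝ (connMap G) z v w := by
      ext u; exact h.fderiv_connMap_symm hz v u w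
    have h3 : LinearMap.trace ℝ V (fderiv ℝ (connMap G) z v w : V →ₗ[ℝ] V) = 0 := by
      let t : (V →L[ℝ] V) →L[ℝ] ℝ := LinearMap.toContinuousLinearMap
        ((LinearMap.trace ℝ V) ∘ₗ (ContinuousLinearMap.coeLM ℝ))
      have ht : HasFDerivAt (fun y => t (connMap G y w)) _ z :=
        t.hasFDerivAt.comp z ((h.differentiableAt_connMap hz).hasFDerivAt.clm_apply
          (hasFDerivAt_const w z))
      have h4 := ht.unique ((hasFDerivAt_const (0 : ℝ) z).congr_of_eventuallyEq (by
        filter_upwards [h.isOpen.mem_nhds hz] with y hy using htr y hy w))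
      have h5 := congrArg (fun A : V →L[ℝ] ℝ => A v) h4
      simpa [t] using h5
    rw [ricciForm, riem, h1, h1, h2]
    simp only [ContinuousLinearMap.toLinearMap_sub, ContinuousLinearMap.toLinearMap_add, map_sub,
      map_add, h3, htr z hz]
    ring
  have hneg : ricciForm G z (Complex.I • v) (Complex.I • w) = -ricciForm G z v w := by
    rw [key, key]
    have h1 : (((fderiv ℝ (connMap G) z).flip (Complex.I • v)).flip (Complex.I • w)
        : V →ₗ[ℝ] V) = -(((fderiv ℝ (connMap G) z).flip v).flip w : V →ₗ[ℝ] V) := by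
      ext u
      change fderiv ℝ (connMap G) z u (Complex.I • v) (Complex.I • w) =
        -fderiv ℝ (connMap G) z u v w
      rw [h.fderiv_connMap_I hz, h.fderiv_connMap_symm hz, h.fderiv_connMap_I hz, I_smul_I_smul,
        h.fderiv_connMap_symm hz]
    have h2 : ((connMap G z (Complex.I • v)).comp (connMap G z (Complex.I • w)) : V →ₗ[ℝ] V) =
        -((connMap G z v).comp (connMap G z w) : V →ₗ[ℝ] V) := by
      ext u
      change connMap G z (Complex.I • v) (connMap G z (Complex.I • w) u) =
        -connMap G z v (connMap G z w u)
      rw [h.connMap_I_left hz, h.connMap_I_left hz, h.connMap_I hz, I_smul_I_smul]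
    rw [h1, h2, map_neg, map_neg]
    ring
  have := h.ricciForm_I hz v w
  linarith

end IsKahlerOn

/-- The matrix of the hermitian form `B(u, v) + i B(u, i v)` in a complex basis. -/
def hermGram {ι : Type*} (b : ι → V) (B : V → V → ℝ) : Matrix ι ι ℂ :=
  Matrix.of fun j k => (B (b j) (b k) : ℂ) + Complex.I * B (b j) (Complex.I • b k)

theorem trace_real_eq {ι : Type*} [Fintype ι] [DecidableEq ι] (b : Module.Basis ι ℂ V)
    (K : V →ₗ[ℝ] V) (hK : ∀ u, K (Complex.I • u) = Complex.I • K u) :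
    LinearMap.trace ℝ V K = 2 * (∑ j, b.repr (K (b j)) j).re := by
  have hKc : ∀ (c : ℂ) (u : V), K (c • u) = c • K u := by
    intro c u
    have h1 : ∀ x : V, c • x = c.re • x + c.im • Complex.I • x := by
      intro x
      conv_lhs => rw [← Complex.re_add_im c, add_smul, mul_smul]
      rfl
    rw [h1, h1, map_add, map_smul, map_smul, hK]
  let φ : ι → V →ₗ[ℝ] ℝ := fun j => Complex.reLm ∘ₗ (b.coord j).restrictScalars ℝ
  let ψ : ι → V →ₗ[ℝ] ℝ := fun j => Complex.imLm ∘ₗ (b.coord j).restrictScalars ℝ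
  have hsum : K = ∑ j, ((φ j).smulRight (K (b j)) + (ψ j).smulRight (Complex.I • K (b j))) := by
    ext u
    conv_lhs => rw [← b.sum_repr u, map_sum]
    rw [LinearMap.sum_apply]
    refine Finset.sum_congr rfl fun j _ => ?_
    rw [hKc]
    conv_lhs => rw [← Complex.re_add_im (b.repr u j), add_smul, mul_smul]
    rfl
  conv_lhs => rw [hsum]
  rw [map_sum, Complex.re_sum, Finset.mul_sum]
  refine Finset.sum_congr rfl fun j _ => ?_
  rw [map_add, LinearMap.trace_smulRight, LinearMap.trace_smulRight]
  simp [φ, ψ]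
  ring

/-- Jacobi's formula: if `M' = N M` at `0`, then `(det M)' = tr N · det M` there. -/
theorem hasDerivAt_det {ι : Type*} [Fintype ι] [DecidableEq ι] {M : ℝ → Matrix ι ι ℂ}
    {N : Matrix ι ι ℂ} (hM : ∀ i j, HasDerivAt (fun t => M t i j) ((N * M 0) i j) 0) :
    HasDerivAt (fun t => (M t).det) (N.trace * (M 0).det) 0 := by
  have hdet : Differentiable ℝ (fun A : ι → ι → ℂ => (Matrix.of A).det) := by
    simp only [Matrix.det_apply, Matrix.of_apply]
    fun_prop
  have hcurve : HasDerivAt (F := ι → ι → ℂ) (fun t => M t) (N * M 0) 0 :=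
    hasDerivAt_pi.2 fun i => hasDerivAt_pi.2 fun j => hM i j
  have hline : HasDerivAt (F := ι → ι → ℂ) (fun t : ℝ => M 0 + (t : ℂ) • (N * M 0))
      (N * M 0) 0 := by
    refine hasDerivAt_pi.2 fun i => hasDerivAt_pi.2 fun j => ?_
    have := ((Complex.ofRealCLM.hasDerivAt (x := 0)).mul_const ((N * M 0) i j)).const_add (M 0 i j)
    simpa using this
  have hd := (hdet (M 0)).hasFDerivAt
  have h1 := HasFDerivAt.comp_hasDerivAt (𝕜 := ℝ) (F := ι → ι → ℂ) (E := ℂ)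
    (l := fun A : ι → ι → ℂ => (Matrix.of A).det) (f := fun t => M t) 0 hd hcurve
  have hd2 : HasFDerivAt (𝕜 := ℝ) (fun A : ι → ι → ℂ => (Matrix.of A).det)
      (fderiv ℝ (fun A : ι → ι → ℂ => (Matrix.of A).det) (M 0))
      (M 0 + ((0 : ℝ) : ℂ) • (N * M 0)) := by
    have : M 0 + ((0 : ℝ) : ℂ) • (N * M 0) = M 0 := by simp
    rw [this]; exact hd
  have h2 := HasFDerivAt.comp_hasDerivAt (𝕜 := ℝ) (F := ι → ι → ℂ) (E := ℂ)
    (l := fun A : ι → ι → ℂ => (Matrix.of A).det) (f := fun t : ℝ => M 0 + (t : ℂ) • (N * M 0)) 0 hd2 hline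
  have h3 : HasDerivAt (fun t : ℝ => (M 0 + (t : ℂ) • (N * M 0)).det)
      (N.trace * (M 0).det) 0 := by
    have h4 : (fun t : ℝ => (M 0 + (t : ℂ) • (N * M 0)).det) = fun t : ℝ =>
        (1 + N.trace * (t : ℂ) + (Matrix.det (1 + (Polynomial.X : Polynomial ℂ) •
          N.map Polynomial.C)).divX.divX.eval (t : ℂ) * (t : ℂ) ^ 2) * (M 0).det := by
      ext t
      rw [← Matrix.det_one_add_smul, ← Matrix.det_mul, add_mul, one_mul, smul_mul_assoc]
    rw [h4]
    set q := (Matrix.det (1 + (Polynomial.X : Polynomial ℂ) • N.map Polynomial.C)).divX.divX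
    have hid : HasDerivAt (fun t : ℝ => (t : ℂ)) 1 0 := Complex.ofRealCLM.hasDerivAt
    have hq : HasDerivAt (fun t : ℝ => q.eval (t : ℂ)) _ 0 :=
      (q.hasDerivAt ((0 : ℝ) : ℂ)).comp_ofReal
    have h5 := (((hid.const_mul N.trace).const_add 1).add (hq.mul (hid.pow 2))).mul_const (M 0).det
    simpa using h5
  have h6 := h2.unique h3
  rw [← h6]
  exact h1

/-- The trace of the connection of a Kähler metric is the derivative of half the logarithm of the
determinant of its hermitian matrix; it vanishes if this determinant is constant. -/
theorem IsKahlerOn.trace_connMap (h : IsKahlerOn G U) {ι : Type*} [Fintype ι] [DecidableEq ι]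
    (b : Module.Basis ι ℂ V) {c : ℂ} (hc : c ≠ 0)
    (hdet : ∀ z ∈ U, (hermGram b (fun u v => G z u v)).det = c) (hz : z ∈ U) (v : V) :
    LinearMap.trace ℝ V (connMap G z v : V →ₗ[ℝ] V) = 0 := by
  obtain ⟨e, he⟩ := h.isInvertible hz
  have he' : ∀ u w, e u w = G z u w := fun u w => by rw [← he]; rfl
  let K : V →ₗ[ℝ] V := (e.symm : (V →L[ℝ] ℝ) →ₗ[ℝ] V) ∘ₗ (fderiv ℝ G z v : V →ₗ[ℝ] V →L[ℝ] ℝ)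
  have hK : ∀ u w, G z (K u) w = fderiv ℝ G z v u w := by
    intro u w
    rw [← he']
    simp [K]
  have hKI : ∀ u, K (Complex.I • u) = Complex.I • K u := by
    intro u
    refine h.ext hz fun w => ?_
    rw [hK, h.inv_left hz, hK, h.fderiv_inv_left hz]
  -- the difference of `2 Γ(v, ·)` and `K` is skew for `G`
  have hskew : LinearMap.trace ℝ V ((2 : ℝ) • (connMap G z v : V →ₗ[ℝ] V) - K) = 0 := by
    set A : V →ₗ[ℝ] V := (2 : ℝ) • (connMap G z v : V →ₗ[ℝ] V) - K with hA
    have hA1 : ∀ u w, G z (A u) w = fderiv ℝ G z u v w - fderiv ℝ G z w v u := by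
      intro u w
      simp only [hA, LinearMap.sub_apply, LinearMap.smul_apply, ContinuousLinearMap.coe_coe,
        map_sub, map_smul, sub_apply, smul_apply, h.connMap_spec hz, hK, koszul_apply, smul_eq_mul]
      ring
    let d : V ≃ₗ[ℝ] Module.Dual ℝ V :=
      e.toLinearEquiv.trans (LinearMap.toContinuousLinearMap (𝕜 := ℝ) (E := V) (F' := ℝ)).symm
    have hd : ∀ u w, d u w = G z u w := fun u w => he' u w
    have h1 : d.conj A = -(Module.Dual.transpose (R := ℝ) A) := by
      ext y w
      obtain ⟨u, rfl⟩ := d.surjective y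
      rw [LinearEquiv.conj_apply_apply, d.symm_apply_apply, hd, hA1]
      change _ = -(d u (A w))
      rw [hd, h.symm z hz u, hA1]
      ring
    have h2 := LinearMap.trace_conj' A d
    rw [h1, map_neg, LinearMap.trace_transpose'] at h2
    linarith
  have htrK : LinearMap.trace ℝ V K = 0 := by
    rw [trace_real_eq b K hKI]
    set H : ℝ → Matrix ι ι ℂ := fun t => hermGram b (fun u w => G (z + t • v) u w) with hH
    let N : Matrix ι ι ℂ := Matrix.of fun j l => b.repr (K (b j)) l
    have hGd : ∀ u w, HasDerivAt (fun t : ℝ => G (z + t • v) u w) (G z (K u) w) 0 := by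
      intro u w
      have h1 : HasDerivAt (fun t : ℝ => z + t • v) v 0 := by
        simpa using ((hasDerivAt_id (0 : ℝ)).smul_const v).const_add z
      have h2 : HasFDerivAt (fun y => G y u w) (fderiv ℝ (fun y => G y u w) z) (z + (0 : ℝ) • v) := by
        rw [zero_smul, add_zero]
        exact ((((h.contDiffAt hz).differentiableAt (by simp)).clm_apply
          (differentiableAt_const u)).clm_apply (differentiableAt_const w)).hasFDerivAt
      have h3 := h2.comp_hasDerivAt (0 : ℝ) h1
      rwa [h.fderiv_apply hz, ← hK] at h3
    have hlin : ∀ (x w : V), (G z x w : ℂ) + Complex.I * G z x (Complex.I • w) =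
        ∑ l, b.repr x l * ((G z (b l) w : ℂ) + Complex.I * G z (b l) (Complex.I • w)) := by
      intro x w
      let θ : V →ₗ[ℂ] ℂ :=
        { toFun := fun x => (G z x w : ℂ) + Complex.I * G z x (Complex.I • w)
          map_add' := fun x y => by simp; ring
          map_smul' := fun a x => by
            have h1 : a • x = a.re • x + a.im • Complex.I • x := by
              conv_lhs => rw [← Complex.re_add_im a, add_smul, mul_smul]
              rfl
            rw [h1]
            simp only [map_add, map_smul, add_apply, smul_apply, smul_eq_mul, h.inv_left hz,
              I_smul_I_smul, map_neg, RingHom.id_apply]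
            apply Complex.ext
            · simp
              ring
            · simp }
      change θ x = ∑ l, b.repr x l * θ (b l)
      conv_lhs => rw [← b.sum_repr x, map_sum]
      simp
    have hM : ∀ i j, HasDerivAt (fun t => H t i j) ((N * H 0) i j) 0 := by
      intro i j
      have h1 := (hGd (b i) (b j)).ofReal_comp.add
        ((hGd (b i) (Complex.I • b j)).ofReal_comp.const_mul Complex.I)
      rw [hlin] at h1
      refine h1.congr_deriv ?_
      simp [Matrix.mul_apply, N, hH, hermGram]
    have h1 := hasDerivAt_det hM
    have hc0 : (H 0).det = c := by
      rw [← hdet z hz]; simp [hH]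
    have hconst : HasDerivAt (fun t => (H t).det) 0 0 := by
      refine (hasDerivAt_const (0 : ℝ) c).congr_of_eventuallyEq ?_
      have hcont : ContinuousAt (fun t : ℝ => z + t • v) 0 := by fun_prop
      have := hcont.preimage_mem_nhds (t := U) (by
        simpa using h.isOpen.mem_nhds hz)
      filter_upwards [this] with t ht using hdet _ ht
    have h2 := h1.unique hconst
    rw [hc0] at h2
    have h3 : N.trace = 0 := (mul_eq_zero.1 h2).resolve_right hc
    have h4 : ∑ j, b.repr (K (b j)) j = 0 := h3
    rw [h4]; simp
  rw [map_sub, map_smul, htrK, sub_zero, smul_eq_mul] at hskew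
  linarith

end KahlerRicci

/-! ### The ordinary differential equation of the profile -/

section Profile
open Polynomial

theorem contDiff_eval (p : ℝ[X]) : ContDiff ℝ ∞ fun x => p.eval x := by
  simpa using Polynomial.contDiff_aeval (𝕜 := ℝ) p ∞

theorem exists_derivative_eq (p : ℝ[X]) : ∃ q : ℝ[X], derivative q = p := by
  induction p using Polynomial.induction_on' with
  | add p q hp hq =>
    obtain ⟨p', rfl⟩ := hp
    obtain ⟨q', rfl⟩ := hq
    exact ⟨p' + q', derivative_add⟩
  | monomial n a =>
    refine ⟨monomial (n + 1) (a / (n + 1)), ?_⟩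
    rw [derivative_monomial]
    congr 1
    push_cast
    field_simp

/-- Inversion of a smooth function with negative derivative on an interval `(lo, hi)`, which tends to
infinity at `lo` and vanishes at a point `e` of the interval. -/
theorem exists_smooth_inverse {φ : ℝ → ℝ} {lo e hi : ℝ} (he : e ∈ Ioo lo hi)
    (hφ : ContDiffOn ℝ ∞ φ (Ioo lo hi)) (hneg : ∀ x ∈ Ioo lo hi, deriv φ x < 0) (h0 : φ e = 0)
    (hlim : Filter.Tendsto φ (𝓝[>] lo) Filter.atTop) :
    ∃ X : ℝ → ℝ, (∀ x ∈ Ioo lo hi, X (φ x) = x) ∧ ∀ t, 0 ≤ t → ContDiffAt ℝ ∞ X t ∧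
      X t ∈ Ioc lo e ∧ φ (X t) = t ∧ deriv X t = (deriv φ (X t))⁻¹ := by
  classical
  have hanti : StrictAntiOn φ (Ioo lo hi) := strictAntiOn_of_deriv_neg (convex_Ioo lo hi)
    hφ.continuousOn (by simpa using hneg)
  let X : ℝ → ℝ := fun t => if h : ∃ x ∈ Ioo lo hi, φ x = t then h.choose else e
  have hX : ∀ x ∈ Ioo lo hi, X (φ x) = x := by
    intro x hx
    have h : ∃ x' ∈ Ioo lo hi, φ x' = φ x := ⟨x, hx, rfl⟩
    have h1 : X (φ x) = h.choose := dif_pos h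
    rw [h1]
    exact hanti.injOn h.choose_spec.1 hx h.choose_spec.2
  refine ⟨X, hX, fun t ht => ?_⟩
  obtain ⟨x, hx, hxt⟩ : ∃ x ∈ Ioc lo e, φ x = t := by
    obtain ⟨y, hy, hyt⟩ : ∃ y ∈ Ioo lo e, t ≤ φ y :=
      ((Filter.eventually_of_mem (Ioo_mem_nhdsGT he.1) fun _ h => h).and (hlim.eventually_ge_atTop t)).exists
    have hc : ContinuousOn φ (Icc y e) := hφ.continuousOn.mono fun z hz =>
      ⟨hy.1.trans_le hz.1, hz.2.trans_lt he.2⟩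
    obtain ⟨x, hx, hxt⟩ := intermediate_value_Icc' hy.2.le hc (show t ∈ Icc (φ e) (φ y) from
      ⟨by rw [h0]; exact ht, hyt⟩)
    exact ⟨x, ⟨hy.1.trans_le hx.1, hx.2⟩, hxt⟩
  have hx' : x ∈ Ioo lo hi := ⟨hx.1, hx.2.trans_lt he.2⟩
  have hXt : X t = x := by rw [← hxt, hX x hx']
  have hcd : ContDiffAt ℝ ∞ φ x := hφ.contDiffAt (isOpen_Ioo.mem_nhds hx')
  have hd : HasStrictDerivAt φ (deriv φ x) x := hcd.hasStrictDerivAt (by simp)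
  have hne := (hneg x hx').ne
  have hd' : HasFDerivAt φ ((ContinuousLinearEquiv.unitsEquivAut ℝ (Units.mk0 _ hne) :
      ℝ ≃L[ℝ] ℝ) : ℝ →L[ℝ] ℝ) x := (hd.hasStrictFDerivAt_equiv hne).hasFDerivAt
  have hloc := hcd.to_localInverse hd' (by simp)
  have heq : X =ᶠ[𝓝 (φ x)] hcd.localInverse hd' (by simp) := by
    refine (hcd.hasStrictFDerivAt' hd' (by simp)).localInverse_unique ?_
    filter_upwards [isOpen_Ioo.mem_nhds hx'] with y hy using hX y hy
  refine ⟨?_, ?_, ?_, ?_⟩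
  · rw [← hxt]; exact hloc.congr_of_eventuallyEq heq
  · rw [hXt]; exact hx
  · rw [hXt]; exact hxt
  · rw [hXt]
    have := hd.to_local_left_inverse hne (g := X) (by
      filter_upwards [isOpen_Ioo.mem_nhds hx'] with y hy using hX y hy)
    rw [← hxt]
    exact this.hasDerivAt.deriv

/-- A solution of the Einstein equation in one variable. Here `t = e^y` for the invariant variable
`y` of the punctured bundle, `X` is the moment coordinate, with `t X' = -A(X) / P(X)`, and `Q` is the
smooth function `c t / A(X)`, whose power `Q^{1/(n+2)}` is the invariant part of the potential. The
value `t = 0` belongs to the zero section; there `X = 1`. The solution is normalized at `t = 1`. -/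
structure IsProfile (P A : ℝ → ℝ) (b c : ℝ) (X Q : ℝ → ℝ) : Prop where
  smooth_coord : ∀ t, 0 ≤ t → ContDiffAt ℝ ∞ X t
  smooth : ∀ t, 0 ≤ t → ContDiffAt ℝ ∞ Q t
  pos : ∀ t, 0 ≤ t → 0 < Q t
  mem : ∀ t, 0 ≤ t → X t ∈ Ioc (-b) 1
  coord_one : X 1 = 0
  mul_eq : ∀ t, 0 ≤ t → Q t * A (X t) = c * t
  deriv_coord : ∀ t, 0 ≤ t → deriv X t * (Q t * P (X t)) = -c

theorem hasDerivAt_integral_polynomial {p : ℝ[X]} {b : ℝ} {A : ℝ → ℝ}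
    (hA : ∀ x, A x = -∫ s in (-b)..x, s * p.eval s) (x : ℝ) :
    HasDerivAt A (-(x * p.eval x)) x := by
  have hc : Continuous fun s : ℝ => s * p.eval s := continuous_id.mul p.continuous
  have h := (intervalIntegral.integral_hasDerivAt_right (hc.intervalIntegrable (-b) x)
    (hc.stronglyMeasurableAtFilter _ _) hc.continuousAt).neg
  exact h.congr_of_eventuallyEq (Filter.Eventually.of_forall hA)

theorem integral_pos_of_ends {p : ℝ[X]} {b : ℝ} (hb : 0 < b)
    (hp : ∀ x ∈ Icc (-b) 1, 0 < p.eval x) {A : ℝ → ℝ}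
    (hA : ∀ x, A x = -∫ s in (-b)..x, s * p.eval s) (hA1 : A 1 = 0) {x : ℝ}
    (hx : x ∈ Ioo (-b) 1) : 0 < A x := by
  have hd := hasDerivAt_integral_polynomial hA
  have hcont : Continuous A := continuous_iff_continuousAt.2 fun x => (hd x).continuousAt
  have hA0 : A (-b) = 0 := by rw [hA]; simp
  rcases le_or_gt x 0 with h | h
  · have hm : StrictMonoOn A (Icc (-b) 0) := by
      refine strictMonoOn_of_deriv_pos (convex_Icc _ _) hcont.continuousOn fun y hy => ?_
      rw [interior_Icc] at hy
      rw [(hd y).deriv]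
      have := hp y ⟨hy.1.le, by linarith [hy.2]⟩
      nlinarith [hy.2]
    have := hm ⟨le_rfl, by linarith⟩ ⟨hx.1.le, h⟩ hx.1
    rwa [hA0] at this
  · have hm : StrictAntiOn A (Icc 0 1) := by
      refine strictAntiOn_of_deriv_neg (convex_Icc _ _) hcont.continuousOn fun y hy => ?_
      rw [interior_Icc] at hy
      rw [(hd y).deriv]
      have := hp y ⟨by linarith [hy.1], hy.2.le⟩
      nlinarith [hy.1]
    have := hm ⟨h.le, hx.2.le⟩ ⟨zero_le_one, le_rfl⟩ hx.2
    rwa [hA1] at this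

/-- The profile function has simple zeros at both ends. -/
theorem exists_factorization {p : ℝ[X]} {b : ℝ} (hb : 0 < b)
    (hp : ∀ x ∈ Icc (-b) 1, 0 < p.eval x) {A : ℝ → ℝ}
    (hA : ∀ x, A x = -∫ s in (-b)..x, s * p.eval s) (hA1 : A 1 = 0) :
    ∃ R N : ℝ[X], (∀ x, A x = (1 - x) * (x + b) * R.eval x) ∧
      (∀ x ∈ Icc (-b) 1, 0 < R.eval x) ∧
      ∀ x, p.eval x = R.eval x * ((x + b) + b⁻¹ * (1 - x)) + (1 - x) * (x + b) * N.eval x := by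
  have hd := hasDerivAt_integral_polynomial hA
  have hA0 : A (-b) = 0 := by rw [hA]; simp
  have two_roots : ∀ q : ℝ[X], q.eval 1 = 0 → q.eval (-b) = 0 →
      ∃ r : ℝ[X], ∀ x, q.eval x = (1 - x) * (x + b) * r.eval x := by
    intro q h1 h2
    obtain ⟨r, hr⟩ := dvd_iff_isRoot.2 (show q.IsRoot 1 from h1)
    have h3 : r.IsRoot (-b) := by
      have : (-b - 1) * r.eval (-b) = 0 := by
        rw [← h2, hr]; simp
      exact (mul_eq_zero.1 this).resolve_left (by linarith)
    obtain ⟨s, hs⟩ := dvd_iff_isRoot.2 h3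
    refine ⟨-s, fun x => ?_⟩
    rw [hr, hs]
    simp
    ring
  -- `A` is a polynomial, a primitive of `-x p(x)`, and vanishes at both ends
  obtain ⟨q, hq⟩ := exists_derivative_eq (-(Polynomial.X * p))
  have hAq : ∀ x, A x = (q - Polynomial.C (q.eval 1)).eval x := by
    have hdq : ∀ x, HasDerivAt (fun x => A x - (q - Polynomial.C (q.eval 1)).eval x) 0 x := by
      intro x
      have h1 := (q - Polynomial.C (q.eval 1)).hasDerivAt x
      have h2 := (hd x).sub h1
      simp only [derivative_sub, derivative_C, hq, sub_zero, eval_neg, eval_mul, eval_X,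
        sub_self] at h2
      exact h2
    intro x
    have h1 := is_const_of_deriv_eq_zero (fun x => (hdq x).differentiableAt)
      (fun x => (hdq x).deriv) x 1
    simp only [hA1, eval_sub, eval_C, sub_self] at h1
    rw [eval_sub, eval_C]
    linarith
  obtain ⟨R, hR⟩ := two_roots (q - Polynomial.C (q.eval 1)) (by simp) (by rw [← hAq, hA0])
  have hAR : ∀ x, A x = (1 - x) * (x + b) * R.eval x := fun x => by rw [hAq, hR]
  have hdR : ∀ x, -(x * p.eval x) = (-(x + b) + (1 - x)) * R.eval x +
      (1 - x) * (x + b) * (derivative R).eval x := by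
    intro x
    have h1 := ((((hasDerivAt_id x).const_sub 1).mul ((hasDerivAt_id x).add_const b)).mul
      (R.hasDerivAt x)).congr_of_eventuallyEq (f₁ := A) (Filter.Eventually.of_forall hAR)
    rw [(hd x).unique h1]
    simp
  have hR1 : p.eval 1 = R.eval 1 * (1 + b) := by
    have := hdR 1
    simp at this
    linarith
  have hRb : b * p.eval (-b) = (1 + b) * R.eval (-b) := by
    have := hdR (-b)
    simp at this
    linarith
  -- at the ends `R` is read off from the derivative of `A`, in between from the sign of `A`
  have hRpos : ∀ x ∈ Icc (-b) 1, 0 < R.eval x := by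
    intro x hx
    rcases eq_or_lt_of_le hx.1 with h | h
    · have h2 := hp (-b) ⟨le_rfl, by linarith⟩
      rw [← h]
      have h3 := mul_pos hb h2
      rw [hRb] at h3
      exact pos_of_mul_pos_right h3 (by linarith)
    · rcases eq_or_lt_of_le hx.2 with h' | h'
      · have h2 := hp 1 ⟨by linarith, le_rfl⟩
        rw [h']
        rw [hR1] at h2
        exact pos_of_mul_pos_left h2 (by linarith)
      · have h2 := integral_pos_of_ends hb hp hA hA1 ⟨h, h'⟩
        rw [hAR] at h2
        refine pos_of_mul_pos_right h2 ?_
        exact mul_nonneg (by linarith) (by linarith)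
  -- the residues `1` and `b⁻¹` of `p / A` at the ends are those of the two simple fractions
  obtain ⟨N, hN⟩ := two_roots (p - R * ((Polynomial.X + Polynomial.C b) +
      Polynomial.C b⁻¹ * (1 - Polynomial.X)))
    (by simp [hR1]) (by
      simp only [eval_sub, eval_mul, eval_add, eval_X, eval_C, eval_one]
      field_simp
      linarith)
  refine ⟨R, N, hAR, hRpos, fun x => ?_⟩
  have := hN x
  simp only [eval_sub, eval_mul, eval_add, eval_X, eval_C, eval_one] at this
  linarith

/-- Existence of the profile. The separated equation `dt / t = -P / A dx` is integrated by partial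
fractions: `P / A = 1 / (1 - x) + b⁻¹ / (x + b) + N / R`. -/
theorem exists_isProfile {p : ℝ[X]} {b c : ℝ} (hb : 0 < b) (hc : 0 < c)
    (hp : ∀ x ∈ Icc (-b) 1, 0 < p.eval x) {A : ℝ → ℝ}
    (hA : ∀ x, A x = -∫ s in (-b)..x, s * p.eval s) (hA1 : A 1 = 0) :
    ∃ X Q, IsProfile (fun x => p.eval x) A b c X Q := by
  obtain ⟨R, N, hAR, hRpos, hpN⟩ := exists_factorization hb hp hA hA1
  -- an interval to the right of `1` where `R` and `p` stay positive
  obtain ⟨hi, hhi, hpos⟩ : ∃ hi, 1 < hi ∧ ∀ x ∈ Ico (1 : ℝ) hi, 0 < R.eval x ∧ 0 < p.eval x := by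
    have h1 : ∀ᶠ x in 𝓝 (1 : ℝ), 0 < R.eval x ∧ 0 < p.eval x :=
      (R.continuous.continuousAt.eventually (lt_mem_nhds (hRpos 1 ⟨by linarith, le_rfl⟩))).and
        (p.continuous.continuousAt.eventually (lt_mem_nhds (hp 1 ⟨by linarith, le_rfl⟩)))
    obtain ⟨hi, hhi, h2⟩ := (nhdsGE_basis (1 : ℝ)).eventually_iff.1 (h1.filter_mono
      (nhdsWithin_le_nhds (s := Ici 1)))
    exact ⟨hi, hhi, fun x hx => h2 hx⟩
  have hposI : ∀ x ∈ Icc (-b) 1 ∪ Ico 1 hi, 0 < R.eval x ∧ 0 < p.eval x := by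
    rintro x (hx | hx)
    · exact ⟨hRpos x hx, hp x hx⟩
    · exact hpos x hx
  have hpos' : ∀ x ∈ Ioo (-b) hi, 0 < R.eval x ∧ 0 < p.eval x := by
    intro x hx
    rcases le_total x 1 with h | h
    · exact hposI x (Or.inl ⟨hx.1.le, h⟩)
    · exact hposI x (Or.inr ⟨h, hx.2⟩)
  have h0b : (0 : ℝ) ∈ Ioo (-b) hi := ⟨by linarith, by linarith⟩
  let H : ℝ → ℝ := fun x => -∫ s in (0 : ℝ)..x, N.eval s / R.eval s
  have hHcont : ContinuousOn (fun s : ℝ => N.eval s / R.eval s) (Ico (-b) hi) :=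
    N.continuous.continuousOn.div R.continuous.continuousOn fun x hx => by
      rcases le_total x 1 with h | h
      · exact (hposI x (Or.inl ⟨hx.1, h⟩)).1.ne'
      · exact (hposI x (Or.inr ⟨h, hx.2⟩)).1.ne'
  have hHint : ∀ x ∈ Ico (-b) hi, IntervalIntegrable (fun s : ℝ => N.eval s / R.eval s)
      MeasureTheory.volume 0 x := fun x hx =>
    (hHcont.mono (by
      intro s hs
      rw [mem_uIcc] at hs
      rcases hs with hs | hs
      · exact ⟨by linarith [hs.1], hs.2.trans_lt hx.2⟩
      · exact ⟨hx.1.trans hs.1, by linarith [hs.2]⟩)).intervalIntegrable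
  have hHd : ∀ x ∈ Ioo (-b) hi, HasDerivAt H (-(N.eval x / R.eval x)) x := by
    intro x hx
    have hmem : Ioo (-b) hi ∈ 𝓝 x := isOpen_Ioo.mem_nhds hx
    refine (intervalIntegral.integral_hasDerivAt_right (hHint x ⟨hx.1.le, hx.2⟩) ?_ ?_).neg
    · exact (hHcont.mono Ioo_subset_Ico_self).stronglyMeasurableAtFilter isOpen_Ioo x hx
    · exact (hHcont.mono Ioo_subset_Ico_self).continuousAt hmem
  have hHsmooth : ContDiffOn ℝ ∞ H (Ioo (-b) hi) := by
    rw [contDiffOn_infty_iff_deriv_of_isOpen isOpen_Ioo]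
    refine ⟨fun x hx => (hHd x hx).differentiableAt.differentiableWithinAt, ?_⟩
    refine ContDiffOn.congr (f := fun x => -(N.eval x / R.eval x)) ?_ fun x hx => (hHd x hx).deriv
    exact ((contDiff_eval N).contDiffOn.div (contDiff_eval R).contDiffOn
      fun x hx => (hpos' x hx).1.ne').neg
  have hHcontAt : ContinuousWithinAt H (Ioi (-b)) (-b) := by
    have h1 : ContinuousOn (fun x => ∫ s in (0 : ℝ)..x, N.eval s / R.eval s) (uIcc (-b) 0) := by
      refine intervalIntegral.continuousOn_primitive_interval' (b₁ := -b) (b₂ := 0) ?_ ?_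
      · exact (hHint (-b) ⟨le_rfl, by linarith⟩).symm
      · exact right_mem_uIcc
    have h2 := (h1 (-b) left_mem_uIcc).neg
    rw [uIcc_of_le (by linarith)] at h2
    exact (h2.mono_of_mem_nhdsWithin (Icc_mem_nhdsGT_of_mem ⟨le_rfl, by linarith⟩))
  -- `T` is the solution `t` as a function of `x`, normalized by `T 0 = 1`, and `W` the smooth factor with `T = W A`
  let C : ℝ := b ^ b⁻¹
  have hC : 0 < C := Real.rpow_pos_of_pos hb _
  let W : ℝ → ℝ := fun x => C * (x + b) ^ (-b⁻¹ - 1) * Real.exp (H x) / R.eval x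
  let T : ℝ → ℝ := fun x => C * (x + b) ^ (-b⁻¹) * Real.exp (H x) * (1 - x)
  have hWpos : ∀ x ∈ Ioo (-b) hi, 0 < W x := fun x hx =>
    div_pos (mul_pos (mul_pos hC (Real.rpow_pos_of_pos (by linarith [hx.1]) _))
      (Real.exp_pos _)) (hpos' x hx).1
  have hTW : ∀ x ∈ Ioo (-b) hi, T x = W x * A x := by
    intro x hx
    have hxb : 0 < x + b := by linarith [hx.1]
    have h1 : (x + b) ^ (-b⁻¹) = (x + b) ^ (-b⁻¹ - 1) * (x + b) := by
      rw [← Real.rpow_add_one hxb.ne']; congr 1; ring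
    have := (hpos' x hx).1.ne'
    simp only [T, W, hAR, h1]
    field_simp
  have hTd : ∀ x ∈ Ioo (-b) hi, HasDerivAt T (-(W x * p.eval x)) x := by
    intro x hx
    have hxb : 0 < x + b := by linarith [hx.1]
    have hR := (hpos' x hx).1.ne'
    have h1 : (x + b) ^ (-b⁻¹) = (x + b) ^ (-b⁻¹ - 1) * (x + b) := by
      rw [← Real.rpow_add_one hxb.ne']; congr 1; ring
    have h2 := (((((hasDerivAt_id x).add_const b).rpow_const (p := -b⁻¹)
      (Or.inl hxb.ne')).const_mul C).mul (hHd x hx).exp).mul ((hasDerivAt_id x).const_sub 1)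
    refine h2.congr_deriv ?_
    simp only [id, W, hpN, h1, Pi.mul_apply]
    generalize (x + b) ^ (-b⁻¹ - 1) = E
    field_simp
    ring
  have hxb : ∀ q : ℝ, ContDiffOn ℝ ∞ (fun x : ℝ => (x + b) ^ q) (Ioo (-b) hi) := fun q =>
    (contDiffOn_id.add contDiffOn_const).rpow_const_of_ne fun x hx => by
      have : 0 < x + b := by linarith [hx.1]
      exact this.ne'
  have hTsmooth : ContDiffOn ℝ ∞ T (Ioo (-b) hi) :=
    ((contDiffOn_const.mul (hxb _)).mul hHsmooth.exp).mul (contDiffOn_const.sub contDiffOn_id)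
  have hWsmooth : ContDiffOn ℝ ∞ W (Ioo (-b) hi) :=
    ((contDiffOn_const.mul (hxb _)).mul hHsmooth.exp).div
      (contDiff_eval R).contDiffOn fun x hx => (hpos' x hx).1.ne'
  have hTlim : Filter.Tendsto T (𝓝[>] (-b)) Filter.atTop := by
    have h1 : Filter.Tendsto (fun x : ℝ => (x + b) ^ (-b⁻¹)) (𝓝[>] (-b)) Filter.atTop := by
      have h2 : Filter.Tendsto (fun x : ℝ => x + b) (𝓝[>] (-b)) (𝓝[>] 0) := by
        refine tendsto_nhdsWithin_iff.2 ⟨?_, ?_⟩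
        · have : Filter.Tendsto (fun x : ℝ => x + b) (𝓝 (-b)) (𝓝 (-b + b)) :=
            (continuous_id.add continuous_const).tendsto _
          rw [neg_add_cancel] at this
          exact this.mono_left nhdsWithin_le_nhds
        · filter_upwards [self_mem_nhdsWithin] with x hx
          have : -b < x := hx
          show 0 < x + b
          linarith
      exact (tendsto_rpow_neg_nhdsGT_zero (by simpa using hb)).comp h2
    have h3 : Filter.Tendsto (fun x => Real.exp (H x) * (1 - x)) (𝓝[>] (-b))
        (𝓝 (Real.exp (H (-b)) * (1 - -b))) :=
      (hHcontAt.rexp).mul ((continuous_const.sub continuous_id).continuousWithinAt)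
    have h4 : 0 < Real.exp (H (-b)) * (1 - -b) := mul_pos (Real.exp_pos _) (by linarith)
    have h5 := ((Filter.tendsto_const_mul_atTop_of_pos hC).2 h1).atTop_mul_pos h4 h3
    refine h5.congr fun x => ?_
    simp only [T]; ring
  have hneg : ∀ x ∈ Ioo (-b) hi, deriv T x < 0 := by
    intro x hx
    rw [(hTd x hx).deriv]
    have := mul_pos (hWpos x hx) (hpos' x hx).2
    linarith
  obtain ⟨X, hX, hX'⟩ := exists_smooth_inverse (e := 1) ⟨by linarith, hhi⟩ hTsmooth hneg
    (by simp [T]) hTlim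
  have hmem : ∀ t, 0 ≤ t → X t ∈ Ioo (-b) hi := fun t ht =>
    ⟨(hX' t ht).2.1.1, (hX' t ht).2.1.2.trans_lt hhi⟩
  refine ⟨X, fun t => c * W (X t), ⟨fun t ht => (hX' t ht).1, fun t ht => ?_,
    fun t ht => mul_pos hc (hWpos _ (hmem t ht)), fun t ht => (hX' t ht).2.1, ?_, fun t ht => ?_,
    fun t ht => ?_⟩⟩
  · exact contDiffAt_const.mul
      ((hWsmooth.contDiffAt (isOpen_Ioo.mem_nhds (hmem t ht))).comp t (hX' t ht).1)
  · have hT0 : T 0 = 1 := by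
      simp only [T, H, C, intervalIntegral.integral_same, zero_add, sub_zero, mul_one, neg_zero,
        Real.exp_zero]
      rw [← Real.rpow_add hb]; simp
    rw [← hT0]
    exact hX 0 h0b
  · rw [mul_assoc, ← hTW _ (hmem t ht), (hX' t ht).2.2.1]
  · rw [(hX' t ht).2.2.2, (hTd _ (hmem t ht)).deriv]
    have h1 := (hWpos _ (hmem t ht)).ne'
    have h2 := (hpos' _ (hmem t ht)).2.ne'
    field_simp

end Profile

/-! ### The two ends of the moment interval -/

section Ends
open Polynomial

namespace IsProfile
variable {P A : ℝ → ℝ} {b c : ℝ} {X Q : ℝ → ℝ} {t : ℝ}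

theorem hasDerivAt_coord (h : IsProfile P A b c X Q) (ht : 0 ≤ t) :
    HasDerivAt X (deriv X t) t :=
  ((h.smooth_coord t ht).differentiableAt (by simp)).hasDerivAt

/-- The logarithmic derivative of `Q` is `1 - X`. -/
theorem mul_deriv (h : IsProfile P A b c X Q) (hc : c ≠ 0)
    (hA : ∀ x, HasDerivAt A (-(x * P x)) x) (ht : 0 ≤ t) :
    t * deriv Q t = Q t * (1 - X t) := by
  have hQ := ((h.smooth t ht).differentiableAt (by simp)).hasDerivAt
  have key : ∀ t, 0 < t → t * deriv Q t = Q t * (1 - X t) := by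
    intro t ht
    have hQ := ((h.smooth t ht.le).differentiableAt (by simp)).hasDerivAt
    have h1 := hQ.mul ((hA (X t)).comp t (h.hasDerivAt_coord ht.le))
    have h2 : HasDerivAt (fun t => c * t) c t := by
      simpa using (hasDerivAt_id t).const_mul c
    have h3 := h1.unique (h2.congr_of_eventuallyEq (by
      filter_upwards [lt_mem_nhds ht] with s hs using h.mul_eq s hs.le))
    have h4 := h.deriv_coord t ht.le
    have h5 := h.mul_eq t ht.le
    simp only [Function.comp_apply] at h3
    have h6 : deriv Q t * A (X t) = c * (1 - X t) := by
      have : Q t * (-(X t * P (X t)) * deriv X t) = X t * c := by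
        linear_combination (-X t) * h4
      linarith
    have h7 : c * (t * deriv Q t) = c * (Q t * (1 - X t)) := by
      rw [← mul_assoc, ← h5]
      linear_combination Q t * h6
    exact mul_left_cancel₀ hc h7
  rcases eq_or_lt_of_le ht with rfl | ht'
  · -- at the end point the identity holds by continuity
    have hcd : ContinuousAt (fun t => t * deriv Q t) 0 := by
      refine continuousAt_id.mul ?_
      have h2 := (h.smooth 0 le_rfl).fderiv_right (m := 0) (by simp)
      have h3 := (h2.clm_apply (contDiffAt_const (c := (1 : ℝ)))).continuousAt
      exact h3
    have hcX : ContinuousAt (fun t => Q t * (1 - X t)) 0 :=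
      (h.smooth 0 le_rfl).continuousAt.mul
        (continuousAt_const.sub (h.smooth_coord 0 le_rfl).continuousAt)
    have h1 := hcd.tendsto.mono_left (nhdsWithin_le_nhds (s := Ioi 0))
    have h2 := hcX.tendsto.mono_left (nhdsWithin_le_nhds (s := Ioi 0))
    refine tendsto_nhds_unique (h1.congr' ?_) h2
    filter_upwards [self_mem_nhdsWithin] with s hs using key s hs
  · exact key t ht'

theorem profile_pos (h : IsProfile P A b c X Q) (hc : 0 < c) (ht : 0 < t) : 0 < A (X t) := by
  have h1 := h.mul_eq t ht.le
  exact pos_of_mul_pos_right (h1 ▸ mul_pos hc ht) (h.pos t ht.le).le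

end IsProfile

/-- Two profiles which describe the same solution from the two ends of the moment interval agree, by
the uniqueness theorem for ordinary differential equations. -/
theorem profile_unique {p : ℝ[X]} {A P' A' : ℝ → ℝ} {b c c' : ℝ} {X Q X' Q' : ℝ → ℝ} (hb : 0 < b)
    (hc : c ≠ 0) (hc' : c' ≠ 0)
    (hp : ∀ x ∈ Icc (-b) 1, 0 < p.eval x) (hA : ∀ x, HasDerivAt A (-(x * p.eval x)) x)
    (h : IsProfile (fun x => p.eval x) A b c X Q) (h' : IsProfile P' A' b⁻¹ c' X' Q')
    (hP' : ∀ x, P' x = p.eval (-(b * x))) (hA' : ∀ x, A' x = (b ^ 2)⁻¹ * A (-(b * x)))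
    {t : ℝ} (ht : 0 < t) : X' (t ^ (-b)) = -(b⁻¹ * X t) := by
  obtain ⟨K, hK⟩ : ∃ K, LipschitzOnWith K (fun x => -(A x / p.eval x)) (Icc (-b) 1) := by
    refine LocallyLipschitzOn.exists_lipschitzOnWith_of_compact isCompact_Icc ?_
    refine ContDiffOn.locallyLipschitzOn (convex_Icc _ _) ?_
    have hAs : ContDiff ℝ ∞ A := by
      rw [contDiff_infty_iff_deriv]
      refine ⟨fun x => (hA x).differentiableAt, ?_⟩
      have : deriv A = fun x => -(x * p.eval x) := funext fun x => (hA x).deriv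
      rw [this]
      exact (contDiff_id.mul (contDiff_eval p)).neg
    have h1 : ContDiffOn ℝ ∞ (fun x => -(A x / p.eval x)) (Icc (-b) 1) :=
      (hAs.contDiffOn.div (contDiff_eval p).contDiffOn fun x hx => (hp x hx).ne').neg
    exact h1.of_le ENat.LEInfty.out
  have hode : ∀ {P A : ℝ → ℝ} {b c : ℝ} {X Q : ℝ → ℝ}, c ≠ 0 → (∀ x ∈ Icc (-b) 1, 0 < P x) →
      IsProfile P A b c X Q →
      ∀ y, HasDerivAt (fun y => X (Real.exp y)) (-(A (X (Real.exp y)) / P (X (Real.exp y)))) y := by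
    intro P A b c X Q hc hP h y
    have ht := (Real.exp_pos y).le
    have h1 := (h.hasDerivAt_coord ht).comp y (Real.hasDerivAt_exp y)
    refine h1.congr_deriv ?_
    have h2 := h.deriv_coord _ ht
    have h3 := h.mul_eq _ ht
    have hP0 := (hP _ (Ioc_subset_Icc_self (h.mem _ ht))).ne'
    rw [← neg_div, eq_div_iff hP0]
    refine mul_left_cancel₀ hc (mul_left_cancel₀ (h.pos _ ht).ne' ?_)
    linear_combination (c * Real.exp y) * h2 + c * h3
  have hmemIcc : ∀ y, X (Real.exp y) ∈ Icc (-b) 1 := fun y =>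
    Ioc_subset_Icc_self (h.mem _ (Real.exp_pos y).le)
  have hmem' : ∀ y, -(b * X' (Real.exp (-b * y))) ∈ Icc (-b) 1 := by
    intro y
    have h1 := h'.mem _ (Real.exp_pos (-b * y)).le
    constructor
    · nlinarith [h1.2]
    · have h2 := mul_lt_mul_of_pos_left h1.1 hb
      rw [mul_neg, mul_inv_cancel₀ hb.ne'] at h2
      linarith
  have hP'pos : ∀ x ∈ Icc (-b⁻¹) 1, 0 < P' x := by
    intro x hx
    rw [hP']
    refine hp _ ⟨by nlinarith [hx.2], ?_⟩
    have h2 := mul_le_mul_of_nonneg_left hx.1 hb.le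
    rw [mul_neg, mul_inv_cancel₀ hb.ne'] at h2
    linarith
  -- in the variable `y = log t`, both sides solve the autonomous equation `x' = -A(x) / p(x)`
  have huniq := ODE_solution_unique_univ (v := fun _ x => -(A x / p.eval x))
    (s := fun _ => Icc (-b) 1) (K := K) (t₀ := 0) (f := fun y => X (Real.exp y))
    (g := fun y => -(b * X' (Real.exp (-b * y)))) (fun _ => hK)
    (fun y => ⟨hode hc hp h y, hmemIcc y⟩) (fun y => ⟨?_, hmem' y⟩)
    (by simp [h.coord_one, h'.coord_one])
  · have h1 := congrFun huniq (Real.log t)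
    simp only [Real.exp_log ht] at h1
    rw [Real.rpow_def_of_pos ht, mul_comm (Real.log t), h1]
    field_simp
  · have h1 : HasDerivAt (fun y => -b * y) (-b) y := by
      simpa using (hasDerivAt_id y).const_mul (-b)
    have h2 := (((hode hc' hP'pos h' (-b * y)).comp y h1).const_mul b).neg
    refine h2.congr_deriv ?_
    rw [hA', hP']
    have := hb.ne'
    field_simp

/-- The parameter `a` seen from the zero section (`true`) and from the section at infinity
(`false`), where `L` is replaced by its dual. -/
def endA (a : ℝ) (s : Bool) : ℝ := bif s then a else -(a / (1 + 2 * a))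

/-- The eigenvalues of the curvature seen from the two ends. -/
def endMu {n : ℕ} (μ : Fin n → ℝ) (s : Bool) (k : Fin n) : ℝ := bif s then μ k else -μ k

/-- The polynomial weight `∏ (1 + μ_{k,a} x)`. -/
def weight {n : ℕ} (μ : Fin n → ℝ) (a : ℝ) : ℝ[X] :=
  ∏ k, (1 + Polynomial.C (μ k + a * (1 + μ k)) * Polynomial.X)

theorem eval_weight {n : ℕ} (μ : Fin n → ℝ) (a x : ℝ) :
    (weight μ a).eval x = ∏ k, (1 + (μ k + a * (1 + μ k)) * x) := by
  simp [weight, Polynomial.eval_prod]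

/-- The factors of the weight are positive: they are affine in `x`, and positive at both ends. -/
theorem weight_factor_pos {μ a : ℝ} (hμ : -1 < μ ∧ μ < 1) (ha : -(1 / 2) < a) {x : ℝ}
    (hx : x ∈ Icc (-(1 / (1 + 2 * a))) 1) : 0 < 1 + (μ + a * (1 + μ)) * x := by
  have h1 : 0 < 1 + 2 * a := by linarith
  have h2 : -1 ≤ (1 + 2 * a) * x := by
    have := mul_le_mul_of_nonneg_left hx.1 h1.le
    rwa [mul_neg, mul_one_div_cancel h1.ne'] at this
  have h3 := mul_nonneg (show 0 ≤ 1 - μ by linarith [hμ.2]) (show 0 ≤ 1 - x by linarith [hx.2])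
  have h4 := mul_nonneg (show 0 ≤ 1 + μ by linarith [hμ.1])
    (show 0 ≤ 1 + (1 + 2 * a) * x by linarith)
  have h5 := hx.2
  -- twice the factor is `(1 - μ) (1 - x) + (1 + μ) (1 + (1 + 2 a) x)`
  rcases eq_or_lt_of_le h5 with h6 | h6
  · have : 0 < (1 + μ) * (1 + (1 + 2 * a) * x) :=
      mul_pos (by linarith [hμ.1]) (by rw [h6]; linarith)
    nlinarith
  · have : 0 < (1 - μ) * (1 - x) := mul_pos (by linarith [hμ.2]) (by linarith)
    nlinarith

theorem endA_gt {a : ℝ} (ha : -(1 / 2) < a) (s : Bool) : -(1 / 2) < endA a s := by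
  cases s
  · have : 0 < 1 + 2 * a := by linarith
    simp only [endA, cond_false, neg_lt_neg_iff]
    rw [div_lt_iff₀ this]
    linarith
  · exact ha

theorem one_add_two_endA {a : ℝ} (ha : -(1 / 2) < a) : 1 + 2 * endA a false = 1 / (1 + 2 * a) := by
  have : 1 + 2 * a ≠ 0 := by linarith
  simp only [endA, cond_false]
  field_simp
  ring

theorem endMu_mem {n : ℕ} {μ : Fin n → ℝ} (hμ : ∀ k, -1 < μ k ∧ μ k < 1) (s : Bool) (k : Fin n) :
    -1 < endMu μ s k ∧ endMu μ s k < 1 := by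
  cases s
  · simp only [endMu, cond_false]
    exact ⟨by linarith [(hμ k).2], by linarith [(hμ k).1]⟩
  · exact hμ k

theorem profile_eq {n : ℕ} (μ : Fin n → ℝ) (a x : ℝ) :
    profile μ a x = -∫ s in (-(1 / (1 + 2 * a)))..x, s * (weight μ a).eval s := by
  simp only [profile, eval_weight]

theorem eval_weight_false {n : ℕ} (μ : Fin n → ℝ) {a : ℝ} (ha : -(1 / 2) < a) (x : ℝ) :
    (weight (endMu μ false) (endA a false)).eval x =
      (weight μ a).eval (-(1 / (1 + 2 * a) * x)) := by
  rw [eval_weight, eval_weight]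
  refine Finset.prod_congr rfl fun k _ => ?_
  simp only [endMu, endA, cond_false]
  obtain ⟨κ, hκ⟩ : ∃ κ, κ = 1 + 2 * a := ⟨_, rfl⟩
  have h0 : κ ≠ 0 := by linarith
  obtain rfl : a = (κ - 1) / 2 := by linarith
  rw [← hκ]
  field_simp
  ring

theorem profile_false {n : ℕ} (μ : Fin n → ℝ) {a : ℝ} (ha : -(1 / 2) < a)
    (hA : profile μ a 1 = 0) (x : ℝ) :
    profile (endMu μ false) (endA a false) x =
      ((1 / (1 + 2 * a)) ^ 2)⁻¹ * profile μ a (-(1 / (1 + 2 * a) * x)) := by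
  set b : ℝ := 1 / (1 + 2 * a) with hb
  have hb0 : b ≠ 0 := one_div_ne_zero (by linarith)
  have hcont : Continuous fun s : ℝ => s * (weight μ a).eval s :=
    continuous_id.mul (weight μ a).continuous
  -- the integral over the whole interval vanishes, so that it may start at the other end
  have h1 : ∀ y, profile μ a y = -∫ s in (1 : ℝ)..y, s * (weight μ a).eval s := by
    intro y
    rw [profile_eq] at hA ⊢
    rw [← intervalIntegral.integral_add_adjacent_intervals (hcont.intervalIntegrable _ 1)
      (hcont.intervalIntegrable 1 y)]
    linarith
  rw [h1, profile_eq, one_add_two_endA ha, ← hb]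
  have h2 : ∀ s, s * (weight (endMu μ false) (endA a false)).eval s =
      (-b)⁻¹ * ((-b * s) * (weight μ a).eval (-b * s)) := by
    intro s
    rw [eval_weight_false μ ha, ← hb, ← neg_mul]
    field_simp
  simp only [h2]
  rw [intervalIntegral.integral_const_mul,
    intervalIntegral.integral_comp_mul_left (fun s => s * (weight μ a).eval s) (neg_ne_zero.2 hb0)]
  have h3 : -b * -(1 / b) = 1 := by field_simp
  rw [h3, smul_eq_mul, ← neg_mul b x]
  field_simp

/-- The profiles at the two ends, with their relation. -/
theorem exists_profiles {n : ℕ} {μ : Fin n → ℝ} (hμ : ∀ k, -1 < μ k ∧ μ k < 1) {a : ℝ}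
    (ha : -(1 / 2) < a) (hA : profile μ a 1 = 0) : ∃ (c : Bool → ℝ) (X Q : Bool → ℝ → ℝ),
      (∀ s, 0 < c s) ∧
      (∀ s, IsProfile (fun x => (weight (endMu μ s) (endA a s)).eval x)
        (profile (endMu μ s) (endA a s)) (1 / (1 + 2 * endA a s)) (c s) (X s) (Q s)) ∧
      ∀ t, 0 < t → Q false (t ^ (-(1 / (1 + 2 * a)))) = Q true t * t ^ (-(1 / (1 + 2 * a)) - 1) := by
  set b : ℝ := 1 / (1 + 2 * a) with hb
  have hb0 : 0 < b := one_div_pos.2 (by linarith)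
  have hw : ∀ s, ∀ x ∈ Icc (-(1 / (1 + 2 * endA a s))) 1,
      0 < (weight (endMu μ s) (endA a s)).eval x := by
    intro s x hx
    rw [eval_weight]
    exact Finset.prod_pos fun k _ => weight_factor_pos (endMu_mem hμ s k) (endA_gt ha s) hx
  have hends : ∀ s, profile (endMu μ s) (endA a s) 1 = 0 := by
    intro s
    cases s
    · rw [profile_false μ ha hA, profile_eq]
      simp
    · exact hA
  have hex : ∀ s (c : ℝ), 0 < c → ∃ X Q, IsProfile
      (fun x => (weight (endMu μ s) (endA a s)).eval x)
      (profile (endMu μ s) (endA a s)) (1 / (1 + 2 * endA a s)) c X Q := fun s c hc =>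
    exists_isProfile (one_div_pos.2 (by linarith [endA_gt ha s])) hc (hw s)
      (profile_eq _ _) (hends s)
  obtain ⟨X₁, Q₁, h₁⟩ := hex true 1 one_pos
  have hc : 0 < (b ^ 2)⁻¹ := by positivity
  obtain ⟨X₂, Q₂, h₂⟩ := hex false _ hc
  refine ⟨fun s => bif s then 1 else (b ^ 2)⁻¹, fun s => bif s then X₁ else X₂,
    fun s => bif s then Q₁ else Q₂, ?_, ?_, ?_⟩
  · intro s; cases s
    · exact hc
    · exact one_pos
  · intro s; cases s
    · exact h₂
    · exact h₁
  · intro t ht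
    have hb1 : 1 / (1 + 2 * endA a false) = b⁻¹ := by rw [one_add_two_endA ha, ← hb, one_div]
    have hu := profile_unique hb0 one_ne_zero hc.ne' (hw true)
      (hasDerivAt_integral_polynomial (profile_eq μ a)) h₁ (hb1 ▸ h₂)
      (eval_weight_false μ ha) (profile_false μ ha hA) ht
    have ht' : 0 < t ^ (-b) := Real.rpow_pos_of_pos ht _
    have e1 := h₁.mul_eq t ht.le
    have e2 := h₂.mul_eq _ ht'.le
    have hpos := h₁.profile_pos one_pos ht
    rw [hu, profile_false μ ha hA, ← hb] at e2
    have h3 : -(b * -(b⁻¹ * X₁ t)) = X₁ t := by field_simp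
    rw [h3] at e2
    have h4 : Q₂ (t ^ (-b)) * profile μ a (X₁ t) = t ^ (-b) := by
      have h5 : (b ^ 2)⁻¹ ≠ 0 := hc.ne'
      apply mul_left_cancel₀ h5
      linarith
    simp only [cond_true, cond_false]
    change 0 < profile μ a (X₁ t) at hpos
    change Q₁ t * profile μ a (X₁ t) = _ at e1
    refine mul_right_cancel₀ hpos.ne' ?_
    rw [h4, mul_right_comm, e1, one_mul, Real.rpow_sub_one ht.ne']
    field_simp

end Ends

/-! ### Levi forms -/

section Levi
variable {V : Type*} [NormedAddCommGroup V] [NormedSpace ℂ V]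
  {V' : Type*} [NormedAddCommGroup V'] [NormedSpace ℂ V'] {f : V → ℝ} {z : V}

variable (V) in
/-- Multiplication by `i`, as a real linear map. -/
def mulI : V →L[ℝ] V := (Complex.I • ContinuousLinearMap.id ℂ V).restrictScalars ℝ

@[simp] theorem mulI_apply (u : V) : mulI V u = Complex.I • u := rfl

/-- The form `leviForm f` as a field of continuous bilinear forms. -/
def leviMap (f : V → ℝ) (z : V) : V →L[ℝ] V →L[ℝ] ℝ :=
  (1 / 2 : ℝ) • (fderiv ℝ (fderiv ℝ f) z +
    (fderiv ℝ (fderiv ℝ f) z).bilinearComp (mulI V) (mulI V))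

theorem leviMap_apply (f : V → ℝ) (z u v : V) :
    leviMap f z u v = (1 / 2) * (fderiv ℝ (fderiv ℝ f) z u v +
      fderiv ℝ (fderiv ℝ f) z (Complex.I • u) (Complex.I • v)) := rfl

theorem differentiableAt_fderiv (hf : ContDiffAt ℝ 2 f z) : DifferentiableAt ℝ (fderiv ℝ f) z :=
  (hf.fderiv_right (m := 1) (by norm_num)).differentiableAt (by simp)

theorem fderiv_fderiv_symm (hf : ContDiffAt ℝ 2 f z) (u v : V) :
    fderiv ℝ (fderiv ℝ f) z u v = fderiv ℝ (fderiv ℝ f) z v u :=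
  (hf.isSymmSndFDerivAt (by simp)).eq u v

theorem fderiv_fderiv_apply (hf : ContDiffAt ℝ 2 f z) (u v : V) :
    fderiv ℝ (fun y => fderiv ℝ f y u) z v = fderiv ℝ (fderiv ℝ f) z v u := by
  rw [((differentiableAt_fderiv hf).hasFDerivAt.clm_apply (hasFDerivAt_const u z)).fderiv]
  simp

theorem leviForm_eq (hf : ContDiffAt ℝ 2 f z) (u v : V) : leviForm f z u v = leviMap f z u v := by
  rw [leviForm, leviMap_apply, fderiv_fderiv_apply hf, fderiv_fderiv_apply hf,
    fderiv_fderiv_symm hf v, fderiv_fderiv_symm hf (Complex.I • v)]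

theorem leviMap_symm (hf : ContDiffAt ℝ 2 f z) (u v : V) : leviMap f z u v = leviMap f z v u := by
  rw [leviMap_apply, leviMap_apply, fderiv_fderiv_symm hf v, fderiv_fderiv_symm hf (Complex.I • v)]

theorem leviMap_I (f : V → ℝ) (z u v : V) :
    leviMap f z (Complex.I • u) (Complex.I • v) = leviMap f z u v := by
  simp only [leviMap_apply, I_smul_I_smul, map_neg, neg_apply, neg_neg]
  ring

theorem Filter.EventuallyEq.leviMap_eq {g : V → ℝ} (h : f =ᶠ[𝓝 z] g) :
    leviMap f z = leviMap g z := by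
  rw [leviMap, leviMap, h.fderiv.fderiv_eq]

theorem leviMap_comp {Φ : V' → V} {z : V'} (hf : ContDiffAt ℝ 2 f (Φ z))
    (hΦ : ContDiffAt ℂ 2 Φ z) (u v : V') :
    leviMap (fun y => f (Φ y)) z u v = leviMap f (Φ z) (fderiv ℂ Φ z u) (fderiv ℂ Φ z v) := by
  have hd : DifferentiableAt ℂ (fderiv ℂ Φ) z :=
    (hΦ.fderiv_right (m := 1) (by norm_num)).differentiableAt (by simp)
  have hev : ∀ᶠ y in 𝓝 z, DifferentiableAt ℂ Φ y ∧ DifferentiableAt ℝ f (Φ y) := by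
    have h1 := hΦ.eventually (by simp)
    have h2 := hΦ.continuousAt.eventually (hf.eventually (by simp))
    filter_upwards [h1, h2] with y h1 h2
    exact ⟨h1.differentiableAt (by simp), h2.differentiableAt (by simp)⟩
  have key : ∀ u v, fderiv ℝ (fderiv ℝ (fun y => f (Φ y))) z u v =
      fderiv ℝ (fderiv ℝ f) (Φ z) (fderiv ℂ Φ z u) (fderiv ℂ Φ z v) +
        fderiv ℝ f (Φ z) (fderiv ℂ (fderiv ℂ Φ) z u v) := by
    intro u v
    have hc : ContDiffAt ℝ 2 (fun y => f (Φ y)) z := hf.comp z (hΦ.restrict_scalars ℝ)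
    rw [← fderiv_fderiv_apply hc v u]
    have h1 : (fun y => fderiv ℝ (fun y => f (Φ y)) y v) =ᶠ[𝓝 z]
        fun y => fderiv ℝ f (Φ y) (fderiv ℂ Φ y v) := by
      filter_upwards [hev] with y hy
      have := (hy.2.hasFDerivAt.comp y (hy.1.hasFDerivAt.restrictScalars ℝ)).fderiv
      exact congrArg (fun A : V' →L[ℝ] ℝ => A v) this
    rw [h1.fderiv_eq]
    have h2 : HasFDerivAt (fun y => fderiv ℝ f (Φ y)) _ z :=
      (differentiableAt_fderiv hf).hasFDerivAt.comp z
        ((hΦ.differentiableAt (by simp)).hasFDerivAt.restrictScalars ℝ)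
    have h3 : HasFDerivAt (fun y => fderiv ℂ Φ y v) _ z :=
      (hd.hasFDerivAt.clm_apply (hasFDerivAt_const v z)).restrictScalars ℝ
    rw [(h2.clm_apply h3).fderiv]
    simp [add_comm]
  rw [leviMap_apply, leviMap_apply, key, key]
  simp only [map_smul, smul_apply, I_smul_I_smul, map_neg]
  ring

/-- The Levi form of a function whose differential is `p DU + q DV`. -/
theorem leviMap_of_fderiv {U W p q : V → ℝ} {dp dq : V →L[ℝ] ℝ}
    (hU : ContDiffAt ℝ 2 U z) (hW : ContDiffAt ℝ 2 W z)
    (h : ∀ᶠ y in 𝓝 z, fderiv ℝ f y = p y • fderiv ℝ U y + q y • fderiv ℝ W y)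
    (hp : HasFDerivAt p dp z) (hq : HasFDerivAt q dq z) (u v : V) :
    leviMap f z u v = p z * leviMap U z u v + q z * leviMap W z u v +
      (1 / 2) * (dp u * fderiv ℝ U z v + dq u * fderiv ℝ W z v +
        dp (Complex.I • u) * fderiv ℝ U z (Complex.I • v) +
        dq (Complex.I • u) * fderiv ℝ W z (Complex.I • v)) := by
  have key : ∀ u v, fderiv ℝ (fderiv ℝ f) z u v = p z * fderiv ℝ (fderiv ℝ U) z u v +
      q z * fderiv ℝ (fderiv ℝ W) z u v + dp u * fderiv ℝ U z v + dq u * fderiv ℝ W z v := by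
    intro u v
    have h1 := ((hp.smul (differentiableAt_fderiv hU).hasFDerivAt).add
      (hq.smul (differentiableAt_fderiv hW).hasFDerivAt)).congr_of_eventuallyEq h
    rw [h1.fderiv]
    simp
    ring
  rw [leviMap_apply, leviMap_apply, leviMap_apply, key, key]
  ring

/-- If a function is homogeneous of degree two for the flow of a holomorphic vector field `R`, and
invariant under the flow of `i R`, then `R` is its gradient for the Levi form. -/
theorem leviMap_euler (A : V →L[ℂ] V) (hf : ContDiffAt ℝ 2 f z)
    (h1 : ∀ᶠ y in 𝓝 z, fderiv ℝ f y (A y) = 2 * f y)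
    (h2 : ∀ᶠ y in 𝓝 z, fderiv ℝ f y (Complex.I • A y) = 0) (v : V) :
    leviMap f z (A z) v = fderiv ℝ f z v := by
  have hA : HasFDerivAt (fun y => A y) (A.restrictScalars ℝ) z :=
    (A.restrictScalars ℝ).hasFDerivAt
  have hd := (differentiableAt_fderiv hf).hasFDerivAt
  have e1 : ∀ v, fderiv ℝ (fderiv ℝ f) z v (A z) + fderiv ℝ f z (A v) = 2 * fderiv ℝ f z v := by
    intro v
    have := (hd.clm_apply hA).unique
      (((hf.differentiableAt (by simp)).hasFDerivAt.const_mul 2).congr_of_eventuallyEq h1)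
    have := congrArg (fun B : V →L[ℝ] ℝ => B v) this
    simpa [add_comm] using this
  have e2 : ∀ v, fderiv ℝ (fderiv ℝ f) z v (Complex.I • A z) + fderiv ℝ f z (Complex.I • A v) = 0 := by
    intro v
    have := (hd.clm_apply ((mulI V).hasFDerivAt.comp z hA)).unique
      ((hasFDerivAt_const (0 : ℝ) z).congr_of_eventuallyEq h2)
    have := congrArg (fun B : V →L[ℝ] ℝ => B v) this
    simpa [add_comm] using this
  have h3 := e1 v
  have h4 := e2 (Complex.I • v)
  rw [A.map_smul, I_smul_I_smul, map_neg] at h4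
  rw [leviMap_symm hf, leviMap_apply]
  linarith

variable [FiniteDimensional ℂ V]

theorem contDiffOn_leviMap {U : Set V} (hU : IsOpen U) (hf : ContDiffOn ℝ ∞ f U) :
    ContDiffOn ℝ ∞ (leviMap f) U := by
  have : FiniteDimensional ℝ V := FiniteDimensional.complexToReal V
  have h1 : ContDiffOn ℝ ∞ (fderiv ℝ (fderiv ℝ f)) U :=
    (hf.fderiv_of_isOpen hU (m := ∞) (by simp)).fderiv_of_isOpen hU (m := ∞) (by simp)
  refine contDiffOn_clm_apply.2 fun u => contDiffOn_clm_apply.2 fun v => ?_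
  simp only [leviMap_apply]
  have h2 : ∀ u v : V, ContDiffOn ℝ ∞ (fun y => fderiv ℝ (fderiv ℝ f) y u v) U := fun u v =>
    (h1.clm_apply contDiffOn_const).clm_apply contDiffOn_const
  exact contDiffOn_const.mul ((h2 u v).add (h2 _ _))

/-- The Levi form of a smooth function is a Kähler metric where it is positive. -/
theorem isKahlerOn_leviMap {U : Set V} (hU : IsOpen U) (hf : ContDiffOn ℝ ∞ f U)
    (hpos : ∀ z ∈ U, ∀ u, u ≠ 0 → 0 < leviMap f z u u) : IsKahlerOn (leviMap f) U where
  isOpen := hU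
  smooth := contDiffOn_leviMap hU hf
  symm z hz u v := leviMap_symm ((hf.contDiffAt (hU.mem_nhds hz)).of_le ENat.LEInfty.out) u v
  pos := hpos
  inv z _ u v := leviMap_I f z u v
  closed z hz u v w := by
    have hz' := hU.mem_nhds hz
    have h2 : ContDiffAt ℝ 2 (fderiv ℝ f) z :=
      ((hf.contDiffAt hz').fderiv_right (m := ∞) (by simp)).of_le ENat.LEInfty.out
    have hd : DifferentiableAt ℝ (fderiv ℝ (fderiv ℝ f)) z :=
      (h2.fderiv_right (m := 1) (by norm_num)).differentiableAt (by simp)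
    have e1 : ∀ u v w, fderiv ℝ (fderiv ℝ (fderiv ℝ f)) z u v w =
        fderiv ℝ (fderiv ℝ (fderiv ℝ f)) z v u w := fun u v w =>
      congrArg (fun B : V →L[ℝ] ℝ => B w) ((h2.isSymmSndFDerivAt (by simp)).eq u v)
    have e0 : ∀ u v w, fderiv ℝ (fun y => fderiv ℝ (fderiv ℝ f) y v w) z u =
        fderiv ℝ (fderiv ℝ (fderiv ℝ f)) z u v w := by
      intro u v w
      rw [((hd.hasFDerivAt.clm_apply (hasFDerivAt_const v z)).clm_apply
        (hasFDerivAt_const w z)).fderiv]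
      simp
    have e2 : ∀ u v w, fderiv ℝ (fderiv ℝ (fderiv ℝ f)) z u v w =
        fderiv ℝ (fderiv ℝ (fderiv ℝ f)) z u w v := by
      intro u v w
      rw [← e0, ← e0]
      congr 1
      apply Filter.EventuallyEq.fderiv_eq
      filter_upwards [hz'] with y hy
      exact fderiv_fderiv_symm ((hf.contDiffAt (hU.mem_nhds hy)).of_le ENat.LEInfty.out) _ _
    have e3 : ∀ u v w, fderiv ℝ (leviMap f) z w u v = (1 / 2) *
        (fderiv ℝ (fderiv ℝ (fderiv ℝ f)) z w u v +
          fderiv ℝ (fderiv ℝ (fderiv ℝ f)) z w (Complex.I • u) (Complex.I • v)) := by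
      intro u v w
      have hl : DifferentiableAt ℝ (leviMap f) z :=
        ((contDiffOn_leviMap hU hf).contDiffAt hz').differentiableAt (by simp)
      have h5 : fderiv ℝ (fun y => leviMap f y u v) z w = fderiv ℝ (leviMap f) z w u v := by
        rw [((hl.hasFDerivAt.clm_apply (hasFDerivAt_const u z)).clm_apply
          (hasFDerivAt_const v z)).fderiv]
        simp
      have h6 : ∀ u v : V, HasFDerivAt (fun y => fderiv ℝ (fderiv ℝ f) y u v) _ z := fun u v =>
        ((hd.hasFDerivAt.clm_apply (hasFDerivAt_const u z)).clm_apply (hasFDerivAt_const v z))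
      rw [← h5]
      simp only [leviMap_apply]
      rw [(((h6 u v).fun_add (h6 (Complex.I • u) (Complex.I • v))).const_mul (1 / 2)).fderiv]
      simp
      ring
    simp only [e3, I_smul_I_smul, map_neg, neg_apply]
    have t1 := e1 w (Complex.I • u) v
    have t2 := e2 (Complex.I • u) w v
    have t3 := e2 w u (Complex.I • v)
    have t4 := e1 w (Complex.I • v) u
    have t5 := e1 u (Complex.I • v) w
    have t6 := e2 (Complex.I • v) u w
    have t7 := e1 u v (Complex.I • w)
    have t8 := e1 w u (Complex.I • v)
    have t9 := e2 v (Complex.I • w) u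
    have t10 := e1 w v (Complex.I • u)
    have t11 := e2 u (Complex.I • w) v
    have t12 := e2 v w (Complex.I • u)
    have t13 := e1 v (Complex.I • u) w
    have t14 := e2 w v (Complex.I • u)
    have t15 := e1 u v (Complex.I • w)
    linarith

end Levi

/-! ### Hermitian linear algebra -/

section HermitianAlgebra
open Matrix
open scoped ComplexOrder

/-- If `M` has the eigenvalues `μ k` then `α + β M` has the determinant `∏ (α + β μ k)`. -/
theorem det_smul_one_add_smul {m : Type*} [Fintype m] [DecidableEq m] {ι : Type*} [Fintype ι]
    {M : Matrix m m ℂ} {μ : ι → ℂ}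
    (h : M.charpoly = ∏ k, (Polynomial.X - Polynomial.C (μ k))) (α β : ℂ) :
    (α • (1 : Matrix m m ℂ) + β • M).det = ∏ k, (α + β * μ k) := by
  have hcard : Fintype.card m = Fintype.card ι := by
    have h1 := congrArg Polynomial.natDegree h
    rwa [Matrix.charpoly_natDegree_eq_dim, Polynomial.natDegree_prod_of_monic _ _
      (fun k _ => Polynomial.monic_X_sub_C _), Finset.sum_congr rfl
      (fun k _ => Polynomial.natDegree_X_sub_C _), Finset.sum_const, smul_eq_mul, mul_one,
      Finset.card_univ] at h1
  by_cases hβ : β = 0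
  · subst hβ
    simp [hcard]
  · have h1 := congrArg (Polynomial.eval (-α / β)) h
    rw [Matrix.eval_charpoly, Polynomial.eval_prod] at h1
    have h2 : α • (1 : Matrix m m ℂ) + β • M = (-β) • (scalar m (-α / β) - M) := by
      have : scalar m (-α / β) = (-α / β) • (1 : Matrix m m ℂ) := by
        rw [Matrix.scalar_apply, Matrix.smul_one_eq_diagonal]
      rw [this, smul_sub, smul_smul]
      have : -β * (-α / β) = α := by field_simp
      rw [this, neg_smul, sub_neg_eq_add]
    rw [h2, Matrix.det_smul, h1, hcard, ← Finset.card_univ, ← Finset.prod_const,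
      ← Finset.prod_mul_distrib]
    refine Finset.prod_congr rfl fun k _ => ?_
    simp only [Polynomial.eval_sub, Polynomial.eval_X, Polynomial.eval_C]
    field_simp
    ring

theorem charpoly_neg_eq {m : Type*} [Fintype m] [DecidableEq m] {ι : Type*} [Fintype ι]
    {M : Matrix m m ℂ} {μ : ι → ℂ}
    (h : M.charpoly = ∏ k, (Polynomial.X - Polynomial.C (μ k))) :
    (-M).charpoly = ∏ k, (Polynomial.X - Polynomial.C (-μ k)) := by
  refine Polynomial.funext fun x => ?_
  have := det_smul_one_add_smul h x 1
  rw [Matrix.eval_charpoly, Polynomial.eval_prod]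
  have h1 : scalar m x - -M = x • (1 : Matrix m m ℂ) + (1 : ℂ) • M := by
    rw [sub_neg_eq_add, one_smul]
    congr 1
    rw [Matrix.scalar_apply, Matrix.smul_one_eq_diagonal]
  rw [h1, this]
  refine Finset.prod_congr rfl fun k _ => ?_
  simp

/-- A combination of two hermitian matrices, the first of them positive, is positive if its
eigenvalues with respect to the first one are. -/
theorem posDef_add_smul {m : Type*} [Fintype m] [DecidableEq m] {ι : Type*} [Fintype ι]
    {M N : Matrix m m ℂ} (hM : M.PosDef) (hN : N.IsHermitian) {μ : ι → ℝ}
    (h : (M⁻¹ * N).charpoly = ∏ k, (Polynomial.X - Polynomial.C (μ k : ℂ))) {α β : ℝ}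
    (hpos : ∀ k, 0 < α + β * μ k) :
    ((α : ℂ) • M + (β : ℂ) • N).PosDef := by
  open MatrixOrder in
  obtain ⟨B, hB, hMB⟩ := CStarAlgebra.isStrictlyPositive_iff_eq_star_mul_self.mp
    (Matrix.isStrictlyPositive_iff_posDef.2 hM)
  have hB' := (Matrix.isUnit_iff_isUnit_det B).1 hB
  have hBs : IsUnit (star B).det := (Matrix.isUnit_iff_isUnit_det _).1 hB.star
  -- `K` is hermitian and similar to `M⁻¹ N`
  set K : Matrix m m ℂ := (star B)⁻¹ * N * B⁻¹ with hK
  have hKc : K.charpoly = ∏ k, (Polynomial.X - Polynomial.C (μ k : ℂ)) := by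
    rw [← h, hMB, Matrix.mul_inv_rev, hK, Matrix.charpoly_mul_comm, Matrix.mul_assoc]
  have hinv : (B⁻¹)ᴴ = (star B)⁻¹ := by
    rw [Matrix.conjTranspose_nonsing_inv]; rfl
  have hKh : K.IsHermitian := by
    have := isHermitian_conjTranspose_mul_mul (B⁻¹) hN
    rwa [hinv] at this
  have hcomb : (α : ℂ) • M + (β : ℂ) • N =
      star B * ((α : ℂ) • (1 : Matrix m m ℂ) + (β : ℂ) • K) * B := by
    rw [Matrix.mul_add, Matrix.add_mul, Matrix.mul_smul, Matrix.mul_smul, Matrix.smul_mul,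
      Matrix.smul_mul, Matrix.mul_one, ← hMB, hK]
    congr 2
    rw [Matrix.mul_assoc, Matrix.mul_assoc, Matrix.mul_assoc, Matrix.nonsing_inv_mul _ hB',
      Matrix.mul_one, ← Matrix.mul_assoc, Matrix.mul_nonsing_inv _ hBs, Matrix.one_mul]
  rw [hcomb, Matrix.IsUnit.posDef_star_left_conjugate_iff hB]
  have hKK : ((α : ℂ) • (1 : Matrix m m ℂ) + (β : ℂ) • K).IsHermitian := by
    have h1 : star (α : ℂ) = α := Complex.conj_ofReal α
    have h2 : star (β : ℂ) = β := Complex.conj_ofReal β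
    rw [Matrix.IsHermitian, Matrix.conjTranspose_add, Matrix.conjTranspose_smul,
      Matrix.conjTranspose_smul, h1, h2, hKh.eq, Matrix.conjTranspose_one]
  rw [hKK.posDef_iff_eigenvalues_pos]
  intro i
  set e := hKK.eigenvalues i with he
  have h0 : (((α : ℂ) • (1 : Matrix m m ℂ) + (β : ℂ) • K).charpoly).eval (e : ℂ) = 0 := by
    rw [hKK.charpoly_eq, Polynomial.eval_prod]
    exact Finset.prod_eq_zero (Finset.mem_univ i) (by simp [he])
  rw [Matrix.eval_charpoly] at h0
  have h1 : scalar m (e : ℂ) - ((α : ℂ) • (1 : Matrix m m ℂ) + (β : ℂ) • K) =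
      ((e : ℂ) - α) • (1 : Matrix m m ℂ) + (-(β : ℂ)) • K := by
    have : scalar m (e : ℂ) = (e : ℂ) • (1 : Matrix m m ℂ) := by
      rw [Matrix.scalar_apply, Matrix.smul_one_eq_diagonal]
    rw [this, sub_smul, neg_smul]
    abel
  rw [h1, det_smul_one_add_smul hKc, Finset.prod_eq_zero_iff] at h0
  obtain ⟨k, -, hk⟩ := h0
  have h2 : e = α + β * μ k := by
    have : (e : ℂ) = ((α + β * μ k : ℝ) : ℂ) := by
      push_cast
      linear_combination hk
    exact_mod_cast this
  rw [h2]
  exact hpos k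

/-- If `N` has the eigenvalues `μ k` with respect to `M` then
`det (α M + β N) = det M · ∏ (α + β μ k)`. -/
theorem det_add_smul {m : Type*} [Fintype m] [DecidableEq m] {ι : Type*} [Fintype ι]
    {M N : Matrix m m ℂ} (hM : IsUnit M.det) {μ : ι → ℂ}
    (h : (M⁻¹ * N).charpoly = ∏ k, (Polynomial.X - Polynomial.C (μ k))) (α β : ℂ) :
    (α • M + β • N).det = M.det * ∏ k, (α + β * μ k) := by
  have h1 : α • M + β • N = M * (α • (1 : Matrix m m ℂ) + β • (M⁻¹ * N)) := by
    rw [Matrix.mul_add, Matrix.mul_smul, Matrix.mul_smul, Matrix.mul_one,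
      Matrix.mul_nonsing_inv_cancel_left _ _ hM]
  rw [h1, Matrix.det_mul, det_smul_one_add_smul h]

variable {V : Type*} [NormedAddCommGroup V] [NormedSpace ℂ V] {B : V →L[ℝ] V →L[ℝ] ℝ}
  {ι : Type*} [Fintype ι]

/-- The hermitian form with real part `B`. -/
def hermForm (B : V →L[ℝ] V →L[ℝ] ℝ) (u v : V) : ℂ := B u v + Complex.I * B u (Complex.I • v)

theorem hermForm_smul_left (hI : ∀ u v, B (Complex.I • u) (Complex.I • v) = B u v) (c : ℂ)
    (u v : V) : hermForm B (c • u) v = c * hermForm B u v := by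
  have h1 : ∀ u v, B (Complex.I • u) v = -B u (Complex.I • v) := by
    intro u v
    rw [← hI u (Complex.I • v), I_smul_I_smul, map_neg, neg_neg]
  have hc : c • u = c.re • u + c.im • Complex.I • u := by
    conv_lhs => rw [← Complex.re_add_im c]
    rw [add_smul, mul_smul, Complex.coe_smul, Complex.coe_smul]
  conv_rhs => rw [← Complex.re_add_im c]
  rw [hc, hermForm, hermForm]
  simp only [map_add, map_smul, _root_.add_apply, _root_.smul_apply, smul_eq_mul, h1, I_smul_I_smul, map_neg]
  push_cast
  linear_combination (-(c.im : ℂ) * B u (Complex.I • v)) * Complex.I_mul_I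

theorem hermForm_smul_right (B : V →L[ℝ] V →L[ℝ] ℝ) (c : ℂ) (u v : V) :
    hermForm B u (c • v) = (starRingEnd ℂ) c * hermForm B u v := by
  have hc : c • v = c.re • v + c.im • Complex.I • v := by
    conv_lhs => rw [← Complex.re_add_im c]
    rw [add_smul, mul_smul, Complex.coe_smul, Complex.coe_smul]
  have hcc : (starRingEnd ℂ) c = c.re - c.im * Complex.I := by
    apply Complex.ext <;> simp
  have hI : Complex.I • c • v = c.re • Complex.I • v - c.im • v := by
    rw [hc, smul_add, smul_comm Complex.I c.re, smul_comm Complex.I c.im, I_smul_I_smul, smul_neg,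
      sub_eq_add_neg]
  rw [hcc, hermForm, hermForm, hI, hc]
  simp only [map_add, map_sub, map_smul, smul_eq_mul]
  push_cast
  linear_combination ((c.im : ℂ) * B u (Complex.I • v)) * Complex.I_mul_I

theorem hermForm_self (hs : ∀ u v, B u v = B v u)
    (hI : ∀ u v, B (Complex.I • u) (Complex.I • v) = B u v) (u : V) :
    hermForm B u u = B u u := by
  have h1 := hI u (Complex.I • u)
  rw [I_smul_I_smul, map_neg, hs] at h1
  have : B u (Complex.I • u) = 0 := by linarith
  simp [hermForm, this]

theorem hermForm_sum_left (s : Finset ι) (u : ι → V) (v : V) :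
    hermForm B (∑ i ∈ s, u i) v = ∑ i ∈ s, hermForm B (u i) v := by
  simp only [hermForm, map_sum, _root_.sum_apply, Finset.sum_add_distrib,
    Finset.mul_sum, Complex.ofReal_sum]

theorem hermForm_sum_right (s : Finset ι) (u : ι → V) (v : V) :
    hermForm B v (∑ i ∈ s, u i) = ∑ i ∈ s, hermForm B v (u i) := by
  simp only [hermForm, Finset.smul_sum, map_sum, Finset.sum_add_distrib, Finset.mul_sum,
    Complex.ofReal_sum]

theorem isHermitian_hermGram (hs : ∀ u v, B u v = B v u)
    (hI : ∀ u v, B (Complex.I • u) (Complex.I • v) = B u v) (b : ι → V) :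
    (hermGram b (fun u v => B u v)).IsHermitian := by
  ext j k
  have h1 : B (b k) (Complex.I • b j) = -B (b j) (Complex.I • b k) := by
    rw [hs, ← hI, I_smul_I_smul, map_neg, _root_.neg_apply]
  simp [hermGram, Matrix.conjTranspose_apply, hs (b k) (b j), h1]

/-- The hermitian matrix of an invariant symmetric form computes its values on vectors. -/
theorem star_dotProduct_hermGram (hs : ∀ u v, B u v = B v u)
    (hI : ∀ u v, B (Complex.I • u) (Complex.I • v) = B u v) (b : ι → V) (x : ι → ℂ) :
    star x ⬝ᵥ (hermGram b (fun u v => B u v) *ᵥ x) =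
      B (∑ j, star (x j) • b j) (∑ j, star (x j) • b j) := by
  rw [← hermForm_self hs hI, hermForm_sum_left]
  simp only [hermForm_sum_right, hermForm_smul_left hI, hermForm_smul_right, dotProduct, mulVec,
    Finset.mul_sum]
  refine Finset.sum_congr rfl fun j _ => Finset.sum_congr rfl fun k _ => ?_
  have h1 : hermGram b (fun u v => B u v) j k = hermForm B (b j) (b k) := rfl
  rw [h1, starRingEnd_apply, star_star, Pi.star_apply]
  ring

theorem sum_star_smul_ne_zero (b : Module.Basis ι ℂ V) {x : ι → ℂ} (hx : x ≠ 0) :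
    ∑ j, star (x j) • b j ≠ 0 := by
  intro h
  apply hx
  ext j
  have h1 := b.linearIndependent
  rw [Fintype.linearIndependent_iff] at h1
  simpa using h1 (fun j => star (x j)) h j

theorem posDef_hermGram (hs : ∀ u v, B u v = B v u)
    (hI : ∀ u v, B (Complex.I • u) (Complex.I • v) = B u v) (b : Module.Basis ι ℂ V)
    (hpos : ∀ u, u ≠ 0 → 0 < B u u) : (hermGram b (fun u v => B u v)).PosDef := by
  refine Matrix.PosDef.of_dotProduct_mulVec_pos (isHermitian_hermGram hs hI b) fun x hx => ?_
  rw [star_dotProduct_hermGram hs hI]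
  exact_mod_cast hpos _ (sum_star_smul_ne_zero b hx)

theorem sum_star_star_repr (b : Module.Basis ι ℂ V) (u : V) :
    ∑ j, star (star (b.repr u j)) • b j = u := by
  simp only [star_star]
  exact b.sum_repr u

theorem pos_of_posDef_hermGram (hs : ∀ u v, B u v = B v u)
    (hI : ∀ u v, B (Complex.I • u) (Complex.I • v) = B u v) (b : Module.Basis ι ℂ V)
    (h : (hermGram b (fun u v => B u v)).PosDef) {u : V} (hu : u ≠ 0) : 0 < B u u := by
  have hx : (fun j => star (b.repr u j)) ≠ 0 := by
    intro h0
    apply hu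
    rw [← b.repr.map_eq_zero_iff]
    ext j
    simpa using congrFun h0 j
  have h1 := h.dotProduct_mulVec_pos hx
  rw [star_dotProduct_hermGram hs hI, sum_star_star_repr] at h1
  exact_mod_cast h1

/-- A semidefinite invariant form whose hermitian matrix has non-zero determinant is definite. -/
theorem posDef_of_nonneg_of_det [DecidableEq ι] (hs : ∀ u v, B u v = B v u)
    (hI : ∀ u v, B (Complex.I • u) (Complex.I • v) = B u v) (b : Module.Basis ι ℂ V)
    (h0 : ∀ u, 0 ≤ B u u) (hdet : (hermGram b (fun u v => B u v)).det ≠ 0) {u : V} (hu : u ≠ 0) :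
    0 < B u u := by
  refine pos_of_posDef_hermGram hs hI b ?_ hu
  refine (Matrix.PosSemidef.posDef_iff_det_ne_zero ?_).2 hdet
  refine Matrix.PosSemidef.of_dotProduct_mulVec_nonneg (isHermitian_hermGram hs hI b) fun x => ?_
  rw [star_dotProduct_hermGram hs hI]
  exact_mod_cast h0 _

/-- The determinant of a hermitian matrix which is a block matrix after a triangular change of
basis. -/
theorem det_triangular_congr {m l : Type*} [Fintype m] [DecidableEq m] [Fintype l] [DecidableEq l]
    (N : Matrix m m ℂ) (F : Matrix l l ℂ) (C C' : Matrix l m ℂ) (D D' : Matrix l l ℂ) :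
    (fromBlocks (N + Cᵀ * F * C') (Cᵀ * F * D') (D * F * C') (D * F * D')).det =
      N.det * (D.det * F.det * D'.det) := by
  have h : fromBlocks (N + Cᵀ * F * C') (Cᵀ * F * D') (D * F * C') (D * F * D') =
      fromBlocks 1 Cᵀ 0 D * fromBlocks N 0 0 F * fromBlocks 1 0 C' D' := by
    simp [Matrix.fromBlocks_multiply]
  rw [h, Matrix.det_mul, Matrix.det_mul, Matrix.det_fromBlocks_zero₂₁,
    Matrix.det_fromBlocks_zero₁₂, Matrix.det_fromBlocks_zero₁₂]
  simp
  ring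

end HermitianAlgebra

/-! ### Levi forms of logarithms of norms, and forms of rank two -/

section LeviLog
variable {V : Type*} [NormedAddCommGroup V] [NormedSpace ℂ V] {f : V → ℝ} {z : V}

theorem leviMap_lin {U W : V → ℝ} (hU : ContDiffAt ℝ 2 U z) (hW : ContDiffAt ℝ 2 W z) (α β : ℝ)
    (u v : V) : leviMap (fun y => α * U y + β * W y) z u v =
      α * leviMap U z u v + β * leviMap W z u v := by
  have h := leviMap_of_fderiv (f := fun y => α * U y + β * W y) (p := fun _ => α) (q := fun _ => β)
    hU hW ?_ (hasFDerivAt_const α z) (hasFDerivAt_const β z) u v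
  · rw [h]; simp
  · filter_upwards [hU.eventually (by simp), hW.eventually (by simp)] with y h1 h2
    exact (((h1.differentiableAt (by simp)).hasFDerivAt.const_mul α).fun_add
      ((h2.differentiableAt (by simp)).hasFDerivAt.const_mul β)).fderiv

theorem leviMap_re {h : V → ℂ} (hh : ContDiffAt ℂ 2 h z) (u v : V) :
    leviMap (fun y => (h y).re) z u v = 0 := by
  have h0 : fderiv ℝ (fun w : ℂ => w.re) = fun _ => Complex.reCLM :=
    funext fun w => Complex.reCLM.hasFDerivAt.fderiv
  rw [leviMap_comp (f := fun w : ℂ => w.re) Complex.reCLM.contDiff.contDiffAt hh, leviMap_apply, h0]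
  simp

/-- Near a point where `h ≠ 0`, `log |h|²` is the real part of a holomorphic function. -/
theorem log_normSq_eventuallyEq {h : V → ℂ} (hh : ContDiffAt ℂ ω h z) (h0 : h z ≠ 0) :
    ∃ k : V → ℂ, ContDiffAt ℂ ω k z ∧ fderiv ℂ k z = (2 / h z) • fderiv ℂ h z ∧
      (fun y => Real.log (‖h y‖ ^ 2)) =ᶠ[𝓝 z] fun y => (k y).re := by
  have h1 : HasFDerivAt (fun y => h y / h z) ((h z)⁻¹ • fderiv ℂ h z) z := by
    simpa [div_eq_mul_inv] using (hh.differentiableAt (by simp)).hasFDerivAt.mul_const (h z)⁻¹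
  have h2 : h z / h z ∈ Complex.slitPlane := by rw [div_self h0]; simp
  refine ⟨fun y => 2 * Complex.log (h y / h z) + (Real.log (‖h z‖ ^ 2) : ℝ), ?_, ?_, ?_⟩
  · exact (contDiffAt_const.mul ((Complex.contDiffAt_log h2).comp z (hh.div_const _))).add
      contDiffAt_const
  · have h3 := ((h1.clog h2).const_mul 2).add_const ((Real.log (‖h z‖ ^ 2) : ℝ) : ℂ)
    rw [h3.fderiv, div_self h0, inv_one, one_smul, smul_smul, div_eq_mul_inv]
  · filter_upwards [hh.continuousAt.eventually_ne h0] with y hy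
    have h4 : h y / h z ≠ 0 := div_ne_zero hy h0
    simp only [Complex.add_re, Complex.ofReal_re, Complex.mul_re, Complex.re_ofNat,
      Complex.im_ofNat, zero_mul, sub_zero, Complex.log_re, norm_div]
    rw [Real.log_div (norm_ne_zero_iff.2 hy) (norm_ne_zero_iff.2 h0), Real.log_pow, Real.log_pow]
    push_cast
    ring

theorem leviMap_log_normSq {h : V → ℂ} (hh : ContDiffAt ℂ ω h z) (h0 : h z ≠ 0) (u v : V) :
    leviMap (fun y => Real.log (‖h y‖ ^ 2)) z u v = 0 := by
  obtain ⟨k, hk, -, he⟩ := log_normSq_eventuallyEq hh h0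
  rw [Filter.EventuallyEq.leviMap_eq he, leviMap_re (hk.of_le (by exact_mod_cast le_top))]

theorem hasFDerivAt_log_normSq {h : V → ℂ} (hh : ContDiffAt ℂ ω h z) (h0 : h z ≠ 0) :
    HasFDerivAt (fun y => Real.log (‖h y‖ ^ 2))
      (Complex.reCLM.comp (((2 / h z) • fderiv ℂ h z).restrictScalars ℝ)) z := by
  obtain ⟨k, hk, hd, he⟩ := log_normSq_eventuallyEq hh h0
  rw [← hd]
  exact (Complex.reCLM.hasFDerivAt.comp z
    ((hk.differentiableAt (by simp)).hasFDerivAt.restrictScalars ℝ)).congr_of_eventuallyEq he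

end LeviLog

section RankTwo
open Matrix
variable {n : ℕ}

/-- The standard basis of the space of coordinates `((w, ζ), τ)`. -/
def coordBasis (n : ℕ) :
    Module.Basis (Fin n ⊕ Fin 2) ℂ ((EuclideanSpace ℂ (Fin n) × ℂ) × ℂ) :=
  ((((EuclideanSpace.basisFun (Fin n) ℂ).toBasis.prod (Module.Basis.singleton (Fin 1) ℂ)).prod
    (Module.Basis.singleton (Fin 1) ℂ)).reindex
      ((Equiv.sumAssoc _ _ _).trans ((Equiv.refl _).sumCongr finSumFinEquiv)))

theorem coordBasis_inl (j : Fin n) :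
    coordBasis n (Sum.inl j) = ((EuclideanSpace.single j 1, 0), 0) := by
  simp [coordBasis]

theorem coordBasis_zero : coordBasis n (Sum.inr 0) = ((0, 1), 0) := by
  have : (finSumFinEquiv (m := 1) (n := 1)).symm 0 = Sum.inl 0 := rfl
  simp [coordBasis, this]

theorem coordBasis_one : coordBasis n (Sum.inr 1) = ((0, 0), 1) := by
  have : (finSumFinEquiv (m := 1) (n := 1)).symm 1 = Sum.inr 0 := rfl
  simp [coordBasis, this]
  rfl

/-- A form on the space of coordinates `((w, ζ), τ)` which is the sum of a form in `w` and of a form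
of rank two in the differentials of `log |ζ|² + l₁(w)` and `log |τ|² + l₂(w)`. -/
structure IsSplitForm (B : ((EuclideanSpace ℂ (Fin n) × ℂ) × ℂ) →L[ℝ]
      ((EuclideanSpace ℂ (Fin n) × ℂ) × ℂ) →L[ℝ] ℝ)
    (N : EuclideanSpace ℂ (Fin n) →L[ℝ] EuclideanSpace ℂ (Fin n) →L[ℝ] ℝ)
    (ζ τ : ℂ) (l₁ l₂ : EuclideanSpace ℂ (Fin n) →L[ℝ] ℝ)
    (d₁ d₂ : ((EuclideanSpace ℂ (Fin n) × ℂ) × ℂ) → ℝ) (F₁ F₂ F₃ : ℝ) : Prop where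
  fst : ∀ X, d₁ X = l₁ X.1.1 + 2 * (X.1.2 / ζ).re
  snd : ∀ X, d₂ X = l₂ X.1.1 + 2 * (X.2 / τ).re
  eq : ∀ X Y, B X Y = N X.1.1 Y.1.1 + (1 / 2) *
    (F₁ * (d₁ X * d₁ Y + d₁ (Complex.I • X) * d₁ (Complex.I • Y)) +
      F₂ * (d₁ X * d₂ Y + d₁ (Complex.I • X) * d₂ (Complex.I • Y)) +
      F₂ * (d₂ X * d₁ Y + d₂ (Complex.I • X) * d₁ (Complex.I • Y)) +
      F₃ * (d₂ X * d₂ Y + d₂ (Complex.I • X) * d₂ (Complex.I • Y)))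

namespace IsSplitForm
variable {B : ((EuclideanSpace ℂ (Fin n) × ℂ) × ℂ) →L[ℝ]
      ((EuclideanSpace ℂ (Fin n) × ℂ) × ℂ) →L[ℝ] ℝ}
    {N : EuclideanSpace ℂ (Fin n) →L[ℝ] EuclideanSpace ℂ (Fin n) →L[ℝ] ℝ}
    {ζ τ : ℂ} {l₁ l₂ : EuclideanSpace ℂ (Fin n) →L[ℝ] ℝ}
    {d₁ d₂ : ((EuclideanSpace ℂ (Fin n) × ℂ) × ℂ) → ℝ} {F₁ F₂ F₃ : ℝ}

/-- A split form is positive if its base part and its `2 × 2` Hessian `(F₁, F₂; F₂, F₃)` are: the two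
differentials separate the vectors with `w` component zero. -/
theorem pos (h : IsSplitForm B N ζ τ l₁ l₂ d₁ d₂ F₁ F₂ F₃) (hζ : ζ ≠ 0) (hτ : τ ≠ 0)
    (hN : ∀ u, u ≠ 0 → 0 < N u u) (h1 : 0 < F₁) (hdet : 0 < F₁ * F₃ - F₂ ^ 2)
    {X : (EuclideanSpace ℂ (Fin n) × ℂ) × ℂ} (hX : X ≠ 0) : 0 < B X X := by
  have hquad : ∀ α β : ℝ, 0 ≤ F₁ * α ^ 2 + 2 * F₂ * α * β + F₃ * β ^ 2 ∧
      (F₁ * α ^ 2 + 2 * F₂ * α * β + F₃ * β ^ 2 = 0 → α = 0 ∧ β = 0) := by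
    intro α β
    have e : F₁ * (F₁ * α ^ 2 + 2 * F₂ * α * β + F₃ * β ^ 2) =
        (F₁ * α + F₂ * β) ^ 2 + (F₁ * F₃ - F₂ ^ 2) * β ^ 2 := by ring
    have e2 : 0 ≤ (F₁ * F₃ - F₂ ^ 2) * β ^ 2 := mul_nonneg hdet.le (sq_nonneg β)
    refine ⟨nonneg_of_mul_nonneg_right (e ▸ by positivity) h1, fun h0 => ?_⟩
    rw [h0, mul_zero] at e
    have e3 : (F₁ * F₃ - F₂ ^ 2) * β ^ 2 = 0 := by
      have := sq_nonneg (F₁ * α + F₂ * β)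
      linarith
    have hβ : β = 0 := by simpa [hdet.ne'] using e3
    subst hβ
    have e4 : (F₁ * α) ^ 2 = 0 := by simpa using e.symm
    simpa [h1.ne'] using e4
  rw [h.eq]
  obtain ⟨q1, q1'⟩ := hquad (d₁ X) (d₂ X)
  obtain ⟨q2, q2'⟩ := hquad (d₁ (Complex.I • X)) (d₂ (Complex.I • X))
  by_cases hw : X.1.1 = 0
  · rw [hw, map_zero, zero_add]
    have hne : ¬ (F₁ * d₁ X ^ 2 + 2 * F₂ * d₁ X * d₂ X + F₃ * d₂ X ^ 2 = 0 ∧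
        F₁ * d₁ (Complex.I • X) ^ 2 + 2 * F₂ * d₁ (Complex.I • X) * d₂ (Complex.I • X) +
          F₃ * d₂ (Complex.I • X) ^ 2 = 0) := by
      rintro ⟨z1, z2⟩
      obtain ⟨a1, a2⟩ := q1' z1
      obtain ⟨a3, a4⟩ := q2' z2
      rw [h.fst] at a1 a3
      rw [h.snd] at a2 a4
      simp only [Prod.smul_fst, Prod.smul_snd, hw, smul_zero, map_zero, zero_add,
        smul_eq_mul, mul_div_assoc, Complex.I_mul_re] at a1 a2 a3 a4
      have e1 : X.1.2 / ζ = 0 := Complex.ext (by simpa using a1) (by simpa using a3)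
      have e2 : X.2 / τ = 0 := Complex.ext (by simpa using a2) (by simpa using a4)
      apply hX
      ext1
      · ext1
        · exact hw
        · simpa [hζ] using e1
      · simpa [hτ] using e2
    rcases q1.lt_or_eq with h3 | h3
    · nlinarith
    · rcases q2.lt_or_eq with h4 | h4
      · nlinarith
      · exact absurd ⟨h3.symm, h4.symm⟩ hne
  · have := hN _ hw
    nlinarith

/-- The determinant of a split form is the product of the determinants of the base part and of the
Hessian, with the factor `4 / (|ζ|² |τ|²)` from the change of basis to `dw`, `∂ log ζ + …`,
`∂ log τ + …`, which is triangular. -/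
theorem det (h : IsSplitForm B N ζ τ l₁ l₂ d₁ d₂ F₁ F₂ F₃) :
    (hermGram (coordBasis n) (fun u v => B u v)).det =
      (hermMatrix (fun u v => N u v)).det *
        (((F₁ * F₃ - F₂ ^ 2) * (4 / (‖ζ‖ ^ 2 * ‖τ‖ ^ 2)) : ℝ) : ℂ) := by
  -- the complex linear forms whose real parts are the two differentials
  let θ : Fin 2 → ((EuclideanSpace ℂ (Fin n) × ℂ) × ℂ) → ℂ :=
    ![fun X => d₁ X - Complex.I * d₁ (Complex.I • X),
      fun X => d₂ X - Complex.I * d₂ (Complex.I • X)]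
  let F : Matrix (Fin 2) (Fin 2) ℂ := (1 / 2 : ℂ) • !![(F₁ : ℂ), (F₂ : ℂ); (F₂ : ℂ), (F₃ : ℂ)]
  have h00 : ∀ X, d₁ (Complex.I • Complex.I • X) = -d₁ X := by
    intro X
    rw [I_smul_I_smul, h.fst, h.fst]
    simp [neg_div]
    ring
  have h01 : ∀ X, d₂ (Complex.I • Complex.I • X) = -d₂ X := by
    intro X
    rw [I_smul_I_smul, h.snd, h.snd]
    simp [neg_div]
    ring
  have hform : ∀ X Y, hermForm B X Y = hermForm N X.1.1 Y.1.1 +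
      ∑ i, (∑ j, θ j X * F j i) * (starRingEnd ℂ) (θ i Y) := by
    intro X Y
    rw [hermForm, h.eq, h.eq, h00, h01, hermForm]
    simp only [Fin.sum_univ_two, θ, F, Matrix.cons_val_zero, Matrix.cons_val_one,
      Matrix.smul_apply, Matrix.of_apply, smul_eq_mul, Matrix.cons_val', Matrix.cons_val_fin_one,
      map_sub, map_mul, Complex.conj_ofReal, Complex.conj_I, Prod.smul_fst]
    push_cast
    linear_combination (1 / 2 : ℂ) *
      (F₁ * d₁ (Complex.I • X) * d₁ (Complex.I • Y) +
        F₂ * d₁ (Complex.I • X) * d₂ (Complex.I • Y) +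
        F₂ * d₂ (Complex.I • X) * d₁ (Complex.I • Y) +
        F₃ * d₂ (Complex.I • X) * d₂ (Complex.I • Y)) * Complex.I_mul_I
  have hv : ∀ (a : ℂ), (2 * (1 / a).re : ℂ) - Complex.I * (2 * (Complex.I / a).re : ℝ) = 2 / a := by
    intro a
    simp only [div_eq_mul_inv, one_mul]
    generalize a⁻¹ = c
    apply Complex.ext <;> simp
  have t00 : θ 0 (coordBasis n (Sum.inr 0)) = 2 / ζ := by
    rw [← hv]; simp [θ, coordBasis_zero, h.fst]
  have t01 : θ 0 (coordBasis n (Sum.inr 1)) = 0 := by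
    simp [θ, coordBasis_one, h.fst]
  have t10 : θ 1 (coordBasis n (Sum.inr 0)) = 0 := by
    simp [θ, coordBasis_zero, h.snd]
  have t11 : θ 1 (coordBasis n (Sum.inr 1)) = 2 / τ := by
    rw [← hv]; simp [θ, coordBasis_one, h.snd]
  let C : Matrix (Fin 2) (Fin n) ℂ := Matrix.of fun i j => θ i (coordBasis n (Sum.inl j))
  let D : Matrix (Fin 2) (Fin 2) ℂ := Matrix.diagonal ![2 / ζ, 2 / τ]
  have hD : ∀ i k, θ i (coordBasis n (Sum.inr k)) = D k i := by
    intro i k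
    fin_cases i <;> fin_cases k <;> simp [D, t00, t01, t10, t11]
  have hmat : hermGram (coordBasis n) (fun u v => B u v) =
      fromBlocks (hermMatrix (fun u v => N u v) + Cᵀ * F * C.map (starRingEnd ℂ))
        (Cᵀ * F * D.map (starRingEnd ℂ)) (D * F * C.map (starRingEnd ℂ))
        (D * F * D.map (starRingEnd ℂ)) := by
    have hDt : ∀ i k, D.map (starRingEnd ℂ) i k =
        (starRingEnd ℂ) (θ i (coordBasis n (Sum.inr k))) := by
      intro i k
      rw [hD, Matrix.map_apply]
      fin_cases i <;> fin_cases k <;> simp [D]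
    ext i j
    change hermForm B (coordBasis n i) (coordBasis n j) = _
    rw [hform]
    rcases i with i | i <;> rcases j with j | j
    · simp only [fromBlocks_apply₁₁, Matrix.add_apply, Matrix.mul_apply, Matrix.transpose_apply,
        Matrix.map_apply, C, Matrix.of_apply]
      congr 1
      simp only [coordBasis_inl]
      rfl
    · simp only [fromBlocks_apply₁₂, Matrix.mul_apply, Matrix.transpose_apply, hDt, C,
        Matrix.of_apply]
      have : hermForm N (coordBasis n (Sum.inl i)).1.1 (coordBasis n (Sum.inr j)).1.1 = 0 := by
        fin_cases j <;> simp [hermForm, coordBasis_zero, coordBasis_one]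
      rw [this, zero_add]
    · simp only [fromBlocks_apply₂₁, Matrix.mul_apply, Matrix.map_apply, ← hD, C,
        Matrix.of_apply]
      have : hermForm N (coordBasis n (Sum.inr i)).1.1 (coordBasis n (Sum.inl j)).1.1 = 0 := by
        fin_cases i <;> simp [hermForm, coordBasis_zero, coordBasis_one]
      rw [this, zero_add]
    · simp only [fromBlocks_apply₂₂, Matrix.mul_apply, hDt, ← hD]
      have : hermForm N (coordBasis n (Sum.inr i)).1.1 (coordBasis n (Sum.inr j)).1.1 = 0 := by
        fin_cases i <;> simp [hermForm, coordBasis_zero, coordBasis_one]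
      rw [this, zero_add]
  rw [hmat, det_triangular_congr]
  congr 1
  have hDd : D.det = 2 / ζ * (2 / τ) := by simp [D]
  have hDd' : (D.map (starRingEnd ℂ)).det = (starRingEnd ℂ) (2 / ζ * (2 / τ)) := by
    rw [← hDd]
    exact ((starRingEnd ℂ).map_det D).symm
  have hF : F.det = 1 / 4 * (F₁ * F₃ - F₂ ^ 2) := by
    simp [F, Matrix.det_fin_two]
    ring
  rw [hDd, hDd', hF]
  have hz : ∀ a : ℂ, ((‖a‖ : ℂ)) ^ 2 = a * (starRingEnd ℂ) a := fun a => (Complex.mul_conj' a).symm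
  push_cast
  rw [hz, hz, map_mul, map_div₀, map_div₀]
  simp only [map_ofNat]
  ring

end IsSplitForm
end RankTwo

/-! ### The potential of the cone metric -/

section Potential
variable {n : ℕ} {U : Set (EuclideanSpace ℂ (Fin n))} {D H : EuclideanSpace ℂ (Fin n) → ℝ}
  {μ : Fin n → ℝ} {z : (EuclideanSpace ℂ (Fin n) × ℂ) × ℂ}

/-- The data of the base in a chart with domain `U`: the determinant `D` of a Kähler–Einstein
metric, and the square norm `H` of a frame of a hermitian line bundle whose curvature has the
eigenvalues `μ`. -/
structure IsBaseData (U : Set (EuclideanSpace ℂ (Fin n))) (D H : EuclideanSpace ℂ (Fin n) → ℝ)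
    (μ : Fin n → ℝ) : Prop where
  isOpen : IsOpen U
  smooth_det : ContDiffOn ℝ ∞ D U
  smooth_norm : ContDiffOn ℝ ∞ H U
  det_pos : ∀ w ∈ U, 0 < D w
  norm_pos : ∀ w ∈ U, 0 < H w
  levi_neg : ∀ w ∈ U, ∀ u, u ≠ 0 → leviMap (fun z => Real.log (D z)) w u u < 0
  det_eq : ∀ w ∈ U, (hermMatrix fun u v => -leviMap (fun z => Real.log (D z)) w u v).det = D w
  charpoly_eq : ∀ w ∈ U, ((hermMatrix fun u v => -leviMap (fun z => Real.log (D z)) w u v)⁻¹ *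
    hermMatrix fun u v => -leviMap (fun z => Real.log (H z)) w u v).charpoly =
      ∏ k, (Polynomial.X - Polynomial.C (μ k : ℂ))

/-- The domain of the coordinates `((w, ζ), τ)` on the punctured canonical bundle. -/
def coordDomain (U : Set (EuclideanSpace ℂ (Fin n))) :
    Set ((EuclideanSpace ℂ (Fin n) × ℂ) × ℂ) := {z | z.1.1 ∈ U ∧ z.2 ≠ 0}

/-- The square norm of the point with coordinates `(w, ζ)` of the line bundle. -/
def lineNorm (H : EuclideanSpace ℂ (Fin n) → ℝ) (z : (EuclideanSpace ℂ (Fin n) × ℂ) × ℂ) : ℝ :=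
  ‖z.1.2‖ ^ 2 * H z.1.1

/-- The square norm of a point of the canonical bundle, for the metric induced from the base and
from the line bundle. -/
def canNorm (D H : EuclideanSpace ℂ (Fin n) → ℝ) (z : (EuclideanSpace ℂ (Fin n) × ℂ) × ℂ) : ℝ :=
  ‖z.2‖ ^ 2 / (D z.1.1 * H z.1.1)

/-- The combination of the two norms which is constant along the flow of `i ξ_a`. -/
def flowInvariant (a : ℝ) (D H : EuclideanSpace ℂ (Fin n) → ℝ)
    (z : (EuclideanSpace ℂ (Fin n) × ℂ) × ℂ) : ℝ := lineNorm H z * canNorm D H z ^ (-a)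

/-- The Kähler potential of the cone metric. -/
def potential (a : ℝ) (Q : ℝ → ℝ) (D H : EuclideanSpace ℂ (Fin n) → ℝ)
    (z : (EuclideanSpace ℂ (Fin n) × ℂ) × ℂ) : ℝ :=
  (canNorm D H z ^ (1 + a) * Q (flowInvariant a D H z)) ^ ((n : ℝ) + 2)⁻¹

namespace IsBaseData

theorem isOpen_coordDomain (h : IsBaseData U D H μ) : IsOpen (coordDomain U) :=
  (h.isOpen.preimage (continuous_fst.comp continuous_fst)).inter
    (isOpen_ne.preimage continuous_snd)

theorem canNorm_pos (h : IsBaseData U D H μ) (hz : z ∈ coordDomain U) : 0 < canNorm D H z :=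
  div_pos (pow_pos (norm_pos_iff.2 hz.2) 2) (mul_pos (h.det_pos _ hz.1) (h.norm_pos _ hz.1))

theorem lineNorm_nonneg (h : IsBaseData U D H μ) (hz : z ∈ coordDomain U) : 0 ≤ lineNorm H z :=
  mul_nonneg (sq_nonneg _) (h.norm_pos _ hz.1).le

theorem lineNorm_pos (h : IsBaseData U D H μ) (hz : z ∈ coordDomain U) (hζ : z.1.2 ≠ 0) :
    0 < lineNorm H z :=
  mul_pos (pow_pos (norm_pos_iff.2 hζ) 2) (h.norm_pos _ hz.1)

theorem flowInvariant_nonneg (h : IsBaseData U D H μ) (a : ℝ) (hz : z ∈ coordDomain U) :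
    0 ≤ flowInvariant a D H z :=
  mul_nonneg (h.lineNorm_nonneg hz) (Real.rpow_nonneg (h.canNorm_pos hz).le _)

theorem flowInvariant_pos (h : IsBaseData U D H μ) (a : ℝ) (hz : z ∈ coordDomain U)
    (hζ : z.1.2 ≠ 0) : 0 < flowInvariant a D H z :=
  mul_pos (h.lineNorm_pos hz hζ) (Real.rpow_pos_of_pos (h.canNorm_pos hz) _)

theorem contDiffOn_comp_base {g : EuclideanSpace ℂ (Fin n) → ℝ} (hg : ContDiffOn ℝ ∞ g U) :
    ContDiffOn ℝ ∞ (fun z : (EuclideanSpace ℂ (Fin n) × ℂ) × ℂ => g z.1.1) (coordDomain U) :=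
  hg.comp (contDiff_fst.comp contDiff_fst).contDiffOn fun _ hz => hz.1

theorem contDiffOn_canNorm (h : IsBaseData U D H μ) :
    ContDiffOn ℝ ∞ (canNorm D H) (coordDomain U) :=
  ((contDiff_norm_sq ℝ).comp contDiff_snd).contDiffOn.div
    ((contDiffOn_comp_base h.smooth_det).mul (contDiffOn_comp_base h.smooth_norm))
    fun _ hz => (mul_pos (h.det_pos _ hz.1) (h.norm_pos _ hz.1)).ne'

theorem contDiffOn_lineNorm (h : IsBaseData U D H μ) :
    ContDiffOn ℝ ∞ (lineNorm H) (coordDomain U) :=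
  ((contDiff_norm_sq ℝ).comp (contDiff_snd.comp contDiff_fst)).contDiffOn.mul
    (contDiffOn_comp_base h.smooth_norm)

theorem contDiffOn_flowInvariant (h : IsBaseData U D H μ) (a : ℝ) :
    ContDiffOn ℝ ∞ (flowInvariant a D H) (coordDomain U) :=
  h.contDiffOn_lineNorm.mul
    (h.contDiffOn_canNorm.rpow_const_of_ne fun _ hz => (h.canNorm_pos hz).ne')

/-- The differential and the Levi form of a function of `w` only. -/
theorem base_comp {g : EuclideanSpace ℂ (Fin n) → ℝ} (hg : ContDiffAt ℝ ∞ g z.1.1) :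
    ContDiffAt ℝ ∞ (fun y : (EuclideanSpace ℂ (Fin n) × ℂ) × ℂ => g y.1.1) z ∧
    (∀ X, fderiv ℝ (fun y : (EuclideanSpace ℂ (Fin n) × ℂ) × ℂ => g y.1.1) z X =
      fderiv ℝ g z.1.1 X.1.1) ∧
    ∀ X Y, leviMap (fun y : (EuclideanSpace ℂ (Fin n) × ℂ) × ℂ => g y.1.1) z X Y =
      leviMap g z.1.1 X.1.1 Y.1.1 := by
  let p : ((EuclideanSpace ℂ (Fin n) × ℂ) × ℂ) →L[ℂ] EuclideanSpace ℂ (Fin n) :=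
    (ContinuousLinearMap.fst ℂ _ _).comp (ContinuousLinearMap.fst ℂ _ _)
  refine ⟨hg.comp z (contDiff_fst.comp contDiff_fst).contDiffAt, fun X => ?_, fun X Y => ?_⟩
  · have := HasFDerivAt.comp (g := g) (f := fun y => p y) z
      (hg.differentiableAt (by simp)).hasFDerivAt (p.restrictScalars ℝ).hasFDerivAt
    exact congrArg (fun A : ((EuclideanSpace ℂ (Fin n) × ℂ) × ℂ) →L[ℝ] ℝ => A X) this.fderiv
  · have := leviMap_comp (f := g) (Φ := fun y => p y) (z := z) (hg.of_le ENat.LEInfty.out)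
      p.contDiff.contDiffAt X Y
    rwa [p.hasFDerivAt.fderiv] at this

theorem eventually_snd_ne (hζ : z.1.2 ≠ 0) : ∀ᶠ y in 𝓝 z, y.1.2 ≠ 0 :=
  ContinuousAt.eventually_ne (g := fun y : (EuclideanSpace ℂ (Fin n) × ℂ) × ℂ => y.1.2)
    (by fun_prop) hζ

/-- The differential and the Levi form of `log lineNorm`. -/
theorem log_lineNorm (h : IsBaseData U D H μ) (hz : z ∈ coordDomain U) (hζ : z.1.2 ≠ 0) :
    ContDiffAt ℝ ∞ (fun y => Real.log (lineNorm H y)) z ∧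
    (∀ X, fderiv ℝ (fun y => Real.log (lineNorm H y)) z X =
      fderiv ℝ (fun w => Real.log (H w)) z.1.1 X.1.1 + 2 * (X.1.2 / z.1.2).re) ∧
    ∀ X Y, leviMap (fun y => Real.log (lineNorm H y)) z X Y =
      leviMap (fun w => Real.log (H w)) z.1.1 X.1.1 Y.1.1 := by
  have hmem := h.isOpen_coordDomain.mem_nhds hz
  have hs : ContDiffAt ℝ ∞ (fun y => Real.log (lineNorm H y)) z :=
    (h.contDiffOn_lineNorm.contDiffAt hmem).log (h.lineNorm_pos hz hζ).ne'
  obtain ⟨s₁, d₁, l₁⟩ := base_comp (z := z) ((h.smooth_norm.contDiffAt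
    (h.isOpen.mem_nhds hz.1)).log (h.norm_pos _ hz.1).ne')
  have he : (fun y => Real.log (lineNorm H y)) =ᶠ[𝓝 z]
      fun y => 1 * Real.log (H y.1.1) + 1 * Real.log (‖y.1.2‖ ^ 2) := by
    filter_upwards [hmem, eventually_snd_ne hζ] with y hy hy0
    rw [lineNorm, Real.log_mul (pow_ne_zero 2 (norm_ne_zero_iff.2 hy0)) (h.norm_pos _ hy.1).ne']
    ring
  let p : ((EuclideanSpace ℂ (Fin n) × ℂ) × ℂ) →L[ℂ] ℂ :=
    (ContinuousLinearMap.snd ℂ _ _).comp (ContinuousLinearMap.fst ℂ _ _)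
  have hp : fderiv ℂ (fun y : (EuclideanSpace ℂ (Fin n) × ℂ) × ℂ => y.1.2) z = p :=
    p.hasFDerivAt.fderiv
  have hζs : ContDiffAt ℂ ω (fun y : (EuclideanSpace ℂ (Fin n) × ℂ) × ℂ => y.1.2) z :=
    p.contDiff.contDiffAt
  have d₂ := hasFDerivAt_log_normSq hζs hζ
  have s₂ : ContDiffAt ℝ ∞
      (fun y : (EuclideanSpace ℂ (Fin n) × ℂ) × ℂ => Real.log (‖y.1.2‖ ^ 2)) z :=
    ((contDiff_norm_sq ℝ).comp (contDiff_snd.comp contDiff_fst)).contDiffAt.log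
      (pow_ne_zero 2 (norm_ne_zero_iff.2 hζ))
  refine ⟨hs, fun X => ?_, fun X Y => ?_⟩
  · rw [he.fderiv_eq, (((s₁.differentiableAt (by simp)).hasFDerivAt.const_mul 1).fun_add
      (d₂.const_mul 1)).fderiv, hp, ← d₁]
    have e : (2 / z.1.2) * X.1.2 = 2 * (X.1.2 / z.1.2) := by ring
    simp [p, e]
  · rw [Filter.EventuallyEq.leviMap_eq he, leviMap_lin (s₁.of_le ENat.LEInfty.out)
      (s₂.of_le ENat.LEInfty.out), leviMap_log_normSq hζs hζ, l₁]
    simp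

/-- The differential and the Levi form of `log canNorm`. -/
theorem log_canNorm (h : IsBaseData U D H μ) (hz : z ∈ coordDomain U) :
    ContDiffAt ℝ ∞ (fun y => Real.log (canNorm D H y)) z ∧
    (∀ X, fderiv ℝ (fun y => Real.log (canNorm D H y)) z X =
      (-(fderiv ℝ (fun w => Real.log (D w)) z.1.1) - fderiv ℝ (fun w => Real.log (H w)) z.1.1) X.1.1
        + 2 * (X.2 / z.2).re) ∧
    ∀ X Y, leviMap (fun y => Real.log (canNorm D H y)) z X Y =
      -leviMap (fun w => Real.log (D w)) z.1.1 X.1.1 Y.1.1 -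
        leviMap (fun w => Real.log (H w)) z.1.1 X.1.1 Y.1.1 := by
  have hmem := h.isOpen_coordDomain.mem_nhds hz
  have hs : ContDiffAt ℝ ∞ (fun y => Real.log (canNorm D H y)) z :=
    (h.contDiffOn_canNorm.contDiffAt hmem).log (h.canNorm_pos hz).ne'
  obtain ⟨s₁, d₁, l₁⟩ := base_comp (z := z) ((h.smooth_norm.contDiffAt
    (h.isOpen.mem_nhds hz.1)).log (h.norm_pos _ hz.1).ne')
  obtain ⟨s₀, d₀, l₀⟩ := base_comp (z := z) ((h.smooth_det.contDiffAt
    (h.isOpen.mem_nhds hz.1)).log (h.det_pos _ hz.1).ne')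
  have he : (fun y => Real.log (canNorm D H y)) =ᶠ[𝓝 z]
      fun y => (-1) * (1 * Real.log (D y.1.1) + 1 * Real.log (H y.1.1)) +
        1 * Real.log (‖y.2‖ ^ 2) := by
    filter_upwards [hmem] with y hy
    rw [canNorm, Real.log_div (pow_ne_zero 2 (norm_ne_zero_iff.2 hy.2))
      (mul_pos (h.det_pos _ hy.1) (h.norm_pos _ hy.1)).ne',
      Real.log_mul (h.det_pos _ hy.1).ne' (h.norm_pos _ hy.1).ne']
    ring
  let p : ((EuclideanSpace ℂ (Fin n) × ℂ) × ℂ) →L[ℂ] ℂ := ContinuousLinearMap.snd ℂ _ _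
  have hp : fderiv ℂ (fun y : (EuclideanSpace ℂ (Fin n) × ℂ) × ℂ => y.2) z = p :=
    p.hasFDerivAt.fderiv
  have hζs : ContDiffAt ℂ ω (fun y : (EuclideanSpace ℂ (Fin n) × ℂ) × ℂ => y.2) z :=
    p.contDiff.contDiffAt
  have d₂ := hasFDerivAt_log_normSq hζs hz.2
  have s₂ : ContDiffAt ℝ ∞
      (fun y : (EuclideanSpace ℂ (Fin n) × ℂ) × ℂ => Real.log (‖y.2‖ ^ 2)) z :=
    ((contDiff_norm_sq ℝ).comp contDiff_snd).contDiffAt.log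
      (pow_ne_zero 2 (norm_ne_zero_iff.2 hz.2))
  refine ⟨hs, fun X => ?_, fun X Y => ?_⟩
  · rw [he.fderiv_eq, ((((((s₀.differentiableAt (by simp)).hasFDerivAt.const_mul 1).fun_add
      ((s₁.differentiableAt (by simp)).hasFDerivAt.const_mul 1)).const_mul (-1))).fun_add
      (d₂.const_mul 1)).fderiv, hp, sub_apply, neg_apply, ← d₀, ← d₁]
    have e : (2 / z.2) * X.2 = 2 * (X.2 / z.2) := by ring
    simp [p, e]
    ring
  · rw [Filter.EventuallyEq.leviMap_eq he, leviMap_lin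
      ((contDiffAt_const.mul s₀).add (contDiffAt_const.mul s₁) |>.of_le ENat.LEInfty.out)
      (s₂.of_le ENat.LEInfty.out), leviMap_log_normSq hζs hz.2, leviMap_lin
      (s₀.of_le ENat.LEInfty.out) (s₁.of_le ENat.LEInfty.out), l₀, l₁]
    ring

end IsBaseData
end Potential

/-! ### The Levi form of the potential -/

section PotentialMetric
open scoped ComplexOrder
variable {n : ℕ} {U : Set (EuclideanSpace ℂ (Fin n))} {D H : EuclideanSpace ℂ (Fin n) → ℝ}
  {μ : Fin n → ℝ} {z : (EuclideanSpace ℂ (Fin n) × ℂ) × ℂ} {a c : ℝ} {X Q : ℝ → ℝ}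

namespace IsBaseData

theorem potential_base_pos (h : IsBaseData U D H μ)
    (hQ : ∀ t, 0 ≤ t → 0 < Q t) (hz : z ∈ coordDomain U) :
    0 < canNorm D H z ^ (1 + a) * Q (flowInvariant a D H z) :=
  mul_pos (Real.rpow_pos_of_pos (h.canNorm_pos hz) _) (hQ _ (h.flowInvariant_nonneg a hz))

theorem potential_pos (h : IsBaseData U D H μ) (hQ : ∀ t, 0 ≤ t → 0 < Q t)
    (hz : z ∈ coordDomain U) : 0 < potential a Q D H z :=
  Real.rpow_pos_of_pos (h.potential_base_pos hQ hz) _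

theorem contDiffOn_potential (h : IsBaseData U D H μ) (hQ : ∀ t, 0 ≤ t → 0 < Q t)
    (hs : ∀ t, 0 ≤ t → ContDiffAt ℝ ∞ Q t) :
    ContDiffOn ℝ ∞ (potential a Q D H) (coordDomain U) := by
  refine ContDiffOn.rpow_const_of_ne ?_ fun z hz => (h.potential_base_pos hQ hz).ne'
  refine (h.contDiffOn_canNorm.rpow_const_of_ne fun _ hz => (h.canNorm_pos hz).ne').mul ?_
  intro z hz
  exact (hs _ (h.flowInvariant_nonneg a hz)).comp_contDiffWithinAt z
    (h.contDiffOn_flowInvariant a z hz)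

theorem flowInvariant_eq (h : IsBaseData U D H μ) (a : ℝ) (hz : z ∈ coordDomain U)
    (hζ : z.1.2 ≠ 0) : flowInvariant a D H z =
      Real.exp (Real.log (lineNorm H z) - a * Real.log (canNorm D H z)) := by
  rw [flowInvariant, Real.rpow_def_of_pos (h.canNorm_pos hz), sub_eq_add_neg, Real.exp_add,
    Real.exp_log (h.lineNorm_pos hz hζ)]
  ring_nf

theorem hasFDerivAt_flowInvariant (h : IsBaseData U D H μ) (a : ℝ) (hz : z ∈ coordDomain U)
    (hζ : z.1.2 ≠ 0) : HasFDerivAt (flowInvariant a D H) (flowInvariant a D H z •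
      (fderiv ℝ (fun y => Real.log (lineNorm H y)) z -
        a • fderiv ℝ (fun y => Real.log (canNorm D H y)) z)) z := by
  have h1 := ((h.log_lineNorm hz hζ).1.differentiableAt (by simp)).hasFDerivAt
  have h2 := ((h.log_canNorm hz).1.differentiableAt (by simp)).hasFDerivAt
  have h3 := (h1.fun_sub (h2.const_mul a)).exp
  rw [← h.flowInvariant_eq a hz hζ] at h3
  refine h3.congr_of_eventuallyEq ?_
  filter_upwards [h.isOpen_coordDomain.mem_nhds hz, eventually_snd_ne hζ] with y hy hy0
  exact h.flowInvariant_eq a hy hy0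

/-- The moment map `x` decreases along `log lineNorm`, at the rate `A / P`. -/
theorem hasFDerivAt_momentum (h : IsBaseData U D H μ) (hμ : ∀ k, -1 < μ k ∧ μ k < 1)
    (ha : -(1 / 2) < a) (hP : IsProfile (fun x => (weight μ a).eval x) (profile μ a)
      (1 / (1 + 2 * a)) c X Q) (hz : z ∈ coordDomain U) (hζ : z.1.2 ≠ 0) :
    HasFDerivAt (fun y => X (flowInvariant a D H y))
      (-(profile μ a (X (flowInvariant a D H z)) / (weight μ a).eval (X (flowInvariant a D H z))) •
        (fderiv ℝ (fun y => Real.log (lineNorm H y)) z -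
        a • fderiv ℝ (fun y => Real.log (canNorm D H y)) z)) z := by
  have ht := h.flowInvariant_nonneg a hz
  have h1 := (hP.hasDerivAt_coord ht).comp_hasFDerivAt z (h.hasFDerivAt_flowInvariant a hz hζ)
  refine h1.congr_fderiv ?_
  rw [smul_smul]
  congr 1
  have hP0 : 0 < (weight μ a).eval (X (flowInvariant a D H z)) := by
    rw [eval_weight]
    exact Finset.prod_pos fun k _ => weight_factor_pos (hμ k) ha
      (Ioc_subset_Icc_self (hP.mem _ ht))
  have h2 := hP.deriv_coord _ ht
  have h3 := hP.mul_eq _ ht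
  have h4 := (hP.pos _ ht).ne'
  rw [← neg_div, eq_div_iff hP0.ne']
  refine mul_left_cancel₀ h4 ?_
  linear_combination (flowInvariant a D H z) * h2 + h3

theorem hasFDerivAt_potential (h : IsBaseData U D H μ)
    (hP : IsProfile (fun x => (weight μ a).eval x) (profile μ a) (1 / (1 + 2 * a)) c X Q)
    (hc : c ≠ 0) (hz : z ∈ coordDomain U) (hζ : z.1.2 ≠ 0) :
    HasFDerivAt (potential a Q D H)
      ((potential a Q D H z * (1 - X (flowInvariant a D H z)) / (n + 2)) •
          fderiv ℝ (fun y => Real.log (lineNorm H y)) z +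
        (potential a Q D H z * (1 + a * X (flowInvariant a D H z)) / (n + 2)) •
          fderiv ℝ (fun y => Real.log (canNorm D H y)) z) z := by
  have ht := h.flowInvariant_nonneg a hz
  have heq : ∀ y ∈ coordDomain U, potential a Q D H y = Real.exp (((n : ℝ) + 2)⁻¹ *
      ((1 + a) * Real.log (canNorm D H y) + Real.log (Q (flowInvariant a D H y)))) := by
    intro y hy
    have hp := h.potential_base_pos (a := a) hP.pos hy
    rw [potential, Real.rpow_def_of_pos hp, Real.log_mul
      (Real.rpow_pos_of_pos (h.canNorm_pos hy) _).ne'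
      (hP.pos _ (h.flowInvariant_nonneg a hy)).ne', Real.log_rpow (h.canNorm_pos hy), mul_comm]
  have h1 := ((h.log_canNorm hz).1.differentiableAt (by simp)).hasFDerivAt
  have hQ := ((hP.smooth _ ht).differentiableAt (by simp)).hasDerivAt
  have h2 := (hQ.comp_hasFDerivAt z (h.hasFDerivAt_flowInvariant a hz hζ)).log (hP.pos _ ht).ne'
  have h3 := (((h1.const_mul (1 + a)).fun_add h2).const_mul ((n : ℝ) + 2)⁻¹).exp
  simp only [Function.comp_apply] at h3
  rw [← heq z hz] at h3
  refine (h3.congr_of_eventuallyEq ?_).congr_fderiv ?_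
  · filter_upwards [h.isOpen_coordDomain.mem_nhds hz] with y hy using heq y hy
  · have h4 := hP.mul_deriv hc (hasDerivAt_integral_polynomial (profile_eq μ a)) ht
    have h5 : deriv Q (flowInvariant a D H z) * flowInvariant a D H z =
        Q (flowInvariant a D H z) * (1 - X (flowInvariant a D H z)) := by rw [← h4, mul_comm]
    have h6 : (Q (flowInvariant a D H z))⁻¹ * (Q (flowInvariant a D H z) *
        (1 - X (flowInvariant a D H z))) = 1 - X (flowInvariant a D H z) :=
      inv_mul_cancel_left₀ (hP.pos _ ht).ne' _
    rw [smul_smul, smul_smul, smul_smul, mul_assoc (Q (flowInvariant a D H z))⁻¹, h5, h6]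
    module

/-- Away from the zero section, the Levi form of the potential is the sum of a form on the base and
of a form of rank two. -/
theorem isSplitForm_potential (h : IsBaseData U D H μ) (hμ : ∀ k, -1 < μ k ∧ μ k < 1)
    (ha : -(1 / 2) < a) (hP : IsProfile (fun x => (weight μ a).eval x) (profile μ a)
      (1 / (1 + 2 * a)) c X Q) (hc : c ≠ 0) (hz : z ∈ coordDomain U) (hζ : z.1.2 ≠ 0) {x f B : ℝ}
    (hx : X (flowInvariant a D H z) = x) (hf : potential a Q D H z = f)
    (hB : profile μ a x / (weight μ a).eval x = B) :
    IsSplitForm (leviMap (potential a Q D H) z)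
      ((f * (1 + a * x) / (n + 2)) • -leviMap (fun w => Real.log (D w)) z.1.1 +
        (f * ((1 + a) * x) / (n + 2)) • -leviMap (fun w => Real.log (H w)) z.1.1)
      z.1.2 z.2 (fderiv ℝ (fun w => Real.log (H w)) z.1.1)
      (-(fderiv ℝ (fun w => Real.log (D w)) z.1.1) - fderiv ℝ (fun w => Real.log (H w)) z.1.1)
      (fderiv ℝ (fun y => Real.log (lineNorm H y)) z)
      (fderiv ℝ (fun y => Real.log (canNorm D H y)) z)
      (f * ((1 - x) ^ 2 / (n + 2) ^ 2 + B / (n + 2)))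
      (f * ((1 - x) * (1 + a * x) / (n + 2) ^ 2 - a * B / (n + 2)))
      (f * ((1 + a * x) ^ 2 / (n + 2) ^ 2 + a ^ 2 * B / (n + 2))) := by
  obtain ⟨s₁, d₁, l₁⟩ := h.log_lineNorm hz hζ
  obtain ⟨s₂, d₂, l₂⟩ := h.log_canNorm hz
  refine ⟨d₁, d₂, fun Y Z => ?_⟩
  have hf' := h.hasFDerivAt_potential hP hc hz hζ
  have hx' := h.hasFDerivAt_momentum hμ ha hP hz hζ
  rw [hx, hf] at hf'
  rw [hx, hB] at hx'
  have hp := (hf'.mul (hx'.const_sub 1)).mul_const ((n : ℝ) + 2)⁻¹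
  have hq := (hf'.mul ((hx'.const_mul a).const_add 1)).mul_const ((n : ℝ) + 2)⁻¹
  have key := leviMap_of_fderiv (f := potential a Q D H)
    (U := fun y => Real.log (lineNorm H y)) (W := fun y => Real.log (canNorm D H y))
    (s₁.of_le ENat.LEInfty.out) (s₂.of_le ENat.LEInfty.out) ?_ hp hq Y Z
  · rw [key, l₁, l₂]
    simp only [hx, hf, Pi.mul_apply, add_apply, sub_apply, neg_apply, smul_apply, smul_eq_mul]
    generalize (n : ℝ) + 2 = N
    ring
  · filter_upwards [h.isOpen_coordDomain.mem_nhds hz, eventually_snd_ne hζ] with y hy hy0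
    rw [(h.hasFDerivAt_potential hP hc hy hy0).fderiv]
    simp only [Pi.mul_apply, div_eq_mul_inv]

/-- The Hessian determinant of the potential as a function of the two logarithms. -/
theorem hessian_identity (f x a B N : ℝ) (hN : N ≠ 0) :
    (f * ((1 - x) ^ 2 / N ^ 2 + B / N)) * (f * ((1 + a * x) ^ 2 / N ^ 2 + a ^ 2 * B / N)) -
      (f * ((1 - x) * (1 + a * x) / N ^ 2 - a * B / N)) ^ 2 =
        f ^ 2 * B * (1 + a) ^ 2 / N ^ 3 := by
  field_simp
  ring

/-- Away from the zero section the Levi form of the potential is positive, and its determinant is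
constant. -/
theorem leviMap_potential_of_ne (h : IsBaseData U D H μ) (hμ : ∀ k, -1 < μ k ∧ μ k < 1)
    (ha : -(1 / 2) < a) (hP : IsProfile (fun x => (weight μ a).eval x) (profile μ a)
      (1 / (1 + 2 * a)) c X Q) (hc : 0 < c) (hz : z ∈ coordDomain U) (hζ : z.1.2 ≠ 0) :
    (∀ Y, Y ≠ 0 → 0 < leviMap (potential a Q D H) z Y Y) ∧
    (hermGram (coordBasis n) (fun u v => leviMap (potential a Q D H) z u v)).det =
      ((4 * c * (1 + a) ^ 2 / ((n : ℝ) + 2) ^ (n + 3) : ℝ) : ℂ) := by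
  obtain ⟨x, hx⟩ : ∃ x, X (flowInvariant a D H z) = x := ⟨_, rfl⟩
  obtain ⟨f, hf⟩ : ∃ f, potential a Q D H z = f := ⟨_, rfl⟩
  obtain ⟨B, hB⟩ : ∃ B, profile μ a x / (weight μ a).eval x = B := ⟨_, rfl⟩
  have hs := h.isSplitForm_potential hμ ha hP hc.ne' hz hζ hx hf hB
  have ht := h.flowInvariant_pos a hz hζ
  have hxm : x ∈ Icc (-(1 / (1 + 2 * a))) 1 := hx ▸ Ioc_subset_Icc_self (hP.mem _ ht.le)
  have hA : 0 < profile μ a x := hx ▸ hP.profile_pos hc ht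
  have hfac : ∀ k, 0 < 1 + (μ k + a * (1 + μ k)) * x := fun k => weight_factor_pos (hμ k) ha hxm
  have hW : 0 < (weight μ a).eval x := by
    rw [eval_weight]
    exact Finset.prod_pos fun k _ => hfac k
  have hBpos : 0 < B := hB ▸ div_pos hA hW
  have hfpos : 0 < f := hf ▸ h.potential_pos hP.pos hz
  have hN : (0 : ℝ) < n + 2 := by positivity
  have h1a : 0 < 1 + a := by linarith
  have hLs : ∀ {g : EuclideanSpace ℂ (Fin n) → ℝ}, ContDiffOn ℝ ∞ g U → (∀ w ∈ U, 0 < g w) →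
      ContDiffAt ℝ 2 (fun w => Real.log (g w)) z.1.1 := fun hg hp =>
    ((hg.contDiffAt (h.isOpen.mem_nhds hz.1)).log (hp _ hz.1).ne').of_le ENat.LEInfty.out
  have hD2 := hLs h.smooth_det h.det_pos
  have hH2 := hLs h.smooth_norm h.norm_pos
  set GD : EuclideanSpace ℂ (Fin n) →L[ℝ] EuclideanSpace ℂ (Fin n) →L[ℝ] ℝ :=
    -leviMap (fun w => Real.log (D w)) z.1.1 with hGD
  set GH : EuclideanSpace ℂ (Fin n) →L[ℝ] EuclideanSpace ℂ (Fin n) →L[ℝ] ℝ :=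
    -leviMap (fun w => Real.log (H w)) z.1.1 with hGH
  have sD : ∀ u v, GD u v = GD v u := fun u v => by
    simp only [hGD, neg_apply, leviMap_symm hD2 u]
  have sH : ∀ u v, GH u v = GH v u := fun u v => by
    simp only [hGH, neg_apply, leviMap_symm hH2 u]
  have iD : ∀ u v, GD (Complex.I • u) (Complex.I • v) = GD u v := fun u v => by
    simp only [hGD, neg_apply, leviMap_I]
  have iH : ∀ u v, GH (Complex.I • u) (Complex.I • v) = GH u v := fun u v => by
    simp only [hGH, neg_apply, leviMap_I]
  let e := (EuclideanSpace.basisFun (Fin n) ℂ).toBasis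
  have he : ∀ G : EuclideanSpace ℂ (Fin n) →L[ℝ] EuclideanSpace ℂ (Fin n) →L[ℝ] ℝ,
      hermGram e (fun u v => G u v) = hermMatrix (fun u v => G u v) := by
    intro G
    ext i j
    simp [hermGram, hermMatrix, e]
  set α := f * (1 + a * x) / ((n : ℝ) + 2) with hα
  set β := f * ((1 + a) * x) / ((n : ℝ) + 2) with hβ
  have hmat : hermMatrix (fun u v => (α • GD + β • GH) u v) =
      (α : ℂ) • hermMatrix (fun u v => GD u v) + (β : ℂ) • hermMatrix (fun u v => GH u v) := by
    ext i j
    simp only [hermMatrix, Matrix.of_apply, Matrix.add_apply, Matrix.smul_apply, add_apply,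
      smul_apply, smul_eq_mul]
    push_cast
    ring
  have hfac' : ∀ k, α + β * μ k = f / (n + 2) * (1 + (μ k + a * (1 + μ k)) * x) := fun k => by
    rw [hα, hβ]
    ring
  have hposD : (hermMatrix (fun u v => GD u v)).PosDef := by
    rw [← he]
    refine posDef_hermGram sD iD e fun u hu => ?_
    have := h.levi_neg _ hz.1 u hu
    simp only [hGD, neg_apply]
    linarith
  have hcp : ((hermMatrix (fun u v => GD u v))⁻¹ * hermMatrix (fun u v => GH u v)).charpoly =
      ∏ k, (Polynomial.X - Polynomial.C (μ k : ℂ)) := h.charpoly_eq _ hz.1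
  have hpos : (hermMatrix (fun u v => (α • GD + β • GH) u v)).PosDef := by
    rw [hmat]
    refine posDef_add_smul hposD ?_ hcp fun k => ?_
    · rw [← he]
      exact isHermitian_hermGram sH iH e
    · rw [hfac']
      exact mul_pos (div_pos hfpos hN) (hfac k)
  have hident := hessian_identity f x a B (n + 2) hN.ne'
  constructor
  · intro Y hY
    refine hs.pos hζ hz.2 (fun u hu => ?_) ?_ ?_ hY
    · refine pos_of_posDef_hermGram (fun u v => ?_) (fun u v => ?_) e ((he _) ▸ hpos) hu
      · simp only [add_apply, smul_apply, sD u, sH u]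
      · simp only [add_apply, smul_apply, iD, iH]
    · have : 0 < B / ((n : ℝ) + 2) := div_pos hBpos hN
      positivity
    · rw [hident]
      positivity
  · rw [hs.det, hident, hmat, det_add_smul ((Matrix.isUnit_iff_isUnit_det _).1 hposD.isUnit) hcp]
    have hdetD : (hermMatrix (fun u v => GD u v)).det = D z.1.1 := h.det_eq _ hz.1
    have hprod : ∏ k, ((α : ℂ) + (β : ℂ) * (μ k : ℂ)) =
        (((f / (n + 2)) ^ n * (weight μ a).eval x : ℝ) : ℂ) := by
      have : ∀ k, ((α : ℂ) + (β : ℂ) * (μ k : ℂ)) = ((α + β * μ k : ℝ) : ℂ) := fun k => by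
        push_cast; ring
      simp only [this, hfac']
      rw [← Complex.ofReal_prod, Finset.prod_mul_distrib, Finset.prod_const, Finset.card_univ,
        Fintype.card_fin, eval_weight]
    rw [hdetD, hprod, ← Complex.ofReal_mul, ← Complex.ofReal_mul]
    congr 1
    -- the defining relation `Q A = c t` of the profile turns the power of the potential into norms
    have hfp : f ^ (n + 2) * profile μ a x = c * (‖z.2‖ ^ 2 * ‖z.1.2‖ ^ 2 / D z.1.1) := by
      have e1 : f ^ (n + 2) = canNorm D H z ^ (1 + a) * Q (flowInvariant a D H z) := by
        rw [← hf, potential, ← Real.rpow_natCast, ← Real.rpow_mul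
          (h.potential_base_pos hP.pos hz).le]
        push_cast
        rw [inv_mul_cancel₀ hN.ne', Real.rpow_one]
      have e2 := hP.mul_eq _ ht.le
      rw [hx] at e2
      rw [e1, mul_assoc, e2, flowInvariant, Real.rpow_add (h.canNorm_pos hz), Real.rpow_one,
        Real.rpow_neg (h.canNorm_pos hz).le]
      have h3 := (Real.rpow_pos_of_pos (h.canNorm_pos hz) a).ne'
      have h4 := (h.det_pos _ hz.1).ne'
      have h5 := (h.norm_pos _ hz.1).ne'
      field_simp
      rw [canNorm, lineNorm]
      field_simp
    have hB' : (weight μ a).eval x * B = profile μ a x := by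
      rw [← hB, mul_div_cancel₀ _ hW.ne']
    have h4 := (h.det_pos _ hz.1).ne'
    have h5 := norm_ne_zero_iff.2 hζ
    have h6 := norm_ne_zero_iff.2 hz.2
    have h7 : f ^ (n + 2) * ((weight μ a).eval x * B) * D z.1.1 =
        c * (‖z.2‖ ^ 2 * ‖z.1.2‖ ^ 2) := by
      rw [hB', hfp]
      field_simp
    have h8 : D z.1.1 * ((f / ((n : ℝ) + 2)) ^ n * (weight μ a).eval x) *
        (f ^ 2 * B * (1 + a) ^ 2 / ((n : ℝ) + 2) ^ 3 * (4 / (‖z.1.2‖ ^ 2 * ‖z.2‖ ^ 2))) =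
        (f ^ (n + 2) * ((weight μ a).eval x * B) * D z.1.1) * (4 * (1 + a) ^ 2) /
          (((n : ℝ) + 2) ^ (n + 3) * (‖z.2‖ ^ 2 * ‖z.1.2‖ ^ 2)) := by
      rw [div_pow, pow_add, pow_add]
      field_simp
    rw [h8, h7]
    field_simp

/-- The Levi form of the potential is a Kähler metric with constant determinant. On the zero section
this follows by continuity: a semidefinite form with non-zero determinant is definite. -/
theorem leviMap_potential (h : IsBaseData U D H μ) (hμ : ∀ k, -1 < μ k ∧ μ k < 1)
    (ha : -(1 / 2) < a) (hP : IsProfile (fun x => (weight μ a).eval x) (profile μ a)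
      (1 / (1 + 2 * a)) c X Q) (hc : 0 < c) (hz : z ∈ coordDomain U) :
    (∀ Y, Y ≠ 0 → 0 < leviMap (potential a Q D H) z Y Y) ∧
    (hermGram (coordBasis n) (fun u v => leviMap (potential a Q D H) z u v)).det =
      ((4 * c * (1 + a) ^ 2 / ((n : ℝ) + 2) ^ (n + 3) : ℝ) : ℂ) := by
  have hf := h.contDiffOn_potential (a := a) hP.pos hP.smooth
  have hcont : ∀ u v, ContinuousAt (fun y => leviMap (potential a Q D H) y u v) z := fun u v =>
    ((((contDiffOn_leviMap h.isOpen_coordDomain hf).contDiffAt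
      (h.isOpen_coordDomain.mem_nhds hz)).clm_apply contDiffAt_const).clm_apply
        contDiffAt_const).continuousAt
  -- approach `z` from points with `ζ ≠ 0`
  have hcurve : Filter.Tendsto (fun ε : ℂ => ((z.1.1, z.1.2 + ε), z.2)) (𝓝[≠] 0) (𝓝 z) := by
    have : ContinuousAt (fun ε : ℂ => ((z.1.1, z.1.2 + ε), z.2)) 0 := by fun_prop
    have h2 := this.tendsto
    simp only [add_zero] at h2
    exact h2.mono_left nhdsWithin_le_nhds
  have hev : ∀ᶠ ε : ℂ in 𝓝[≠] 0, ((z.1.1, z.1.2 + ε), z.2) ∈ coordDomain U ∧ z.1.2 + ε ≠ 0 := by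
    have h1 : ∀ᶠ ε : ℂ in 𝓝[≠] 0, z.1.2 + ε ≠ 0 := by
      by_cases h0 : z.1.2 = 0
      · filter_upwards [self_mem_nhdsWithin] with ε hε
        simpa [h0] using hε
      · have : ContinuousAt (fun ε : ℂ => z.1.2 + ε) 0 := by fun_prop
        exact (this.eventually_ne (by simpa using h0)).filter_mono nhdsWithin_le_nhds
    filter_upwards [h1] with ε hε
    exact ⟨hz, hε⟩
  have hdet : (hermGram (coordBasis n) (fun u v => leviMap (potential a Q D H) z u v)).det =
      ((4 * c * (1 + a) ^ 2 / ((n : ℝ) + 2) ^ (n + 3) : ℝ) : ℂ) := by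
    have h1 : ContinuousAt (fun y => (hermGram (coordBasis n)
        (fun u v => leviMap (potential a Q D H) y u v)).det) z := by
      have h2 : ContinuousAt (fun y => hermGram (coordBasis n)
          (fun u v => leviMap (potential a Q D H) y u v)) z := by
        refine continuousAt_pi.2 fun i => continuousAt_pi.2 fun j => ?_
        exact (Complex.continuous_ofReal.continuousAt.comp (hcont _ _)).add
          (continuousAt_const.mul (Complex.continuous_ofReal.continuousAt.comp (hcont _ _)))
      exact (Continuous.matrix_det continuous_id).continuousAt.comp h2
    refine tendsto_nhds_unique (h1.tendsto.comp hcurve) (tendsto_const_nhds.congr' ?_)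
    filter_upwards [hev] with ε hε
    exact (h.leviMap_potential_of_ne hμ ha hP hc hε.1 hε.2).2.symm
  have hz2 : ContDiffAt ℝ 2 (potential a Q D H) z :=
    (hf.contDiffAt (h.isOpen_coordDomain.mem_nhds hz)).of_le ENat.LEInfty.out
  refine ⟨fun Y hY => posDef_of_nonneg_of_det (leviMap_symm hz2) (leviMap_I _ z) (coordBasis n)
    (fun Y => ?_) ?_ hY, hdet⟩
  · by_cases hY : Y = 0
    · simp [hY]
    · refine ge_of_tendsto ((hcont Y Y).tendsto.comp hcurve) ?_
      filter_upwards [hev] with ε hε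
      exact ((h.leviMap_potential_of_ne hμ ha hP hc hε.1 hε.2).1 Y hY).le
  · rw [hdet]
    have : (0 : ℝ) < 4 * c * (1 + a) ^ 2 / ((n : ℝ) + 2) ^ (n + 3) := by
      have : 0 < 1 + a := by linarith
      positivity
    exact_mod_cast this.ne'

/-- The Kähler metric given by the potential. -/
theorem isKahlerOn_potential (h : IsBaseData U D H μ) (hμ : ∀ k, -1 < μ k ∧ μ k < 1)
    (ha : -(1 / 2) < a) (hP : IsProfile (fun x => (weight μ a).eval x) (profile μ a)
      (1 / (1 + 2 * a)) c X Q) (hc : 0 < c) :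
    IsKahlerOn (leviMap (potential a Q D H)) (coordDomain U) :=
  isKahlerOn_leviMap h.isOpen_coordDomain (h.contDiffOn_potential hP.pos hP.smooth)
    fun _ hz => (h.leviMap_potential hμ ha hP hc hz).1

/-- The Kähler metric given by the potential is Ricci flat, because its determinant is constant. -/
theorem ricciForm_potential (h : IsBaseData U D H μ) (hμ : ∀ k, -1 < μ k ∧ μ k < 1)
    (ha : -(1 / 2) < a) (hP : IsProfile (fun x => (weight μ a).eval x) (profile μ a)
      (1 / (1 + 2 * a)) c X Q) (hc : 0 < c) (hz : z ∈ coordDomain U)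
    (u v : (EuclideanSpace ℂ (Fin n) × ℂ) × ℂ) :
    ricciForm (leviMap (potential a Q D H)) z u v = 0 := by
  have hK := h.isKahlerOn_potential hμ ha hP hc
  have h0 : (0 : ℝ) < 4 * c * (1 + a) ^ 2 / ((n : ℝ) + 2) ^ (n + 3) := by
    have : 0 < 1 + a := by linarith
    positivity
  exact hK.ricciForm_eq_zero (fun z hz v => hK.trace_connMap (coordBasis n)
    (c := ((4 * c * (1 + a) ^ 2 / ((n : ℝ) + 2) ^ (n + 3) : ℝ) : ℂ)) (by exact_mod_cast h0.ne')
    (fun y hy => (h.leviMap_potential hμ ha hP hc hy).2) hz v) hz u v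

end IsBaseData
end PotentialMetric

/-! ### Riemannian metrics given in charts -/

section MetricCharts
variable {F : Type*} [NormedAddCommGroup F] [NormedSpace ℝ F] {Y : Type*} [TopologicalSpace Y]
  [ChartedSpace F Y] [IsManifold 𝓘(ℝ, F) ∞ Y]

/-- The change of coordinates from the preferred chart at `x` to the one at `x'`. -/
def chartTrans (F : Type*) [NormedAddCommGroup F] {Y : Type*} [TopologicalSpace Y]
  [ChartedSpace F Y] (x x' : Y) (y : F) : F := chartAt F x' ((chartAt F x).symm y)

theorem contDiffAt_chart_trans {φ φ' : OpenPartialHomeomorph Y F}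
    (hφ : φ ∈ IsManifold.maximalAtlas 𝓘(ℝ, F) ∞ Y) (hφ' : φ' ∈ IsManifold.maximalAtlas 𝓘(ℝ, F) ∞ Y)
    {y : F} (hy : y ∈ φ.target) (hy' : φ.symm y ∈ φ'.source) :
    ContDiffAt ℝ ∞ (fun z => φ' (φ.symm z)) y :=
  contMDiffAt_iff_contDiffAt.1 (ContMDiffAt.comp y (contMDiffAt_of_mem_maximalAtlas hφ' hy')
    ((contMDiffOn_symm_of_mem_maximalAtlas hφ).contMDiffAt (φ.open_target.mem_nhds hy)))

theorem trivializationAt_symm {x₀ x : Y} (hx : x ∈ (chartAt F x₀).source) (v : F) :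
    (trivializationAt F (TangentSpace 𝓘(ℝ, F)) x₀).symm x v =
      (fderiv ℝ (chartTrans F x₀ x) (chartAt F x₀ x) v : F) := by
  have h := TangentBundle.symmL_trivializationAt_eq_core (I := 𝓘(ℝ, F)) hx
  have h2 := congrArg (fun A : F →L[ℝ] F => A v) h
  refine Eq.trans ?_ (h2.trans ?_)
  · exact ((trivializationAt F (TangentSpace 𝓘(ℝ, F)) x₀).symmL_apply (R := ℝ) (by simpa using hx) v).symm
  · rw [tangentBundleCore_coordChange_achart]
    simp
    rfl

theorem mfderiv_symm_eq {φ : OpenPartialHomeomorph Y F}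
    (hφ : φ ∈ IsManifold.maximalAtlas 𝓘(ℝ, F) ∞ Y) {y : F} (hy : y ∈ φ.target) (v : F) :
    mfderiv 𝓘(ℝ, F) 𝓘(ℝ, F) φ.symm y v =
      (fderiv ℝ (fun z => chartAt F (φ.symm y) (φ.symm z)) y v : F) := by
  have h1 : MDifferentiableAt 𝓘(ℝ, F) 𝓘(ℝ, F) φ.symm y :=
    ((contMDiffOn_symm_of_mem_maximalAtlas hφ).contMDiffAt
      (φ.open_target.mem_nhds hy)).mdifferentiableAt (by simp)
  have h2 := congrArg (fun A : F →L[ℝ] F => A v) h1.mfderiv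
  refine h2.trans ?_
  have h3 : (fderivWithin ℝ (writtenInExtChartAt 𝓘(ℝ, F) 𝓘(ℝ, F) y φ.symm) (range 𝓘(ℝ, F))
      (extChartAt 𝓘(ℝ, F) y y) : F →L[ℝ] F) =
        fderiv ℝ (fun z => chartAt F (φ.symm y) (φ.symm z)) y := by
    simp [writtenInExtChartAt]
    rfl
  exact congrArg (fun A : F →L[ℝ] F => A v) h3

theorem inCoordinates_tangent {x₀ x : Y} (hx : x ∈ (chartAt F x₀).source)
    (B : TangentSpace 𝓘(ℝ, F) x →L[ℝ] TangentSpace 𝓘(ℝ, F) x →L[ℝ] ℝ) (u v : F) :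
    (ContinuousLinearMap.inCoordinates F (TangentSpace 𝓘(ℝ, F)) (F →L[ℝ] ℝ)
      (fun y : Y => TangentSpace 𝓘(ℝ, F) y →L[ℝ] ℝ) x₀ x x₀ x B : F →L[ℝ] F →L[ℝ] ℝ) u v =
      B (fderiv ℝ (chartTrans F x₀ x) (chartAt F x₀ x) u : F)
        (fderiv ℝ (chartTrans F x₀ x) (chartAt F x₀ x) v : F) := by
  rw [← trivializationAt_symm hx u, ← trivializationAt_symm hx v]
  have h := inCoordinates_apply_eq₂ (𝕜 := ℝ) (F₁ := F) (F₂ := F) (F₃ := ℝ)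
    (E₁ := fun y : Y => TangentSpace 𝓘(ℝ, F) y) (E₂ := fun y : Y => TangentSpace 𝓘(ℝ, F) y)
    (E₃ := Bundle.Trivial Y ℝ) (x₀ := x₀) (x := x) (ϕ := B) (v := u) (w := v)
    (by simpa using hx) (by simpa using hx) (mem_univ x)
  exact h.trans (by simp)

/-- A positive definite form on a finite dimensional space has bounded unit ball. -/
theorem isVonNBounded_unitBall [FiniteDimensional ℝ F] (B : F →L[ℝ] F →L[ℝ] ℝ)
    (hB : ∀ v, v ≠ 0 → 0 < B v v) : Bornology.IsVonNBounded ℝ {v : F | B v v < 1} := by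
  have hc : Continuous fun v : F => B v v := B.continuous.clm_apply continuous_id
  rw [NormedSpace.isVonNBounded_iff]
  obtain ⟨m, hm, hle⟩ : ∃ m, 0 < m ∧ ∀ v : F, m * ‖v‖ ^ 2 ≤ B v v := by
    rcases (Metric.sphere (0 : F) 1).eq_empty_or_nonempty with h0 | h0
    · refine ⟨1, one_pos, fun v => ?_⟩
      have hv : v = 0 := by
        by_contra hv
        have : (‖v‖⁻¹ • v) ∈ Metric.sphere (0 : F) 1 := by
          simp [norm_smul, norm_ne_zero_iff.2 hv]
        rw [h0] at this
        exact this
      simp [hv]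
    · obtain ⟨v₀, hv₀, hmin⟩ := (isCompact_sphere (0 : F) 1).exists_isMinOn h0 hc.continuousOn
      have hv₀' : v₀ ≠ 0 := by
        rintro rfl
        simp at hv₀
      refine ⟨B v₀ v₀, hB _ hv₀', fun v => ?_⟩
      by_cases hv : v = 0
      · simp [hv]
      · have hn := norm_ne_zero_iff.2 hv
        have h1 : (‖v‖⁻¹ • v) ∈ Metric.sphere (0 : F) 1 := by
          simp [norm_smul, hn]
        have h2 : B v₀ v₀ ≤ B (‖v‖⁻¹ • v) (‖v‖⁻¹ • v) := hmin h1
        simp only [map_smul, smul_apply, smul_eq_mul] at h2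
        have h3 := mul_le_mul_of_nonneg_right h2 (sq_nonneg ‖v‖)
        refine h3.trans (le_of_eq ?_)
        field_simp
  refine (Metric.isBounded_iff_subset_closedBall 0).2 ⟨Real.sqrt m⁻¹, fun v hv => ?_⟩
  rw [mem_closedBall_zero_iff]
  refine Real.le_sqrt_of_sq_le ?_
  have h1 := hle v
  have h2 : m * ‖v‖ ^ 2 < 1 := h1.trans_lt hv
  rw [← one_div, le_div_iff₀ hm]
  linarith

/-- The metric given by its expressions `G x` in the preferred charts at the points `x`. -/
def metricOfCharts [FiniteDimensional ℝ F] (G : Y → F → F →L[ℝ] F →L[ℝ] ℝ)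
    (hs : ∀ x, ContDiffOn ℝ ∞ (G x) (chartAt F x).target)
    (hsymm : ∀ x u v, G x (chartAt F x x) u v = G x (chartAt F x x) v u)
    (hpos : ∀ x u, u ≠ 0 → 0 < G x (chartAt F x x) u u)
    (hG : ∀ x₀ x, x ∈ (chartAt F x₀).source → ∀ u v, G x₀ (chartAt F x₀ x) u v =
      G x (chartAt F x x) (fderiv ℝ (chartTrans F x₀ x) (chartAt F x₀ x) u)
        (fderiv ℝ (chartTrans F x₀ x) (chartAt F x₀ x) v)) : Metric F Y where
  inner x := (G x (chartAt F x x) : F →L[ℝ] F →L[ℝ] ℝ)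
  symm x u v := hsymm x u v
  pos x u hu := hpos x u hu
  isVonNBounded x := isVonNBounded_unitBall (G x (chartAt F x x)) (hpos x)
  contMDiff := by
    intro x₀
    rw [contMDiffAt_hom_bundle]
    refine ⟨contMDiffAt_id, ?_⟩
    have h1 : ContMDiffAt 𝓘(ℝ, F) 𝓘(ℝ, F →L[ℝ] F →L[ℝ] ℝ) ∞
        (fun x => G x₀ (chartAt F x₀ x)) x₀ := by
      refine ContMDiffAt.comp x₀ (I' := 𝓘(ℝ, F)) (g := G x₀) ?_ ?_
      · exact ((hs x₀).contDiffAt ((chartAt F x₀).open_target.mem_nhds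
          (mem_chart_target F x₀))).contMDiffAt
      · exact contMDiffAt_of_mem_maximalAtlas (IsManifold.chart_mem_maximalAtlas x₀)
          (mem_chart_source F x₀)
    refine h1.congr_of_eventuallyEq ?_
    filter_upwards [(chartAt F x₀).open_source.mem_nhds (mem_chart_source F x₀)] with x hx
    ext u v
    refine (inCoordinates_tangent hx (G x (chartAt F x x)) u v).trans (hG x₀ x hx u v).symm

theorem inChart_metricOfCharts [FiniteDimensional ℝ F] (G : Y → F → F →L[ℝ] F →L[ℝ] ℝ)
    (hs hsymm hpos hG) (x₀ : Y) {y : F} (hy : y ∈ (chartAt F x₀).target) (u v : F) :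
    (metricOfCharts G hs hsymm hpos hG).inChart (chartAt F x₀) y u v = G x₀ y u v := by
  have h := hG x₀ _ ((chartAt F x₀).map_target hy) u v
  rw [(chartAt F x₀).right_inv hy] at h
  rw [h, Metric.inChart, mfderiv_symm_eq (IsManifold.chart_mem_maximalAtlas x₀) hy,
    mfderiv_symm_eq (IsManifold.chart_mem_maximalAtlas x₀) hy]
  rfl

theorem Metric.contDiffOn_inChart (g : Metric F Y) {φ : OpenPartialHomeomorph Y F}
    (hφ : φ ∈ IsManifold.maximalAtlas 𝓘(ℝ, F) ∞ Y) (u v : F) :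
    ContDiffOn ℝ ∞ (fun y => g.inChart φ y u v) φ.target := by
  intro y₀ hy₀
  refine ContDiffAt.contDiffWithinAt ?_
  set x₁ := φ.symm y₀ with hx₁
  have h1 := g.contMDiff x₁
  rw [contMDiffAt_hom_bundle] at h1
  have hφs : ContMDiffAt 𝓘(ℝ, F) 𝓘(ℝ, F) ∞ φ.symm y₀ :=
    (contMDiffOn_symm_of_mem_maximalAtlas hφ).contMDiffAt (φ.open_target.mem_nhds hy₀)
  have h2 : ContDiffAt ℝ ∞ (fun z => (ContinuousLinearMap.inCoordinates F (TangentSpace 𝓘(ℝ, F))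
      (F →L[ℝ] ℝ) (fun y : Y => TangentSpace 𝓘(ℝ, F) y →L[ℝ] ℝ) x₁ (φ.symm z) x₁ (φ.symm z)
        (g.inner (φ.symm z)) : F →L[ℝ] F →L[ℝ] ℝ)) y₀ :=
    contMDiffAt_iff_contDiffAt.1 (ContMDiffAt.comp y₀ (g := fun x =>
      (ContinuousLinearMap.inCoordinates F (TangentSpace 𝓘(ℝ, F))
      (F →L[ℝ] ℝ) (fun y : Y => TangentSpace 𝓘(ℝ, F) y →L[ℝ] ℝ) x₁ x x₁ x
        (g.inner x) : F →L[ℝ] F →L[ℝ] ℝ)) h1.2 hφs)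
  have hψ : ContDiffAt ℝ ∞ (fun z => chartAt F x₁ (φ.symm z)) y₀ :=
    contDiffAt_chart_trans hφ (IsManifold.chart_mem_maximalAtlas x₁) hy₀ (mem_chart_source F x₁)
  have hd : ContDiffAt ℝ ∞ (fderiv ℝ (fun z => chartAt F x₁ (φ.symm z))) y₀ :=
    hψ.fderiv_right (by simp)
  refine ((h2.clm_apply (hd.clm_apply (contDiffAt_const (c := u)))).clm_apply
    (hd.clm_apply (contDiffAt_const (c := v)))).congr_of_eventuallyEq ?_
  have hopen : (φ.symm ≫ₕ chartAt F x₁).source ∈ 𝓝 y₀ := by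
    refine (φ.symm ≫ₕ chartAt F x₁).open_source.mem_nhds ?_
    rw [OpenPartialHomeomorph.trans_source]
    exact ⟨hy₀, mem_chart_source F x₁⟩
  filter_upwards [hopen] with z hz
  rw [OpenPartialHomeomorph.trans_source] at hz
  obtain ⟨hz1, hz2⟩ := hz
  have hzψ := contDiffAt_chart_trans hφ (IsManifold.chart_mem_maximalAtlas x₁) hz1 hz2
  have hz2' : φ.symm z ∈ (chartAt F x₁).source := hz2
  rw [inCoordinates_tangent hz2']
  have key : ∀ u : F, fderiv ℝ (fun z' => chartAt F (φ.symm z) (φ.symm z')) z u =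
      fderiv ℝ (chartTrans F x₁ (φ.symm z)) (chartAt F x₁ (φ.symm z))
        (fderiv ℝ (fun z => chartAt F x₁ (φ.symm z)) z u) := by
    intro u
    have h3 : DifferentiableAt ℝ (chartTrans F x₁ (φ.symm z)) (chartAt F x₁ (φ.symm z)) := by
      refine (contDiffAt_chart_trans (IsManifold.chart_mem_maximalAtlas x₁)
        (IsManifold.chart_mem_maximalAtlas _) ((chartAt F x₁).map_source hz2') ?_).differentiableAt
          (by simp)
      rw [(chartAt F x₁).left_inv hz2']
      exact mem_chart_source F _
    rw [← ContinuousLinearMap.comp_apply, ← fderiv_comp z h3 (hzψ.differentiableAt (by simp))]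
    congr 1
    refine Filter.EventuallyEq.fderiv_eq ?_
    filter_upwards [(φ.symm ≫ₕ chartAt F x₁).open_source.mem_nhds
      (by rw [OpenPartialHomeomorph.trans_source]; exact ⟨hz1, hz2⟩)] with w hw
    rw [OpenPartialHomeomorph.trans_source] at hw
    simp only [Function.comp_apply, chartTrans]
    rw [(chartAt F x₁).left_inv hw.2]
  rw [Metric.inChart, mfderiv_symm_eq hφ hz1, mfderiv_symm_eq hφ hz1, key, key]

end MetricCharts

/-! ### Potentials of Ricci flat Kähler cones -/

section ConePotential
variable {n : ℕ}

/-- The linear maps `((w, ζ), τ) ↦ ((w, e^{k t} ζ), e^{m t} τ)`. -/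
def scaleMap (n : ℕ) (k m t : ℝ) : ((EuclideanSpace ℂ (Fin n) × ℂ) × ℂ) →L[ℂ]
    ((EuclideanSpace ℂ (Fin n) × ℂ) × ℂ) :=
  ((ContinuousLinearMap.id ℂ _).prodMap
    ((Real.exp (k * t) : ℂ) • ContinuousLinearMap.id ℂ ℂ)).prodMap
      ((Real.exp (m * t) : ℂ) • ContinuousLinearMap.id ℂ ℂ)

/-- The infinitesimal generator `((w, ζ), τ) ↦ ((0, k ζ), m τ)` of `scaleMap`. -/
def eulerMap (n : ℕ) (k m : ℝ) : ((EuclideanSpace ℂ (Fin n) × ℂ) × ℂ) →L[ℂ]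
    ((EuclideanSpace ℂ (Fin n) × ℂ) × ℂ) :=
  ((0 : EuclideanSpace ℂ (Fin n) →L[ℂ] EuclideanSpace ℂ (Fin n)).prodMap
    ((k : ℂ) • ContinuousLinearMap.id ℂ ℂ)).prodMap ((m : ℂ) • ContinuousLinearMap.id ℂ ℂ)

variable {k m : ℝ}

theorem scaleMap_apply (t : ℝ) (z : (EuclideanSpace ℂ (Fin n) × ℂ) × ℂ) :
    scaleMap n k m t z = ((z.1.1, Real.exp (k * t) * z.1.2), Real.exp (m * t) * z.2) := rfl

theorem eulerMap_apply (z : (EuclideanSpace ℂ (Fin n) × ℂ) × ℂ) :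
    eulerMap n k m z = ((0, k * z.1.2), m * z.2) := rfl

theorem scaleMap_add (s t : ℝ) (z : (EuclideanSpace ℂ (Fin n) × ℂ) × ℂ) :
    scaleMap n k m s (scaleMap n k m t z) = scaleMap n k m (s + t) z := by
  simp only [scaleMap_apply, mul_add, Real.exp_add]
  push_cast
  ring_nf

theorem scaleMap_zero (z : (EuclideanSpace ℂ (Fin n) × ℂ) × ℂ) : scaleMap n k m 0 z = z := by
  simp [scaleMap_apply]

theorem scaleMap_mem {U : Set (EuclideanSpace ℂ (Fin n))} (t : ℝ)
    {z : (EuclideanSpace ℂ (Fin n) × ℂ) × ℂ} (hz : z ∈ coordDomain U) :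
    scaleMap n k m t z ∈ coordDomain U :=
  ⟨hz.1, mul_ne_zero (by exact_mod_cast (Real.exp_pos _).ne') hz.2⟩

/-- The properties, in one of the coordinate systems `((w, ζ), τ)`, of a function `f` for which
`i ∂ ∂̄ f` is a Ricci flat Kähler cone metric, with homothetic vector field `eulerMap n k m` and with
`r² = 2 f`. -/
structure IsConePotential (U : Set (EuclideanSpace ℂ (Fin n)))
    (f : (EuclideanSpace ℂ (Fin n) × ℂ) × ℂ → ℝ) (k m : ℝ) : Prop where
  isOpen : IsOpen U
  smooth : ContDiffOn ℝ ∞ f (coordDomain U)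
  pos : ∀ z ∈ coordDomain U, 0 < f z
  levi_pos : ∀ z ∈ coordDomain U, ∀ u, u ≠ 0 → 0 < leviMap f z u u
  ricci_eq_zero : ∀ z ∈ coordDomain U, ∀ u v, ricciForm (leviMap f) z u v = 0
  scale : ∀ z ∈ coordDomain U, ∀ t, f (scaleMap n k m t z) = Real.exp (2 * t) * f z
  norm_congr : ∀ z z', z.1.1 = z'.1.1 → ‖z.1.2‖ = ‖z'.1.2‖ → ‖z.2‖ = ‖z'.2‖ → f z = f z'
  radial : ∃ ε : ℝ, 0 < ε ∧ ∀ y : EuclideanSpace ℂ (Fin n) × ℂ, y.1 ∈ U → ∀ ρ : ℝ, ∃ d, ε ≤ d ∧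
    HasDerivAt (fun ρ : ℝ => Real.log (f (y, (Real.exp ρ : ℂ)))) d ρ

/-- The potential constructed from the profile is the potential of a Ricci flat Kähler cone. -/
theorem IsBaseData.isConePotential {U : Set (EuclideanSpace ℂ (Fin n))}
    {D H : EuclideanSpace ℂ (Fin n) → ℝ} {μ : Fin n → ℝ} {a c : ℝ} {X Q : ℝ → ℝ}
    (h : IsBaseData U D H μ) (hμ : ∀ k, -1 < μ k ∧ μ k < 1)
    (ha : -(1 / 2) < a) (hP : IsProfile (fun x => (weight μ a).eval x) (profile μ a)
      (1 / (1 + 2 * a)) c X Q) (hc : 0 < c) :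
    IsConePotential U (potential a Q D H) (a * (((n : ℝ) + 2) / (1 + a)))
      (((n : ℝ) + 2) / (1 + a)) where
  isOpen := h.isOpen
  smooth := h.contDiffOn_potential hP.pos hP.smooth
  pos _ hz := h.potential_pos hP.pos hz
  levi_pos _ hz := (h.leviMap_potential hμ ha hP hc hz).1
  ricci_eq_zero _ hz := h.ricciForm_potential hμ ha hP hc hz
  norm_congr z z' h1 h2 h3 := by
    simp only [potential, canNorm, flowInvariant, lineNorm, h1, h2, h3]
  scale z hz t := by
    have h1a : (0 : ℝ) < 1 + a := by linarith
    have hN : (0 : ℝ) < (n : ℝ) + 2 := by positivity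
    set m : ℝ := ((n : ℝ) + 2) / (1 + a) with hm
    have hz' := scaleMap_mem (k := a * m) (m := m) t hz
    have e1 : canNorm D H (scaleMap n (a * m) m t z) = Real.exp (m * t) ^ 2 * canNorm D H z := by
      simp only [canNorm, scaleMap_apply, norm_mul, Complex.norm_real, Real.norm_eq_abs,
        Real.abs_exp, mul_pow, mul_div_assoc]
    have e2 : lineNorm H (scaleMap n (a * m) m t z) =
        Real.exp (a * m * t) ^ 2 * lineNorm H z := by
      simp only [lineNorm, scaleMap_apply, norm_mul, Complex.norm_real, Real.norm_eq_abs,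
        Real.abs_exp, mul_pow, mul_assoc]
    have hp := (h.canNorm_pos hz).le
    have hexp : ∀ x y : ℝ, (Real.exp x ^ 2) ^ y = Real.exp (2 * x * y) := by
      intro x y
      rw [← Real.exp_nat_mul, ← Real.exp_mul]
      push_cast
      ring_nf
    have e3 : flowInvariant a D H (scaleMap n (a * m) m t z) = flowInvariant a D H z := by
      rw [flowInvariant, flowInvariant, e1, e2, Real.mul_rpow (by positivity) hp, hexp,
        ← Real.exp_nat_mul]
      have : Real.exp ((2 : ℕ) * (a * m * t)) * Real.exp (2 * (m * t) * -a) = 1 := by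
        rw [← Real.exp_add, Real.exp_eq_one_iff]
        push_cast
        ring
      linear_combination (lineNorm H z * canNorm D H z ^ (-a)) * this
    rw [potential, potential, e3, e1, Real.mul_rpow (by positivity) hp, hexp, mul_assoc,
      Real.mul_rpow (Real.exp_pos _).le (h.potential_base_pos hP.pos hz).le, ← Real.exp_mul]
    congr 2
    rw [hm]
    field_simp
  radial := by
    have h1a : (0 : ℝ) < 1 + a := by linarith
    have h2a : (0 : ℝ) < 1 + 2 * a := by linarith
    have hN : (0 : ℝ) < (n : ℝ) + 2 := by positivity
    refine ⟨2 * ((n : ℝ) + 2)⁻¹ * min (1 + a) ((1 + a) / (1 + 2 * a)), ?_, fun y hy ρ => ?_⟩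
    · have : 0 < min (1 + a) ((1 + a) / (1 + 2 * a)) := lt_min h1a (div_pos h1a h2a)
      positivity
    have hmem : ∀ ρ : ℝ, (y, (Real.exp ρ : ℂ)) ∈ coordDomain U := fun ρ =>
      ⟨hy, Complex.ofReal_ne_zero.2 (Real.exp_pos ρ).ne'⟩
    set C : ℝ := (D y.1 * H y.1)⁻¹ with hC
    have hCpos : 0 < C := inv_pos.2 (mul_pos (h.det_pos _ hy) (h.norm_pos _ hy))
    have e1 : ∀ ρ : ℝ, canNorm D H (y, (Real.exp ρ : ℂ)) = C * Real.exp (2 * ρ) := by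
      intro ρ
      simp only [canNorm, Complex.norm_real, Real.norm_eq_abs, Real.abs_exp]
      rw [two_mul, Real.exp_add, hC, div_eq_mul_inv]
      ring
    set T : ℝ := ‖y.2‖ ^ 2 * H y.1 * C ^ (-a) with hT
    have e2 : ∀ ρ : ℝ, flowInvariant a D H (y, (Real.exp ρ : ℂ)) = T * Real.exp (-2 * a * ρ) := by
      intro ρ
      rw [flowInvariant, e1, Real.mul_rpow hCpos.le (Real.exp_pos _).le, ← Real.exp_mul, lineNorm, hT]
      ring_nf
    have e3 : ∀ ρ : ℝ, Real.log (potential a Q D H (y, (Real.exp ρ : ℂ))) = ((n : ℝ) + 2)⁻¹ *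
        ((1 + a) * (Real.log C + 2 * ρ) + Real.log (Q (T * Real.exp (-2 * a * ρ)))) := by
      intro ρ
      have h1 := h.potential_base_pos (a := a) hP.pos (hmem ρ)
      rw [potential, Real.log_rpow h1, Real.log_mul
        (Real.rpow_pos_of_pos (h.canNorm_pos (hmem ρ)) _).ne'
        (hP.pos _ (h.flowInvariant_nonneg a (hmem ρ))).ne',
        Real.log_rpow (h.canNorm_pos (hmem ρ)), e1, e2,
        Real.log_mul hCpos.ne' (Real.exp_pos _).ne', Real.log_exp]
    set t : ℝ := T * Real.exp (-2 * a * ρ) with ht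
    have ht0 : 0 ≤ t := by
      rw [ht, ← e2]; exact h.flowInvariant_nonneg a (hmem ρ)
    have hQ := ((hP.smooth t ht0).differentiableAt (by simp)).hasDerivAt
    have hQpos := hP.pos t ht0
    have d1 : HasDerivAt (fun ρ : ℝ => T * Real.exp (-2 * a * ρ)) (-2 * a * t) ρ := by
      have := ((((hasDerivAt_id ρ).const_mul (-2 * a)).exp).const_mul T)
      refine this.congr_deriv ?_
      simp only [id, ht]
      ring
    have d2 := ((hQ.comp ρ d1).log hQpos.ne')
    have d3 : HasDerivAt (fun ρ : ℝ => (1 + a) * (Real.log C + 2 * ρ)) ((1 + a) * 2) ρ := by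
      have := (((hasDerivAt_id ρ).const_mul 2).const_add (Real.log C)).const_mul (1 + a)
      simpa using this
    refine ⟨_, ?_, ((d3.add d2).const_mul ((n : ℝ) + 2)⁻¹).congr_of_eventuallyEq
      (Filter.Eventually.of_forall e3)⟩
    have h4 := hP.mul_deriv hc.ne' (hasDerivAt_integral_polynomial (profile_eq μ a)) ht0
    have h5 : deriv Q t * (-2 * a * t) / (Q ∘ fun ρ => T * Real.exp (-2 * a * ρ)) ρ =
        -2 * a * (1 - X t) := by
      have : (Q ∘ fun ρ => T * Real.exp (-2 * a * ρ)) ρ = Q t := rfl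
      rw [this, div_eq_iff hQpos.ne']
      linear_combination (-2 * a) * h4
    rw [h5]
    have h6 := hP.mem t ht0
    have h7 : min (1 + a) ((1 + a) / (1 + 2 * a)) ≤ 1 + a * X t := by
      -- `1 + a x` is affine in `x`, with the values `1 + a` and `(1 + a) / (1 + 2 a)` at the ends
      rcases le_total 0 a with h0 | h0
      · refine (min_le_right _ _).trans ?_
        have h8 : (1 + a) / (1 + 2 * a) = 1 + a * (-(1 / (1 + 2 * a))) := by
          field_simp
          ring
        rw [h8]
        have := mul_le_mul_of_nonneg_left h6.1.le h0
        linarith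
      · refine (min_le_left _ _).trans ?_
        nlinarith [mul_le_mul_of_nonpos_left h6.2 h0]
    have h8 : (0 : ℝ) < ((n : ℝ) + 2)⁻¹ := inv_pos.2 hN
    calc 2 * ((n : ℝ) + 2)⁻¹ * min (1 + a) ((1 + a) / (1 + 2 * a))
        ≤ 2 * ((n : ℝ) + 2)⁻¹ * (1 + a * X t) := by gcongr
      _ = _ := by ring

end ConePotential

/-! ### The homothetic flow and the level set -/

/-- A function on the line whose derivative has a positive lower bound is onto. -/
theorem exists_eq_of_le_deriv {g : ℝ → ℝ} {ε : ℝ} (hε : 0 < ε)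
    (hg : ∀ x, ∃ d, ε ≤ d ∧ HasDerivAt g d x) (c : ℝ) : ∃ x, g x = c := by
  have hmono : Monotone fun x => g x - ε * x := by
    refine monotone_of_deriv_nonneg (fun x => ?_) fun x => ?_
    · obtain ⟨d, -, hd⟩ := hg x
      exact hd.differentiableAt.sub (differentiableAt_id.const_mul ε)
    · obtain ⟨d, hle, hd⟩ := hg x
      have h := hd.fun_sub ((hasDerivAt_id x).const_mul ε)
      simp only [id] at h
      rw [h.deriv]
      linarith
  have hcont : Continuous g := continuous_iff_continuousAt.2 fun x =>
    let ⟨_, _, hd⟩ := hg x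
    hd.continuousAt
  have hR : g 0 + ε * ((c - g 0) / ε) = c := by field_simp; ring
  refine mem_range_of_exists_le_of_exists_ge hcont ?_ ?_
  · rcases le_total (g 0) c with h | h
    · exact ⟨0, h⟩
    · have := hmono (show (c - g 0) / ε ≤ 0 from div_nonpos_of_nonpos_of_nonneg (by linarith) hε.le)
      exact ⟨(c - g 0) / ε, by simp only at this; linarith⟩
  · rcases le_total c (g 0) with h | h
    · exact ⟨0, h⟩
    · have := hmono (show 0 ≤ (c - g 0) / ε from div_nonneg (by linarith) hε.le)
      exact ⟨(c - g 0) / ε, by simp only at this; linarith⟩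

section Link
variable {n : ℕ} {U : Set (EuclideanSpace ℂ (Fin n))}
  {f : (EuclideanSpace ℂ (Fin n) × ℂ) × ℂ → ℝ} {k m : ℝ}
  {z : (EuclideanSpace ℂ (Fin n) × ℂ) × ℂ}

theorem hasDerivAt_scaleMap (z : (EuclideanSpace ℂ (Fin n) × ℂ) × ℂ) (t : ℝ) :
    HasDerivAt (fun t => scaleMap n k m t z) (eulerMap n k m (scaleMap n k m t z)) t := by
  have h : ∀ c : ℝ, ∀ x : ℂ, HasDerivAt (fun t : ℝ => (Real.exp (c * t) : ℂ) * x)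
      (c * (Real.exp (c * t) * x)) t := by
    intro c x
    have h1 := (((hasDerivAt_id t).const_mul c).exp).ofReal_comp.mul_const x
    refine h1.congr_deriv ?_
    simp only [id]
    push_cast
    ring
  exact ((hasDerivAt_const t z.1.1).prodMk (h k z.1.2)).prodMk (h m z.2)

namespace IsConePotential

theorem isOpen_coordDomain (h : IsConePotential U f k m) : IsOpen (coordDomain U) :=
  (h.isOpen.preimage (continuous_fst.comp continuous_fst)).inter
    (isOpen_ne.preimage continuous_snd)

theorem contDiffAt (h : IsConePotential U f k m) (hz : z ∈ coordDomain U) : ContDiffAt ℝ ∞ f z :=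
  h.smooth.contDiffAt (h.isOpen_coordDomain.mem_nhds hz)

theorem hasFDerivAt (h : IsConePotential U f k m) (hz : z ∈ coordDomain U) :
    HasFDerivAt f (fderiv ℝ f z) z :=
  ((h.contDiffAt hz).differentiableAt (by simp)).hasFDerivAt

theorem fderiv_euler (h : IsConePotential U f k m) (hz : z ∈ coordDomain U) :
    fderiv ℝ f z (eulerMap n k m z) = 2 * f z := by
  have h1 := hasDerivAt_scaleMap (k := k) (m := m) z 0
  rw [scaleMap_zero] at h1
  have h2 := (h.hasFDerivAt hz).comp_hasDerivAt_of_eq 0 h1 (scaleMap_zero z).symm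
  have h3 : HasDerivAt (fun t : ℝ => Real.exp (2 * t) * f z) (2 * f z) 0 := by
    simpa using (((hasDerivAt_id (0 : ℝ)).const_mul 2).exp).mul_const (f z)
  exact h2.unique (h3.congr_of_eventuallyEq (Filter.Eventually.of_forall fun t => h.scale z hz t))

theorem fderiv_I_euler (h : IsConePotential U f k m) (hz : z ∈ coordDomain U) :
    fderiv ℝ f z (Complex.I • eulerMap n k m z) = 0 := by
  have hr : ∀ c : ℝ, ∀ x : ℂ, HasDerivAt (fun t : ℝ => Complex.exp ((c * t : ℝ) * Complex.I) * x)
      (Complex.I * (c * x)) 0 := by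
    intro c x
    have h1 := ((((hasDerivAt_id (0 : ℝ)).const_mul c).ofReal_comp.mul_const
      Complex.I).cexp).mul_const x
    refine h1.congr_deriv ?_
    simp
    ring
  have h1 : HasDerivAt (fun t : ℝ => ((z.1.1, Complex.exp ((k * t : ℝ) * Complex.I) * z.1.2),
      Complex.exp ((m * t : ℝ) * Complex.I) * z.2)) ((0, Complex.I * (k * z.1.2)),
        Complex.I * (m * z.2)) 0 := ((hasDerivAt_const 0 z.1.1).prodMk (hr k z.1.2)).prodMk (hr m z.2)
  have h2 := (h.hasFDerivAt hz).comp_hasDerivAt_of_eq 0 h1 (by simp)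
  have h3 := h2.unique ((hasDerivAt_const (0 : ℝ) (f z)).congr_of_eventuallyEq
    (Filter.Eventually.of_forall fun t => h.norm_congr _ _ rfl
      (by simp only [norm_mul, Complex.norm_exp_ofReal_mul_I, one_mul])
      (by simp only [norm_mul, Complex.norm_exp_ofReal_mul_I, one_mul])))
  rw [eulerMap_apply]
  simpa using h3

theorem leviMap_euler (h : IsConePotential U f k m) (hz : z ∈ coordDomain U)
    (v : (EuclideanSpace ℂ (Fin n) × ℂ) × ℂ) :
    leviMap f z (eulerMap n k m z) v = fderiv ℝ f z v := by
  have hn := h.isOpen_coordDomain.mem_nhds hz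
  refine SasakiEinstein.leviMap_euler _ ((h.contDiffAt hz).of_le ENat.LEInfty.out) ?_ ?_ v
  · filter_upwards [hn] with y hy using h.fderiv_euler hy
  · filter_upwards [hn] with y hy using h.fderiv_I_euler hy

theorem leviMap_scale (h : IsConePotential U f k m) (hz : z ∈ coordDomain U) (t : ℝ)
    (u v : (EuclideanSpace ℂ (Fin n) × ℂ) × ℂ) :
    leviMap f (scaleMap n k m t z) (scaleMap n k m t u) (scaleMap n k m t v) =
      Real.exp (2 * t) * leviMap f z u v := by
  have h1 := leviMap_comp (f := f) (Φ := scaleMap n k m t) (z := z)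
    ((h.contDiffAt (scaleMap_mem t hz)).of_le ENat.LEInfty.out)
    (scaleMap n k m t).contDiff.contDiffAt u v
  rw [ContinuousLinearMap.fderiv] at h1
  rw [← h1]
  have h2 : (fun y => f (scaleMap n k m t y)) =ᶠ[𝓝 z] fun y => Real.exp (2 * t) * f y + 0 * f y := by
    filter_upwards [h.isOpen_coordDomain.mem_nhds hz] with y hy
    rw [h.scale y hy, zero_mul, add_zero]
  have hf := (h.contDiffAt hz).of_le (ENat.LEInfty.out : (2 : ℕ∞ω) ≤ ∞)
  rw [Filter.EventuallyEq.leviMap_eq h2, leviMap_lin hf hf]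
  simp

/-- Each ray in a fibre of the canonical bundle meets the level set `f = 1/2` once, and the point of
intersection depends smoothly on the ray. -/
theorem exists_radius (h : IsConePotential U f k m) : ∃ ρ : EuclideanSpace ℂ (Fin n) × ℂ → ℝ,
    ContDiffOn ℝ ∞ ρ {y | y.1 ∈ U} ∧ ∀ y, y.1 ∈ U → ∀ τ : ℂ, τ ≠ 0 →
      (f (y, τ) = 1 / 2 ↔ ‖τ‖ = Real.exp (ρ y)) := by
  obtain ⟨ε, hε, hrad⟩ := h.radial
  have hmem : ∀ y : EuclideanSpace ℂ (Fin n) × ℂ, y.1 ∈ U → ∀ ρ : ℝ,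
      (y, (Real.exp ρ : ℂ)) ∈ coordDomain U := fun y hy ρ =>
    ⟨hy, Complex.ofReal_ne_zero.2 (Real.exp_pos ρ).ne'⟩
  have hinj : ∀ y : EuclideanSpace ℂ (Fin n) × ℂ, y.1 ∈ U →
      StrictMono fun ρ : ℝ => Real.log (f (y, (Real.exp ρ : ℂ))) := by
    intro y hy
    refine strictMono_of_deriv_pos fun ρ => ?_
    obtain ⟨d, hle, hd⟩ := hrad y hy ρ
    rw [hd.deriv]
    linarith
  choose! ρ hρ using fun (y : EuclideanSpace ℂ (Fin n) × ℂ) (hy : y.1 ∈ U) =>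
    exists_eq_of_le_deriv hε (hrad y hy) (Real.log (1 / 2))
  have hUopen : IsOpen {y : EuclideanSpace ℂ (Fin n) × ℂ | y.1 ∈ U} :=
    h.isOpen.preimage continuous_fst
  refine ⟨ρ, fun y₀ hy₀ => ?_, fun y hy τ hτ => ?_⟩
  · refine ContDiffAt.contDiffWithinAt ?_
    have hF : ContDiffAt ℝ ∞ (fun p : (EuclideanSpace ℂ (Fin n) × ℂ) × ℝ =>
        Real.log (f (p.1, (Real.exp p.2 : ℂ)))) (y₀, ρ y₀) := by
      refine ContDiffAt.log ?_ (h.pos _ (hmem y₀ hy₀ (ρ y₀))).ne'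
      refine (h.contDiffAt (hmem y₀ hy₀ (ρ y₀))).comp (y₀, ρ y₀)
        (f := fun p : (EuclideanSpace ℂ (Fin n) × ℂ) × ℝ => (p.1, (Real.exp p.2 : ℂ))) ?_
      exact contDiffAt_fst.prodMk
        (Complex.ofRealCLM.contDiff.contDiffAt.comp (y₀, ρ y₀) contDiffAt_snd.exp)
    obtain ⟨d, hle, hd⟩ := hrad y₀ hy₀ (ρ y₀)
    have hd0 : d ≠ 0 := (hε.trans_le hle).ne'
    -- the radial derivative is invertible, so that the implicit function theorem applies
    have hinv : (fderiv ℝ (fun p : (EuclideanSpace ℂ (Fin n) × ℂ) × ℝ =>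
        Real.log (f (p.1, (Real.exp p.2 : ℂ)))) (y₀, ρ y₀) ∘L
          .inr ℝ (EuclideanSpace ℂ (Fin n) × ℂ) ℝ).IsInvertible := by
      refine ⟨ContinuousLinearEquiv.unitsEquivAut ℝ (Units.mk0 d hd0), ?_⟩
      ext
      have h1 := (hF.differentiableAt (by simp)).hasFDerivAt.comp_hasDerivAt (ρ y₀)
        ((hasDerivAt_const (ρ y₀) y₀).prodMk (hasDerivAt_id (ρ y₀)))
      simpa using (h1.unique hd).symm
    have himp := hF.contDiffAt_implicitFunction (by simp) hinv
    refine himp.congr_of_eventuallyEq ?_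
    filter_upwards [hF.eventually_apply_implicitFunction (by simp) hinv, hUopen.mem_nhds hy₀]
      with y hy hyU
    refine (hinj y hyU).injective ?_
    rw [hρ y hyU, hy, hρ y₀ hy₀]
  · have hpos : 0 < ‖τ‖ := norm_pos_iff.2 hτ
    have h1 : f (y, τ) = f (y, (Real.exp (Real.log ‖τ‖) : ℂ)) := by
      refine h.norm_congr _ _ rfl rfl ?_
      simp [Real.exp_log hpos]
    have h2 : f (y, (Real.exp (ρ y) : ℂ)) = 1 / 2 :=
      Real.log_injOn_pos (mem_Ioi.2 (h.pos _ (hmem y hy _))) (mem_Ioi.2 (by norm_num)) (hρ y hy)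
    rw [h1]
    constructor
    · intro h3
      have := (hinj y hy).injective (a₁ := Real.log ‖τ‖) (a₂ := ρ y) (by simp only [h2, h3])
      rw [← this, Real.exp_log hpos]
    · intro h3
      rw [h3, Real.log_exp, h2]

end IsConePotential
end Link

/-! ### The metric of the link -/

section LinkMetric
variable {n : ℕ} {U : Set (EuclideanSpace ℂ (Fin n))}
  {f : (EuclideanSpace ℂ (Fin n) × ℂ) × ℂ → ℝ} {k m : ℝ}
  {ρ : EuclideanSpace ℂ (Fin n) × ℂ → ℝ} {β : ℝ} {q : (EuclideanSpace ℂ (Fin n) × ℂ) × ℝ}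

/-- The level set `|τ| = e^{ρ(y)}` in the canonical bundle, in the coordinates `(y, θ)` of the circle
bundle, where `θ = arg τ - β`. -/
def sectionCoord (ρ : EuclideanSpace ℂ (Fin n) × ℂ → ℝ) (β : ℝ)
    (q : (EuclideanSpace ℂ (Fin n) × ℂ) × ℝ) : (EuclideanSpace ℂ (Fin n) × ℂ) × ℂ :=
  (q.1, (Real.exp (ρ q.1) : ℂ) * Complex.exp ((q.2 + β : ℝ) * Complex.I))

/-- The diffeomorphism of the cone onto the punctured canonical bundle, in coordinates. -/
def coneCoord (k m : ℝ) (ρ : EuclideanSpace ℂ (Fin n) × ℂ → ℝ) (β : ℝ)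
    (p : ((EuclideanSpace ℂ (Fin n) × ℂ) × ℝ) × ℝ) : (EuclideanSpace ℂ (Fin n) × ℂ) × ℂ :=
  scaleMap n k m (Real.log p.2) (sectionCoord ρ β p.1)

/-- The form induced by the Levi form of `f` on the level set. -/
def sectionMetric (f : (EuclideanSpace ℂ (Fin n) × ℂ) × ℂ → ℝ)
    (ρ : EuclideanSpace ℂ (Fin n) × ℂ → ℝ) (β : ℝ) (q : (EuclideanSpace ℂ (Fin n) × ℂ) × ℝ) :
    ((EuclideanSpace ℂ (Fin n) × ℂ) × ℝ) →L[ℝ] ((EuclideanSpace ℂ (Fin n) × ℂ) × ℝ) →L[ℝ] ℝ :=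
  (leviMap f (sectionCoord ρ β q)).bilinearComp (fderiv ℝ (sectionCoord ρ β) q)
    (fderiv ℝ (sectionCoord ρ β) q)

theorem sectionMetric_apply (u v : (EuclideanSpace ℂ (Fin n) × ℂ) × ℝ) :
    sectionMetric f ρ β q u v = leviMap f (sectionCoord ρ β q) (fderiv ℝ (sectionCoord ρ β) q u)
      (fderiv ℝ (sectionCoord ρ β) q v) := rfl

theorem sectionCoord_snd_ne : (sectionCoord ρ β q).2 ≠ 0 :=
  mul_ne_zero (Complex.ofReal_ne_zero.2 (Real.exp_pos _).ne') (Complex.exp_ne_zero _)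

theorem norm_sectionCoord_snd : ‖(sectionCoord ρ β q).2‖ = Real.exp (ρ q.1) := by
  rw [sectionCoord, norm_mul, Complex.norm_exp_ofReal_mul_I, mul_one, Complex.norm_real,
    Real.norm_eq_abs, Real.abs_exp]

/-- `ρ` is the logarithmic radius of the level set `f = 1/2`, for the potential `f` of a cone. -/
structure IsRadius (U : Set (EuclideanSpace ℂ (Fin n)))
    (f : (EuclideanSpace ℂ (Fin n) × ℂ) × ℂ → ℝ) (k m : ℝ)
    (ρ : EuclideanSpace ℂ (Fin n) × ℂ → ℝ) : Prop extends IsConePotential U f k m where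
  smooth_radius : ContDiffOn ℝ ∞ ρ {y | y.1 ∈ U}
  eq_half_iff : ∀ y, y.1 ∈ U → ∀ τ : ℂ, τ ≠ 0 → (f (y, τ) = 1 / 2 ↔ ‖τ‖ = Real.exp (ρ y))

namespace IsRadius

theorem sectionCoord_mem (hq : q.1.1 ∈ U) : sectionCoord ρ β q ∈ coordDomain U :=
  ⟨hq, sectionCoord_snd_ne⟩

theorem apply_sectionCoord (h : IsRadius U f k m ρ) (hq : q.1.1 ∈ U) :
    f (sectionCoord ρ β q) = 1 / 2 :=
  (h.eq_half_iff q.1 hq _ sectionCoord_snd_ne).2 norm_sectionCoord_snd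

theorem isOpen_link (h : IsRadius U f k m ρ) :
    IsOpen {q : (EuclideanSpace ℂ (Fin n) × ℂ) × ℝ | q.1.1 ∈ U} :=
  h.isOpen.preimage (continuous_fst.comp continuous_fst)

theorem contDiffAt_radius (h : IsRadius U f k m ρ) {y : EuclideanSpace ℂ (Fin n) × ℂ}
    (hy : y.1 ∈ U) : ContDiffAt ℝ ∞ ρ y :=
  h.smooth_radius.contDiffAt ((h.isOpen.preimage continuous_fst).mem_nhds hy)

theorem contDiffAt_sectionCoord (h : IsRadius U f k m ρ) (hq : q.1.1 ∈ U) :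
    ContDiffAt ℝ ∞ (sectionCoord ρ β) q := by
  have h1 : ContDiffAt ℝ ∞ (fun q : (EuclideanSpace ℂ (Fin n) × ℂ) × ℝ => ρ q.1) q :=
    (h.contDiffAt_radius hq).comp q contDiffAt_fst
  refine contDiffAt_fst.prodMk ((Complex.ofRealCLM.contDiff.contDiffAt.comp q h1.exp).mul ?_)
  refine ContDiffAt.cexp ((Complex.ofRealCLM.contDiff.contDiffAt.comp q
    (contDiffAt_snd.add contDiffAt_const)).mul contDiffAt_const)

theorem hasFDerivAt_sectionCoord (h : IsRadius U f k m ρ) (hq : q.1.1 ∈ U) :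
    HasFDerivAt (sectionCoord ρ β) (fderiv ℝ (sectionCoord ρ β) q) q :=
  ((h.contDiffAt_sectionCoord hq).differentiableAt (by simp)).hasFDerivAt

theorem fderiv_sectionCoord_ne_zero (h : IsRadius U f k m ρ) (hq : q.1.1 ∈ U)
    {u : (EuclideanSpace ℂ (Fin n) × ℂ) × ℝ} (hu : u ≠ 0) :
    fderiv ℝ (sectionCoord ρ β) q u ≠ 0 := by
  have h1 : HasFDerivAt (fun q : (EuclideanSpace ℂ (Fin n) × ℂ) × ℝ => ρ q.1) _ q :=
    HasFDerivAt.comp (g := ρ) (f := Prod.fst) q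
      ((h.contDiffAt_radius hq).differentiableAt (by simp)).hasFDerivAt hasFDerivAt_fst
  have h2 : HasFDerivAt (fun q : (EuclideanSpace ℂ (Fin n) × ℂ) × ℝ =>
      ((q.2 + β : ℝ) : ℂ) * Complex.I) _ q :=
    (Complex.ofRealCLM.hasFDerivAt.comp q (hasFDerivAt_snd.add_const β)).mul_const Complex.I
  have h3 := hasFDerivAt_fst.prodMk
    ((Complex.ofRealCLM.hasFDerivAt.comp q h1.exp).mul h2.cexp)
  have h4 : HasFDerivAt (sectionCoord ρ β) _ q := h3
  intro h0
  rw [h4.fderiv] at h0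
  have e1 : u.1 = 0 := congrArg Prod.fst h0
  have e2 := congrArg Prod.snd h0
  simp [e1, Complex.exp_ne_zero] at e2
  exact hu (Prod.ext e1 e2)

theorem isCoordMetric_sectionMetric (h : IsRadius U f k m ρ) :
    IsCoordMetric (sectionMetric f ρ β) {q | q.1.1 ∈ U} where
  isOpen := h.isOpen_link
  smooth := by
    have h1 : ContDiffOn ℝ ∞ (fun q => leviMap f (sectionCoord ρ β q))
        {q : (EuclideanSpace ℂ (Fin n) × ℂ) × ℝ | q.1.1 ∈ U} :=
      (contDiffOn_leviMap h.isOpen_coordDomain h.smooth).comp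
        (fun q hq => (h.contDiffAt_sectionCoord hq).contDiffWithinAt) fun q hq => sectionCoord_mem hq
    have h2 : ContDiffOn ℝ ∞ (fderiv ℝ (sectionCoord ρ β))
        {q : (EuclideanSpace ℂ (Fin n) × ℂ) × ℝ | q.1.1 ∈ U} := fun q hq =>
      ((h.contDiffAt_sectionCoord hq).fderiv_right (by simp)).contDiffWithinAt
    exact contDiffOn_clm_apply.2 fun u => contDiffOn_clm_apply.2 fun v =>
      (h1.clm_apply (h2.clm_apply contDiffOn_const)).clm_apply (h2.clm_apply contDiffOn_const)
  symm q hq u v :=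
    leviMap_symm ((h.contDiffAt (sectionCoord_mem hq)).of_le ENat.LEInfty.out) _ _
  pos q hq u hu := h.levi_pos _ (sectionCoord_mem hq) _ (h.fderiv_sectionCoord_ne_zero hq hu)

theorem hasFDerivAt_coneCoord (h : IsRadius U f k m ρ) (hq : q.1.1 ∈ U) {r : ℝ} (hr : 0 < r) :
    HasFDerivAt (coneCoord k m ρ β)
      ((((scaleMap n k m (Real.log r)).restrictScalars ℝ).comp
        (fderiv ℝ (sectionCoord ρ β) q)).comp (ContinuousLinearMap.fst ℝ _ ℝ) +
      (ContinuousLinearMap.snd ℝ _ ℝ).smulRight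
        (r⁻¹ • eulerMap n k m (coneCoord k m ρ β (q, r)))) (q, r) := by
  have h1 : HasFDerivAt (fun p : ((EuclideanSpace ℂ (Fin n) × ℂ) × ℝ) × ℝ => sectionCoord ρ β p.1)
      _ (q, r) := HasFDerivAt.comp (g := sectionCoord ρ β) (f := Prod.fst) (q, r)
        (h.hasFDerivAt_sectionCoord hq) hasFDerivAt_fst
  have h2 : ∀ c : ℝ, HasFDerivAt (fun p : ((EuclideanSpace ℂ (Fin n) × ℂ) × ℝ) × ℝ =>
      (Real.exp (c * Real.log p.2) : ℂ)) _ (q, r) := fun c =>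
    Complex.ofRealCLM.hasFDerivAt.comp (q, r) (((hasFDerivAt_snd.log hr.ne').const_mul c).exp)
  have h3 : HasFDerivAt (coneCoord k m ρ β) _ (q, r) :=
    (h1.fst.fst.prodMk ((h2 k).mul h1.fst.snd)).prodMk ((h2 m).mul h1.snd)
  refine h3.congr_fderiv ?_
  ext u <;> simp [coneCoord, scaleMap_apply, eulerMap_apply] <;> ring

theorem fderiv_coneCoord (h : IsRadius U f k m ρ) (hq : q.1.1 ∈ U) {r : ℝ} (hr : 0 < r)
    (u : ((EuclideanSpace ℂ (Fin n) × ℂ) × ℝ) × ℝ) :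
    fderiv ℝ (coneCoord k m ρ β) (q, r) u =
      scaleMap n k m (Real.log r) (fderiv ℝ (sectionCoord ρ β) q u.1) +
        (u.2 / r) • eulerMap n k m (coneCoord k m ρ β (q, r)) := by
  rw [(h.hasFDerivAt_coneCoord hq hr).fderiv]
  simp [div_eq_mul_inv, smul_smul]

theorem apply_coneCoord (h : IsRadius U f k m ρ) (hq : q.1.1 ∈ U) {r : ℝ} (hr : 0 < r) :
    f (coneCoord k m ρ β (q, r)) = r ^ 2 / 2 := by
  rw [coneCoord, h.scale _ (sectionCoord_mem hq), h.apply_sectionCoord hq, two_mul, Real.exp_add,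
    Real.exp_log hr]
  ring

/-- The pull-back of the Levi form to the cone is the cone metric. -/
theorem leviMap_coneCoord (h : IsRadius U f k m ρ) (hq : q.1.1 ∈ U) {r : ℝ} (hr : 0 < r)
    (u v : ((EuclideanSpace ℂ (Fin n) × ℂ) × ℝ) × ℝ) :
    leviMap f (coneCoord k m ρ β (q, r)) (fderiv ℝ (coneCoord k m ρ β) (q, r) u)
      (fderiv ℝ (coneCoord k m ρ β) (q, r) v) = coneMetric (sectionMetric f ρ β) (q, r) u v := by
  have hmem : coneCoord k m ρ β (q, r) ∈ coordDomain U := scaleMap_mem _ (sectionCoord_mem hq)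
  have hs := leviMap_symm ((h.contDiffAt hmem).of_le (ENat.LEInfty.out : (2 : ℕ∞ω) ≤ ∞))
  have hR := h.leviMap_euler hmem
  have hRR : leviMap f (coneCoord k m ρ β (q, r)) (eulerMap n k m (coneCoord k m ρ β (q, r)))
      (eulerMap n k m (coneCoord k m ρ β (q, r))) = r ^ 2 := by
    rw [hR, h.fderiv_euler hmem, h.apply_coneCoord hq hr]
    ring
  -- `f` is constant on the level sets of `r`
  have hRu : ∀ u, leviMap f (coneCoord k m ρ β (q, r)) (eulerMap n k m (coneCoord k m ρ β (q, r)))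
      (scaleMap n k m (Real.log r) (fderiv ℝ (sectionCoord ρ β) q u)) = 0 := by
    intro u
    rw [hR]
    have h1 : HasFDerivAt (fun q => f (scaleMap n k m (Real.log r) (sectionCoord ρ β q))) _ q :=
      (h.hasFDerivAt hmem).comp q ((((scaleMap n k m (Real.log r)).restrictScalars ℝ).hasFDerivAt).comp
        q (h.hasFDerivAt_sectionCoord hq))
    have h2 := h1.unique ((hasFDerivAt_const (r ^ 2 / 2) q).congr_of_eventuallyEq (by
      filter_upwards [h.isOpen_link.mem_nhds hq] with y hy using h.apply_coneCoord hy hr))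
    exact congrArg (fun A : _ →L[ℝ] ℝ => A u) h2
  have he : Real.exp (2 * Real.log r) = r ^ 2 := by
    rw [two_mul, Real.exp_add, Real.exp_log hr]; ring
  rw [h.fderiv_coneCoord hq hr, h.fderiv_coneCoord hq hr, coneMetric_apply]
  simp only [map_add, map_smul, _root_.add_apply, _root_.smul_apply, smul_eq_mul, hRR, hRu,
    hs _ (eulerMap n k m (coneCoord k m ρ β (q, r)))]
  rw [coneCoord, h.leviMap_scale (sectionCoord_mem hq), he, sectionMetric_apply]
  field_simp
  ring

/-- The link of a Ricci flat Kähler cone is an Einstein manifold. -/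
theorem ricciForm_sectionMetric (h : IsRadius U f k m ρ) (hq : q.1.1 ∈ U)
    (v w : (EuclideanSpace ℂ (Fin n) × ℂ) × ℝ) :
    ricciForm (sectionMetric f ρ β) q v w = (2 * (n + 1) : ℝ) * sectionMetric f ρ β q v w := by
  have hG := h.isCoordMetric_sectionMetric (β := β)
  have hmaps : MapsTo (coneCoord k m ρ β) ({q | q.1.1 ∈ U} ×ˢ Ioi (0 : ℝ)) (coordDomain U) :=
    fun p hp => scaleMap_mem _ (sectionCoord_mem hp.1)
  have hK := isKahlerOn_leviMap h.isOpen_coordDomain h.smooth h.levi_pos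
  have hfin : Module.finrank ℝ ((EuclideanSpace ℂ (Fin n) × ℂ) × ℝ) = 2 * n + 3 := by
    rw [Module.finrank_prod, finrank_real_of_complex]
    simp
    ring
  have hfin' : Module.finrank ℝ ((EuclideanSpace ℂ (Fin n) × ℂ) × ℂ) = 2 * n + 4 := by
    rw [finrank_real_of_complex]
    simp
    ring
  have hiso : ∀ p ∈ ({q | q.1.1 ∈ U} ×ˢ Ioi (0 : ℝ) :
      Set (((EuclideanSpace ℂ (Fin n) × ℂ) × ℝ) × ℝ)), ∀ u v,
      coneMetric (sectionMetric f ρ β) p u v = leviMap f (coneCoord k m ρ β p)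
        (fderiv ℝ (coneCoord k m ρ β) p u) (fderiv ℝ (coneCoord k m ρ β) p v) :=
    fun p hp u v => (h.leviMap_coneCoord hp.1 hp.2 u v).symm
  have hsmooth : ContDiffOn ℝ ∞ (coneCoord k m ρ β) ({q | q.1.1 ∈ U} ×ˢ Ioi (0 : ℝ)) := by
    intro p hp
    refine ContDiffAt.contDiffWithinAt ?_
    have h1 : ContDiffAt ℝ ∞ (fun p : ((EuclideanSpace ℂ (Fin n) × ℂ) × ℝ) × ℝ =>
        sectionCoord ρ β p.1) p := (h.contDiffAt_sectionCoord hp.1).comp p contDiffAt_fst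
    have h2 : ∀ c : ℝ, ContDiffAt ℝ ∞ (fun p : ((EuclideanSpace ℂ (Fin n) × ℂ) × ℝ) × ℝ =>
        (Real.exp (c * Real.log p.2) : ℂ)) p := fun c =>
      Complex.ofRealCLM.contDiff.contDiffAt.comp p
        ((contDiffAt_const.mul (contDiffAt_snd.log (ne_of_gt hp.2))).exp)
    exact (h1.fst.fst.prodMk ((h2 k).mul h1.fst.snd)).prodMk ((h2 m).mul h1.snd)
  -- the differential preserves a definite form, hence it is injective
  have hsurj : ∀ p ∈ ({q | q.1.1 ∈ U} ×ˢ Ioi (0 : ℝ) :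
      Set (((EuclideanSpace ℂ (Fin n) × ℂ) × ℝ) × ℝ)),
      Function.Surjective (fderiv ℝ (coneCoord k m ρ β) p) := by
    intro p hp
    refine (LinearMap.injective_iff_surjective_of_finrank_eq_finrank
      (f := (fderiv ℝ (coneCoord k m ρ β) p).toLinearMap) ?_).1 ?_
    · rw [Module.finrank_prod, hfin, hfin', Module.finrank_self]
    · refine (injective_iff_map_eq_zero _).2 fun u hu => ?_
      by_contra hne
      have h1 := hG.cone.pos p hp u hne
      have h2 : fderiv ℝ (coneCoord k m ρ β) p u = 0 := hu
      rw [hiso p hp, h2] at h1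
      simp at h1
  have hone : (q, (1 : ℝ)) ∈ ({q | q.1.1 ∈ U} ×ˢ Ioi (0 : ℝ) :
      Set (((EuclideanSpace ℂ (Fin n) × ℂ) × ℝ) × ℝ)) := ⟨hq, mem_Ioi.2 one_pos⟩
  -- at `r = 1`, where the Ricci form of the cone vanishes, the constant is `(2 n + 3) - 1`
  have h1 := ricciForm_comp hG.cone hK.toIsCoordMetric hsmooth hmaps hsurj hiso
    (z := (q, 1)) hone (v, 0) (w, 0)
  rw [h.ricci_eq_zero _ (hmaps hone), ricciForm_cone hG hq one_pos, hfin] at h1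
  push_cast at h1
  linarith

end IsRadius

theorem IsConePotential.exists_isRadius (h : IsConePotential U f k m) :
    ∃ ρ, IsRadius U f k m ρ := by
  obtain ⟨ρ, h1, h2⟩ := h.exists_radius
  exact ⟨ρ, h, h1, h2⟩

end LinkMetric

/-! ### Determinants and changes of coordinates -/

section Determinants

/-- The determinant of a linear map of `V × K` which is triangular. -/
theorem det_of_triangular {K V : Type*} [Field K] [CharZero K] [AddCommGroup V] [Module K V]
    [FiniteDimensional K V] (A : V →ₗ[K] V) (B : V →ₗ[K] K) (κ : K) (T : V × K →ₗ[K] V × K)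
    (hT : ∀ u v, T (u, v) = (A u, B u + κ * v)) : LinearMap.det T = LinearMap.det A * κ := by
  let S : (V →ₗ[K] K) → (V × K →ₗ[K] V × K) := fun B =>
    (LinearMap.fst K V K).prod (B.comp (LinearMap.fst K V K) + LinearMap.snd K V K)
  have hS : ∀ B u v, S B (u, v) = (u, B u + v) := fun B u v => rfl
  -- the shear `S B` has determinant one, because its square is conjugate to it
  have hdet : LinearMap.det (S B) = 1 := by
    have h1 : LinearMap.det (S B) * LinearMap.det (S (-B)) = 1 := by
      rw [← LinearMap.det_comp]
      refine Eq.trans (congrArg _ ?_) LinearMap.det_id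
      refine LinearMap.ext fun p => ?_
      obtain ⟨u, v⟩ := p
      simp [hS]
    have h2 : LinearMap.prodMap (LinearMap.id : V →ₗ[K] V) ((2 : K) • LinearMap.id) ∘ₗ S B =
        (S B ∘ₗ S B) ∘ₗ LinearMap.prodMap (LinearMap.id : V →ₗ[K] V) ((2 : K) • LinearMap.id) := by
      refine LinearMap.ext fun p => ?_
      obtain ⟨u, v⟩ := p
      simp [hS]
      ring
    have h3 := congrArg LinearMap.det h2
    simp only [LinearMap.det_comp, LinearMap.det_prodMap, LinearMap.det_smul, LinearMap.det_id,
      Module.finrank_self, pow_one, mul_one, one_mul] at h3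
    have h4 : LinearMap.det (S B) ≠ 0 := left_ne_zero_of_mul_eq_one h1
    have h5 : (2 * LinearMap.det (S B)) * (LinearMap.det (S B) - 1) = 0 := by linear_combination -h3
    have h6 := (mul_eq_zero.1 h5).resolve_left (mul_ne_zero two_ne_zero h4)
    exact sub_eq_zero.1 h6
  have h : T = LinearMap.prodMap A LinearMap.id ∘ₗ S B ∘ₗ
      LinearMap.prodMap (LinearMap.id : V →ₗ[K] V) (κ • LinearMap.id) := by
    refine LinearMap.ext fun p => ?_
    obtain ⟨u, v⟩ := p
    simp [hS, hT]
  rw [h, LinearMap.det_comp, LinearMap.det_comp, hdet, LinearMap.det_prodMap, LinearMap.det_prodMap]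
  simp

variable {n : ℕ}

/-- The transformation rule for the determinant of a hermitian form under a complex linear map. -/
theorem det_hermMatrix_comp
    {B : EuclideanSpace ℂ (Fin n) →L[ℝ] EuclideanSpace ℂ (Fin n) →L[ℝ] ℝ}
    (hI : ∀ u v, B (Complex.I • u) (Complex.I • v) = B u v)
    (A : EuclideanSpace ℂ (Fin n) →L[ℂ] EuclideanSpace ℂ (Fin n)) :
    (hermMatrix fun u v => B (A u) (A v)).det =
      ((‖LinearMap.det (A : EuclideanSpace ℂ (Fin n) →ₗ[ℂ] EuclideanSpace ℂ (Fin n))‖ ^ 2 : ℝ) : ℂ) *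
        (hermMatrix fun u v => B u v).det := by
  set e := (EuclideanSpace.basisFun (Fin n) ℂ).toBasis with he
  have hei : ∀ j, e j = EuclideanSpace.single j 1 := fun j => by simp [he]
  set P := LinearMap.toMatrix e e (A : EuclideanSpace ℂ (Fin n) →ₗ[ℂ] EuclideanSpace ℂ (Fin n)) with hP
  have hA : ∀ j, A (e j) = ∑ l, P l j • e l := by
    intro j
    rw [← e.sum_repr (A (e j))]
    simp [hP, LinearMap.toMatrix_apply]
  have hM : (hermMatrix fun u v => B (A u) (A v)) =
      P.transpose * (hermMatrix fun u v => B u v) * P.map (starRingEnd ℂ) := by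
    ext j l
    have h1 : (hermMatrix fun u v => B (A u) (A v)) j l = hermForm B (A (e j)) (A (e l)) := by
      simp [hermMatrix, hermForm, hei]
    have h2 : ∀ j l, (hermMatrix fun u v => B u v) j l = hermForm B (e j) (e l) := by
      intro j l
      simp [hermMatrix, hermForm, hei]
    rw [h1, hA, hA, hermForm_sum_left, Matrix.mul_apply]
    simp only [hermForm_sum_right, hermForm_smul_left hI, hermForm_smul_right, Matrix.mul_apply, h2,
      Matrix.transpose_apply, Matrix.map_apply, Finset.sum_mul]
    rw [Finset.sum_comm]
    refine Finset.sum_congr rfl fun i _ => ?_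
    rw [Finset.mul_sum]
    refine Finset.sum_congr rfl fun l' _ => ?_
    ring
  have hdet : P.det = LinearMap.det (A : EuclideanSpace ℂ (Fin n) →ₗ[ℂ] EuclideanSpace ℂ (Fin n)) :=
    LinearMap.det_toMatrix e _
  have hmap : (P.map (starRingEnd ℂ)).det = starRingEnd ℂ P.det :=
    ((starRingEnd ℂ).map_det P).symm
  rw [hM, Matrix.det_mul, Matrix.det_mul, Matrix.det_transpose, hmap, hdet, Complex.ofReal_pow,
    ← Complex.mul_conj']
  ring

end Determinants

section Charts
variable {F : Type*} [NormedAddCommGroup F] [NormedSpace ℝ F] {Y : Type*} [TopologicalSpace Y]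
  [ChartedSpace F Y] [IsManifold 𝓘(ℝ, F) ∞ Y]

theorem fderiv_chart_trans {φ φ' : OpenPartialHomeomorph Y F}
    (hφ : φ ∈ IsManifold.maximalAtlas 𝓘(ℝ, F) ∞ Y) (hφ' : φ' ∈ IsManifold.maximalAtlas 𝓘(ℝ, F) ∞ Y)
    {y : F} (hy : y ∈ φ.target) (hy' : φ.symm y ∈ φ'.source) (x : Y)
    (hx : φ.symm y ∈ (chartAt F x).source) :
    fderiv ℝ (fun z => chartAt F x (φ.symm z)) y =
      (fderiv ℝ (fun z => chartAt F x (φ'.symm z)) (φ' (φ.symm y))).comp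
        (fderiv ℝ (fun z => φ' (φ.symm z)) y) := by
  have h1 := (contDiffAt_chart_trans hφ hφ' hy hy').differentiableAt (by simp)
  have h2 : DifferentiableAt ℝ (fun z => chartAt F x (φ'.symm z)) (φ' (φ.symm y)) := by
    refine (contDiffAt_chart_trans hφ' (IsManifold.chart_mem_maximalAtlas x)
      (φ'.map_source hy') ?_).differentiableAt (by simp)
    rwa [φ'.left_inv hy']
  rw [← fderiv_comp y h2 h1]
  refine Filter.EventuallyEq.fderiv_eq ?_
  filter_upwards [(φ.symm ≫ₕ φ').open_source.mem_nhds
    (by rw [OpenPartialHomeomorph.trans_source]; exact ⟨hy, hy'⟩)] with w hw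
  rw [OpenPartialHomeomorph.trans_source] at hw
  simp only [Function.comp_apply]
  rw [φ'.left_inv hw.2]

/-- The value of a metric on two tangent vectors given in the preferred chart. -/
def Metric.coef (g : Metric F Y) (x : Y) (u v : F) : ℝ := g.inner x u v

theorem Metric.inChart_eq_coef (g : Metric F Y) {φ : OpenPartialHomeomorph Y F}
    (hφ : φ ∈ IsManifold.maximalAtlas 𝓘(ℝ, F) ∞ Y) {y : F} (hy : y ∈ φ.target) (u v : F) :
    g.inChart φ y u v = g.coef (φ.symm y) (fderiv ℝ (fun z => chartAt F (φ.symm y) (φ.symm z)) y u)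
      (fderiv ℝ (fun z => chartAt F (φ.symm y) (φ.symm z)) y v) := by
  rw [Metric.inChart, mfderiv_symm_eq hφ hy, mfderiv_symm_eq hφ hy]
  rfl

/-- The transformation rule of a metric under a change of coordinates. -/
theorem Metric.inChart_trans (g : Metric F Y) {φ φ' : OpenPartialHomeomorph Y F}
    (hφ : φ ∈ IsManifold.maximalAtlas 𝓘(ℝ, F) ∞ Y) (hφ' : φ' ∈ IsManifold.maximalAtlas 𝓘(ℝ, F) ∞ Y)
    {y : F} (hy : y ∈ φ.target) (hy' : φ.symm y ∈ φ'.source) (u v : F) :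
    g.inChart φ y u v = g.inChart φ' (φ' (φ.symm y)) (fderiv ℝ (fun z => φ' (φ.symm z)) y u)
      (fderiv ℝ (fun z => φ' (φ.symm z)) y v) := by
  rw [g.inChart_eq_coef hφ hy, g.inChart_eq_coef hφ' (φ'.map_source hy'), φ'.left_inv hy',
    fderiv_chart_trans hφ hφ' hy hy' _ (mem_chart_source F _)]
  rfl

theorem Metric.inChart_pos (g : Metric F Y) {φ : OpenPartialHomeomorph Y F}
    (hφ : φ ∈ IsManifold.maximalAtlas 𝓘(ℝ, F) ∞ Y) {y : F} (hy : y ∈ φ.target) {u : F} (hu : u ≠ 0) :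
    0 < g.inChart φ y u u := by
  rw [g.inChart_eq_coef hφ hy]
  refine g.pos (φ.symm y) _ fun h0 => hu ?_
  have h1 := fderiv_chart_trans (IsManifold.chart_mem_maximalAtlas (φ.symm y)) hφ
    (mem_chart_target F (φ.symm y))
    (by rw [(chartAt F (φ.symm y)).left_inv (mem_chart_source F _)]; exact φ.map_target hy)
    (φ.symm y) (by
      rw [(chartAt F (φ.symm y)).left_inv (mem_chart_source F _)]; exact mem_chart_source F _)
  have h2 : (fderiv ℝ (fun z => φ ((chartAt F (φ.symm y)).symm z)) (chartAt F (φ.symm y) (φ.symm y))).comp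
      (fderiv ℝ (fun z => chartAt F (φ.symm y) (φ.symm z)) y) = ContinuousLinearMap.id ℝ F := by
    have hd1 : DifferentiableAt ℝ (fun z => chartAt F (φ.symm y) (φ.symm z)) y :=
      (contDiffAt_chart_trans hφ (IsManifold.chart_mem_maximalAtlas _) hy
        (mem_chart_source F _)).differentiableAt (by simp)
    have hd2 : DifferentiableAt ℝ (fun z => φ ((chartAt F (φ.symm y)).symm z))
        (chartAt F (φ.symm y) (φ.symm y)) := by
      refine (contDiffAt_chart_trans (IsManifold.chart_mem_maximalAtlas _) hφ
        (mem_chart_target F (φ.symm y)) ?_).differentiableAt (by simp)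
      rw [(chartAt F (φ.symm y)).left_inv (mem_chart_source F _)]
      exact φ.map_target hy
    rw [← fderiv_comp y hd2 hd1]
    refine (Filter.EventuallyEq.fderiv_eq ?_).trans fderiv_id
    filter_upwards [(φ.symm ≫ₕ chartAt F (φ.symm y)).open_source.mem_nhds
      (by rw [OpenPartialHomeomorph.trans_source]; exact ⟨hy, mem_chart_source F _⟩)] with w hw
    rw [OpenPartialHomeomorph.trans_source] at hw
    simp only [Function.comp_apply]
    rw [(chartAt F (φ.symm y)).left_inv hw.2, φ.right_inv hw.1, id]
  have h3 := congrArg (fun A : F →L[ℝ] F => A u) h2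
  have h4 : fderiv ℝ (fun z => chartAt F (φ.symm y) (φ.symm z)) y u = 0 := h0
  simpa [h4] using h3.symm

theorem Metric.inChart_symm (g : Metric F Y) (φ : OpenPartialHomeomorph Y F) (y u v : F) :
    g.inChart φ y u v = g.inChart φ y v u := g.symm _ _ _

/-- The expression of a metric in a chart, as a field of bilinear maps. -/
def Metric.inChartMap (g : Metric F Y) (φ : OpenPartialHomeomorph Y F) (y : F) :
    F →L[ℝ] F →L[ℝ] ℝ :=
  ContinuousLinearMap.bilinearComp (E := F) (F := F) (G := ℝ) (E' := F) (F' := F)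
    (g.inner (φ.symm y)) (mfderiv 𝓘(ℝ, F) 𝓘(ℝ, F) φ.symm y) (mfderiv 𝓘(ℝ, F) 𝓘(ℝ, F) φ.symm y)

theorem Metric.inChartMap_apply (g : Metric F Y) (φ : OpenPartialHomeomorph Y F) (y u v : F) :
    g.inChartMap φ y u v = g.inChart φ y u v := rfl

end Charts

/-! ### The Kähler–Einstein base -/

section BaseData
variable {n : ℕ} {W : Type*} [TopologicalSpace W] [ChartedSpace (EuclideanSpace ℂ (Fin n)) W]
  [IsManifold 𝓘(ℂ, EuclideanSpace ℂ (Fin n)) ω W]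
  {L : W → Type*} [∀ w, AddCommGroup (L w)] [∀ w, Module ℂ (L w)]
  [TopologicalSpace (TotalSpace ℂ L)] [∀ w, TopologicalSpace (L w)] [FiberBundle ℂ L]
  [VectorBundle ℂ ℂ L]

variable (L) in
/-- The domain, in the coordinates of the preferred chart at `α`, of the preferred frame at `α`. -/
def coordBase (α : W) : Set (EuclideanSpace ℂ (Fin n)) :=
  (chartAt (EuclideanSpace ℂ (Fin n)) α).target ∩
    (chartAt (EuclideanSpace ℂ (Fin n)) α).symm ⁻¹' (trivializationAt ℂ L α).baseSet

/-- The determinant of a Kähler metric in the coordinates at `α`. -/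
def baseDet (g₀ : Metric (EuclideanSpace ℂ (Fin n)) W) (α : W) (w : EuclideanSpace ℂ (Fin n)) : ℝ :=
  (hermMatrix (g₀.inChart (chartAt (EuclideanSpace ℂ (Fin n)) α) w)).det.re

/-- The square norm of the preferred frame at `α`, for the bundle `L` if `s = true`, and of the dual
frame of the dual bundle if `s = false`. -/
def frameNorm (h : HermitianMetric (EuclideanSpace ℂ (Fin n)) L) (α : W) (s : Bool)
    (w : EuclideanSpace ℂ (Fin n)) : ℝ :=
  bif s then h.sqNorm ((chartAt (EuclideanSpace ℂ (Fin n)) α).symm w)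
    (lineFrame L α ((chartAt (EuclideanSpace ℂ (Fin n)) α).symm w) 1)
  else (h.sqNorm ((chartAt (EuclideanSpace ℂ (Fin n)) α).symm w)
    (lineFrame L α ((chartAt (EuclideanSpace ℂ (Fin n)) α).symm w) 1))⁻¹

theorem isOpen_coordBase (α : W) : IsOpen (coordBase (n := n) L α) :=
  (chartAt (EuclideanSpace ℂ (Fin n)) α).isOpen_inter_preimage_symm
    (trivializationAt ℂ L α).open_baseSet

theorem mem_baseDomain {α : W} {w : EuclideanSpace ℂ (Fin n)} (hw : w ∈ coordBase L α) :
    (chartAt (EuclideanSpace ℂ (Fin n)) α).symm w ∈ baseDomain (EuclideanSpace ℂ (Fin n)) L α :=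
  ⟨(chartAt _ α).map_target hw.1, hw.2⟩

theorem lineFrame_ne_zero {α w : W} (hw : w ∈ baseDomain (EuclideanSpace ℂ (Fin n)) L α) :
    lineFrame L α w 1 ≠ 0 := by
  intro h0
  have := lineCoord_lineFrame hw 1
  rw [h0, map_zero] at this
  exact zero_ne_one this

theorem chartAt_mem_maximalAtlas_real (α : W) : chartAt (EuclideanSpace ℂ (Fin n)) α ∈
    IsManifold.maximalAtlas 𝓘(ℝ, EuclideanSpace ℂ (Fin n)) ∞ W :=
  IsManifold.chart_mem_maximalAtlas α

theorem leviForm_I {V : Type*} [NormedAddCommGroup V] [NormedSpace ℂ V] (f : V → ℝ) (y u v : V) :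
    leviForm f y (Complex.I • u) (Complex.I • v) = leviForm f y u v := by
  have h : ∀ u v, fderiv ℝ (fun z => fderiv ℝ f z (-u)) y v = -fderiv ℝ (fun z => fderiv ℝ f z u) y v := by
    intro u v
    simp only [map_neg]
    rw [fderiv_fun_neg]
    rfl
  rw [leviForm, leviForm, I_smul_I_smul, I_smul_I_smul, map_neg, h, neg_neg, add_comm]

/-- A Kähler–Einstein metric is invariant under the complex structure and is the Levi form of
`-log det`. -/
theorem IsKahlerEinsteinForm.inChart_I {g₀ : Metric (EuclideanSpace ℂ (Fin n)) W}
    (hg₀ : IsKahlerEinsteinForm g₀) (α : W) {w : EuclideanSpace ℂ (Fin n)}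
    (hw : w ∈ (chartAt (EuclideanSpace ℂ (Fin n)) α).target) (u v : EuclideanSpace ℂ (Fin n)) :
    g₀.inChart (chartAt (EuclideanSpace ℂ (Fin n)) α) w (Complex.I • u) (Complex.I • v) =
      g₀.inChart (chartAt (EuclideanSpace ℂ (Fin n)) α) w u v := by
  rw [← hg₀.2 _ (IsManifold.chart_mem_maximalAtlas α) w hw,
    ← hg₀.2 _ (IsManifold.chart_mem_maximalAtlas α) w hw, leviForm_I]

open scoped ComplexOrder in
theorem IsKahlerEinsteinForm.det_pos {g₀ : Metric (EuclideanSpace ℂ (Fin n)) W}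
    (hg₀ : IsKahlerEinsteinForm g₀) (α : W) {w : EuclideanSpace ℂ (Fin n)}
    (hw : w ∈ (chartAt (EuclideanSpace ℂ (Fin n)) α).target) :
    0 < baseDet g₀ α w ∧
      (hermMatrix (g₀.inChart (chartAt (EuclideanSpace ℂ (Fin n)) α) w)).det = baseDet g₀ α w := by
  set φ := chartAt (EuclideanSpace ℂ (Fin n)) α
  have h := posDef_hermGram (B := g₀.inChartMap φ w) (fun u v => g₀.inChart_symm φ w u v)
    (hg₀.inChart_I α hw) (EuclideanSpace.basisFun (Fin n) ℂ).toBasis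
    (fun u hu => g₀.inChart_pos (chartAt_mem_maximalAtlas_real α) hw hu)
  have h2 : hermGram (EuclideanSpace.basisFun (Fin n) ℂ).toBasis (fun u v => g₀.inChartMap φ w u v) =
      hermMatrix (g₀.inChart φ w) := by
    ext i j
    simp [hermGram, hermMatrix, Metric.inChartMap_apply]
  rw [h2] at h
  have h3 := h.det_pos
  rw [Complex.pos_iff] at h3
  exact ⟨h3.1, Complex.ext rfl (by simpa using h3.2.symm)⟩

theorem contDiffOn_baseDet (g₀ : Metric (EuclideanSpace ℂ (Fin n)) W) (α : W) :
    ContDiffOn ℝ ∞ (baseDet g₀ α) (chartAt (EuclideanSpace ℂ (Fin n)) α).target := by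
  have h := fun u v => g₀.contDiffOn_inChart (chartAt_mem_maximalAtlas_real α) u v
  have h1 : ContDiffOn ℝ ∞ (fun w => (hermMatrix (g₀.inChart
      (chartAt (EuclideanSpace ℂ (Fin n)) α) w)).det) (chartAt (EuclideanSpace ℂ (Fin n)) α).target := by
    simp only [Matrix.det_apply]
    refine ContDiffOn.sum fun σ _ => ContDiffOn.const_smul _ (contDiffOn_prod fun i _ => ?_)
    exact (Complex.ofRealCLM.contDiff.comp_contDiffOn (h _ _)).add
      (contDiffOn_const.mul (Complex.ofRealCLM.contDiff.comp_contDiffOn (h _ _)))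
  exact Complex.reCLM.contDiff.comp_contDiffOn h1

theorem IsKahlerEinsteinForm.levi_eq {g₀ : Metric (EuclideanSpace ℂ (Fin n)) W}
    (hg₀ : IsKahlerEinsteinForm g₀) (α : W) {w : EuclideanSpace ℂ (Fin n)}
    (hw : w ∈ (chartAt (EuclideanSpace ℂ (Fin n)) α).target) (u v : EuclideanSpace ℂ (Fin n)) :
    -leviMap (fun z => Real.log (baseDet g₀ α z)) w u v =
      g₀.inChart (chartAt (EuclideanSpace ℂ (Fin n)) α) w u v := by
  have h : ContDiffAt ℝ 2 (fun z => Real.log (baseDet g₀ α z)) w :=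
    (((contDiffOn_baseDet g₀ α).contDiffAt ((chartAt _ α).open_target.mem_nhds hw)).log
      (hg₀.det_pos α hw).1.ne').of_le ENat.LEInfty.out
  rw [← leviForm_eq h]
  exact hg₀.2 _ (IsManifold.chart_mem_maximalAtlas α) w hw u v

theorem frameNorm_pos (h : HermitianMetric (EuclideanSpace ℂ (Fin n)) L) (α : W) (s : Bool)
    {w : EuclideanSpace ℂ (Fin n)} (hw : w ∈ coordBase L α) : 0 < frameNorm h α s w := by
  have := h.pos _ _ (lineFrame_ne_zero (mem_baseDomain hw))
  cases s
  · exact inv_pos.2 this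
  · exact this

theorem contDiffOn_frameNorm (h : HermitianMetric (EuclideanSpace ℂ (Fin n)) L) (α : W) (s : Bool) :
    ContDiffOn ℝ ∞ (frameNorm h α s) (coordBase L α) := by
  have h1 : ContDiffOn ℝ ∞ (fun w => h.sqNorm ((chartAt (EuclideanSpace ℂ (Fin n)) α).symm w)
      (lineFrame L α ((chartAt (EuclideanSpace ℂ (Fin n)) α).symm w) 1)) (coordBase L α) := by
    rw [← contMDiffOn_iff_contDiffOn]
    have h2 : ContMDiffOn 𝓘(ℝ, EuclideanSpace ℂ (Fin n)) 𝓘(ℝ, EuclideanSpace ℂ (Fin n)) ∞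
        (chartAt (EuclideanSpace ℂ (Fin n)) α).symm (coordBase L α) :=
      (contMDiffOn_symm_of_mem_maximalAtlas (chartAt_mem_maximalAtlas_real α)).mono inter_subset_left
    refine ((h.smooth (trivializationAt ℂ L α)).comp h2 fun w hw => hw.2).congr fun w hw => ?_
    simp only [Function.comp_apply, lineFrame]
    rw [Trivialization.symmₗ_apply _ hw.2]
  cases s
  · exact h1.inv fun w hw => (h.pos _ _ (lineFrame_ne_zero (mem_baseDomain hw))).ne'
  · exact h1

theorem hermMatrix_neg (B : EuclideanSpace ℂ (Fin n) → EuclideanSpace ℂ (Fin n) → ℝ) :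
    hermMatrix (fun u v => -B u v) = -hermMatrix B := by
  ext i j
  simp [hermMatrix]
  ring

/-- The data of the base in the preferred coordinates at `α`, at both ends of the projective
bundle. -/
theorem isBaseData {h : HermitianMetric (EuclideanSpace ℂ (Fin n)) L}
    {g₀ : Metric (EuclideanSpace ℂ (Fin n)) W} (hg₀ : IsKahlerEinsteinForm g₀) {μ : Fin n → ℝ}
    (hμ : HasConstantEigenvalues h g₀ μ) (α : W) (s : Bool) :
    IsBaseData (coordBase L α) (baseDet g₀ α) (frameNorm h α s) (endMu μ s) where
  isOpen := isOpen_coordBase α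
  smooth_det := (contDiffOn_baseDet g₀ α).mono inter_subset_left
  smooth_norm := contDiffOn_frameNorm h α s
  det_pos w hw := (hg₀.det_pos α hw.1).1
  norm_pos w hw := frameNorm_pos h α s hw
  levi_neg w hw u hu := by
    have h1 := hg₀.levi_eq α hw.1 u u
    have h2 := g₀.inChart_pos (chartAt_mem_maximalAtlas_real α) hw.1 hu
    linarith
  det_eq w hw := by
    simp only [hg₀.levi_eq α hw.1]
    exact (hg₀.det_pos α hw.1).2
  charpoly_eq w hw := by
    simp only [hg₀.levi_eq α hw.1]
    have h1 := hμ _ (IsManifold.chart_mem_maximalAtlas α) (trivializationAt ℂ L α) w hw.1 hw.2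
    have hlog : ContDiffAt ℝ 2 (fun z => Real.log (frameNorm h α true z)) w :=
      (((contDiffOn_frameNorm h α true).contDiffAt ((isOpen_coordBase α).mem_nhds hw)).log
        (frameNorm_pos h α true hw).ne').of_le ENat.LEInfty.out
    have h2 : chernForm h (chartAt (EuclideanSpace ℂ (Fin n)) α) (trivializationAt ℂ L α) w =
        fun u v => -leviMap (fun z => Real.log (frameNorm h α true z)) w u v := by
      have he : (fun z => Real.log (h.sqNorm ((chartAt (EuclideanSpace ℂ (Fin n)) α).symm z)
          ((trivializationAt ℂ L α).symm ((chartAt (EuclideanSpace ℂ (Fin n)) α).symm z) 1))) =ᶠ[𝓝 w]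
            fun z => Real.log (frameNorm h α true z) := by
        filter_upwards [(isOpen_coordBase α).mem_nhds hw] with z hz
        simp only [frameNorm, lineFrame, cond_true]
        rw [Trivialization.symmₗ_apply _ hz.2]
      ext u v
      rw [chernForm, leviForm_eq (hlog.congr_of_eventuallyEq he), Filter.EventuallyEq.leviMap_eq he]
    rw [h2] at h1
    cases s
    · have h3 : (fun z => Real.log (frameNorm h α false z)) =
          fun z => (-1) * Real.log (frameNorm h α true z) + 0 * Real.log (frameNorm h α true z) := by
        ext z
        simp [frameNorm, Real.log_inv]
      have h4 : (fun u v => -leviMap (fun z => Real.log (frameNorm h α false z)) w u v) =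
          fun u v => -(fun u v => -leviMap (fun z => Real.log (frameNorm h α true z)) w u v) u v := by
        ext u v
        rw [h3, leviMap_lin hlog hlog]
        simp
      rw [h4, hermMatrix_neg, Matrix.mul_neg]
      simpa [endMu] using charpoly_neg_eq h1
    · exact h1

end BaseData

/-! ### Charts of the punctured canonical bundle -/

section CanonicalCharts
variable {V : Type*} [NormedAddCommGroup V] [NormedSpace ℂ V] [FiniteDimensional ℂ V]
  {M : Type*} [TopologicalSpace M] [ChartedSpace V M] [IsManifold 𝓘(ℂ, V) ω M]
  {p p' q : puncturedCanonical V M} {z : V × ℂ}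

theorem mem_chart_source_punctured :
    q ∈ (chartAt (V × ℂ) p).source ↔ q.1.base ∈ (chartAt V p.1.base).source := by
  rw [TopologicalSpace.Opens.chartAt_eq, OpenPartialHomeomorph.subtypeRestr_source]
  rfl

theorem chartAt_punctured_apply (p q : puncturedCanonical V M) : chartAt (V × ℂ) p q =
    (chartAt V p.1.base q.1.base, formCoord (chartAt V p.1.base) q.1.base q.1.form) := rfl

theorem formCoord_ne_zero (hq : q.1.base ∈ (chartAt V p.1.base).source) :
    formCoord (chartAt V p.1.base) q.1.base q.1.form ≠ 0 := by
  obtain ⟨c, hc⟩ := exists_smul_stdForm q.1.base q.1.form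
  rw [hc, formCoord_smul_stdForm]
  refine mul_ne_zero (fun h0 => q.2 ?_) (jac_ne_zero (chart_mem_atlas V _) hq)
  rw [hc, h0, zero_smul]

/-- The point of the punctured canonical bundle with given coordinates. -/
def puncturedPoint (p : puncturedCanonical V M) (z : V × ℂ)
    (hz : z.1 ∈ (chartAt V p.1.base).target) (h0 : z.2 ≠ 0) : puncturedCanonical V M :=
  ⟨⟨(chartAt V p.1.base).symm z.1,
    (z.2 / jac (chartAt V p.1.base) ((chartAt V p.1.base).symm z.1)) • stdForm _⟩,
    smul_ne_zero (div_ne_zero h0 (jac_ne_zero (chart_mem_atlas V _)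
      ((chartAt V p.1.base).map_target hz))) (stdForm_ne_zero _)⟩

theorem puncturedPoint_mem (hz : z.1 ∈ (chartAt V p.1.base).target) (h0 : z.2 ≠ 0) :
    puncturedPoint p z hz h0 ∈ (chartAt (V × ℂ) p).source :=
  mem_chart_source_punctured.2 ((chartAt V p.1.base).map_target hz)

theorem chartAt_puncturedPoint (hz : z.1 ∈ (chartAt V p.1.base).target) (h0 : z.2 ≠ 0) :
    chartAt (V × ℂ) p (puncturedPoint p z hz h0) = z := by
  rw [chartAt_punctured_apply]
  ext1
  · exact (chartAt V p.1.base).right_inv hz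
  · dsimp only [puncturedPoint]
    rw [formCoord_smul_stdForm, div_mul_cancel₀]
    exact jac_ne_zero (chart_mem_atlas V _) ((chartAt V p.1.base).map_target hz)

theorem mem_chart_target_punctured :
    z ∈ (chartAt (V × ℂ) p).target ↔ z.1 ∈ (chartAt V p.1.base).target ∧ z.2 ≠ 0 := by
  constructor
  · intro hz
    have h1 := (chartAt (V × ℂ) p).map_target hz
    have h2 := (chartAt (V × ℂ) p).right_inv hz
    rw [← h2, chartAt_punctured_apply]
    have h3 := mem_chart_source_punctured.1 h1
    exact ⟨(chartAt V p.1.base).map_source h3, formCoord_ne_zero h3⟩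
  · rintro ⟨h1, h2⟩
    rw [← chartAt_puncturedPoint h1 h2]
    exact (chartAt (V × ℂ) p).map_source (puncturedPoint_mem h1 h2)

theorem chartAt_punctured_symm (hz : z.1 ∈ (chartAt V p.1.base).target) (h0 : z.2 ≠ 0) :
    (chartAt (V × ℂ) p).symm z = puncturedPoint p z hz h0 := by
  conv_lhs => rw [← chartAt_puncturedPoint hz h0]
  exact (chartAt (V × ℂ) p).left_inv (puncturedPoint_mem hz h0)

theorem base_chartAt_symm (hz : z ∈ (chartAt (V × ℂ) p).target) :
    ((chartAt (V × ℂ) p).symm z).1.base = (chartAt V p.1.base).symm z.1 := by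
  obtain ⟨h1, h2⟩ := mem_chart_target_punctured.1 hz
  rw [chartAt_punctured_symm h1 h2]
  rfl

/-- The change of coordinates on the canonical bundle. -/
theorem chartAt_punctured_trans (hz : z ∈ (chartAt (V × ℂ) p).target)
    (hz' : (chartAt (V × ℂ) p).symm z ∈ (chartAt (V × ℂ) p').source) :
    chartAt (V × ℂ) p' ((chartAt (V × ℂ) p).symm z) =
      (chartAt V p'.1.base ((chartAt V p.1.base).symm z.1),
        z.2 / LinearMap.det (fderiv ℂ (fun y => chartAt V p'.1.base ((chartAt V p.1.base).symm y))
          z.1 : V →ₗ[ℂ] V)) := by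
  obtain ⟨h1, h2⟩ := mem_chart_target_punctured.1 hz
  rw [mem_chart_source_punctured, base_chartAt_symm hz] at hz'
  have h3 := (chartAt V p.1.base).map_target h1
  have h4 := jac_comp (chart_mem_atlas V p.1.base) (chart_mem_atlas V p'.1.base) h3 hz'
  rw [(chartAt V p.1.base).right_inv h1] at h4
  have h5 := jac_ne_zero (chart_mem_atlas V p'.1.base) hz'
  have h6 := jac_ne_zero (chart_mem_atlas V p.1.base) h3
  rw [chartAt_punctured_symm h1 h2, chartAt_punctured_apply]
  ext1
  · rfl
  · dsimp only [puncturedPoint]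
    rw [formCoord_smul_stdForm, h4]
    rw [h4] at h6
    field_simp

end CanonicalCharts

/-! ### Changes of coordinates of the projective bundle -/

section ProjectiveTransitions
variable {E : Type*} [NormedAddCommGroup E] [NormedSpace ℂ E] [FiniteDimensional ℂ E]
  {W : Type*} [TopologicalSpace W] [ChartedSpace E W] [IsManifold 𝓘(ℂ, E) ω W]
  {L : W → Type*} [∀ w, AddCommGroup (L w)] [∀ w, Module ℂ (L w)]
  [TopologicalSpace (TotalSpace ℂ L)] [∀ w, TopologicalSpace (L w)] [FiberBundle ℂ L]
  [VectorBundle ℂ ℂ L]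

/-- The jacobian determinant of a change of coordinates on the base. -/
def baseJac (E : Type*) [NormedAddCommGroup E] [NormedSpace ℂ E] {W : Type*} [TopologicalSpace W]
    [ChartedSpace E W] (α β : W) (w : E) : ℂ :=
  LinearMap.det (fderiv ℂ (chartTrans E α β) w : E →ₗ[ℂ] E)

variable (E L) in
/-- The domain of the change of coordinates and of frames on the base. -/
def overlapBase (α β : W) : Set E :=
  (chartAt E α).target ∩ (chartAt E α).symm ⁻¹' (baseDomain E L α ∩ baseDomain E L β)

variable (E L) in
/-- The factor by which the fibre coordinate `ζ` is multiplied in a change of frames. -/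
def frameRatio (α β : W) (s : Bool) (w : E) : ℂ :=
  bif s then lineTrans L α β ((chartAt E α).symm w)
  else (lineTrans L α β ((chartAt E α).symm w))⁻¹

theorem lineTrans_ne_zero {α β w : W} (hα : w ∈ baseDomain E L α) (hβ : w ∈ baseDomain E L β) :
    lineTrans L α β w ≠ 0 := by
  intro h0
  have h1 := lineFrame_lineCoord hβ (lineFrame L α w 1)
  rw [← lineTrans, h0, map_zero] at h1
  have h2 := lineCoord_lineFrame hα 1
  rw [← h1, map_zero] at h2
  exact zero_ne_one h2

theorem lineFrame_eq_smul {α β w : W} (hβ : w ∈ baseDomain E L β) :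
    lineFrame L α w 1 = lineTrans L α β w • lineFrame L β w 1 := by
  rw [← map_smul, smul_eq_mul, mul_one, lineTrans, lineFrame_lineCoord hβ]

theorem frameRatio_ne_zero {α β : W} (s : Bool) {w : E} (hw : w ∈ overlapBase E L α β) :
    frameRatio E L α β s w ≠ 0 := by
  have := lineTrans_ne_zero hw.2.1 hw.2.2
  cases s
  · exact inv_ne_zero this
  · exact this

theorem isOpen_overlapBase (α β : W) : IsOpen (overlapBase E L α β) :=
  (chartAt E α).isOpen_inter_preimage_symm ((isOpen_baseDomain α).inter (isOpen_baseDomain β))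

theorem differentiableAt_frameRatio [ContMDiffVectorBundle ω ℂ L 𝓘(ℂ, E)] {α β : W} (s : Bool)
    {w : E} (hw : w ∈ overlapBase E L α β) : DifferentiableAt ℂ (frameRatio E L α β s) w := by
  have h : DifferentiableAt ℂ (fun w => lineTrans L α β ((chartAt E α).symm w)) w :=
    ((contDiffOn_lineTrans (E := E) (L := L) α β).contDiffAt
      ((isOpen_overlapBase α β).mem_nhds hw)).differentiableAt (by simp)
  cases s
  · exact h.inv (lineTrans_ne_zero hw.2.1 hw.2.2)
  · exact h

theorem differentiableAt_chartTrans {α β : W} {w : E} (hw : w ∈ (chartAt E α).target)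
    (hw' : (chartAt E α).symm w ∈ (chartAt E β).source) :
    DifferentiableAt ℂ (chartTrans E α β) w := by
  refine ((contDiffOn_trans (chart_mem_atlas E α) (chart_mem_atlas E β)).contDiffAt
    (((chartAt E α).symm ≫ₕ chartAt E β).open_source.mem_nhds ?_)).differentiableAt (by simp)
  rw [OpenPartialHomeomorph.trans_source]
  exact ⟨hw, hw'⟩

theorem baseJac_ne_zero {α β : W} {w : E} (hw : w ∈ (chartAt E α).target)
    (hw' : (chartAt E α).symm w ∈ (chartAt E β).source) : baseJac E α β w ≠ 0 := by
  have h1 := jac_comp (chart_mem_atlas E α) (chart_mem_atlas E β) ((chartAt E α).map_target hw) hw'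
  rw [(chartAt E α).right_inv hw] at h1
  exact right_ne_zero_of_mul (h1 ▸ jac_ne_zero (chart_mem_atlas E α) ((chartAt E α).map_target hw))

theorem mem_projTrans_source (i j : W × Bool) (y : E × ℂ) :
    y ∈ ((projChart E L i).symm.trans (projChart E L j)).source ↔
      y.1 ∈ overlapBase E L i.1 j.1 ∧ (i.2 ≠ j.2 → y.2 ≠ 0) := by
  rw [projChart_source]
  refine and_congr_right fun h => ?_
  have h1 : y.1 ∈ overlapBase E L i.1 j.1 := h
  have hl := lineTrans_ne_zero h1.2.1 h1.2.2
  obtain ⟨α, s⟩ := i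
  obtain ⟨β, s'⟩ := j
  cases s <;> cases s' <;> simp [homTrans, swapIf] <;> first | exact hl | exact fun _ => hl

theorem projTrans_same (α β : W) (s : Bool) {y : E × ℂ}
    (hy : y ∈ ((projChart E L (α, s)).symm.trans (projChart E L (β, s))).source) :
    (projChart E L (α, s)).symm.trans (projChart E L (β, s)) y =
      (chartTrans E α β y.1, y.2 * frameRatio E L α β s y.1) := by
  rw [projChart_trans _ _ _ hy]
  cases s <;> simp [homTrans, swapIf, frameRatio, chartTrans, div_eq_mul_inv]

theorem projTrans_swap (α β : W) (s : Bool) {y : E × ℂ}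
    (hy : y ∈ ((projChart E L (α, s)).symm.trans (projChart E L (β, !s))).source) :
    (projChart E L (α, s)).symm.trans (projChart E L (β, !s)) y =
      (chartTrans E α β y.1, (y.2 * frameRatio E L α β s y.1)⁻¹) := by
  rw [projChart_trans _ _ _ hy]
  cases s <;> simp [homTrans, swapIf, frameRatio, chartTrans, div_eq_mul_inv]

variable [ContMDiffVectorBundle ω ℂ L 𝓘(ℂ, E)]

theorem det_projTrans_same (α β : W) (s : Bool) {y : E × ℂ}
    (hy : y ∈ ((projChart E L (α, s)).symm.trans (projChart E L (β, s))).source) :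
    LinearMap.det (fderiv ℂ (fun y => (projChart E L (α, s)).symm.trans (projChart E L (β, s)) y) y :
      E × ℂ →ₗ[ℂ] E × ℂ) = baseJac E α β y.1 * frameRatio E L α β s y.1 := by
  obtain ⟨hw, -⟩ := (mem_projTrans_source _ _ _).1 hy
  have h1 : HasFDerivAt (fun y : E × ℂ => chartTrans E α β y.1) _ y :=
    (differentiableAt_chartTrans hw.1 hw.2.2.1).hasFDerivAt.comp y hasFDerivAt_fst
  have h2 : HasFDerivAt (fun y : E × ℂ => frameRatio E L α β s y.1) _ y :=
    (differentiableAt_frameRatio s hw).hasFDerivAt.comp y hasFDerivAt_fst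
  have h3 := h1.prodMk (hasFDerivAt_snd.mul h2)
  have h4 := h3.congr_of_eventuallyEq (f₁ := fun y =>
    (projChart E L (α, s)).symm.trans (projChart E L (β, s)) y) (by
      filter_upwards [((projFamily E L).open_source (α, s) (β, s)).mem_nhds hy] with x hx
        using projTrans_same α β s hx)
  rw [h4.fderiv]
  refine det_of_triangular _ (y.2 • (fderiv ℂ (frameRatio E L α β s) y.1 : E →ₗ[ℂ] ℂ)) _ _
    fun u v => ?_
  simp

theorem det_projTrans_swap (α β : W) (s : Bool) {y : E × ℂ}
    (hy : y ∈ ((projChart E L (α, s)).symm.trans (projChart E L (β, !s))).source) :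
    LinearMap.det (fderiv ℂ (fun y => (projChart E L (α, s)).symm.trans (projChart E L (β, !s)) y) y :
      E × ℂ →ₗ[ℂ] E × ℂ) = baseJac E α β y.1 * -(y.2 ^ 2 * frameRatio E L α β s y.1)⁻¹ := by
  obtain ⟨hw, hζ⟩ := (mem_projTrans_source _ _ _).1 hy
  have hζ0 : y.2 ≠ 0 := hζ (by simp)
  have hr := frameRatio_ne_zero s hw
  have h1 : HasFDerivAt (fun y : E × ℂ => chartTrans E α β y.1) _ y :=
    (differentiableAt_chartTrans hw.1 hw.2.2.1).hasFDerivAt.comp y hasFDerivAt_fst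
  have h2 : HasFDerivAt (fun y : E × ℂ => frameRatio E L α β s y.1) _ y :=
    (differentiableAt_frameRatio s hw).hasFDerivAt.comp y hasFDerivAt_fst
  have h3 := h1.prodMk ((hasDerivAt_inv (mul_ne_zero hζ0 hr)).comp_hasFDerivAt y
    (hasFDerivAt_snd.mul h2))
  have h4 := h3.congr_of_eventuallyEq (f₁ := fun y =>
    (projChart E L (α, s)).symm.trans (projChart E L (β, !s)) y) (by
      filter_upwards [((projFamily E L).open_source (α, s) (β, !s)).mem_nhds hy] with x hx
        using projTrans_swap α β s hx)
  rw [h4.fderiv]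
  refine det_of_triangular _ ((-((y.2 * frameRatio E L α β s y.1) ^ 2)⁻¹ * y.2) •
    (fderiv ℂ (frameRatio E L α β s) y.1 : E →ₗ[ℂ] ℂ)) _ _ fun u v => ?_
  simp [Prod.ext_iff]
  field_simp

/-- The chart of the projective bundle used at a point of the punctured canonical bundle: a point of
`W`, and the end of the projective bundle at which the fibre coordinate vanishes. -/
def endIdx (p : PuncturedK E L) : W × Bool := (projFamily E L).idx p.1.base

variable {p p' : PuncturedK E L} {z : (E × ℂ) × ℂ}

theorem mem_target_iff : z ∈ (chartAt ((E × ℂ) × ℂ) p).target ↔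
    (z.1.1 ∈ (chartAt E (endIdx p).1).target ∧
      (chartAt E (endIdx p).1).symm z.1.1 ∈ (trivializationAt ℂ L (endIdx p).1).baseSet) ∧ z.2 ≠ 0 :=
  mem_chart_target_punctured

theorem mem_source_iff (hz : z ∈ (chartAt ((E × ℂ) × ℂ) p).target) :
    (chartAt ((E × ℂ) × ℂ) p).symm z ∈ (chartAt ((E × ℂ) × ℂ) p').source ↔
      z.1.1 ∈ overlapBase E L (endIdx p).1 (endIdx p').1 ∧
        ((endIdx p).2 ≠ (endIdx p').2 → z.1.2 ≠ 0) := by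
  rw [mem_chart_source_punctured, base_chartAt_symm hz, ← mem_projTrans_source,
    PartialEquiv.trans_source]
  exact ⟨fun h => ⟨(mem_target_iff.1 hz).1, h⟩, fun h => h.2⟩

/-- The change of coordinates between two charts at the same end. -/
theorem trans_same (hz : z ∈ (chartAt ((E × ℂ) × ℂ) p).target)
    (hz' : (chartAt ((E × ℂ) × ℂ) p).symm z ∈ (chartAt ((E × ℂ) × ℂ) p').source)
    (hs : (endIdx p).2 = (endIdx p').2) :
    chartAt ((E × ℂ) × ℂ) p' ((chartAt ((E × ℂ) × ℂ) p).symm z) =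
      ((chartTrans E (endIdx p).1 (endIdx p').1 z.1.1,
        z.1.2 * frameRatio E L (endIdx p).1 (endIdx p').1 (endIdx p).2 z.1.1),
        z.2 / (baseJac E (endIdx p).1 (endIdx p').1 z.1.1 *
          frameRatio E L (endIdx p).1 (endIdx p').1 (endIdx p).2 z.1.1)) := by
  have h1 := (mem_projTrans_source (endIdx p) (endIdx p') z.1).2 ((mem_source_iff hz).1 hz')
  have h2 : endIdx p' = ((endIdx p').1, (endIdx p).2) := Prod.ext rfl hs.symm
  rw [h2] at h1
  rw [chartAt_punctured_trans hz hz']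
  have h3 : (fun y => chartAt (E × ℂ) p'.1.base ((chartAt (E × ℂ) p.1.base).symm y)) = fun y =>
      (projChart E L ((endIdx p).1, (endIdx p).2)).symm.trans
        (projChart E L ((endIdx p').1, (endIdx p).2)) y := by
    rw [← h2]; rfl
  have e1 := det_projTrans_same (endIdx p).1 (endIdx p').1 (endIdx p).2 h1
  have e2 := projTrans_same (endIdx p).1 (endIdx p').1 (endIdx p).2 h1
  rw [h3, e1]
  refine Prod.ext ((congrFun h3 z.1).trans e2) rfl

/-- The change of coordinates between two charts at opposite ends. -/
theorem trans_swap (hz : z ∈ (chartAt ((E × ℂ) × ℂ) p).target)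
    (hz' : (chartAt ((E × ℂ) × ℂ) p).symm z ∈ (chartAt ((E × ℂ) × ℂ) p').source)
    (hs : (endIdx p).2 ≠ (endIdx p').2) :
    chartAt ((E × ℂ) × ℂ) p' ((chartAt ((E × ℂ) × ℂ) p).symm z) =
      ((chartTrans E (endIdx p).1 (endIdx p').1 z.1.1,
        (z.1.2 * frameRatio E L (endIdx p).1 (endIdx p').1 (endIdx p).2 z.1.1)⁻¹),
        z.2 / (baseJac E (endIdx p).1 (endIdx p').1 z.1.1 *
          -(z.1.2 ^ 2 * frameRatio E L (endIdx p).1 (endIdx p').1 (endIdx p).2 z.1.1)⁻¹)) := by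
  have h1 := (mem_projTrans_source (endIdx p) (endIdx p') z.1).2 ((mem_source_iff hz).1 hz')
  have h2 : endIdx p' = ((endIdx p').1, !(endIdx p).2) :=
    Prod.ext rfl (Bool.eq_not_of_ne hs.symm)
  rw [h2] at h1
  rw [chartAt_punctured_trans hz hz']
  have h3 : (fun y => chartAt (E × ℂ) p'.1.base ((chartAt (E × ℂ) p.1.base).symm y)) = fun y =>
      (projChart E L ((endIdx p).1, (endIdx p).2)).symm.trans
        (projChart E L ((endIdx p').1, !(endIdx p).2)) y := by
    rw [← h2]; rfl
  have e1 := det_projTrans_swap (endIdx p).1 (endIdx p').1 (endIdx p).2 h1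
  have e2 := projTrans_swap (endIdx p).1 (endIdx p').1 (endIdx p).2 h1
  rw [h3, e1]
  refine Prod.ext ((congrFun h3 z.1).trans e2) rfl

end ProjectiveTransitions

/-! ### Agreement of the potentials at the two ends -/

section Compatibility
variable {n : ℕ}

/-- The weight of the fibre coordinate of the canonical bundle for the homothetic flow, at the two
ends of the projective bundle. -/
def endSpeed (n : ℕ) (a : ℝ) (s : Bool) : ℝ := ((n : ℝ) + 2) / (1 + endA a s)

theorem endSpeed_false (n : ℕ) {a : ℝ} (ha : -(1 / 2) < a) :
    endSpeed n a false = (1 + 2 * a) * endSpeed n a true := by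
  have h1 : 1 + 2 * a ≠ 0 := by linarith
  have h3 : 1 + -(a / (1 + 2 * a)) = (1 + a) / (1 + 2 * a) := by
    rw [← neg_div, one_add_div h1]
    congr 1
    ring
  simp only [endSpeed, endA, cond_true, cond_false, h3]
  rw [div_div_eq_mul_div]
  ring

theorem endA_mul_endSpeed_false (n : ℕ) {a : ℝ} (ha : -(1 / 2) < a) :
    endA a false * endSpeed n a false = -(a * endSpeed n a true) := by
  have h1 : 1 + 2 * a ≠ 0 := by linarith
  have h2 : a / (1 + 2 * a) * (1 + 2 * a) = a := div_mul_cancel₀ a h1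
  rw [endSpeed_false n ha]
  simp only [endA, cond_false]
  linear_combination (-endSpeed n a true) * h2

theorem endA_mul_endSpeed_not (n : ℕ) {a : ℝ} (ha : -(1 / 2) < a) (s : Bool) :
    endA a (!s) * endSpeed n a (!s) = -(endA a s * endSpeed n a s) := by
  have h : endA a true = a := rfl
  cases s
  · simp only [Bool.not_false, endA_mul_endSpeed_false n ha, h, neg_neg]
  · simp only [Bool.not_true, endA_mul_endSpeed_false n ha, h]

theorem endSpeed_not (n : ℕ) {a : ℝ} (ha : -(1 / 2) < a) (s : Bool) :
    endSpeed n a (!s) = endSpeed n a s + 2 * (endA a s * endSpeed n a s) := by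
  have h : endA a true = a := rfl
  cases s
  · rw [endA_mul_endSpeed_false n ha, endSpeed_false n ha, Bool.not_false]
    ring
  · rw [Bool.not_true, endSpeed_false n ha, h]
    ring

theorem potential_congr {a : ℝ} {Q : ℝ → ℝ} {D H D' H' : EuclideanSpace ℂ (Fin n) → ℝ}
    {z z' : (EuclideanSpace ℂ (Fin n) × ℂ) × ℂ} (hl : lineNorm H z = lineNorm H' z')
    (hc : canNorm D H z = canNorm D' H' z') : potential a Q D H z = potential a Q D' H' z' := by
  simp only [potential, flowInvariant, hl, hc]

/-- The potentials at the two ends agree: the line bundle is replaced by its dual, and `τ` picks up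
the factor `ζ²` of the change of the frame `dζ`. -/
theorem potential_swap {a : ℝ} (ha : -(1 / 2) < a) {Q : Bool → ℝ → ℝ}
    (hQ : ∀ t, 0 < t → Q false (t ^ (-(1 / (1 + 2 * a)))) = Q true t * t ^ (-(1 / (1 + 2 * a)) - 1))
    {D H D' H' : EuclideanSpace ℂ (Fin n) → ℝ} {z z' : (EuclideanSpace ℂ (Fin n) × ℂ) × ℂ}
    (hlpos : 0 < lineNorm H z) (hcpos : 0 < canNorm D H z)
    (hl : lineNorm H' z' = (lineNorm H z)⁻¹)
    (hc : canNorm D' H' z' = canNorm D H z * lineNorm H z ^ 2) :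
    potential (endA a false) (Q false) D' H' z' = potential (endA a true) (Q true) D H z := by
  set b : ℝ := 1 / (1 + 2 * a) with hb
  have hb1 : b * (1 + 2 * a) = 1 := by
    have : 1 + 2 * a ≠ 0 := by linarith
    rw [hb, one_div, inv_mul_cancel₀ this]
  have hA : endA a false = -(a * b) := by
    simp only [endA, cond_false, hb]
    ring
  clear_value b
  obtain ⟨l, hle⟩ : ∃ l, lineNorm H z = Real.exp l := ⟨_, (Real.exp_log hlpos).symm⟩
  obtain ⟨c, hce⟩ : ∃ c, canNorm D H z = Real.exp c := ⟨_, (Real.exp_log hcpos).symm⟩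
  have hc' : canNorm D' H' z' = Real.exp (c + 2 * l) := by
    rw [hc, hce, hle, ← Real.exp_nat_mul, ← Real.exp_add]
    norm_num
  have hT : flowInvariant (endA a true) D H z = Real.exp (l - a * c) := by
    simp only [flowInvariant, endA, cond_true, hle, hce]
    rw [← Real.exp_mul, ← Real.exp_add]
    ring_nf
  have hT' : flowInvariant (endA a false) D' H' z' = Real.exp (l - a * c) ^ (-b) := by
    rw [flowInvariant, hA, hl, hle, hc', ← Real.exp_neg, ← Real.exp_mul, ← Real.exp_mul,
      ← Real.exp_add]
    congr 1
    linear_combination l * hb1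
  rw [potential, potential, hT', hQ _ (Real.exp_pos _), hT, hc', hce, hA]
  congr 1
  simp only [endA, cond_true, ← Real.exp_mul]
  have : Real.exp ((c + 2 * l) * (1 + -(a * b))) * Real.exp ((l - a * c) * (-b - 1)) =
      Real.exp (c * (1 + a)) := by
    rw [← Real.exp_add]
    congr 1
    linear_combination (-l) * hb1
  linear_combination Q true (Real.exp (l - a * c)) * this

end Compatibility

section Norms
variable {n : ℕ} {W : Type*} [TopologicalSpace W] [ChartedSpace (EuclideanSpace ℂ (Fin n)) W]
  [IsManifold 𝓘(ℂ, EuclideanSpace ℂ (Fin n)) ω W]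
  {L : W → Type*} [∀ w, AddCommGroup (L w)] [∀ w, Module ℂ (L w)]
  [TopologicalSpace (TotalSpace ℂ L)] [∀ w, TopologicalSpace (L w)] [FiberBundle ℂ L]
  [VectorBundle ℂ ℂ L] {α β : W} {w : EuclideanSpace ℂ (Fin n)}

theorem baseDet_trans {g₀ : Metric (EuclideanSpace ℂ (Fin n)) W} (hg₀ : IsKahlerEinsteinForm g₀)
    (hw : w ∈ (chartAt (EuclideanSpace ℂ (Fin n)) α).target)
    (hw' : (chartAt (EuclideanSpace ℂ (Fin n)) α).symm w ∈
      (chartAt (EuclideanSpace ℂ (Fin n)) β).source) :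
    baseDet g₀ α w = ‖baseJac (EuclideanSpace ℂ (Fin n)) α β w‖ ^ 2 *
      baseDet g₀ β (chartTrans (EuclideanSpace ℂ (Fin n)) α β w) := by
  have hw'' := (chartAt (EuclideanSpace ℂ (Fin n)) β).map_source hw'
  have h1 := (hg₀.det_pos α hw).2
  have h2 := (hg₀.det_pos β hw'').2
  have hd := differentiableAt_chartTrans hw hw'
  have h3 := det_hermMatrix_comp (B := g₀.inChartMap (chartAt (EuclideanSpace ℂ (Fin n)) β)
    (chartTrans (EuclideanSpace ℂ (Fin n)) α β w)) (hg₀.inChart_I β hw'')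
    (fderiv ℂ (chartTrans (EuclideanSpace ℂ (Fin n)) α β) w)
  have h4 : (fun u v => g₀.inChartMap (chartAt (EuclideanSpace ℂ (Fin n)) β)
      (chartTrans (EuclideanSpace ℂ (Fin n)) α β w)
        (fderiv ℂ (chartTrans (EuclideanSpace ℂ (Fin n)) α β) w u)
        (fderiv ℂ (chartTrans (EuclideanSpace ℂ (Fin n)) α β) w v)) =
      g₀.inChart (chartAt (EuclideanSpace ℂ (Fin n)) α) w := by
    ext u v
    rw [g₀.inChart_trans (chartAt_mem_maximalAtlas_real α) (chartAt_mem_maximalAtlas_real β) hw hw',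
      Metric.inChartMap_apply]
    have h5 := hd.fderiv_restrictScalars ℝ
    have h6 : ∀ u, fderiv ℝ (fun z => (chartAt (EuclideanSpace ℂ (Fin n)) β)
        ((chartAt (EuclideanSpace ℂ (Fin n)) α).symm z)) w u =
          fderiv ℂ (chartTrans (EuclideanSpace ℂ (Fin n)) α β) w u := fun u =>
      congrArg (fun A : _ →L[ℝ] _ => A u) h5
    rw [h6, h6]
    rfl
  rw [h4, h1] at h3
  have h7 : hermMatrix (fun u v => g₀.inChartMap (chartAt (EuclideanSpace ℂ (Fin n)) β)
      (chartTrans (EuclideanSpace ℂ (Fin n)) α β w) u v) =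
      hermMatrix (g₀.inChart (chartAt (EuclideanSpace ℂ (Fin n)) β)
        (chartTrans (EuclideanSpace ℂ (Fin n)) α β w)) := rfl
  rw [h7, show (hermMatrix (g₀.inChart (chartAt (EuclideanSpace ℂ (Fin n)) β)
        (chartTrans (EuclideanSpace ℂ (Fin n)) α β w))).det = _ from h2, ← Complex.ofReal_mul] at h3
  exact_mod_cast h3

theorem sqNorm_trans (h : HermitianMetric (EuclideanSpace ℂ (Fin n)) L)
    (hw : w ∈ overlapBase (EuclideanSpace ℂ (Fin n)) L α β) :
    frameNorm h α true w = ‖frameRatio (EuclideanSpace ℂ (Fin n)) L α β true w‖ ^ 2 *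
      frameNorm h β true (chartTrans (EuclideanSpace ℂ (Fin n)) α β w) := by
  have h1 : (chartAt (EuclideanSpace ℂ (Fin n)) β).symm
      (chartTrans (EuclideanSpace ℂ (Fin n)) α β w) =
      (chartAt (EuclideanSpace ℂ (Fin n)) α).symm w :=
    (chartAt (EuclideanSpace ℂ (Fin n)) β).left_inv hw.2.2.1
  simp only [frameNorm, frameRatio, cond_true]
  rw [h1, lineFrame_eq_smul hw.2.2, h.sqNorm_smul]

theorem chartTrans_mem_coordBase (hw : w ∈ overlapBase (EuclideanSpace ℂ (Fin n)) L α β) :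
    chartTrans (EuclideanSpace ℂ (Fin n)) α β w ∈ coordBase L β := by
  refine ⟨(chartAt (EuclideanSpace ℂ (Fin n)) β).map_source hw.2.2.1, ?_⟩
  rw [mem_preimage, chartTrans, (chartAt (EuclideanSpace ℂ (Fin n)) β).left_inv hw.2.2.1]
  exact hw.2.2.2

theorem frameNorm_trans (h : HermitianMetric (EuclideanSpace ℂ (Fin n)) L)
    (hw : w ∈ overlapBase (EuclideanSpace ℂ (Fin n)) L α β) (s : Bool) :
    frameNorm h α s w = ‖frameRatio (EuclideanSpace ℂ (Fin n)) L α β s w‖ ^ 2 *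
      frameNorm h β s (chartTrans (EuclideanSpace ℂ (Fin n)) α β w) := by
  have h1 := sqNorm_trans h hw
  cases s
  · have h2 : ∀ α w, frameNorm h α false w = (frameNorm h α true w)⁻¹ := fun _ _ => rfl
    have h3 : frameRatio (EuclideanSpace ℂ (Fin n)) L α β false w =
      (frameRatio (EuclideanSpace ℂ (Fin n)) L α β true w)⁻¹ := rfl
    rw [h2, h2, h1, h3, mul_inv, norm_inv, inv_pow]
  · exact h1

theorem frameNorm_trans_not (h : HermitianMetric (EuclideanSpace ℂ (Fin n)) L)
    (hw : w ∈ overlapBase (EuclideanSpace ℂ (Fin n)) L α β) (s : Bool) :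
    frameNorm h α s w * frameNorm h β (!s) (chartTrans (EuclideanSpace ℂ (Fin n)) α β w) =
      ‖frameRatio (EuclideanSpace ℂ (Fin n)) L α β s w‖ ^ 2 := by
  have h0 := (frameNorm_pos h β s (chartTrans_mem_coordBase hw)).ne'
  have h2 : ∀ α w, frameNorm h α (!s) w = (frameNorm h α s w)⁻¹ := by
    intro α w
    cases s
    · exact (inv_inv _).symm
    · rfl
  rw [frameNorm_trans h hw, h2, mul_assoc, mul_inv_cancel₀ h0, mul_one]

end Norms

/-! ### Atlases of cone potentials -/

section ConeAtlas
variable {n : ℕ} {W : Type*} [TopologicalSpace W] [ChartedSpace (EuclideanSpace ℂ (Fin n)) W]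
  [IsManifold 𝓘(ℂ, EuclideanSpace ℂ (Fin n)) ω W]
  {L : W → Type*} [∀ w, AddCommGroup (L w)] [∀ w, Module ℂ (L w)]
  [TopologicalSpace (TotalSpace ℂ L)] [∀ w, TopologicalSpace (L w)] [FiberBundle ℂ L]
  [VectorBundle ℂ ℂ L]

/-- The potential in the coordinates at a point of `W` and at an end of the projective bundle. -/
def endPotential (h : HermitianMetric (EuclideanSpace ℂ (Fin n)) L)
    (g₀ : Metric (EuclideanSpace ℂ (Fin n)) W) (a : ℝ) (Q : Bool → ℝ → ℝ) (i : W × Bool) :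
    (EuclideanSpace ℂ (Fin n) × ℂ) × ℂ → ℝ :=
  potential (endA a i.2) (Q i.2) (baseDet g₀ i.1) (frameNorm h i.1 i.2)

variable {h : HermitianMetric (EuclideanSpace ℂ (Fin n)) L}
  {g₀ : Metric (EuclideanSpace ℂ (Fin n)) W} {a : ℝ} {Q : Bool → ℝ → ℝ} {α β : W}
  {z : (EuclideanSpace ℂ (Fin n) × ℂ) × ℂ}

theorem endPotential_same (hg₀ : IsKahlerEinsteinForm g₀) (s : Bool)
    (hw : z.1.1 ∈ overlapBase (EuclideanSpace ℂ (Fin n)) L α β) :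
    endPotential h g₀ a Q (β, s) ((chartTrans (EuclideanSpace ℂ (Fin n)) α β z.1.1,
        z.1.2 * frameRatio (EuclideanSpace ℂ (Fin n)) L α β s z.1.1),
        z.2 / (baseJac (EuclideanSpace ℂ (Fin n)) α β z.1.1 *
          frameRatio (EuclideanSpace ℂ (Fin n)) L α β s z.1.1)) = endPotential h g₀ a Q (α, s) z := by
  have hD := baseDet_trans hg₀ hw.1 hw.2.2.1
  have hH := frameNorm_trans h hw s
  have hr := norm_ne_zero_iff.2 (frameRatio_ne_zero s hw)
  have hJ := norm_ne_zero_iff.2 (baseJac_ne_zero hw.1 hw.2.2.1)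
  have hD' := (hg₀.det_pos β (chartTrans_mem_coordBase hw).1).1.ne'
  have hH' := (frameNorm_pos h β s (chartTrans_mem_coordBase hw)).ne'
  refine (potential_congr ?_ ?_).symm
  · simp only [lineNorm, hH, norm_mul]
    ring
  · simp only [canNorm, hD, hH, norm_mul, norm_div]
    field_simp

theorem endPotential_swap (hg₀ : IsKahlerEinsteinForm g₀) (ha : -(1 / 2) < a)
    (hQ : ∀ t, 0 < t → Q false (t ^ (-(1 / (1 + 2 * a)))) = Q true t * t ^ (-(1 / (1 + 2 * a)) - 1))
    (hw : z.1.1 ∈ overlapBase (EuclideanSpace ℂ (Fin n)) L α β) (hζ : z.1.2 ≠ 0) (hτ : z.2 ≠ 0) :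
    endPotential h g₀ a Q (β, false) ((chartTrans (EuclideanSpace ℂ (Fin n)) α β z.1.1,
        (z.1.2 * frameRatio (EuclideanSpace ℂ (Fin n)) L α β true z.1.1)⁻¹),
        z.2 / (baseJac (EuclideanSpace ℂ (Fin n)) α β z.1.1 *
          -(z.1.2 ^ 2 * frameRatio (EuclideanSpace ℂ (Fin n)) L α β true z.1.1)⁻¹)) =
      endPotential h g₀ a Q (α, true) z := by
  have hD := baseDet_trans hg₀ hw.1 hw.2.2.1
  have hHH : frameNorm h α true z.1.1 * frameNorm h β false
      (chartTrans (EuclideanSpace ℂ (Fin n)) α β z.1.1) = _ := frameNorm_trans_not h hw true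
  have hr := norm_ne_zero_iff.2 (frameRatio_ne_zero true hw)
  have hJ := norm_ne_zero_iff.2 (baseJac_ne_zero hw.1 hw.2.2.1)
  have hDpos := (hg₀.det_pos α hw.1).1
  have hD' := (hg₀.det_pos β (chartTrans_mem_coordBase hw).1).1.ne'
  have hH' := (frameNorm_pos h β false (chartTrans_mem_coordBase hw)).ne'
  have hHpos := frameNorm_pos h α true ⟨hw.1, hw.2.1.2⟩
  have hζn := norm_ne_zero_iff.2 hζ
  refine potential_swap ha hQ ?_ ?_ ?_ ?_
  · exact mul_pos (pow_pos (norm_pos_iff.2 hζ) 2) hHpos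
  · exact div_pos (pow_pos (norm_pos_iff.2 hτ) 2) (mul_pos hDpos hHpos)
  · simp only [lineNorm, norm_mul, norm_inv]
    field_simp
    rw [← hHH]
    ring
  · simp only [lineNorm, canNorm, hD, norm_mul, norm_inv, norm_div, norm_neg, norm_pow]
    field_simp
    rw [← hHH]
    ring

variable (L) in
/-- Functions `f i` in the charts of the punctured canonical bundle which are the expressions of one
potential of a Ricci flat Kähler cone metric, with the homothetic flow `scaleMap`. The charts are
indexed by a point of `W` and by an end of the projective bundle. -/
structure IsConeAtlas [ContMDiffVectorBundle ω ℂ L 𝓘(ℂ, EuclideanSpace ℂ (Fin n))]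
    (f : W × Bool → (EuclideanSpace ℂ (Fin n) × ℂ) × ℂ → ℝ) (k m : Bool → ℝ) : Prop where
  cone : ∀ i, IsConePotential (coordBase L i.1) (f i) (k i.2) (m i.2)
  trans : ∀ (p p' : PuncturedK (EuclideanSpace ℂ (Fin n)) L) z,
    z ∈ (chartAt ((EuclideanSpace ℂ (Fin n) × ℂ) × ℂ) p).target →
    (chartAt ((EuclideanSpace ℂ (Fin n) × ℂ) × ℂ) p).symm z ∈
      (chartAt ((EuclideanSpace ℂ (Fin n) × ℂ) × ℂ) p').source →
    f (endIdx p') (chartTrans ((EuclideanSpace ℂ (Fin n) × ℂ) × ℂ) p p' z) = f (endIdx p) z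
  weight_not : ∀ s, k (!s) = -k s ∧ m (!s) = m s + 2 * k s

variable [ContMDiffVectorBundle ω ℂ L 𝓘(ℂ, EuclideanSpace ℂ (Fin n))]
  {p p' : PuncturedK (EuclideanSpace ℂ (Fin n)) L}

theorem isConeAtlas {μ : Fin n → ℝ} {c : Bool → ℝ} {X : Bool → ℝ → ℝ} (hg₀ : IsKahlerEinsteinForm g₀)
    (hev : HasConstantEigenvalues h g₀ μ) (hμ : ∀ k, -1 < μ k ∧ μ k < 1) (ha : -(1 / 2) < a)
    (hc : ∀ s, 0 < c s)
    (hP : ∀ s, IsProfile (fun x => (weight (endMu μ s) (endA a s)).eval x)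
      (profile (endMu μ s) (endA a s)) (1 / (1 + 2 * endA a s)) (c s) (X s) (Q s))
    (hQ : ∀ t, 0 < t → Q false (t ^ (-(1 / (1 + 2 * a)))) = Q true t * t ^ (-(1 / (1 + 2 * a)) - 1)) :
    IsConeAtlas L (endPotential h g₀ a Q) (fun s => endA a s * endSpeed n a s) (endSpeed n a) where
  cone i := (isBaseData hg₀ hev i.1 i.2).isConePotential (endMu_mem hμ i.2) (endA_gt ha i.2)
    (hP i.2) (hc i.2)
  weight_not s := ⟨endA_mul_endSpeed_not n ha s, endSpeed_not n ha s⟩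
  trans := by
    have key : ∀ (p p' : PuncturedK (EuclideanSpace ℂ (Fin n)) L) z,
        z ∈ (chartAt ((EuclideanSpace ℂ (Fin n) × ℂ) × ℂ) p).target →
        (chartAt ((EuclideanSpace ℂ (Fin n) × ℂ) × ℂ) p).symm z ∈
          (chartAt ((EuclideanSpace ℂ (Fin n) × ℂ) × ℂ) p').source →
        ((endIdx p).2 = false → (endIdx p').2 = false) →
        endPotential h g₀ a Q (endIdx p')
          (chartTrans ((EuclideanSpace ℂ (Fin n) × ℂ) × ℂ) p p' z) =
            endPotential h g₀ a Q (endIdx p) z := by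
      intro p p' z hz hz' hs
      obtain ⟨hw, hζ⟩ := (mem_source_iff hz).1 hz'
      have hτ := (mem_target_iff.1 hz).2
      by_cases hss : (endIdx p).2 = (endIdx p').2
      · rw [chartTrans, trans_same hz hz' hss]
        have h1 := endPotential_same (h := h) (a := a) (Q := Q) hg₀ (endIdx p).2 hw
        have h2 : ((endIdx p').1, (endIdx p).2) = endIdx p' := Prod.ext rfl hss
        rw [h2] at h1
        exact h1
      · have hp : (endIdx p).2 = true := by
          by_contra h0
          rw [Bool.not_eq_true] at h0
          exact hss (h0.trans (hs h0).symm)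
        have hp' : (endIdx p').2 = false := by
          by_contra h0
          rw [Bool.not_eq_false] at h0
          exact hss (hp.trans h0.symm)
        rw [chartTrans, trans_swap hz hz' hss, hp]
        have h1 := endPotential_swap (h := h) hg₀ ha hQ hw (hζ hss) hτ
        have h2 : ((endIdx p').1, false) = endIdx p' := Prod.ext rfl hp'.symm
        have h3 : ((endIdx p).1, true) = endIdx p := Prod.ext rfl hp.symm
        rw [h2, h3] at h1
        exact h1
    intro p p' z hz hz'
    by_cases hs : (endIdx p).2 = false → (endIdx p').2 = false
    · exact key p p' z hz hz' hs
    · push Not at hs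
      have hz1 := (chartAt ((EuclideanSpace ℂ (Fin n) × ℂ) × ℂ) p').map_source hz'
      have hz2 : (chartAt ((EuclideanSpace ℂ (Fin n) × ℂ) × ℂ) p').symm
          (chartTrans ((EuclideanSpace ℂ (Fin n) × ℂ) × ℂ) p p' z) =
            (chartAt ((EuclideanSpace ℂ (Fin n) × ℂ) × ℂ) p).symm z :=
        (chartAt ((EuclideanSpace ℂ (Fin n) × ℂ) × ℂ) p').left_inv hz'
      have h1 := key p' p (chartTrans ((EuclideanSpace ℂ (Fin n) × ℂ) × ℂ) p p' z) hz1
        (by rw [hz2]; exact (chartAt ((EuclideanSpace ℂ (Fin n) × ℂ) × ℂ) p).map_target hz)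
        (fun h0 => absurd h0 hs.2)
      rw [← h1]
      congr 1
      rw [chartTrans, hz2]
      exact (chartAt ((EuclideanSpace ℂ (Fin n) × ℂ) × ℂ) p).right_inv hz

theorem target_eq (p : PuncturedK (EuclideanSpace ℂ (Fin n)) L) :
    (chartAt ((EuclideanSpace ℂ (Fin n) × ℂ) × ℂ) p).target = coordDomain (coordBase L (endIdx p).1) :=
  Set.ext fun _ => mem_target_iff

namespace IsConeAtlas
variable {f : W × Bool → (EuclideanSpace ℂ (Fin n) × ℂ) × ℂ → ℝ} {k m : Bool → ℝ}

theorem scale_mem_target (t : ℝ) {k m : ℝ}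
    (hz : z ∈ (chartAt ((EuclideanSpace ℂ (Fin n) × ℂ) × ℂ) p).target) :
    scaleMap n k m t z ∈ (chartAt ((EuclideanSpace ℂ (Fin n) × ℂ) × ℂ) p).target := by
  rw [target_eq] at hz ⊢
  exact scaleMap_mem t hz

theorem scale_mem_source (t : ℝ) {k m : ℝ}
    (hz : z ∈ (chartAt ((EuclideanSpace ℂ (Fin n) × ℂ) × ℂ) p).target)
    (hz' : (chartAt ((EuclideanSpace ℂ (Fin n) × ℂ) × ℂ) p).symm z ∈
      (chartAt ((EuclideanSpace ℂ (Fin n) × ℂ) × ℂ) p').source) :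
    (chartAt ((EuclideanSpace ℂ (Fin n) × ℂ) × ℂ) p).symm (scaleMap n k m t z) ∈
      (chartAt ((EuclideanSpace ℂ (Fin n) × ℂ) × ℂ) p').source := by
  rw [mem_source_iff (scale_mem_target t hz)]
  rw [mem_source_iff hz] at hz'
  refine ⟨hz'.1, fun hs => ?_⟩
  rw [scaleMap_apply]
  exact mul_ne_zero (Complex.ofReal_ne_zero.2 (Real.exp_pos _).ne') (hz'.2 hs)

/-- The flow commutes with the changes of coordinates. -/
theorem scale_trans (h : IsConeAtlas L f k m) (t : ℝ)
    (hz : z ∈ (chartAt ((EuclideanSpace ℂ (Fin n) × ℂ) × ℂ) p).target)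
    (hz' : (chartAt ((EuclideanSpace ℂ (Fin n) × ℂ) × ℂ) p).symm z ∈
      (chartAt ((EuclideanSpace ℂ (Fin n) × ℂ) × ℂ) p').source) :
    chartTrans ((EuclideanSpace ℂ (Fin n) × ℂ) × ℂ) p p'
      (scaleMap n (k (endIdx p).2) (m (endIdx p).2) t z) =
    scaleMap n (k (endIdx p').2) (m (endIdx p').2) t
      (chartTrans ((EuclideanSpace ℂ (Fin n) × ℂ) × ℂ) p p' z) := by
  have h1 := scale_mem_target (k := k (endIdx p).2) (m := m (endIdx p).2) t hz
  have h2 := scale_mem_source (k := k (endIdx p).2) (m := m (endIdx p).2) t hz hz'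
  by_cases hs : (endIdx p).2 = (endIdx p').2
  · rw [chartTrans, chartTrans, trans_same h1 h2 hs, trans_same hz hz' hs, ← hs]
    simp only [scaleMap_apply]
    refine Prod.ext (Prod.ext rfl ?_) ?_
    · simp only; ring
    · simp only; ring
  · have hn : (endIdx p').2 = !(endIdx p).2 := Bool.eq_not_of_ne (Ne.symm hs)
    obtain ⟨hk, hm⟩ := h.weight_not (endIdx p).2
    obtain ⟨hw, hζ⟩ := (mem_source_iff hz).1 hz'
    have hζ0 := hζ hs
    have hr := frameRatio_ne_zero (endIdx p).2 hw
    rw [chartTrans, chartTrans, trans_swap h1 h2 hs, trans_swap hz hz' hs, hn, hk, hm]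
    simp only [scaleMap_apply]
    have e1 : Real.exp (-k (endIdx p).2 * t) = (Real.exp (k (endIdx p).2 * t))⁻¹ := by
      rw [← Real.exp_neg]; ring_nf
    have e2 : Real.exp ((m (endIdx p).2 + 2 * k (endIdx p).2) * t) =
        Real.exp (m (endIdx p).2 * t) * Real.exp (k (endIdx p).2 * t) ^ 2 := by
      rw [← Real.exp_nat_mul, ← Real.exp_add]
      push_cast
      ring_nf
    rw [e1, e2]
    have e0 : (Real.exp (k (endIdx p).2 * t) : ℂ) ≠ 0 :=
      Complex.ofReal_ne_zero.2 (Real.exp_pos _).ne'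
    refine Prod.ext (Prod.ext rfl ?_) ?_
    · simp only
      push_cast
      rw [mul_assoc, mul_inv]
    · simp only [mul_inv, mul_pow, div_eq_mul_inv, mul_neg, inv_neg, inv_inv]
      push_cast
      ring

end IsConeAtlas
end ConeAtlas

/-! ### The potential and the flow on the punctured canonical bundle -/

section GlobalObjects
variable {n : ℕ} {W : Type*} [TopologicalSpace W] [ChartedSpace (EuclideanSpace ℂ (Fin n)) W]
  [IsManifold 𝓘(ℂ, EuclideanSpace ℂ (Fin n)) ω W]
  {L : W → Type*} [∀ w, AddCommGroup (L w)] [∀ w, Module ℂ (L w)]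
  [TopologicalSpace (TotalSpace ℂ L)] [∀ w, TopologicalSpace (L w)] [FiberBundle ℂ L]
  [VectorBundle ℂ ℂ L] [ContMDiffVectorBundle ω ℂ L 𝓘(ℂ, EuclideanSpace ℂ (Fin n))]

/-- The space of the coordinates `((w, ζ), τ)` on the canonical bundle. -/
abbrev ConeModel (n : ℕ) : Type := (EuclideanSpace ℂ (Fin n) × ℂ) × ℂ

/-- The space of the coordinates `((w, ζ), θ)` on the circle bundle. -/
abbrev LinkModel (n : ℕ) : Type := (EuclideanSpace ℂ (Fin n) × ℂ) × ℝ

variable {f : W × Bool → ConeModel n → ℝ} {k m : Bool → ℝ}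
  {p p' q : PuncturedK (EuclideanSpace ℂ (Fin n)) L} {z : ConeModel n}

/-- The potential on the punctured canonical bundle with the coordinate expressions `f`. -/
def globalPot (f : W × Bool → ConeModel n → ℝ) (q : PuncturedK (EuclideanSpace ℂ (Fin n)) L) : ℝ :=
  f (endIdx q) (chartAt (ConeModel n) q q)

/-- The flow on the punctured canonical bundle which is `scaleMap` in coordinates. -/
def coneFlow (k m : Bool → ℝ) (t : ℝ) (q : PuncturedK (EuclideanSpace ℂ (Fin n)) L) :
    PuncturedK (EuclideanSpace ℂ (Fin n)) L :=
  (chartAt (ConeModel n) q).symm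
    (scaleMap n (k (endIdx q).2) (m (endIdx q).2) t (chartAt (ConeModel n) q q))

theorem contDiffAt_chartTrans {V X : Type*} [NormedAddCommGroup V] [NormedSpace ℂ V]
    [FiniteDimensional ℂ V]
    [TopologicalSpace X] [ChartedSpace V X] [IsManifold 𝓘(ℂ, V) ω X] {p p' : X} {z : V}
    (hz : z ∈ (chartAt V p).target) (hz' : (chartAt V p).symm z ∈ (chartAt V p').source) :
    ContDiffAt ℂ ω (chartTrans V p p') z := by
  refine (contDiffOn_trans (chart_mem_atlas V p) (chart_mem_atlas V p')).contDiffAt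
    (((chartAt V p).symm ≫ₕ chartAt V p').open_source.mem_nhds ?_)
  rw [OpenPartialHomeomorph.trans_source]
  exact ⟨hz, hz'⟩

theorem coneFlow_mem (k m : Bool → ℝ) (t : ℝ) (hq : q ∈ (chartAt (ConeModel n) p).source) :
    coneFlow k m t q ∈ (chartAt (ConeModel n) p).source :=
  IsConeAtlas.scale_mem_source t (mem_chart_target (ConeModel n) q)
    (by rwa [(chartAt (ConeModel n) q).left_inv (mem_chart_source _ q)])

/-- A flow is smooth if it is smooth in the charts, and if it preserves their domains. -/
theorem contMDiffAt_flow_of_chart {V X : Type*} [NormedAddCommGroup V] [NormedSpace ℝ V]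
    [TopologicalSpace X] [ChartedSpace V X] [IsManifold 𝓘(ℝ, V) ∞ X] {c : ℝ → X → X}
    {g : ℝ → V → V} (hg : ContDiff ℝ ∞ (fun x : ℝ × V => g x.1 x.2)) {x : ℝ × X}
    (hc : ∀ s, ∀ y ∈ (chartAt V x.2).source,
      c s y ∈ (chartAt V x.2).source ∧ chartAt V x.2 (c s y) = g s (chartAt V x.2 y)) :
    ContMDiffAt (𝓘(ℝ, ℝ).prod 𝓘(ℝ, V)) 𝓘(ℝ, V) ∞ (fun x : ℝ × X => c x.1 x.2) x := by
  obtain ⟨t, q⟩ := x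
  have hq := mem_chart_source V q
  have h0 : ContMDiffAt (𝓘(ℝ, ℝ).prod 𝓘(ℝ, V)) 𝓘(ℝ, V) ∞
      (fun x : ℝ × X => chartAt V q x.2) (t, q) :=
    ContMDiffAt.comp (t, q) (g := chartAt V q)
      (contMDiffAt_of_mem_maximalAtlas (IsManifold.chart_mem_maximalAtlas q) hq) contMDiffAt_snd
  have h2 : ContMDiffAt (𝓘(ℝ, ℝ).prod 𝓘(ℝ, V)) 𝓘(ℝ, V) ∞
      (fun x : ℝ × X => g x.1 (chartAt V q x.2)) (t, q) :=
    hg.comp_contMDiffAt (contMDiffAt_fst.prodMk_space h0)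
  have hmem : g t (chartAt V q q) ∈ (chartAt V q).target := by
    rw [← (hc t q hq).2]
    exact (chartAt V q).map_source (hc t q hq).1
  have h3 := ContMDiffAt.comp (t, q) (g := (chartAt V q).symm)
    ((contMDiffOn_symm_of_mem_maximalAtlas (IsManifold.chart_mem_maximalAtlas (I := 𝓘(ℝ, V))
      (n := ∞) q)).contMDiffAt ((chartAt V q).open_target.mem_nhds hmem)) h2
  refine h3.congr_of_eventuallyEq ?_
  have hn : ∀ᶠ x : ℝ × X in 𝓝 (t, q), x.2 ∈ (chartAt V q).source :=
    continuousAt_snd.eventually ((chartAt V q).open_source.mem_nhds hq)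
  filter_upwards [hn] with x hx
  rw [Function.comp_apply, ← (hc x.1 x.2 hx).2, (chartAt V q).left_inv (hc x.1 x.2 hx).1]

theorem contDiff_scaleMap (n : ℕ) (k m : ℝ) :
    ContDiff ℝ ∞ (fun x : ℝ × ConeModel n => scaleMap n k m x.1 x.2) := by
  have e : ∀ c : ℝ, ContDiff ℝ ∞ (fun x : ℝ × ConeModel n => (Real.exp (c * x.1) : ℂ)) := fun c =>
    Complex.ofRealCLM.contDiff.comp (contDiff_const.mul contDiff_fst).exp
  exact (contDiff_snd.fst.fst.prodMk ((e _).mul contDiff_snd.fst.snd)).prodMk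
    ((e _).mul contDiff_snd.snd)

theorem coneFlow_zero (k m : Bool → ℝ) (q : PuncturedK (EuclideanSpace ℂ (Fin n)) L) :
    coneFlow k m 0 q = q := by
  rw [coneFlow, scaleMap_zero, (chartAt (ConeModel n) q).left_inv (mem_chart_source _ q)]

namespace IsConeAtlas

theorem isConePotential (h : IsConeAtlas L f k m) (p : PuncturedK (EuclideanSpace ℂ (Fin n)) L) :
    IsConePotential (coordBase L (endIdx p).1) (f (endIdx p)) (k (endIdx p).2) (m (endIdx p).2) :=
  h.cone _

theorem globalPot_eq (h : IsConeAtlas L f k m) (hq : q ∈ (chartAt (ConeModel n) p).source) :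
    globalPot f q = f (endIdx p) (chartAt (ConeModel n) p q) := by
  have h1 := (chartAt (ConeModel n) p).left_inv hq
  have h2 := h.trans p q (chartAt (ConeModel n) p q) ((chartAt (ConeModel n) p).map_source hq)
    (by rw [h1]; exact mem_chart_source _ q)
  rw [chartTrans, h1] at h2
  exact h2

theorem chartAt_coneFlow (h : IsConeAtlas L f k m) (t : ℝ)
    (hq : q ∈ (chartAt (ConeModel n) p).source) :
    chartAt (ConeModel n) p (coneFlow k m t q) =
      scaleMap n (k (endIdx p).2) (m (endIdx p).2) t (chartAt (ConeModel n) p q) := by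
  have h1 := (chartAt (ConeModel n) q).left_inv (mem_chart_source _ q)
  have h2 := h.scale_trans (p := q) (p' := p) t (mem_chart_target (ConeModel n) q) (by rwa [h1])
  rw [chartTrans, chartTrans, h1] at h2
  exact h2

theorem coneFlow_add (h : IsConeAtlas L f k m) (s t : ℝ)
    (q : PuncturedK (EuclideanSpace ℂ (Fin n)) L) :
    coneFlow k m s (coneFlow k m t q) = coneFlow k m (s + t) q := by
  have hq := mem_chart_source (ConeModel n) q
  have h1 := coneFlow_mem k m t hq
  refine (chartAt (ConeModel n) q).injOn (coneFlow_mem k m s h1) (coneFlow_mem k m _ hq) ?_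
  rw [h.chartAt_coneFlow s h1, h.chartAt_coneFlow t hq, h.chartAt_coneFlow _ hq, scaleMap_add]

theorem chartAt_mem (p : PuncturedK (EuclideanSpace ℂ (Fin n)) L)
    (hq : q ∈ (chartAt (ConeModel n) p).source) :
    chartAt (ConeModel n) p q ∈ coordDomain (coordBase L (endIdx p).1) := by
  rw [← target_eq]
  exact (chartAt (ConeModel n) p).map_source hq

theorem globalPot_coneFlow (h : IsConeAtlas L f k m) (t : ℝ)
    (q : PuncturedK (EuclideanSpace ℂ (Fin n)) L) :
    globalPot f (coneFlow k m t q) = Real.exp (2 * t) * globalPot f q := by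
  have hq := mem_chart_source (ConeModel n) q
  rw [h.globalPot_eq (coneFlow_mem k m t hq), h.globalPot_eq hq, h.chartAt_coneFlow t hq,
    (h.isConePotential q).scale _ (chartAt_mem q hq)]

theorem globalPot_pos (h : IsConeAtlas L f k m) (q : PuncturedK (EuclideanSpace ℂ (Fin n)) L) :
    0 < globalPot f q :=
  (h.isConePotential q).pos _ (chartAt_mem q (mem_chart_source _ q))

theorem contMDiff_globalPot (h : IsConeAtlas L f k m) :
    ContMDiff 𝓘(ℝ, ConeModel n) 𝓘(ℝ, ℝ) ∞
      (globalPot f : PuncturedK (EuclideanSpace ℂ (Fin n)) L → ℝ) := by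
  intro q
  have h1 : ContMDiffAt 𝓘(ℝ, ConeModel n) 𝓘(ℝ, ℝ) ∞
      (fun q' => f (endIdx q) (chartAt (ConeModel n) q q')) q := by
    refine ContMDiffAt.comp q (I' := 𝓘(ℝ, ConeModel n)) (g := f (endIdx q)) ?_ ?_
    · exact ((h.isConePotential q).contDiffAt (chartAt_mem q (mem_chart_source _ q))).contMDiffAt
    · exact contMDiffAt_of_mem_maximalAtlas (IsManifold.chart_mem_maximalAtlas q)
        (mem_chart_source _ q)
  refine h1.congr_of_eventuallyEq ?_
  filter_upwards [(chartAt (ConeModel n) q).open_source.mem_nhds (mem_chart_source _ q)] with q' hq'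
  exact h.globalPot_eq hq'

theorem contMDiff_coneFlow (h : IsConeAtlas L f k m) :
    ContMDiff (𝓘(ℝ, ℝ).prod 𝓘(ℝ, ConeModel n)) 𝓘(ℝ, ConeModel n) ∞
      (fun x : ℝ × PuncturedK (EuclideanSpace ℂ (Fin n)) L => coneFlow k m x.1 x.2) := fun x =>
  contMDiffAt_flow_of_chart (contDiff_scaleMap n (k (endIdx x.2).2) (m (endIdx x.2).2))
    fun s _ hy => ⟨coneFlow_mem k m s hy, h.chartAt_coneFlow s hy⟩

/-- The Levi forms of the coordinate expressions of the potential agree, because the changes of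
coordinates are holomorphic. -/
theorem leviMap_trans (h : IsConeAtlas L f k m) (hz : z ∈ (chartAt (ConeModel n) p).target)
    (hz' : (chartAt (ConeModel n) p).symm z ∈ (chartAt (ConeModel n) p').source) (u v : ConeModel n) :
    leviMap (f (endIdx p)) z u v = leviMap (f (endIdx p')) (chartTrans (ConeModel n) p p' z)
      (fderiv ℝ (chartTrans (ConeModel n) p p') z u)
      (fderiv ℝ (chartTrans (ConeModel n) p p') z v) := by
  have hΦ : ContDiffAt ℂ ω (chartTrans (ConeModel n) p p') z := contDiffAt_chartTrans hz hz'
  have hR : fderiv ℝ (chartTrans (ConeModel n) p p') z =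
      (fderiv ℂ (chartTrans (ConeModel n) p p') z).restrictScalars ℝ :=
    DifferentiableAt.fderiv_restrictScalars ℝ (hΦ.differentiableAt (by simp))
  have hf : ContDiffAt ℝ 2 (f (endIdx p')) (chartTrans (ConeModel n) p p' z) :=
    ((h.isConePotential p').contDiffAt (chartAt_mem p' hz')).of_le ENat.LEInfty.out
  have h1 := leviMap_comp hf (hΦ.of_le le_top) u v
  rw [hR]
  refine Eq.trans ?_ h1
  congr 2
  refine Filter.EventuallyEq.leviMap_eq ?_
  have hopen : ((chartAt (ConeModel n) p).symm ≫ₕ chartAt (ConeModel n) p').source ∈ 𝓝 z := by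
    refine ((chartAt (ConeModel n) p).symm ≫ₕ chartAt (ConeModel n) p').open_source.mem_nhds ?_
    rw [OpenPartialHomeomorph.trans_source]
    exact ⟨hz, hz'⟩
  filter_upwards [hopen] with y hy
  rw [OpenPartialHomeomorph.trans_source] at hy
  exact (h.trans p p' y hy.1 hy.2).symm

/-- The Kähler metric with potential `globalPot f`. -/
def coneKahler (h : IsConeAtlas L f k m) :
    Metric (ConeModel n) (PuncturedK (EuclideanSpace ℂ (Fin n)) L) :=
  metricOfCharts (fun p => leviMap (f (endIdx p)))
    (fun p => by
      rw [target_eq]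
      exact contDiffOn_leviMap (h.isConePotential p).isOpen_coordDomain (h.isConePotential p).smooth)
    (fun p u v => leviMap_symm (((h.isConePotential p).contDiffAt
      (chartAt_mem p (mem_chart_source _ p))).of_le ENat.LEInfty.out) u v)
    (fun p u hu => (h.isConePotential p).levi_pos _ (chartAt_mem p (mem_chart_source _ p)) u hu)
    (fun p q hq u v => by
      have h1 := (chartAt (ConeModel n) p).left_inv hq
      have h2 := h.leviMap_trans (p := p) (p' := q) ((chartAt (ConeModel n) p).map_source hq)
        (by rw [h1]; exact mem_chart_source _ q) u v
      have h3 : chartTrans (ConeModel n) p q (chartAt (ConeModel n) p q) = chartAt (ConeModel n) q q := by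
        rw [chartTrans, h1]
      rw [h3] at h2
      exact h2)

theorem inChart_coneKahler (h : IsConeAtlas L f k m) (hz : z ∈ (chartAt (ConeModel n) p).target)
    (u v : ConeModel n) :
    h.coneKahler.inChart (chartAt (ConeModel n) p) z u v = leviMap (f (endIdx p)) z u v :=
  inChart_metricOfCharts _ _ _ _ _ p hz u v

theorem exists_chartAt {φ : OpenPartialHomeomorph (PuncturedK (EuclideanSpace ℂ (Fin n)) L)
    (ConeModel n)} (hφ : φ ∈ atlas (ConeModel n) (PuncturedK (EuclideanSpace ℂ (Fin n)) L)) :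
    ∃ p, φ = chartAt (ConeModel n) p := by
  obtain ⟨p, hp⟩ := mem_iUnion.1 hφ
  exact ⟨p, hp⟩

theorem isKahler_coneKahler (h : IsConeAtlas L f k m) : IsKahler h.coneKahler := by
  refine ⟨fun p u v => leviMap_I (V := ConeModel n) _ _ _ _, fun φ hφ z hz u v w => ?_⟩
  obtain ⟨p, rfl⟩ := exists_chartAt hφ
  have hK := isKahlerOn_leviMap (h.isConePotential p).isOpen_coordDomain
    (h.isConePotential p).smooth (h.isConePotential p).levi_pos
  have hz' := hz
  rw [target_eq] at hz'
  have key : ∀ u v w : ConeModel n,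
      fderiv ℝ (fun y => h.coneKahler.inChart (chartAt (ConeModel n) p) y u v) z w =
        fderiv ℝ (leviMap (f (endIdx p))) z w u v := by
    intro u v w
    have e : (fun y => h.coneKahler.inChart (chartAt (ConeModel n) p) y u v) =ᶠ[𝓝 z]
        fun y => leviMap (f (endIdx p)) y u v := by
      filter_upwards [(chartAt (ConeModel n) p).open_target.mem_nhds hz] with y hy
      exact h.inChart_coneKahler hy u v
    have hd : DifferentiableAt ℝ (leviMap (f (endIdx p))) z :=
      (hK.contDiffAt hz').differentiableAt (by simp)
    rw [e.fderiv_eq, ((hd.hasFDerivAt.clm_apply (hasFDerivAt_const u z)).clm_apply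
      (hasFDerivAt_const v z)).fderiv]
    simp
  rw [key, key, key]
  exact hK.closed z hz' u v w

end IsConeAtlas
end GlobalObjects

/-! ### Charts of the circle bundle -/

section CircleCharts
variable {V : Type*} [NormedAddCommGroup V] [NormedSpace ℂ V] [FiniteDimensional ℂ V]
  {M : Type*} [TopologicalSpace M] [ChartedSpace V M] [IsManifold 𝓘(ℂ, V) ω M]
  {s s' : CircleBundle V M} {y : V × ℝ} {q q' : puncturedCanonical V M}

/-- The angle at which the preferred fibre coordinate at a point of the circle bundle is centred. -/
def circleAngle (s : CircleBundle V M) : ℝ :=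
  (formCoord (chartAt V s.base) s.base s.ray.someVector).arg

theorem mem_circle_source : s' ∈ (chartAt (V × ℝ) s).source ↔
    s'.base ∈ (chartAt V s.base).source ∧
      rayCoord (chartAt V s.base) (circleAngle s) s' ∈ Complex.slitPlane := Iff.rfl

theorem chartAt_circle_apply : chartAt (V × ℝ) s s' =
    (chartAt V s.base s'.base, (rayCoord (chartAt V s.base) (circleAngle s) s').arg) := rfl

/-- A point of the canonical bundle over a given point of the circle bundle. -/
def liftPoint (s : CircleBundle V M) : puncturedCanonical V M :=
  ⟨⟨s.base, s.ray.someVector⟩, s.ray.someVector_ne_zero⟩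

theorem rayCoord_toCircleBundle (i : OpenPartialHomeomorph M V) (β : ℝ) (q : puncturedCanonical V M) :
    ∃ a : ℝ, 0 < a ∧ rayCoord i β (toCircleBundle q) =
      a * (formCoord i q.1.base q.1.form * Complex.exp (-(β * Complex.I))) := by
  have hq : q.1.form ≠ 0 := q.2
  have h := (rayOfNeZero ℝ q.1.form hq).someVector_ray
  rw [ray_eq_iff] at h
  obtain ⟨a, ha, h1⟩ := h.symm.exists_pos_left hq (Module.Ray.someVector_ne_zero _)
  refine ⟨a, ha, ?_⟩
  rw [← mul_assoc, ← formCoord_real_smul, h1]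
  rfl

/-- The map onto the circle bundle is `(y, r e^{i (θ + β)}) ↦ (y, θ)` in coordinates. -/
theorem toCircleBundle_chart_symm {r : ℝ} (hr : 0 < r) (hy : y ∈ (chartAt (V × ℝ) s).target)
    {p : puncturedCanonical V M} (hp : p.1.base = s.base) :
    toCircleBundle ((chartAt (V × ℂ) p).symm
      (y.1, (r : ℂ) * Complex.exp ((y.2 + circleAngle s : ℝ) * Complex.I))) =
        (chartAt (V × ℝ) s).symm y := by
  have hr' : (r : ℂ) * Complex.exp ((y.2 + circleAngle s : ℝ) * Complex.I) ≠ 0 :=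
    mul_ne_zero (Complex.ofReal_ne_zero.2 hr.ne') (Complex.exp_ne_zero _)
  have hz : (y.1, (r : ℂ) * Complex.exp ((y.2 + circleAngle s : ℝ) * Complex.I)) ∈
      (chartAt (V × ℂ) p).target := by
    rw [mem_chart_target_punctured, hp]
    exact ⟨hy.1, hr'⟩
  set q := (chartAt (V × ℂ) p).symm
    (y.1, (r : ℂ) * Complex.exp ((y.2 + circleAngle s : ℝ) * Complex.I)) with hq
  have h1 : chartAt (V × ℂ) p q = _ := (chartAt (V × ℂ) p).right_inv hz
  have h2 : q.1.base ∈ (chartAt V p.1.base).source :=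
    mem_chart_source_punctured.1 ((chartAt (V × ℂ) p).map_target hz)
  rw [chartAt_punctured_apply, hp] at h1
  rw [hp] at h2
  obtain ⟨e1, e2⟩ := Prod.ext_iff.1 h1
  obtain ⟨a, ha, h3⟩ := rayCoord_toCircleBundle (chartAt V s.base) (circleAngle s) q
  have h4 : rayCoord (chartAt V s.base) (circleAngle s) (toCircleBundle q) =
      ((a * r : ℝ) : ℂ) * Complex.exp ((y.2 : ℝ) * Complex.I) := by
    have : Complex.exp ((y.2 + circleAngle s : ℝ) * Complex.I) *
        Complex.exp (-(circleAngle s * Complex.I)) = Complex.exp ((y.2 : ℝ) * Complex.I) := by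
      rw [← Complex.exp_add]; congr 1; push_cast; ring
    refine h3.trans ?_
    rw [← this]
    dsimp only at e2
    rw [e2]
    push_cast
    ring
  have h5 : toCircleBundle q ∈ (chartAt (V × ℝ) s).source := by
    rw [mem_circle_source]
    refine ⟨h2, ?_⟩
    rw [h4, pos_mul_mem_slitPlane (mul_pos ha hr)]
    exact (arg_exp hy.2).2
  have h6 : chartAt (V × ℝ) s (toCircleBundle q) = y := by
    rw [chartAt_circle_apply]
    refine Prod.ext e1 ?_
    dsimp only
    rw [h4, Complex.arg_real_mul _ (mul_pos ha hr)]
    exact (arg_exp hy.2).1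
  rw [← h6]
  exact ((chartAt (V × ℝ) s).left_inv h5).symm

/-- Two points of the canonical bundle on the same ray have proportional fibre coordinates. -/
theorem chartAt_of_toCircleBundle_eq (h : toCircleBundle q = toCircleBundle q')
    (p : puncturedCanonical V M) : ∃ a : ℝ, 0 < a ∧
      chartAt (V × ℂ) p q' = ((chartAt (V × ℂ) p q).1, (a : ℂ) * (chartAt (V × ℂ) p q).2) := by
  obtain ⟨⟨x, σ⟩, hσ⟩ := q
  obtain ⟨⟨x', σ'⟩, hσ'⟩ := q'
  have hx : x = x' := congrArg CircleBundle.base h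
  subst hx
  have hσ0 : σ ≠ 0 := hσ
  have hσ0' : σ' ≠ 0 := hσ'
  have h1 : rayOfNeZero ℝ σ hσ0 = rayOfNeZero ℝ σ' hσ0' := by
    have := h
    simp only [toCircleBundle, CircleBundle.mk.injEq, true_and] at this
    exact this
  rw [ray_eq_iff] at h1
  obtain ⟨a, ha, h2⟩ := h1.exists_pos_left hσ0 hσ0'
  refine ⟨a, ha, ?_⟩
  rw [chartAt_punctured_apply, chartAt_punctured_apply]
  dsimp only
  rw [← h2, formCoord_real_smul]

theorem contMDiff_toCircleBundle : ContMDiff 𝓘(ℝ, V × ℂ) 𝓘(ℝ, V × ℝ) ∞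
    (toCircleBundle : puncturedCanonical V M → CircleBundle V M) := by
  intro q
  set s := toCircleBundle q with hs
  have hq := mem_chart_source (V × ℂ) q
  set β := circleAngle s with hβ
  set ψ : V × ℂ → V × ℝ := fun z => (z.1, (Complex.log (z.2 * Complex.exp (-(β * Complex.I)))).im)
    with hψ
  have hsq : s ∈ (chartAt (V × ℝ) s).source := mem_chart_source _ s
  have key : ∀ q' : puncturedCanonical V M, q' ∈ (chartAt (V × ℂ) q).source →
      ((chartAt (V × ℂ) q q').2 * Complex.exp (-(β * Complex.I)) ∈ Complex.slitPlane ↔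
        rayCoord (chartAt V s.base) β (toCircleBundle q') ∈ Complex.slitPlane) ∧
      chartAt (V × ℝ) s (toCircleBundle q') = ψ (chartAt (V × ℂ) q q') := by
    intro q' hq'
    obtain ⟨a, ha, h3⟩ := rayCoord_toCircleBundle (chartAt V s.base) β q'
    refine ⟨?_, ?_⟩
    · rw [h3, pos_mul_mem_slitPlane ha]
      rfl
    · rw [chartAt_circle_apply, ← hβ, h3, Complex.arg_real_mul _ ha, hψ]
      dsimp only
      rw [Complex.log_im]
      rfl
  have h0 : (chartAt (V × ℂ) q q).2 * Complex.exp (-(β * Complex.I)) ∈ Complex.slitPlane :=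
    (key q hq).1.2 hsq.2
  have hlin : ContDiff ℝ ∞ (fun z : V × ℂ => z.2 * Complex.exp (-(β * Complex.I))) :=
    contDiff_snd.mul contDiff_const
  have hψs : ContDiffAt ℝ ∞ ψ (chartAt (V × ℂ) q q) := by
    refine contDiffAt_fst.prodMk (ContDiffAt.comp (g := Complex.imCLM)
      (f := fun z : V × ℂ => Complex.log (z.2 * Complex.exp (-(β * Complex.I)))) _
        Complex.imCLM.contDiff.contDiffAt ?_)
    exact ContDiffAt.comp (g := Complex.log)
      (f := fun z : V × ℂ => z.2 * Complex.exp (-(β * Complex.I))) _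
        ((Complex.contDiffAt_log h0).restrict_scalars ℝ) hlin.contDiffAt
  have h1 : ContMDiffAt 𝓘(ℝ, V × ℂ) 𝓘(ℝ, V × ℝ) ∞ (fun q' => ψ (chartAt (V × ℂ) q q')) q :=
    hψs.comp_contMDiffAt (contMDiffAt_of_mem_maximalAtlas (IsManifold.chart_mem_maximalAtlas q) hq)
  have hmem : ψ (chartAt (V × ℂ) q q) ∈ (chartAt (V × ℝ) s).target := by
    rw [← (key q hq).2]
    exact (chartAt (V × ℝ) s).map_source hsq
  have h2 := ContMDiffAt.comp q (g := (chartAt (V × ℝ) s).symm)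
    ((contMDiffOn_symm_of_mem_maximalAtlas (IsManifold.chart_mem_maximalAtlas (I := 𝓘(ℝ, V × ℝ))
      (n := ∞) s)).contMDiffAt ((chartAt (V × ℝ) s).open_target.mem_nhds hmem)) h1
  refine h2.congr_of_eventuallyEq ?_
  have hc : ContinuousAt (fun q' => (chartAt (V × ℂ) q q').2 * Complex.exp (-(β * Complex.I))) q :=
    ContinuousAt.comp (f := chartAt (V × ℂ) q)
      (g := fun z : V × ℂ => z.2 * Complex.exp (-(β * Complex.I))) hlin.continuous.continuousAt
      ((chartAt (V × ℂ) q).continuousAt hq)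
  filter_upwards [(chartAt (V × ℂ) q).open_source.mem_nhds hq,
    hc.eventually (Complex.isOpen_slitPlane.mem_nhds h0)] with q' hq' h3
  have h4 : toCircleBundle q' ∈ (chartAt (V × ℝ) s).source :=
    ⟨mem_chart_source_punctured.1 hq', (key q' hq').1.1 h3⟩
  rw [Function.comp_apply, ← (key q' hq').2, (chartAt (V × ℝ) s).left_inv h4]

end CircleCharts

/-! ### The diffeomorphism with the cone -/

section ConeOfFlow
variable {F : Type*} [NormedAddCommGroup F] [NormedSpace ℝ F] {Y : Type*} [TopologicalSpace Y]
  [ChartedSpace F Y] {V : Type*} [NormedAddCommGroup V] [NormedSpace ℂ V] {X : Type*}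
  [TopologicalSpace X] [ChartedSpace V X]

theorem posReal_pos (r : posReal) : 0 < (r : ℝ) := r.2

theorem exp_two_mul_log (r : posReal) : Real.exp (2 * Real.log r) = (r : ℝ) ^ 2 := by
  rw [two_mul, Real.exp_add, Real.exp_log (posReal_pos r), sq]

theorem contMDiff_log_posReal : ContMDiff 𝓘(ℝ, ℝ) 𝓘(ℝ, ℝ) ∞ (fun r : posReal => Real.log r) :=
  fun r => (Real.contDiffAt_log.2 (posReal_pos r).ne').comp_contMDiffAt (contMDiff_subtype_val r)

/-- The diffeomorphism of a cone onto `X` given by a flow `c` on `X`, a radius function `R` and a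
section `σ` of a projection `pr`, which takes its values in the level set `R = 1`. -/
def coneDiffeoOfFlow {c : ℝ → X → X} {R : X → posReal} {σ : Y → X} {pr : X → Y}
    (hc : ContMDiff (𝓘(ℝ, ℝ).prod 𝓘(ℝ, V)) 𝓘(ℝ, V) ∞ (fun x : ℝ × X => c x.1 x.2))
    (hR : ContMDiff 𝓘(ℝ, V) 𝓘(ℝ, ℝ) ∞ R) (hσ : ContMDiff 𝓘(ℝ, F) 𝓘(ℝ, V) ∞ σ)
    (hpr : ContMDiff 𝓘(ℝ, V) 𝓘(ℝ, F) ∞ pr) (hadd : ∀ s t x, c s (c t x) = c (s + t) x)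
    (hzero : ∀ x, c 0 x = x) (hRσ : ∀ y (r : posReal), R (c (Real.log r) (σ y)) = r)
    (hprσ : ∀ y, pr (σ y) = y)
    (hσpr : ∀ x, σ (pr (c (-Real.log (R x)) x)) = c (-Real.log (R x)) x) : ConeDiffeo F Y V X where
  toFun x := c (Real.log x.2) (σ x.1)
  invFun x := (pr (c (-Real.log (R x)) x), R x)
  left_inv := by
    rintro ⟨y, r⟩
    dsimp only
    rw [hRσ, hadd, neg_add_cancel, hzero, hprσ]
  right_inv x := by
    dsimp only
    rw [hσpr, hadd, add_neg_cancel, hzero]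
  contMDiff_toFun :=
    hc.comp ((contMDiff_log_posReal.comp contMDiff_snd).prodMk (hσ.comp contMDiff_fst))
  contMDiff_invFun := by
    have h1 : ContMDiff 𝓘(ℝ, V) 𝓘(ℝ, ℝ) ∞ (fun x => -Real.log (R x)) :=
      contDiff_neg.comp_contMDiff (contMDiff_log_posReal.comp hR)
    exact (hpr.comp (hc.comp (h1.prodMk contMDiff_id))).prodMk hR

end ConeOfFlow

section ConeDiffeomorphism
variable {n : ℕ} {W : Type*} [TopologicalSpace W] [ChartedSpace (EuclideanSpace ℂ (Fin n)) W]
  [IsManifold 𝓘(ℂ, EuclideanSpace ℂ (Fin n)) ω W]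
  {L : W → Type*} [∀ w, AddCommGroup (L w)] [∀ w, Module ℂ (L w)]
  [TopologicalSpace (TotalSpace ℂ L)] [∀ w, TopologicalSpace (L w)] [FiberBundle ℂ L]
  [VectorBundle ℂ ℂ L] [ContMDiffVectorBundle ω ℂ L 𝓘(ℂ, EuclideanSpace ℂ (Fin n))]
  {f : W × Bool → ConeModel n → ℝ} {k m : Bool → ℝ}
  {ρ : W × Bool → EuclideanSpace ℂ (Fin n) × ℂ → ℝ}
  {p q q' : PuncturedK (EuclideanSpace ℂ (Fin n)) L} {s : CircleK (EuclideanSpace ℂ (Fin n)) L}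
  {y : LinkModel n}

variable (L) in
/-- A potential of a Ricci flat Kähler cone metric, together with the logarithmic radii `ρ i` of the
level set `f = 1/2` in all charts. -/
structure IsRadiusAtlas (f : W × Bool → ConeModel n → ℝ) (k m : Bool → ℝ)
    (ρ : W × Bool → EuclideanSpace ℂ (Fin n) × ℂ → ℝ) : Prop extends IsConeAtlas L f k m where
  radius : ∀ i, IsRadius (coordBase L i.1) (f i) (k i.2) (m i.2) (ρ i)

theorem IsConeAtlas.exists_isRadiusAtlas (h : IsConeAtlas L f k m) :
    ∃ ρ, IsRadiusAtlas L f k m ρ := by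
  choose ρ hρ using fun i => (h.cone i).exists_isRadius
  exact ⟨ρ, h, hρ⟩

/-- The index of the chart of the projective bundle used at a point of the circle bundle. -/
def linkIdx (s : CircleK (EuclideanSpace ℂ (Fin n)) L) : W × Bool := endIdx (liftPoint s)

/-- The section of the circle bundle with values in the level set `f = 1/2`. -/
def linkSection (ρ : W × Bool → EuclideanSpace ℂ (Fin n) × ℂ → ℝ)
    (s : CircleK (EuclideanSpace ℂ (Fin n)) L) : PuncturedK (EuclideanSpace ℂ (Fin n)) L :=
  (chartAt (ConeModel n) (liftPoint s)).symm
    (sectionCoord (ρ (linkIdx s)) (circleAngle s) (chartAt (LinkModel n) s s))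

theorem sectionCoord_mem_target (ρ : EuclideanSpace ℂ (Fin n) × ℂ → ℝ) (β : ℝ)
    (hy : y ∈ (chartAt (LinkModel n) s).target) :
    sectionCoord ρ β y ∈ (chartAt (ConeModel n) (liftPoint s)).target :=
  mem_chart_target_punctured.2 ⟨hy.1, sectionCoord_snd_ne⟩

theorem mem_coordBase_of_mem_target (hy : y ∈ (chartAt (LinkModel n) s).target) :
    y.1.1 ∈ coordBase L (linkIdx s).1 := by
  have h := sectionCoord_mem_target 0 0 hy
  rw [target_eq] at h
  exact h.1

theorem toCircleBundle_sectionCoord (ρ : EuclideanSpace ℂ (Fin n) × ℂ → ℝ)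
    (hy : y ∈ (chartAt (LinkModel n) s).target) :
    toCircleBundle ((chartAt (ConeModel n) (liftPoint s)).symm (sectionCoord ρ (circleAngle s) y)) =
      (chartAt (LinkModel n) s).symm y :=
  toCircleBundle_chart_symm (Real.exp_pos _) hy rfl

namespace IsRadiusAtlas

theorem globalPot_sectionCoord (h : IsRadiusAtlas L f k m ρ)
    (hy : y ∈ (chartAt (LinkModel n) s).target) :
    globalPot f ((chartAt (ConeModel n) (liftPoint s)).symm
      (sectionCoord (ρ (linkIdx s)) (circleAngle s) y)) = 1 / 2 := by
  have h1 := sectionCoord_mem_target (ρ (linkIdx s)) (circleAngle s) hy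
  rw [h.globalPot_eq ((chartAt (ConeModel n) (liftPoint s)).map_target h1),
    (chartAt (ConeModel n) (liftPoint s)).right_inv h1]
  exact (h.radius _).apply_sectionCoord (mem_coordBase_of_mem_target hy)

/-- The level set meets each ray in at most one point. -/
theorem eq_of_toCircleBundle_eq (h : IsRadiusAtlas L f k m ρ)
    (hqq' : toCircleBundle q = toCircleBundle q') (hq : globalPot f q = 1 / 2)
    (hq' : globalPot f q' = 1 / 2) : q = q' := by
  obtain ⟨a, ha, h1⟩ := chartAt_of_toCircleBundle_eq hqq' q
  have hqs := mem_chart_source (ConeModel n) q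
  have hqs' : q' ∈ (chartAt (ConeModel n) q).source := by
    have hb : q.1.base = q'.1.base := congrArg CircleBundle.base hqq'
    have h2 := mem_chart_source_punctured.1 hqs
    rw [hb] at h2
    rw [mem_chart_source_punctured, hb]
    exact h2
  set z := chartAt (ConeModel n) q q with hz
  obtain ⟨hzU, hz0⟩ : z ∈ coordDomain (coordBase L (endIdx q).1) := IsConeAtlas.chartAt_mem q hqs
  have ha0 : (a : ℂ) ≠ 0 := Complex.ofReal_ne_zero.2 ha.ne'
  rw [h.globalPot_eq hqs, ← hz] at hq
  rw [h.globalPot_eq hqs', h1] at hq'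
  have e1 := ((h.radius (endIdx q)).eq_half_iff z.1 hzU z.2 hz0).1 hq
  have e2 := ((h.radius (endIdx q)).eq_half_iff z.1 hzU _ (mul_ne_zero ha0 hz0)).1 hq'
  rw [norm_mul, ← e1, Complex.norm_real, Real.norm_eq_abs, abs_of_pos ha] at e2
  have ha1 : a = 1 := (mul_eq_right₀ (norm_ne_zero_iff.2 hz0)).1 e2
  refine (chartAt (ConeModel n) q).injOn hqs hqs' ?_
  rw [h1, ha1, Complex.ofReal_one, one_mul, ← hz]

theorem toCircleBundle_linkSection (ρ : W × Bool → EuclideanSpace ℂ (Fin n) × ℂ → ℝ)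
    (s : CircleK (EuclideanSpace ℂ (Fin n)) L) : toCircleBundle (linkSection ρ s) = s :=
  (toCircleBundle_sectionCoord _ (mem_chart_target (LinkModel n) s)).trans
    ((chartAt (LinkModel n) s).left_inv (mem_chart_source _ s))

theorem globalPot_linkSection (h : IsRadiusAtlas L f k m ρ)
    (s : CircleK (EuclideanSpace ℂ (Fin n)) L) : globalPot f (linkSection ρ s) = 1 / 2 :=
  h.globalPot_sectionCoord (mem_chart_target (LinkModel n) s)

theorem linkSection_symm (h : IsRadiusAtlas L f k m ρ)
    (hy : y ∈ (chartAt (LinkModel n) s).target) :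
    linkSection ρ ((chartAt (LinkModel n) s).symm y) = (chartAt (ConeModel n) (liftPoint s)).symm
      (sectionCoord (ρ (linkIdx s)) (circleAngle s) y) :=
  h.eq_of_toCircleBundle_eq ((toCircleBundle_linkSection _ _).trans
    (toCircleBundle_sectionCoord _ hy).symm) (h.globalPot_linkSection _) (h.globalPot_sectionCoord hy)

theorem contMDiff_linkSection (h : IsRadiusAtlas L f k m ρ) :
    ContMDiff 𝓘(ℝ, LinkModel n) 𝓘(ℝ, ConeModel n) ∞
      (linkSection ρ : CircleK (EuclideanSpace ℂ (Fin n)) L → _) := by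
  intro s
  have hs := mem_chart_source (LinkModel n) s
  have ht := mem_chart_target (LinkModel n) s
  have h1 : ContMDiffAt 𝓘(ℝ, LinkModel n) 𝓘(ℝ, ConeModel n) ∞
      (sectionCoord (ρ (linkIdx s)) (circleAngle s) ∘ chartAt (LinkModel n) s) s :=
    ((h.radius _).contDiffAt_sectionCoord (mem_coordBase_of_mem_target ht)).comp_contMDiffAt
      (contMDiffAt_of_mem_maximalAtlas (IsManifold.chart_mem_maximalAtlas s) hs)
  have h2 := ContMDiffAt.comp s (g := (chartAt (ConeModel n) (liftPoint s)).symm)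
    ((contMDiffOn_symm_of_mem_maximalAtlas (IsManifold.chart_mem_maximalAtlas (I := 𝓘(ℝ, ConeModel n))
      (n := ∞) (liftPoint s))).contMDiffAt
        ((chartAt (ConeModel n) (liftPoint s)).open_target.mem_nhds (sectionCoord_mem_target _ _ ht))) h1
  refine h2.congr_of_eventuallyEq ?_
  filter_upwards [(chartAt (LinkModel n) s).open_source.mem_nhds hs] with s' hs'
  have h3 := h.linkSection_symm ((chartAt (LinkModel n) s).map_source hs')
  rw [(chartAt (LinkModel n) s).left_inv hs'] at h3
  exact h3

theorem two_mul_globalPot_pos (h : IsRadiusAtlas L f k m ρ)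
    (q : PuncturedK (EuclideanSpace ℂ (Fin n)) L) : 0 < 2 * globalPot f q :=
  mul_pos two_pos (h.globalPot_pos q)

/-- The radius function `r = √(2 f)` of the cone. -/
def coneRadius (h : IsRadiusAtlas L f k m ρ) (q : PuncturedK (EuclideanSpace ℂ (Fin n)) L) :
    posReal :=
  ⟨Real.sqrt (2 * globalPot f q), Real.sqrt_pos.2 (h.two_mul_globalPot_pos q)⟩

theorem coneRadius_sq (h : IsRadiusAtlas L f k m ρ) (q : PuncturedK (EuclideanSpace ℂ (Fin n)) L) :
    (h.coneRadius q : ℝ) ^ 2 = 2 * globalPot f q :=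
  Real.sq_sqrt (h.two_mul_globalPot_pos q).le

theorem contMDiff_coneRadius (h : IsRadiusAtlas L f k m ρ) :
    ContMDiff 𝓘(ℝ, ConeModel n) 𝓘(ℝ, ℝ) ∞ h.coneRadius := by
  intro q
  rw [← ContMDiffAt.subtypeVal_comp_iff]
  have h1 : ContDiffAt ℝ ∞ (fun x : ℝ => Real.sqrt (2 * x)) (globalPot f q) :=
    (contDiffAt_const.mul contDiffAt_id).sqrt (h.two_mul_globalPot_pos q).ne'
  exact h1.comp_contMDiffAt (h.contMDiff_globalPot q)

theorem coneRadius_coneFlow (h : IsRadiusAtlas L f k m ρ)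
    (s : CircleK (EuclideanSpace ℂ (Fin n)) L) (r : posReal) :
    h.coneRadius (coneFlow k m (Real.log r) (linkSection ρ s)) = r := by
  refine Subtype.ext ?_
  rw [coneRadius]
  dsimp only
  rw [h.globalPot_coneFlow, h.globalPot_linkSection, exp_two_mul_log]
  rw [show 2 * ((r : ℝ) ^ 2 * (1 / 2)) = (r : ℝ) ^ 2 by ring, Real.sqrt_sq (posReal_pos r).le]

/-- The diffeomorphism of the cone over the circle bundle onto the punctured canonical bundle, given
by the homothetic flow and by the level set `f = 1/2`. -/
def coneDiffeo (h : IsRadiusAtlas L f k m ρ) :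
    ConeDiffeo (LinkModel n) (CircleK (EuclideanSpace ℂ (Fin n)) L) (ConeModel n)
      (PuncturedK (EuclideanSpace ℂ (Fin n)) L) :=
  coneDiffeoOfFlow h.contMDiff_coneFlow h.contMDiff_coneRadius h.contMDiff_linkSection
    contMDiff_toCircleBundle h.coneFlow_add (coneFlow_zero k m) h.coneRadius_coneFlow
    (toCircleBundle_linkSection ρ) fun q => by
      refine h.eq_of_toCircleBundle_eq (toCircleBundle_linkSection _ _) (h.globalPot_linkSection _) ?_
      rw [h.globalPot_coneFlow, mul_neg, Real.exp_neg, exp_two_mul_log, h.coneRadius_sq]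
      have := (h.globalPot_pos q).ne'
      field_simp

theorem coneDiffeo_apply (h : IsRadiusAtlas L f k m ρ) (s : CircleK (EuclideanSpace ℂ (Fin n)) L)
    (r : posReal) : h.coneDiffeo (s, r) = coneFlow k m (Real.log r) (linkSection ρ s) := rfl

/-- In coordinates, the diffeomorphism is `coneCoord`. -/
theorem chartAt_coneDiffeo (h : IsRadiusAtlas L f k m ρ)
    (hy : y ∈ (chartAt (LinkModel n) s).target) (r : posReal) :
    h.coneDiffeo ((chartAt (LinkModel n) s).symm y, r) ∈
        (chartAt (ConeModel n) (liftPoint s)).source ∧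
      chartAt (ConeModel n) (liftPoint s) (h.coneDiffeo ((chartAt (LinkModel n) s).symm y, r)) =
        coneCoord (k (linkIdx s).2) (m (linkIdx s).2) (ρ (linkIdx s)) (circleAngle s) (y, r) := by
  have h1 := sectionCoord_mem_target (ρ (linkIdx s)) (circleAngle s) hy
  have h2 := (chartAt (ConeModel n) (liftPoint s)).map_target h1
  rw [coneDiffeo_apply, h.linkSection_symm hy]
  refine ⟨coneFlow_mem _ _ _ h2, ?_⟩
  rw [h.chartAt_coneFlow _ h2, (chartAt (ConeModel n) (liftPoint s)).right_inv h1]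
  rfl

end IsRadiusAtlas
end ConeDiffeomorphism

/-! ### The Sasaki–Einstein metric -/

section Differential
variable {F : Type*} [NormedAddCommGroup F] [NormedSpace ℝ F] {Y : Type*} [TopologicalSpace Y]
  [ChartedSpace F Y] {V : Type*} [NormedAddCommGroup V] [NormedSpace ℂ V] [FiniteDimensional ℂ V]
  {X : Type*} [TopologicalSpace X] [ChartedSpace V X] [IsManifold 𝓘(ℂ, V) ω X]

theorem chartAt_posReal_symm (r : posReal) {t : ℝ} (ht : 0 < t) :
    (chartAt ℝ r).symm t = (⟨t, ht⟩ : posReal) := by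
  refine (chartAt ℝ r).left_inv (x := (⟨t, ht⟩ : posReal)) ?_
  rw [TopologicalSpace.Opens.chartAt_eq, OpenPartialHomeomorph.subtypeRestr_source]
  exact mem_univ _

/-- The differential of a diffeomorphism of a cone, computed from its expression `g` in the preferred
chart of the link and in an arbitrary chart of the target. -/
theorem ConeDiffeo.d_eq (Φ : ConeDiffeo F Y V X) (y : Y) (r : posReal) (p : X) {g : F × ℝ → V}
    (hΦ : ∀ z ∈ (chartAt F y).target, ∀ t : posReal,
      Φ ((chartAt F y).symm z, t) ∈ (chartAt V p).source ∧
        chartAt V p (Φ ((chartAt F y).symm z, t)) = g (z, t))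
    (hg : DifferentiableAt ℝ g (chartAt F y y, (r : ℝ))) (u : F) (α : ℝ) :
    Φ.d y r u α = (fderiv ℝ (chartTrans V p (Φ (y, r))) (g (chartAt F y y, (r : ℝ)))
      (fderiv ℝ g (chartAt F y y, (r : ℝ)) (u, α)) : V) := by
  have h1 : MDifferentiableAt (𝓘(ℝ, F).prod 𝓘(ℝ, ℝ)) 𝓘(ℝ, V) Φ (y, r) :=
    Φ.contMDiff.contMDiffAt.mdifferentiableAt (by simp)
  have h2 := congrArg (fun A : F × ℝ →L[ℝ] V => A (u, α)) h1.mfderiv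
  refine h2.trans ?_
  have h3 : (fderivWithin ℝ (writtenInExtChartAt (𝓘(ℝ, F).prod 𝓘(ℝ, ℝ)) 𝓘(ℝ, V) (y, r) Φ)
      (range (𝓘(ℝ, F).prod 𝓘(ℝ, ℝ))) (extChartAt (𝓘(ℝ, F).prod 𝓘(ℝ, ℝ)) (y, r) (y, r)) :
        F × ℝ →L[ℝ] V) =
      fderiv ℝ (fun z : F × ℝ => chartAt V (Φ (y, r)) (Φ ((chartAt F y).symm z.1, (chartAt ℝ r).symm z.2)))
        (chartAt F y y, (r : ℝ)) := by
    simp [writtenInExtChartAt]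
    rfl
  have hy := mem_chart_target F y
  obtain ⟨e1, e2⟩ := hΦ _ hy r
  rw [(chartAt F y).left_inv (mem_chart_source F y)] at e1 e2
  have e3 := (chartAt V p).left_inv e1
  rw [e2] at e3
  have ht : g (chartAt F y y, (r : ℝ)) ∈ (chartAt V p).target := by
    rw [← e2]
    exact (chartAt V p).map_source e1
  have hd : DifferentiableAt ℝ (chartTrans V p (Φ (y, r))) (g (chartAt F y y, (r : ℝ))) :=
    ((contDiffAt_chartTrans ht (by rw [e3]; exact mem_chart_source V _)).differentiableAt
      (by simp)).restrictScalars ℝ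
  have h4 : (fun z : F × ℝ => chartAt V (Φ (y, r)) (Φ ((chartAt F y).symm z.1, (chartAt ℝ r).symm z.2)))
      =ᶠ[𝓝 (chartAt F y y, (r : ℝ))] (chartTrans V p (Φ (y, r)) ∘ g) := by
    have hn : (chartAt F y).target ×ˢ Ioi (0 : ℝ) ∈ 𝓝 (chartAt F y y, (r : ℝ)) :=
      ((chartAt F y).open_target.prod isOpen_Ioi).mem_nhds ⟨hy, posReal_pos r⟩
    filter_upwards [hn] with z hz
    have ht0 : 0 < z.2 := hz.2
    obtain ⟨e4, e5⟩ := hΦ z.1 hz.1 ⟨z.2, ht0⟩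
    rw [chartAt_posReal_symm r ht0]
    have e6 := (chartAt V p).left_inv e4
    rw [e5] at e6
    change _ = chartAt V (Φ (y, r)) ((chartAt V p).symm (g z))
    rw [← e6]
  refine (congrArg (fun A : F × ℝ →L[ℝ] V => A (u, α)) h3).trans ?_
  rw [h4.fderiv_eq, fderiv_comp _ hd hg]
  rfl

end Differential

section LinkGeometry
variable {n : ℕ} {W : Type*} [TopologicalSpace W] [ChartedSpace (EuclideanSpace ℂ (Fin n)) W]
  [IsManifold 𝓘(ℂ, EuclideanSpace ℂ (Fin n)) ω W]
  {L : W → Type*} [∀ w, AddCommGroup (L w)] [∀ w, Module ℂ (L w)]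
  [TopologicalSpace (TotalSpace ℂ L)] [∀ w, TopologicalSpace (L w)] [FiberBundle ℂ L]
  [VectorBundle ℂ ℂ L] [ContMDiffVectorBundle ω ℂ L 𝓘(ℂ, EuclideanSpace ℂ (Fin n))]
  {f : W × Bool → ConeModel n → ℝ} {k m : Bool → ℝ}
  {ρ : W × Bool → EuclideanSpace ℂ (Fin n) × ℂ → ℝ}
  {p p' : PuncturedK (EuclideanSpace ℂ (Fin n)) L} {z : ConeModel n}
  {s s' : CircleK (EuclideanSpace ℂ (Fin n)) L} {y : LinkModel n}

/-- The generator of the flow is invariant under the changes of coordinates. -/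
theorem IsConeAtlas.fderiv_chartTrans_euler (h : IsConeAtlas L f k m)
    (hz : z ∈ (chartAt (ConeModel n) p).target)
    (hz' : (chartAt (ConeModel n) p).symm z ∈ (chartAt (ConeModel n) p').source) :
    fderiv ℝ (chartTrans (ConeModel n) p p') z (eulerMap n (k (endIdx p).2) (m (endIdx p).2) z) =
      eulerMap n (k (endIdx p').2) (m (endIdx p').2) (chartTrans (ConeModel n) p p' z) := by
  have hd : DifferentiableAt ℝ (chartTrans (ConeModel n) p p') z :=
    ((contDiffAt_chartTrans hz hz').differentiableAt (by simp)).restrictScalars ℝ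
  have h1 := hasDerivAt_scaleMap (k := k (endIdx p).2) (m := m (endIdx p).2) z 0
  have h2 := hasDerivAt_scaleMap (k := k (endIdx p').2) (m := m (endIdx p').2)
    (chartTrans (ConeModel n) p p' z) 0
  rw [scaleMap_zero] at h1 h2
  have h3 : HasDerivAt (fun t => chartTrans (ConeModel n) p p'
      (scaleMap n (k (endIdx p).2) (m (endIdx p).2) t z)) _ 0 :=
    HasFDerivAt.comp_hasDerivAt_of_eq (l := chartTrans (ConeModel n) p p') (0 : ℝ) hd.hasFDerivAt h1 (scaleMap_zero z).symm
  refine h3.unique (h2.congr_of_eventuallyEq (Filter.Eventually.of_forall fun t => ?_))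
  exact h.scale_trans t hz hz'

namespace IsRadiusAtlas

/-- The section of the circle bundle, in two charts. -/
theorem sectionCoord_trans (h : IsRadiusAtlas L f k m ρ)
    (hy : y ∈ (chartAt (LinkModel n) s).target)
    (hy' : (chartAt (LinkModel n) s).symm y ∈ (chartAt (LinkModel n) s').source) :
    (chartAt (ConeModel n) (liftPoint s)).symm (sectionCoord (ρ (linkIdx s)) (circleAngle s) y) ∈
        (chartAt (ConeModel n) (liftPoint s')).source ∧
      chartTrans (ConeModel n) (liftPoint s) (liftPoint s')
        (sectionCoord (ρ (linkIdx s)) (circleAngle s) y) =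
      sectionCoord (ρ (linkIdx s')) (circleAngle s') (chartTrans (LinkModel n) s s' y) := by
  have ht := (chartAt (LinkModel n) s').map_source hy'
  have h1 := h.linkSection_symm hy
  have h2 := h.linkSection_symm ht
  rw [(chartAt (LinkModel n) s').left_inv hy'] at h2
  rw [chartTrans, ← h1, h2]
  have h3 := sectionCoord_mem_target (ρ (linkIdx s')) (circleAngle s') ht
  exact ⟨(chartAt (ConeModel n) (liftPoint s')).map_target h3,
    (chartAt (ConeModel n) (liftPoint s')).right_inv h3⟩

theorem sectionMetric_trans (h : IsRadiusAtlas L f k m ρ)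
    (hy : y ∈ (chartAt (LinkModel n) s).target)
    (hy' : (chartAt (LinkModel n) s).symm y ∈ (chartAt (LinkModel n) s').source)
    (u v : LinkModel n) :
    sectionMetric (f (linkIdx s)) (ρ (linkIdx s)) (circleAngle s) y u v =
      sectionMetric (f (linkIdx s')) (ρ (linkIdx s')) (circleAngle s')
        (chartTrans (LinkModel n) s s' y) (fderiv ℝ (chartTrans (LinkModel n) s s') y u)
        (fderiv ℝ (chartTrans (LinkModel n) s s') y v) := by
  have ht := (chartAt (LinkModel n) s').map_source hy'
  have hz := sectionCoord_mem_target (ρ (linkIdx s)) (circleAngle s) hy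
  obtain ⟨hz', e⟩ := h.sectionCoord_trans hy hy'
  have hT : DifferentiableAt ℝ (chartTrans (ConeModel n) (liftPoint s) (liftPoint s'))
      (sectionCoord (ρ (linkIdx s)) (circleAngle s) y) :=
    ((contDiffAt_chartTrans hz hz').differentiableAt (by simp)).restrictScalars ℝ
  have hS := (h.radius (linkIdx s)).hasFDerivAt_sectionCoord (β := circleAngle s)
    (mem_coordBase_of_mem_target hy)
  have hS' := (h.radius (linkIdx s')).hasFDerivAt_sectionCoord (β := circleAngle s')
    (q := chartTrans (LinkModel n) s s' y) (mem_coordBase_of_mem_target ht)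
  have hC : DifferentiableAt ℝ (chartTrans (LinkModel n) s s') y :=
    (contDiffAt_chart_trans (IsManifold.chart_mem_maximalAtlas s)
      (IsManifold.chart_mem_maximalAtlas s') hy hy').differentiableAt (by simp)
  have key : (fderiv ℝ (chartTrans (ConeModel n) (liftPoint s) (liftPoint s'))
      (sectionCoord (ρ (linkIdx s)) (circleAngle s) y)).comp
        (fderiv ℝ (sectionCoord (ρ (linkIdx s)) (circleAngle s)) y) =
      (fderiv ℝ (sectionCoord (ρ (linkIdx s')) (circleAngle s'))
        (chartTrans (LinkModel n) s s' y)).comp (fderiv ℝ (chartTrans (LinkModel n) s s') y) := by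
    refine (hT.hasFDerivAt.comp y hS).unique ((hS'.comp y hC.hasFDerivAt).congr_of_eventuallyEq ?_)
    have hopen : ((chartAt (LinkModel n) s).symm ≫ₕ chartAt (LinkModel n) s').source ∈ 𝓝 y := by
      refine ((chartAt (LinkModel n) s).symm ≫ₕ chartAt (LinkModel n) s').open_source.mem_nhds ?_
      rw [OpenPartialHomeomorph.trans_source]
      exact ⟨hy, hy'⟩
    filter_upwards [hopen] with x hx
    rw [OpenPartialHomeomorph.trans_source] at hx
    exact (h.sectionCoord_trans hx.1 hx.2).2
  have h1 := h.leviMap_trans hz hz' (fderiv ℝ (sectionCoord (ρ (linkIdx s)) (circleAngle s)) y u)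
    (fderiv ℝ (sectionCoord (ρ (linkIdx s)) (circleAngle s)) y v)
  have key' := fun w => congrArg (fun A : LinkModel n →L[ℝ] ConeModel n => A w) key
  simp only [ContinuousLinearMap.comp_apply] at key'
  rw [e, key', key'] at h1
  exact h1

/-- The metric on the circle bundle induced on the level set `f = 1/2`. -/
def linkMetric (h : IsRadiusAtlas L f k m ρ) :
    Metric (LinkModel n) (CircleK (EuclideanSpace ℂ (Fin n)) L) :=
  metricOfCharts (fun s => sectionMetric (f (linkIdx s)) (ρ (linkIdx s)) (circleAngle s))
    (fun s => (h.radius (linkIdx s)).isCoordMetric_sectionMetric.smooth.mono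
      fun _ hy => mem_coordBase_of_mem_target hy)
    (fun s => (h.radius (linkIdx s)).isCoordMetric_sectionMetric.symm _
      (mem_coordBase_of_mem_target (mem_chart_target (LinkModel n) s)))
    (fun s => (h.radius (linkIdx s)).isCoordMetric_sectionMetric.pos _
      (mem_coordBase_of_mem_target (mem_chart_target (LinkModel n) s)))
    (fun s s' hs' u v => by
      have h1 := (chartAt (LinkModel n) s).left_inv hs'
      have h2 := h.sectionMetric_trans (s := s) (s' := s') ((chartAt (LinkModel n) s).map_source hs')
        (by rw [h1]; exact mem_chart_source _ s') u v
      have h3 : chartTrans (LinkModel n) s s' (chartAt (LinkModel n) s s') =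
          chartAt (LinkModel n) s' s' := by
        rw [chartTrans, h1]
      rw [h3] at h2
      exact h2)

theorem isEinstein_linkMetric (h : IsRadiusAtlas L f k m ρ) :
    IsEinstein h.linkMetric (2 * (n + 1)) := by
  intro s
  have hs := mem_chart_target (LinkModel n) s
  have hbase : chartAt (LinkModel n) s s ∈ (chartAt (LinkModel n) s).target := hs
  have hR := h.radius (linkIdx s)
  have hG : IsCoordMetric (sectionMetric (f (linkIdx s)) (ρ (linkIdx s)) (circleAngle s))
      (chartAt (LinkModel n) s).target :=
    ⟨(chartAt (LinkModel n) s).open_target,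
      hR.isCoordMetric_sectionMetric.smooth.mono fun _ hy => mem_coordBase_of_mem_target hy,
      fun y hy => hR.isCoordMetric_sectionMetric.symm y (mem_coordBase_of_mem_target hy),
      fun y hy => hR.isCoordMetric_sectionMetric.pos y (mem_coordBase_of_mem_target hy)⟩
  have hin : ∀ y ∈ (chartAt (LinkModel n) s).target, ∀ u v,
      h.linkMetric.inChart (chartAt (LinkModel n) s) y u v =
        sectionMetric (f (linkIdx s)) (ρ (linkIdx s)) (circleAngle s) y u v :=
    fun y hy u v => inChart_metricOfCharts _ _ _ _ _ s hy u v
  refine ⟨chartAt (LinkModel n) s, IsManifold.chart_mem_maximalAtlas s, mem_chart_source _ s,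
    Module.finBasis ℝ (LinkModel n), fun i j => ?_⟩
  rw [ricci_eq hG _ hin hs, hR.ricciForm_sectionMetric (mem_coordBase_of_mem_target hs),
    hG.symm _ hs, ← hin _ hs]
  rfl

theorem d_coneDiffeo (h : IsRadiusAtlas L f k m ρ) (s : CircleK (EuclideanSpace ℂ (Fin n)) L)
    (r : posReal) (u : LinkModel n) (α : ℝ) :
    h.coneDiffeo.d s r u α =
      (fderiv ℝ (chartTrans (ConeModel n) (liftPoint s) (h.coneDiffeo (s, r)))
        (coneCoord (k (linkIdx s).2) (m (linkIdx s).2) (ρ (linkIdx s)) (circleAngle s)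
          (chartAt (LinkModel n) s s, (r : ℝ)))
        (fderiv ℝ (coneCoord (k (linkIdx s).2) (m (linkIdx s).2) (ρ (linkIdx s)) (circleAngle s))
          (chartAt (LinkModel n) s s, (r : ℝ)) (u, α)) : ConeModel n) :=
  h.coneDiffeo.d_eq s r (liftPoint s) (fun _ hz t => h.chartAt_coneDiffeo hz t)
    ((h.radius (linkIdx s)).hasFDerivAt_coneCoord
      (mem_coordBase_of_mem_target (mem_chart_target (LinkModel n) s))
      (posReal_pos r)).differentiableAt u α

theorem coneCoord_mem_target (h : IsRadiusAtlas L f k m ρ)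
    (s : CircleK (EuclideanSpace ℂ (Fin n)) L) (r : posReal) :
    coneCoord (k (linkIdx s).2) (m (linkIdx s).2) (ρ (linkIdx s)) (circleAngle s)
        (chartAt (LinkModel n) s s, (r : ℝ)) ∈ (chartAt (ConeModel n) (liftPoint s)).target ∧
      (chartAt (ConeModel n) (liftPoint s)).symm
        (coneCoord (k (linkIdx s).2) (m (linkIdx s).2) (ρ (linkIdx s)) (circleAngle s)
          (chartAt (LinkModel n) s s, (r : ℝ))) = h.coneDiffeo (s, r) := by
  obtain ⟨h1, h2⟩ := h.chartAt_coneDiffeo (mem_chart_target (LinkModel n) s) r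
  rw [(chartAt (LinkModel n) s).left_inv (mem_chart_source _ s)] at h1 h2
  rw [← h2]
  exact ⟨(chartAt (ConeModel n) (liftPoint s)).map_source h1,
    (chartAt (ConeModel n) (liftPoint s)).left_inv h1⟩

theorem isSasaki_linkMetric (h : IsRadiusAtlas L f k m ρ) : IsSasaki h.linkMetric h.coneDiffeo := by
  refine ⟨h.coneKahler, h.isKahler_coneKahler, fun s r u v α β => ?_⟩
  obtain ⟨hz, e⟩ := h.coneCoord_mem_target s r
  have hz' := mem_chart_source (ConeModel n) (h.coneDiffeo (s, r))
  have h1 := h.leviMap_trans (p' := h.coneDiffeo (s, r)) hz (by rw [e]; exact hz')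
    (fderiv ℝ (coneCoord (k (linkIdx s).2) (m (linkIdx s).2) (ρ (linkIdx s)) (circleAngle s))
      (chartAt (LinkModel n) s s, (r : ℝ)) (u, α))
    (fderiv ℝ (coneCoord (k (linkIdx s).2) (m (linkIdx s).2) (ρ (linkIdx s)) (circleAngle s))
      (chartAt (LinkModel n) s s, (r : ℝ)) (v, β))
  have h2 := (h.radius (linkIdx s)).leviMap_coneCoord (β := circleAngle s)
    (mem_coordBase_of_mem_target (mem_chart_target (LinkModel n) s)) (posReal_pos r) (u, α) (v, β)
  have h3 := h1.symm.trans h2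
  have h4 : chartTrans (ConeModel n) (liftPoint s) (h.coneDiffeo (s, r))
      (coneCoord (k (linkIdx s).2) (m (linkIdx s).2) (ρ (linkIdx s)) (circleAngle s)
        (chartAt (LinkModel n) s s, (r : ℝ))) =
      chartAt (ConeModel n) (h.coneDiffeo (s, r)) (h.coneDiffeo (s, r)) := by
    rw [chartTrans, e]
  rw [coneMetric_apply, h4] at h3
  exact (congrArg₂ (fun A B : ConeModel n => leviMap (f (endIdx (h.coneDiffeo (s, r))))
    (chartAt (ConeModel n) (h.coneDiffeo (s, r)) (h.coneDiffeo (s, r))) A B)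
    (h.d_coneDiffeo s r u α) (h.d_coneDiffeo s r v β)).trans (h3.trans (add_comm _ _))

/-- The radial vector field of the cone is the generator of the flow. -/
theorem d_coneDiffeo_radial (h : IsRadiusAtlas L f k m ρ)
    (s : CircleK (EuclideanSpace ℂ (Fin n)) L) (r : posReal) :
    h.coneDiffeo.d s r 0 r = (eulerMap n (k (endIdx (h.coneDiffeo (s, r))).2)
      (m (endIdx (h.coneDiffeo (s, r))).2)
        (chartAt (ConeModel n) (h.coneDiffeo (s, r)) (h.coneDiffeo (s, r))) : ConeModel n) := by
  obtain ⟨hz, e⟩ := h.coneCoord_mem_target s r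
  have hz' := mem_chart_source (ConeModel n) (h.coneDiffeo (s, r))
  have h1 := (h.radius (linkIdx s)).fderiv_coneCoord (β := circleAngle s)
    (mem_coordBase_of_mem_target (mem_chart_target (LinkModel n) s)) (posReal_pos r) (0, (r : ℝ))
  have h2 := h.fderiv_chartTrans_euler (p' := h.coneDiffeo (s, r)) hz (by rw [e]; exact hz')
  simp only [map_zero, zero_add, div_self (posReal_pos r).ne', one_smul] at h1
  refine (h.d_coneDiffeo s r 0 r).trans ?_
  refine (congrArg (fderiv ℝ (chartTrans (ConeModel n) (liftPoint s) (h.coneDiffeo (s, r))) _)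
    h1).trans (h2.trans ?_)
  rw [chartTrans, e]

end IsRadiusAtlas
end LinkGeometry

/-! ### The Reeb field -/

section ReebField
variable {n : ℕ} {W : Type*} [TopologicalSpace W] [ChartedSpace (EuclideanSpace ℂ (Fin n)) W]
  [IsManifold 𝓘(ℂ, EuclideanSpace ℂ (Fin n)) ω W]
  {L : W → Type*} [∀ w, AddCommGroup (L w)] [∀ w, Module ℂ (L w)]
  [TopologicalSpace (TotalSpace ℂ L)] [∀ w, TopologicalSpace (L w)] [FiberBundle ℂ L]
  [VectorBundle ℂ ℂ L] [ContMDiffVectorBundle ω ℂ L 𝓘(ℂ, EuclideanSpace ℂ (Fin n))]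

theorem endIdx_snd_eq_false_iff {p : PuncturedK (EuclideanSpace ℂ (Fin n)) L} :
    (endIdx p).2 = false ↔ p.1.base.line.rep.2 = 0 := by
  simp only [endIdx, projFamily]
  split_ifs with h <;> simp [h]

theorem xi_of_false (a : ℝ) {p : PuncturedK (EuclideanSpace ℂ (Fin n)) L}
    (h : (endIdx p).2 = false) : xi a p =
      (((0, -(a * Complex.I * (chartAt (ConeModel n) p p).1.2)),
        (1 + 2 * a) * Complex.I * (chartAt (ConeModel n) p p).2) : ConeModel n) :=
  if_pos (endIdx_snd_eq_false_iff.1 h)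

theorem xi_of_true (a : ℝ) {p : PuncturedK (EuclideanSpace ℂ (Fin n)) L}
    (h : (endIdx p).2 = true) : xi a p =
      (((0, a * Complex.I * (chartAt (ConeModel n) p p).1.2),
        Complex.I * (chartAt (ConeModel n) p p).2) : ConeModel n) :=
  if_neg fun h0 => by simp [endIdx_snd_eq_false_iff.2 h0] at h

/-- A multiple of `ξ_a` is `J` applied to the generator of the homothetic flow. -/
theorem smul_xi {a : ℝ} (ha : -(1 / 2) < a) (p : PuncturedK (EuclideanSpace ℂ (Fin n)) L) :
    ((n + 2) / (1 + a) : ℝ) • xi a p = (Complex.I • eulerMap n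
      (endA a (endIdx p).2 * endSpeed n a (endIdx p).2) (endSpeed n a (endIdx p).2)
        (chartAt (ConeModel n) p p) : ConeModel n) := by
  have hc : endSpeed n a true = (n + 2) / (1 + a) := rfl
  rw [← hc]
  cases h : (endIdx p).2
  · rw [xi_of_false a h, endA_mul_endSpeed_false n ha, endSpeed_false n ha,
      eulerMap_apply]
    refine Prod.ext (Prod.ext ?_ ?_) ?_
    · exact (smul_zero _).trans (smul_zero _).symm
    · change (endSpeed n a true : ℝ) • (-(a * Complex.I * (chartAt (ConeModel n) p p).1.2)) =
        Complex.I • (((-(a * endSpeed n a true) : ℝ) : ℂ) * (chartAt (ConeModel n) p p).1.2)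
      rw [Complex.real_smul, smul_eq_mul]
      push_cast
      ring
    · change (endSpeed n a true : ℝ) • ((1 + 2 * a) * Complex.I * (chartAt (ConeModel n) p p).2) =
        Complex.I • ((((1 + 2 * a) * endSpeed n a true : ℝ) : ℂ) * (chartAt (ConeModel n) p p).2)
      rw [Complex.real_smul, smul_eq_mul]
      push_cast
      ring
  · rw [xi_of_true a h, eulerMap_apply]
    refine Prod.ext (Prod.ext ?_ ?_) ?_
    · exact (smul_zero _).trans (smul_zero _).symm
    · change (endSpeed n a true : ℝ) • (a * Complex.I * (chartAt (ConeModel n) p p).1.2) =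
        Complex.I • (((a * endSpeed n a true : ℝ) : ℂ) * (chartAt (ConeModel n) p p).1.2)
      rw [Complex.real_smul, smul_eq_mul]
      push_cast
      ring
    · change (endSpeed n a true : ℝ) • (Complex.I * (chartAt (ConeModel n) p p).2) =
        Complex.I • (((endSpeed n a true : ℝ) : ℂ) * (chartAt (ConeModel n) p p).2)
      rw [Complex.real_smul, smul_eq_mul]
      ring

end ReebField

end

end SasakiEinstein

open SasakiEinstein
theorem proposition1 (n : ℕ) (W : Type*) [TopologicalSpace W] [T2Space W] [CompactSpace W]
    [ConnectedSpace W] [ChartedSpace (EuclideanSpace ℂ (Fin n)) W]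
    [IsManifold 𝓘(ℂ, EuclideanSpace ℂ (Fin n)) ω W]
    (L : W → Type*) [∀ w, AddCommGroup (L w)] [∀ w, Module ℂ (L w)]
    [TopologicalSpace (TotalSpace ℂ L)] [∀ w, TopologicalSpace (L w)] [FiberBundle ℂ L]
    [VectorBundle ℂ ℂ L] [ContMDiffVectorBundle ω ℂ L 𝓘(ℂ, EuclideanSpace ℂ (Fin n))]
    (h : HermitianMetric (EuclideanSpace ℂ (Fin n)) L)
    (g₀ : Metric (EuclideanSpace ℂ (Fin n)) W) (hg₀ : IsKahlerEinsteinForm g₀)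
    (μ : Fin n → ℝ) (hmono : Monotone μ) (hμ : HasConstantEigenvalues h g₀ μ)
    (hμ1 : ∀ k, -1 < μ k ∧ μ k < 1)
    (a : ℝ) (ha : -(1 / 2) < a) (hA : profile μ a 1 = 0) :
    ∃ (g : Metric ((EuclideanSpace ℂ (Fin n) × ℂ) × ℝ) (CircleK (EuclideanSpace ℂ (Fin n)) L))
      (Φ : ConeDiffeo ((EuclideanSpace ℂ (Fin n) × ℂ) × ℝ) (CircleK (EuclideanSpace ℂ (Fin n)) L)
        ((EuclideanSpace ℂ (Fin n) × ℂ) × ℂ) (PuncturedK (EuclideanSpace ℂ (Fin n)) L)),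
      (∀ s, toCircleBundle (Φ (s, ⟨1, one_mem_posReal⟩)) = s) ∧
      IsSasaki g Φ ∧ IsEinstein g (2 * (n + 1)) ∧
      IsReebField Φ (fun p => ((n + 2) / (1 + a) : ℝ) • xi a p) := by
  obtain ⟨c, X, Q, hc, hP, hQ⟩ := exists_profiles hμ1 ha hA
  obtain ⟨ρ, hρ⟩ := (isConeAtlas (L := L) hg₀ hμ hμ1 ha hc hP hQ).exists_isRadiusAtlas
  refine ⟨hρ.linkMetric, hρ.coneDiffeo, fun s => ?_, hρ.isSasaki_linkMetric,
    hρ.isEinstein_linkMetric, fun s r => ?_⟩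
  · rw [hρ.coneDiffeo_apply]
    dsimp only
    rw [Real.log_one, coneFlow_zero]
    exact IsRadiusAtlas.toCircleBundle_linkSection ρ s
  · exact (smul_xi ha _).trans
      (congrArg (fun v : ConeModel n => Complex.I • v) (hρ.d_coneDiffeo_radial s r)).symm
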